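/- Fix $q>4$. For real $\gamma$ with $-1<\gamma<2$ put, as convergent improper integrals, $$\mathrm{Ai}_\gamma(x)=\tfrac1\pi\int_0^\infty\sigma^\gamma\cos\left(\tfrac{\sigma^3}3+x\sigma-\tfrac{\gamma\pi}2\right)d\sigma,\quad \mathrm{Gi}_\gamma(x)=\tfrac1\pi\int_0^\infty\sigma^\gamma\sin\left(\tfrac{\sigma^3}3+x\sigma-\tfrac{\gamma\pi}2\right)d\sigma,$$ $$\mathrm{Hi}_\gamma(x)=\tfrac1\pi\int_0^\infty\sigma^\gamma e^{-\sigma^3/3+\sigma x}\,d\sigma .$$ For $a>0$ write $\xi=a^{1/3}(x+a^{-1})$, $\eta=a^{1/3}(y+a^{-1})$ and let $$\frac{a^{1/3}}{\pi}K^a_\gamma(x,y)=\begin{cases}\mathrm{Ai}_{-\gamma}(\eta)\,\mathrm{Hi}_\gamma(\xi), & x<y,\\[1mm] \mathrm{Hi}_{-\gamma}(\eta)\mathrm{Ai}_\gamma(\xi)-\sin(\gamma\pi)\big(\mathrm{Gi}_{-\gamma}(\eta)\mathrm{Gi}_\gamma(\xi)+\mathrm{Ai}_{-\gamma}(\eta)\mathrm{Ai}_\gamma(\xi)\big)\\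 \quad-\cos(\gamma\pi)\big(\mathrm{Ai}_{-\gamma}(\eta)\mathrm{Gi}_\gamma(\xi)-\mathrm{Gi}_{-\gamma}(\eta)\mathrm{Ai}_\gamma(\xi)\big), & x\ge y,\end{cases}$$ and let $K^0_\gamma(x,y)=\frac12e^{-|x-y|}$. Put $T^a_\gamma F(x)=\int_{\mathbb R}K^a_\gamma(x,y)F(y)\,dy$; this is the solution operator $F\mapsto u$ of $a((1+\gamma)u+xu_x)-u_{xxx}+u_x=F_x$. Let $Q=Q_p(x)=\left(\frac{p+2}2\right)^{1/p}\mathrm{sech}^{2/p}\left(\frac{px}2\right)$. Let $w=w^a$ be the weight given for $a>0$ by $$w^a(x)=\begin{cases}e^{-\frac1{3a}}\left(1+a^{-2/3}|1+ax|\right)^{-3/8}, & x\le -a^{-1},\\ \exp\left(\frac1{3a}\left[(1+ax)^{3/2}-1\right]\right), & -a^{-1}\le x\le0,\\ (1+ax)^{-1-\gamma}, & x\ge0,\end{cases}$$ and by $w^0(x)=e^{-|x|/2}$ for $x<0$, $w^0(x)=1$ for $x\ge0$. Let $C_b$ be the Banach space of bounded continuous functions $\mathbb R\to\mathbb R$ with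 the supremum norm. For $v,u\in C_b$ let $$S^a_vu=u-w^{-1}\,T^a_\gamma\left[(p+1)\,w^{p+1}|v|^p\,u-\langle u,wQ_x\rangle\,Q_x\right],\qquad \langle f,g\rangle=\int_{\mathbb R}fg\,dx .$$ **Proposition 6.4.** There exist $\delta>0$ and $C<\infty$, depending only on $q$, such that for all $p\in[3,q]$, all real $\gamma$ with $|\gamma+\frac12|\le\delta$, all $0\le a\le\delta$ and all $v\in C_b$ with $\sup_x|v(x)-Q(x)/w^a(x)|\le\delta$, the following holds: for every $u\in C_b$ the integrals defining $S^a_vu$ converge absolutely, $S^a_v$ is a bounded linear operator $C_b\to C_b$, it is invertible, and $\|(S^a_v)^{-1}\|_{L(C_b,C_b)}\le C$. -/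

import Mathlib

noncomputable section

namespace GKdV

/-- Generalized Airy function
`Ai_γ(x) = π⁻¹ ∫₀^∞ σ^γ cos(σ³/3 + xσ - γπ/2) dσ`, as a convergent improper integral
(the integral is not absolutely convergent; it converges for `-1 < γ < 2`). -/
def Ai (γ x : ℝ) : ℝ :=
  (1 / Real.pi) * Filter.limUnder Filter.atTop (fun R : ℝ =>
    ∫ σ in (0 : ℝ)..R, σ ^ γ * Real.cos (σ ^ 3 / 3 + x * σ - γ * Real.pi / 2))

/-- Generalized Scorer function
`Gi_γ(x) = π⁻¹ ∫₀^∞ σ^γ sin(σ³/3 + xσ - γπ/2) dσ`, as a convergent improper integral. -/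
def Gi (γ x : ℝ) : ℝ :=
  (1 / Real.pi) * Filter.limUnder Filter.atTop (fun R : ℝ =>
    ∫ σ in (0 : ℝ)..R, σ ^ γ * Real.sin (σ ^ 3 / 3 + x * σ - γ * Real.pi / 2))

/-- Generalized Scorer function
`Hi_γ(x) = π⁻¹ ∫₀^∞ σ^γ exp(-σ³/3 + σx) dσ` (absolutely convergent for `γ > -1`). -/
def Hi (γ x : ℝ) : ℝ :=
  (1 / Real.pi) * ∫ σ in Set.Ioi (0 : ℝ), σ ^ γ * Real.exp (-(σ ^ 3) / 3 + σ * x)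

/-- The kernel `K^a_γ(x, y)`. For `a = 0` it is `½ exp(-|x - y|)`, the kernel of `(1 - ∂²)⁻¹`.
For `a > 0`, with `ξ = a^{1/3}(x + 1/a)` and `η = a^{1/3}(y + 1/a)`, it is the kernel such that
`u(x) = ∫ K^a_γ(x, y) F(y) dy` solves `a((1+γ)u + x u_x) - u_xxx + u_x = F_x`. For `x < y` only the
non-oscillating function `Hi_γ(ξ)` occurs, for `x > y` only `Ai_γ(ξ)` and `Gi_γ(ξ)` occur. -/
def kernel (a γ x y : ℝ) : ℝ :=
  if a = 0 then (1 / 2) * Real.exp (-|x - y|)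
  else
    let ξ : ℝ := a ^ (1 / 3 : ℝ) * (x + a⁻¹)
    let η : ℝ := a ^ (1 / 3 : ℝ) * (y + a⁻¹)
    Real.pi * a ^ (-(1 / 3) : ℝ) *
      (if x < y then Ai (-γ) η * Hi γ ξ
        else
          Hi (-γ) η * Ai γ ξ
            - Real.sin (γ * Real.pi) * (Gi (-γ) η * Gi γ ξ + Ai (-γ) η * Ai γ ξ)
            - Real.cos (γ * Real.pi) * (Ai (-γ) η * Gi γ ξ - Gi (-γ) η * Ai γ ξ))

/-- The operator `T^a_γ F (x) = ∫ K^a_γ(x, y) F(y) dy`. -/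
def T (a γ : ℝ) (F : ℝ → ℝ) (x : ℝ) : ℝ :=
  ∫ y, kernel a γ x y * F y

/-- The weight `w^a` (it depends on `γ` as well when `a > 0`). -/
def weight (a γ x : ℝ) : ℝ :=
  if a = 0 then
    if x < 0 then Real.exp (-|x| / 2) else 1
  else if x ≤ -a⁻¹ then
    Real.exp (-(1 / (3 * a))) * (1 + a ^ (-(2 / 3) : ℝ) * |1 + a * x|) ^ (-(3 / 8) : ℝ)
  else if x ≤ 0 then
    Real.exp (1 / (3 * a) * ((1 + a * x) ^ (3 / 2 : ℝ) - 1))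
  else
    (1 + a * x) ^ (-1 - γ)

/-- The soliton `Q_p(x) = ((p+2)/2)^{1/p} sech^{2/p}(px/2)`. -/
def Q (p x : ℝ) : ℝ :=
  ((p + 2) / 2) ^ (1 / p) * (1 / Real.cosh (p * x / 2)) ^ (2 / p)

/-- The function `(p+1) w^{p+1} |v|^p u - ⟨u, w Q_x⟩ Q_x` to which `T^a_γ` is applied. -/
def linPart (a γ p : ℝ) (v u : ℝ → ℝ) (y : ℝ) : ℝ :=
  (p + 1) * weight a γ y ^ (p + 1) * |v y| ^ p * u y
    - (∫ z, u z * (weight a γ z * deriv (Q p) z)) * deriv (Q p) y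

/-- The linearized operator
`S^a_v u = u - w⁻¹ T^a_γ[(p+1) w^{p+1} |v|^p u - ⟨u, w Q_x⟩ Q_x]`. -/
def S (a γ p : ℝ) (v u : ℝ → ℝ) (x : ℝ) : ℝ :=
  u x - (weight a γ x)⁻¹ * T a γ (linPart a γ p v u) x

end GKdV

end

noncomputable section

open Filter Topology MeasureTheory Complex

namespace GKdV

/-! The operator is `1 - linOp`, where `linOp` is an integral operator minus a rank one term, so the
statement is a perturbation result around the case `a = 0`, `v = Q / w`.

In that case `U = w u` turns `S u = 0` into `U = (1 - ∂²)⁻¹[(p+1) Q^p U - c Q']` with `c = ⟨U, Q'⟩`.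
The integral operator is compact, being a norm limit of finite rank operators
(`isCompactOperator_kernelOp_zero`). By the Fredholm alternative only injectivity is needed
(`eq_zero_of_linearized`). The Wronskian `W = U' Q' - U Q''` satisfies `W' = c Q'²` and vanishes at
both ends, so `c = 0` and `W = 0`; hence `U = d Q'`, and `0 = c = d ∫ Q'²` forces `d = 0`. The rank
one term is there to exclude the translation mode `Q'`.

Two estimates carry this to nearby parameters. Replacing `v` by `Q / w` changes the density `(p+1)
w^{p+1} |v|^p` by at most `C δ (e^{-|y|} + w⁴)` (`abs_density_sub_le`; here `p ≥ 3` enters), and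
against such densities the weighted kernel has a majorant whose integral in `y` is bounded uniformly
in `x` and `a` (`wkernel_bounds`, `integral_majorant_le`). For the soliton density, which decays
like `e^{-|y|}`, `linOp` converges in operator norm as `a → 0` and `p → p₀`, uniformly in `γ`
(`tendsto_linOp`): the weighted kernel converges off the diagonal and is `O(e^{-|x|/16} + a)` for
large `|x|`. Since invertibility is an open condition and inversion is continuous, the inverse is
controlled near each `p₀`, and compactness of `[3, q]` makes the constants uniform.

All information on the kernel comes from asymptotics of `Ai`, `Gi`, `Hi` uniform in the index. `Ai`
and `Gi` are the real and imaginary parts of one oscillatory integral, whose contour is moved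
through the saddle `i√x` for `x > 0` and `√|x|` for `x < 0`; `Hi` is handled by Laplace's method at
`σ = √x`. The exponential parts combine into the phase `(2/(3a))((1 + ax)^{3/2} - 1)`, which tends
to `x` and so produces `½ e^{-|x-y|}` in the limit; the algebraically decaying `Gi · Gi`-type
products carry an extra factor `a`. -/

/-- The integrand `z^α exp(i(z³/3 + xz))` whose integral over `(0,∞)` gives the Airy functions. -/
def airyInt (α x : ℝ) (z : ℂ) : ℂ := z ^ (α : ℂ) * cexp (I * (z ^ 3 / 3 + x * z))

/-! ### Contour deformation for the oscillatory integrals. -/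

theorem norm_airyInt (α x : ℝ) (z : ℂ) :
    ‖airyInt α x z‖ = ‖z‖ ^ α * Real.exp (-z.re ^ 2 * z.im + z.im ^ 3 / 3 - x * z.im) := by
  rw [airyInt, norm_mul, norm_cpow_real, Complex.norm_exp]
  congr 2
  have : z = z.re + z.im * I := (re_add_im z).symm
  rw [this]
  simp [pow_succ]
  ring

theorem norm_airyInt_add_mul_I (α x s t : ℝ) :
    ‖airyInt α x (s + t * I)‖
      = ‖(s + t * I : ℂ)‖ ^ α * Real.exp (-s ^ 2 * t + t ^ 3 / 3 - x * t) := by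
  rw [norm_airyInt]; simp

theorem differentiableAt_airyInt (α x : ℝ) {z : ℂ} (hz : z ∈ slitPlane) :
    DifferentiableAt ℂ (airyInt α x) z := by
  unfold airyInt
  exact (DifferentiableAt.cpow_const differentiableAt_id hz).mul (by fun_prop)

theorem add_mul_I_mem_slitPlane {s t : ℝ} (h : 0 < s ∨ t ≠ 0) : (s + t * I : ℂ) ∈ slitPlane := by
  rw [mem_slitPlane_iff]; simpa using h

theorem continuousAt_airyInt (α x : ℝ) {z : ℂ} (hz : z ∈ slitPlane) :
    ContinuousAt (airyInt α x) z := (differentiableAt_airyInt α x hz).continuousAt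

theorem airyInt_rect_of_pos (α x h : ℝ) {u v : ℝ} (hu : 0 < u) (huv : u ≤ v) :
    ∫ s in u..v, airyInt α x s = (∫ s in u..v, airyInt α x (s + h * I))
      - I * (∫ t in (0 : ℝ)..h, airyInt α x (v + t * I))
      + I * (∫ t in (0 : ℝ)..h, airyInt α x (u + t * I)) := by
  have := Complex.integral_boundary_rect_eq_zero_of_differentiableOn (airyInt α x) (u : ℂ)
    (v + h * I) (by
      intro z hz
      refine (differentiableAt_airyInt α x ?_).differentiableWithinAt
      rw [mem_slitPlane_iff]
      left
      have := hz.1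
      simp [Set.uIcc_of_le huv] at this
      linarith [this.1])
  simp at this
  linear_combination this

/-- The majorant does not involve `s` and is integrable at `t = 0` because `|α| < 1`. It dominates
the integrand while a vertical edge slides onto the imaginary axis. -/
theorem norm_rpow_le_of_neg_im {α s t : ℝ} (hα : |α| < 1) (hs : 0 ≤ s) (hs1 : s ≤ 1) (ht : t ≠ 0) :
    ‖(s + t * I : ℂ)‖ ^ α ≤ |t| ^ (-|α|) + (1 + |t|) := by
  have h1 : |t| ≤ ‖(s + t * I : ℂ)‖ := by simpa using Complex.abs_im_le_norm (s + t * I : ℂ)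
  have h2 : ‖(s + t * I : ℂ)‖ ≤ 1 + |t| := by
    refine (norm_add_le _ _).trans ?_
    simp [abs_of_nonneg hs]
    exact hs1
  have ht' : 0 < |t| := abs_pos.mpr ht
  rcases le_total ‖(s + t * I : ℂ)‖ 1 with h | h
  · have : ‖(s + t * I : ℂ)‖ ^ α ≤ ‖(s + t * I : ℂ)‖ ^ (-|α|) :=
      Real.rpow_le_rpow_of_exponent_ge (by linarith) h (neg_abs_le α)
    have h3 : ‖(s + t * I : ℂ)‖ ^ (-|α|) ≤ |t| ^ (-|α|) :=
      Real.rpow_le_rpow_of_nonpos ht' h1 (by simp)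
    linarith
  · have : ‖(s + t * I : ℂ)‖ ^ α ≤ ‖(s + t * I : ℂ)‖ ^ (1 : ℝ) :=
      Real.rpow_le_rpow_of_exponent_le h (by linarith [le_abs_self α])
    rw [Real.rpow_one] at this
    have : 0 ≤ |t| ^ (-|α|) := by positivity
    linarith

theorem intervalIntegrable_abs_rpow {r : ℝ} (hr : -1 < r) (a b : ℝ) :
    IntervalIntegrable (fun t : ℝ => |t| ^ r) volume a b := by
  have key : ∀ c : ℝ, IntervalIntegrable (fun t : ℝ => |t| ^ r) volume 0 c := by
    have pos : ∀ c : ℝ, 0 ≤ c → IntervalIntegrable (fun t : ℝ => |t| ^ r) volume 0 c := by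
      intro c hc
      refine (intervalIntegral.intervalIntegrable_rpow' (a := 0) (b := c) hr).congr ?_
      intro t ht
      rw [Set.uIoc_of_le hc] at ht
      simp [abs_of_pos ht.1]
    intro c
    rcases le_total 0 c with hc | hc
    · exact pos c hc
    · have h := IntervalIntegrable.comp_sub_left (pos (-c) (by linarith)) 0
      simpa using h
  exact (key a).symm.trans (key b)

/-- The corner `0` of the contour is the branch point of `z^α`, so Cauchy's theorem only applies to
rectangles with left edge `Re z = u > 0`; this is the passage `u → 0⁺` for that edge. -/
theorem airyInt_vertical_tendsto (α x h : ℝ) (hα : |α| < 1) :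
    Tendsto (fun u : ℝ => ∫ t in (0 : ℝ)..h, airyInt α x (u + t * I)) (𝓝[>] 0)
      (𝓝 (∫ t in (0 : ℝ)..h, airyInt α x (t * I))) := by
  have hmem : ∀ᶠ u : ℝ in 𝓝[>] 0, 0 < u ∧ u ≤ 1 := by
    filter_upwards [Ioc_mem_nhdsGT (zero_lt_one' ℝ)] with u hu using hu
  refine intervalIntegral.tendsto_integral_filter_of_dominated_convergence
    (fun t => (|t| ^ (-|α|) + (1 + |t|)) * Real.exp (|t| + |t| ^ 3 + |x| * |t|)) ?_ ?_ ?_ ?_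
  · filter_upwards [hmem] with u hu
    refine Continuous.aestronglyMeasurable ?_
    rw [continuous_iff_continuousAt]
    intro t
    exact ContinuousAt.comp (f := fun t : ℝ => (u + t * I : ℂ))
      (continuousAt_airyInt α x (add_mul_I_mem_slitPlane (Or.inl hu.1)))
      (Continuous.continuousAt (by fun_prop))
  · filter_upwards [hmem] with u hu
    have : ∀ᵐ t : ℝ, t ≠ 0 := by
      have := (measure_singleton (μ := volume) (0 : ℝ))
      exact compl_mem_ae_iff.mpr this
    filter_upwards [this] with t ht _
    rw [norm_airyInt_add_mul_I]
    gcongr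
    · exact norm_rpow_le_of_neg_im hα hu.1.le hu.2 ht
    · have h1 : -u ^ 2 * t ≤ |t| := by
        have : u ^ 2 ≤ 1 := by nlinarith [hu.1, hu.2]
        calc -u ^ 2 * t ≤ |-u ^ 2 * t| := le_abs_self _
          _ = u ^ 2 * |t| := by rw [abs_mul, abs_neg, abs_of_nonneg (by positivity)]
          _ ≤ 1 * |t| := by gcongr
          _ = |t| := one_mul _
      have h2 : t ^ 3 / 3 ≤ |t| ^ 3 := by
        have : t ^ 3 ≤ |t| ^ 3 := by rw [← abs_pow]; exact le_abs_self _
        have h0 : 0 ≤ |t| ^ 3 := by positivity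
        linarith
      have h3 : -(x * t) ≤ |x| * |t| := by rw [← abs_mul]; exact neg_le_abs _
      linarith
  · refine IntervalIntegrable.mul_continuousOn ?_ (by fun_prop)
    exact (intervalIntegrable_abs_rpow (by linarith) 0 h).add
      (Continuous.intervalIntegrable (by fun_prop) _ _)
  · have : ∀ᵐ t : ℝ, t ≠ 0 := by
      have := (measure_singleton (μ := volume) (0 : ℝ))
      exact compl_mem_ae_iff.mpr this
    filter_upwards [this] with t ht _
    have hc : ContinuousAt (fun u : ℝ => airyInt α x (u + t * I)) 0 := by
      exact ContinuousAt.comp (f := fun u : ℝ => (u + t * I : ℂ))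
        (continuousAt_airyInt α x (add_mul_I_mem_slitPlane (Or.inr ht)))
        (Continuous.continuousAt (by fun_prop))
    have := hc.tendsto.mono_left (nhdsWithin_le_nhds (s := Set.Ioi 0))
    simpa using this

theorem tendsto_integral_lower {f : ℝ → ℂ} {b : ℝ} (hb : 0 < b)
    (hf : IntervalIntegrable f volume 0 b) :
    Tendsto (fun u : ℝ => ∫ s in u..b, f s) (𝓝[>] 0) (𝓝 (∫ s in (0 : ℝ)..b, f s)) := by
  have h1 : ContinuousWithinAt (fun u : ℝ => ∫ s in b..u, f s) (Set.Icc 0 b) 0 := by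
    refine intervalIntegral.continuousWithinAt_primitive (by simp) ?_
    simpa [hb.le] using hf
  have h2 : Tendsto (fun u : ℝ => ∫ s in b..u, f s) (𝓝[>] 0) (𝓝 (∫ s in b..(0:ℝ), f s)) := by
    refine h1.tendsto.mono_left ?_
    rw [nhdsWithin_le_iff]
    filter_upwards [Ioc_mem_nhdsGT hb] with u hu using ⟨hu.1.le, hu.2⟩
  have := h2.neg
  simpa only [← intervalIntegral.integral_symm] using this

theorem continuousOn_airyInt_horizontal (α x h : ℝ) :
    ContinuousOn (fun s : ℝ => airyInt α x (s + h * I)) (Set.Ioi 0) := by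
  intro s hs
  refine ContinuousAt.continuousWithinAt ?_
  exact ContinuousAt.comp (f := fun s : ℝ => (s + h * I : ℂ))
      (continuousAt_airyInt α x (add_mul_I_mem_slitPlane (Or.inl hs)))
      (Continuous.continuousAt (by fun_prop))

theorem continuous_airyInt_horizontal (α x : ℝ) {h : ℝ} (hh : h ≠ 0) :
    Continuous (fun s : ℝ => airyInt α x (s + h * I)) := by
  rw [continuous_iff_continuousAt]
  intro s
  exact ContinuousAt.comp (f := fun s : ℝ => (s + h * I : ℂ))
      (continuousAt_airyInt α x (add_mul_I_mem_slitPlane (Or.inr hh)))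
      (Continuous.continuousAt (by fun_prop))

theorem intervalIntegrable_airyInt (α x : ℝ) (hα : |α| < 1) {b : ℝ} (hb : 0 ≤ b) :
    IntervalIntegrable (fun s : ℝ => airyInt α x s) volume 0 b := by
  refine (intervalIntegrable_abs_rpow (r := α) (by linarith [neg_abs_le α]) 0 b).mono_fun ?_ ?_
  · rw [Set.uIoc_of_le hb]
    refine ContinuousOn.aestronglyMeasurable ?_ measurableSet_Ioc
    have := continuousOn_airyInt_horizontal α x 0
    simp only [ofReal_zero, zero_mul, add_zero] at this
    exact this.mono (fun s hs => hs.1)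
  · refine Eventually.of_forall fun s => ?_
    have := norm_airyInt_add_mul_I α x s 0
    simp at this
    simp only [this]
    rw [Real.norm_of_nonneg (by positivity)]

/-- The sign of `h` is left open: `h > 0` serves positive `x`, while for negative `x` the path must
first go below the real axis. -/
theorem airyInt_rect (α x : ℝ) {h v : ℝ} (hα : |α| < 1) (hh : h ≠ 0) (hv : 0 < v) :
    ∫ s in (0 : ℝ)..v, airyInt α x s = (∫ s in (0 : ℝ)..v, airyInt α x (s + h * I))
      - I * (∫ t in (0 : ℝ)..h, airyInt α x (v + t * I))
      + I * (∫ t in (0 : ℝ)..h, airyInt α x (t * I)) := by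
  have h1 := tendsto_integral_lower hv (intervalIntegrable_airyInt α x hα hv.le)
  have h2 := tendsto_integral_lower hv
    ((continuous_airyInt_horizontal α x hh).intervalIntegrable 0 v)
  have h3 := airyInt_vertical_tendsto α x h hα
  refine tendsto_nhds_unique h1 (((h2.sub_const _).add (h3.const_mul I)).congr' ?_)
  filter_upwards [Ioc_mem_nhdsGT hv] with u hu
  exact (airyInt_rect_of_pos α x h hu.1 hu.2).symm

theorem rpow_le_rpow_neg_abs_add {r α : ℝ} (hr : 0 < r) (hα : |α| < 1) :
    r ^ α ≤ r ^ (-|α|) + r := by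
  rcases le_total r 1 with h | h
  · have : r ^ α ≤ r ^ (-|α|) := Real.rpow_le_rpow_of_exponent_ge hr h (neg_abs_le α)
    linarith
  · have : r ^ α ≤ r ^ (1 : ℝ) :=
      Real.rpow_le_rpow_of_exponent_le h (by linarith [le_abs_self α])
    rw [Real.rpow_one] at this
    have : 0 ≤ r ^ (-|α|) := by positivity
    linarith

theorem norm_airyInt_horizontal_le (α x : ℝ) {s h : ℝ} (hα : |α| < 1) (hs : 0 ≤ s) (hh : 0 < h) :
    ‖airyInt α x (s + h * I)‖ ≤ (h ^ (-|α|) + (s + h)) * Real.exp (h ^ 3 / 3 - x * h)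
      * Real.exp (-h * s ^ 2) := by
  rw [norm_airyInt_add_mul_I, mul_assoc, ← Real.exp_add]
  have h1 : h ≤ ‖(s + h * I : ℂ)‖ := by
    simpa [abs_of_pos hh] using Complex.abs_im_le_norm (s + h * I : ℂ)
  have h2 : ‖(s + h * I : ℂ)‖ ≤ s + h := by
    refine (norm_add_le _ _).trans ?_
    simp [abs_of_nonneg hs, abs_of_pos hh]
  have h3 : ‖(s + h * I : ℂ)‖ ^ (-|α|) ≤ h ^ (-|α|) :=
    Real.rpow_le_rpow_of_nonpos hh h1 (by simp)
  have h4 := rpow_le_rpow_neg_abs_add (α := α) (hh.trans_le h1) hα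
  gcongr
  · linarith
  · linarith

theorem integrableOn_horizontal_bound (A B E : ℝ) {h : ℝ} (hh : 0 < h) :
    IntegrableOn (fun s : ℝ => (A + (s + B)) * E * Real.exp (-h * s ^ 2)) (Set.Ioi 0) := by
  have h1 := (integrable_exp_neg_mul_sq hh).integrableOn (s := Set.Ioi (0 : ℝ))
  have h2 := (integrable_mul_exp_neg_mul_sq hh).integrableOn (s := Set.Ioi (0 : ℝ))
  refine (((h1.const_mul (A + B)).add h2).mul_const E).congr ?_
  refine Eventually.of_forall fun s => ?_
  simp
  ring

theorem integrableOn_airyInt_horizontal (α x : ℝ) {h : ℝ} (hα : |α| < 1) (hh : 0 < h) :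
    IntegrableOn (fun s : ℝ => airyInt α x (s + h * I)) (Set.Ioi 0) := by
  refine (integrableOn_horizontal_bound (h ^ (-|α|)) h (Real.exp (h ^ 3 / 3 - x * h)) hh).mono' ?_ ?_
  · exact (continuous_airyInt_horizontal α x hh.ne').aestronglyMeasurable
  · filter_upwards [ae_restrict_mem measurableSet_Ioi] with s hs
    exact norm_airyInt_horizontal_le α x hα (le_of_lt hs) hh

/-- On `Re z = v` the integrand is at most a constant times `v e^{-v² t}`. Integrating in `t` gains
`v⁻²`, so the edge contributes `O(1/v)`; this is what makes the improper integral converge. -/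
theorem airyInt_right_edge_tendsto (α x : ℝ) {h : ℝ} (hα : |α| < 1) (hh : 0 < h) :
    Tendsto (fun v : ℝ => ∫ t in (0 : ℝ)..h, airyInt α x (v + t * I)) atTop (𝓝 0) := by
  set E := Real.exp (h ^ 3 + |x| * h)
  have key : ∀ v : ℝ, 1 ≤ v → ‖∫ t in (0 : ℝ)..h, airyInt α x (v + t * I)‖
      ≤ (1 + h) * E * v⁻¹ := by
    intro v hv
    have hv0 : 0 < v := by linarith
    have hb : ∀ t ∈ Set.Ioc 0 h, ‖airyInt α x (v + t * I)‖
        ≤ (v + h) * E * Real.exp (-v ^ 2 * t) := by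
      intro t ht
      rw [norm_airyInt_add_mul_I, mul_assoc, ← Real.exp_add]
      have h1 : v ≤ ‖(v + t * I : ℂ)‖ := by
        simpa [abs_of_pos hv0] using Complex.abs_re_le_norm (v + t * I : ℂ)
      have h2 : ‖(v + t * I : ℂ)‖ ≤ v + h := by
        refine (norm_add_le _ _).trans ?_
        simp [abs_of_pos hv0, abs_of_pos ht.1]
        exact ht.2
      have h3 : ‖(v + t * I : ℂ)‖ ^ α ≤ ‖(v + t * I : ℂ)‖ ^ (1 : ℝ) :=
        Real.rpow_le_rpow_of_exponent_le (hv.trans h1) (by linarith [le_abs_self α])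
      rw [Real.rpow_one] at h3
      gcongr
      · linarith
      · have h5 : t ^ 3 ≤ h ^ 3 := pow_le_pow_left₀ ht.1.le ht.2 3
        have h6 : -(x * t) ≤ |x| * h := by
          calc -(x * t) ≤ |x * t| := neg_le_abs _
            _ = |x| * t := by rw [abs_mul, abs_of_pos ht.1]
            _ ≤ |x| * h := by gcongr; exact ht.2
        have h7 : 0 ≤ h ^ 3 := by positivity
        have h8 : 0 ≤ t ^ 3 := pow_nonneg ht.1.le 3
        linarith
    have := intervalIntegral.norm_integral_le_of_norm_le hh.le
      (Eventually.of_forall fun t ht => hb t ht)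
      (Continuous.intervalIntegrable (μ := volume) (by fun_prop) _ _)
    refine this.trans ?_
    have hi : ∫ t in (0 : ℝ)..h, Real.exp (-v ^ 2 * t) = (1 - Real.exp (-v ^ 2 * h)) / v ^ 2 := by
      have hne : -v ^ 2 ≠ 0 := by simp [hv0.ne']
      rw [intervalIntegral.integral_comp_mul_left (fun t => Real.exp t) hne, integral_exp]
      simp
      field_simp
      ring
    rw [intervalIntegral.integral_const_mul, hi]
    have he : (1 - Real.exp (-v ^ 2 * h)) / v ^ 2 ≤ 1 / v ^ 2 := by
      gcongr
      linarith [Real.exp_pos (-v ^ 2 * h)]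
    have hE : 0 < E := Real.exp_pos _
    calc (v + h) * E * ((1 - Real.exp (-v ^ 2 * h)) / v ^ 2)
        ≤ ((1 + h) * v) * E * (1 / v ^ 2) := by
          gcongr
          · apply div_nonneg _ (by positivity)
            rw [sub_nonneg, Real.exp_le_one_iff]
            have : 0 ≤ v ^ 2 * h := by positivity
            linarith
          · nlinarith
      _ = (1 + h) * E * v⁻¹ := by field_simp
  refine squeeze_zero_norm' (a := fun v : ℝ => (1 + h) * E * v⁻¹) ?_ ?_
  · filter_upwards [eventually_ge_atTop 1] with v hv using key v hv
  · simpa using tendsto_inv_atTop_zero.const_mul ((1 + h) * E)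

/-- The value of the improper integral of `airyInt` over `(0, ∞)`. -/
theorem tendsto_integral_airyInt (α x : ℝ) {h : ℝ} (hα : |α| < 1) (hh : 0 < h) :
    Tendsto (fun R : ℝ => ∫ s in (0 : ℝ)..R, airyInt α x s) atTop
      (𝓝 ((∫ s in Set.Ioi (0 : ℝ), airyInt α x (s + h * I))
        + I * ∫ t in (0 : ℝ)..h, airyInt α x (t * I))) := by
  have h1 := intervalIntegral_tendsto_integral_Ioi 0
    (integrableOn_airyInt_horizontal α x hα hh) tendsto_id
  have h2 := (airyInt_right_edge_tendsto α x hα hh).const_mul I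
  have := (h1.sub h2).add_const (I * ∫ t in (0 : ℝ)..h, airyInt α x (t * I))
  simp only [mul_zero, sub_zero] at this
  refine this.congr' ?_
  filter_upwards [eventually_gt_atTop 0] with v hv
  exact (airyInt_rect α x hα hh.ne' hv).symm

/-- The value of the improper integral, with a path that goes below the real axis up to `b`. -/
theorem tendsto_integral_airyInt_staircase (α x : ℝ) {h b : ℝ} (hα : |α| < 1) (hh : 0 < h)
    (hb : 0 < b) :
    Tendsto (fun R : ℝ => ∫ s in (0 : ℝ)..R, airyInt α x s) atTop
      (𝓝 ((∫ s in Set.Ioi b, airyInt α x (s + h * I))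
        + I * (∫ t in (-h)..h, airyInt α x (b + t * I))
        + (∫ s in (0 : ℝ)..b, airyInt α x (s + (-h : ℝ) * I))
        + I * ∫ t in (0 : ℝ)..(-h), airyInt α x (t * I))) := by
  have h1 := intervalIntegral_tendsto_integral_Ioi b
    ((integrableOn_airyInt_horizontal α x hα hh).mono_set (Set.Ioi_subset_Ioi hb.le)) tendsto_id
  have h2 := (airyInt_right_edge_tendsto α x hα hh).const_mul I
  have := (h1.sub h2).add_const (I * (∫ t in (-h)..h, airyInt α x (b + t * I))
        + (∫ s in (0 : ℝ)..b, airyInt α x (s + (-h : ℝ) * I))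
        + I * ∫ t in (0 : ℝ)..(-h), airyInt α x (t * I))
  simp only [mul_zero, sub_zero, ← add_assoc] at this
  refine this.congr' ?_
  filter_upwards [eventually_gt_atTop b] with v hv
  -- The segment `[b, v]` is pushed up and `[0, b]` is pushed down; the two vertical edges at `b`
  -- then join into one crossing from `-h` to `h`.
  have e1 := airyInt_rect_of_pos α x h hb hv.le
  have e2 := airyInt_rect α x (h := -h) hα (by linarith) hb
  have e3 : ∫ s in (0 : ℝ)..v, airyInt α x s
      = (∫ s in (0 : ℝ)..b, airyInt α x s) + ∫ s in b..v, airyInt α x s := by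
    have i1 := intervalIntegrable_airyInt α x hα hb.le
    have i2 := intervalIntegrable_airyInt α x hα (hb.le.trans hv.le)
    exact (intervalIntegral.integral_add_adjacent_intervals i1 (i1.symm.trans i2)).symm
  have cont : Continuous fun t : ℝ => airyInt α x (b + t * I) := by
    rw [continuous_iff_continuousAt]
    intro t
    exact ContinuousAt.comp (f := fun t : ℝ => (b + t * I : ℂ))
      (continuousAt_airyInt α x (add_mul_I_mem_slitPlane (Or.inl hb)))
      (Continuous.continuousAt (by fun_prop))
  have e4 : (∫ t in (-h)..h, airyInt α x (b + t * I))
      = (∫ t in (0 : ℝ)..h, airyInt α x (b + t * I))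
        - ∫ t in (0 : ℝ)..(-h), airyInt α x (b + t * I) :=
    (intervalIntegral.integral_interval_sub_left (cont.intervalIntegrable _ _)
      (cont.intervalIntegrable _ _)).symm
  rw [e3, e1, e2, e4]
  push_cast
  simp only [id]
  ring

theorem airyInt_ofReal (α x : ℝ) {s : ℝ} (hs : 0 ≤ s) :
    cexp (-I * (α * Real.pi / 2)) * airyInt α x s
      = (s ^ α * Real.cos (s ^ 3 / 3 + x * s - α * Real.pi / 2) : ℝ)
        + (s ^ α * Real.sin (s ^ 3 / 3 + x * s - α * Real.pi / 2) : ℝ) * I := by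
  rw [airyInt, ← ofReal_cpow hs]
  have : cexp (-I * (α * Real.pi / 2)) * (((s ^ α : ℝ) : ℂ) * cexp (I * ((s : ℂ) ^ 3 / 3 + x * s)))
      = ((s ^ α : ℝ) : ℂ) * cexp (((s ^ 3 / 3 + x * s - α * Real.pi / 2 : ℝ) : ℂ) * I) := by
    rw [mul_left_comm, ← Complex.exp_add]
    congr 2
    push_cast
    ring
  rw [this, Complex.exp_mul_I]
  push_cast
  ring

/-- Cosine and sine are the two components of one complex exponential, rotated by the constant phase
`e^{-iαπ/2}`. Existence of the limit has to be supplied, since `limUnder` has an arbitrary value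
otherwise. -/
theorem Ai_eq_Gi_eq_of_tendsto {α x : ℝ} {L : ℂ} (hα : |α| < 1)
    (hL : Tendsto (fun R : ℝ => ∫ s in (0 : ℝ)..R, airyInt α x s) atTop (𝓝 L)) :
    Ai α x = 1 / Real.pi * (cexp (-I * (α * Real.pi / 2)) * L).re ∧
    Gi α x = 1 / Real.pi * (cexp (-I * (α * Real.pi / 2)) * L).im := by
  have h1 := hL.const_mul (cexp (-I * (α * Real.pi / 2)))
  have key : ∀ R : ℝ, 0 ≤ R → cexp (-I * (α * Real.pi / 2)) * ∫ s in (0 : ℝ)..R, airyInt α x s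
      = ((∫ s in (0 : ℝ)..R, s ^ α * Real.cos (s ^ 3 / 3 + x * s - α * Real.pi / 2) : ℝ) : ℂ)
      + ((∫ s in (0 : ℝ)..R, s ^ α * Real.sin (s ^ 3 / 3 + x * s - α * Real.pi / 2) : ℝ) : ℂ)
        * I := by
    intro R hR
    have hi : IntervalIntegrable (fun s : ℝ => s ^ α) volume 0 R :=
      intervalIntegral.intervalIntegrable_rpow' (by linarith [neg_abs_le α])
    rw [← intervalIntegral.integral_const_mul, ← intervalIntegral.integral_ofReal,
      ← intervalIntegral.integral_ofReal, ← intervalIntegral.integral_mul_const,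
      ← intervalIntegral.integral_add]
    · refine intervalIntegral.integral_congr fun s hs => ?_
      rw [Set.uIcc_of_le hR] at hs
      exact airyInt_ofReal α x hs.1
    · have h := hi.mul_continuousOn (g := fun s : ℝ =>
        Real.cos (s ^ 3 / 3 + x * s - α * Real.pi / 2)) (by fun_prop)
      exact ⟨h.1.ofReal, h.2.ofReal⟩
    · have h := hi.mul_continuousOn (g := fun s : ℝ =>
        Real.sin (s ^ 3 / 3 + x * s - α * Real.pi / 2)) (by fun_prop)
      exact IntervalIntegrable.mul_const (f := fun s : ℝ => ((s ^ α *
        Real.sin (s ^ 3 / 3 + x * s - α * Real.pi / 2) : ℝ) : ℂ)) ⟨h.1.ofReal, h.2.ofReal⟩ I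
  constructor
  · rw [Ai]
    congr 1
    refine Tendsto.limUnder_eq ?_
    refine ((Complex.continuous_re.tendsto _).comp h1).congr' ?_
    filter_upwards [eventually_ge_atTop 0] with R hR
    simp only [Function.comp_apply]
    rw [key R hR]
    simp
  · rw [Gi]
    congr 1
    refine Tendsto.limUnder_eq ?_
    refine ((Complex.continuous_im.tendsto _).comp h1).congr' ?_
    filter_upwards [eventually_ge_atTop 0] with R hR
    simp only [Function.comp_apply]
    rw [key R hR]
    simp

/-- The part of the contour integral along the horizontal line `Im z = h`. -/
def horizontalPart (α x h : ℝ) : ℂ :=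
  cexp (-I * (α * Real.pi / 2)) * ∫ s in Set.Ioi (0 : ℝ), airyInt α x (s + h * I)

/-- The part of the contour integral along the imaginary axis. -/
def verticalPart (α x h : ℝ) : ℝ := ∫ t in (0 : ℝ)..h, t ^ α * Real.exp (t ^ 3 / 3 - x * t)

/-- On the positive imaginary axis `z^α = t^α e^{iαπ/2}`, which the phase cancels exactly, and the
exponent `i(z³/3 + xz)` is real. -/
theorem airyInt_mul_I (α x : ℝ) {t : ℝ} (ht : 0 < t) :
    cexp (-I * (α * Real.pi / 2)) * airyInt α x (t * I)
      = ((t ^ α * Real.exp (t ^ 3 / 3 - x * t) : ℝ) : ℂ) := by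
  have hne : (t * I : ℂ) ≠ 0 := by simp [ht.ne']
  rw [airyInt, Complex.cpow_def_of_ne_zero hne, Complex.log_ofReal_mul ht I_ne_zero,
    Complex.log_I, ← Complex.exp_add, ← Complex.exp_add, Real.rpow_def_of_pos ht,
    ← Real.exp_add, Complex.ofReal_exp]
  congr 1
  push_cast
  have h2 : I ^ 2 = -1 := I_sq
  have h4 : I ^ 4 = 1 := I_pow_four
  ring_nf
  rw [h2, h4]
  ring

/-- The vertical part enters as `i` times a real number and drops out of `Ai`. This is why `Ai`
decays exponentially for `x → +∞`, whereas `Gi` keeps the algebraic contribution of the endpoint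
`0`. -/
theorem Ai_eq_Gi_eq (α x : ℝ) {h : ℝ} (hα : |α| < 1) (hh : 0 < h) :
    Ai α x = 1 / Real.pi * (horizontalPart α x h).re ∧
    Gi α x = 1 / Real.pi * ((horizontalPart α x h).im + verticalPart α x h) := by
  have := Ai_eq_Gi_eq_of_tendsto hα (tendsto_integral_airyInt α x hα hh)
  have e : cexp (-I * (α * Real.pi / 2)) * (∫ t in (0 : ℝ)..h, airyInt α x (t * I))
      = (verticalPart α x h : ℂ) := by
    rw [verticalPart, ← intervalIntegral.integral_const_mul, ← intervalIntegral.integral_ofReal]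
    refine intervalIntegral.integral_congr_ae (Eventually.of_forall fun t ht => ?_)
    rw [Set.uIoc_of_le hh.le] at ht
    exact airyInt_mul_I α x ht.1
  rw [mul_add, mul_left_comm, e] at this
  simpa [horizontalPart] using this

theorem norm_phase (α : ℝ) : ‖cexp (-I * (α * Real.pi / 2))‖ = 1 := by
  have : -I * (α * Real.pi / 2) = ((-(α * Real.pi / 2) : ℝ) : ℂ) * I := by push_cast; ring
  rw [this, norm_exp_ofReal_mul_I]

theorem abs_Ai_le_abs_Gi_le {α x : ℝ} {L : ℂ} (hα : |α| < 1)
    (hL : Tendsto (fun R : ℝ => ∫ s in (0 : ℝ)..R, airyInt α x s) atTop (𝓝 L)) :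
    |Ai α x| ≤ ‖L‖ ∧ |Gi α x| ≤ ‖L‖ := by
  obtain ⟨h1, h2⟩ := Ai_eq_Gi_eq_of_tendsto hα hL
  have h3 : ‖cexp (-I * (α * Real.pi / 2)) * L‖ = ‖L‖ := by rw [norm_mul, norm_phase, one_mul]
  have hpi : |1 / Real.pi| ≤ 1 := by
    rw [abs_of_pos (by positivity), div_le_one Real.pi_pos]
    linarith [Real.pi_gt_three]
  rw [h1, h2, abs_mul, abs_mul]
  constructor
  · calc _ ≤ 1 * ‖cexp (-I * (α * Real.pi / 2)) * L‖ := by gcongr; exact abs_re_le_norm _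
      _ = ‖L‖ := by rw [h3, one_mul]
  · calc _ ≤ 1 * ‖cexp (-I * (α * Real.pi / 2)) * L‖ := by gcongr; exact abs_im_le_norm _
      _ = ‖L‖ := by rw [h3, one_mul]

/-! ### Continuity of `Ai`, `Gi` and `Hi`. -/

theorem continuous_horizontalPart (α : ℝ) (hα : |α| < 1) :
    Continuous fun x => horizontalPart α x 1 := by
  refine continuous_const.mul ?_
  rw [continuous_iff_continuousAt]
  intro x₀
  refine continuousAt_of_dominated
    (bound := fun s => ((1 : ℝ) ^ (-|α|) + (s + 1)) * Real.exp (1 ^ 3 / 3 - (x₀ - 1) * 1)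
      * Real.exp (-1 * s ^ 2)) ?_ ?_ ?_ ?_
  · exact Eventually.of_forall fun x =>
      (by simpa using (continuous_airyInt_horizontal α x one_ne_zero).aestronglyMeasurable)
  · have : ∀ᶠ x in 𝓝 x₀, x₀ - 1 < x := lt_mem_nhds (by linarith)
    filter_upwards [this] with x hx
    filter_upwards [ae_restrict_mem measurableSet_Ioi] with s hs
    have hs' : (0 : ℝ) < s := hs
    refine (norm_airyInt_horizontal_le α x hα (le_of_lt hs) one_pos).trans ?_
    gcongr
  · exact integrableOn_horizontal_bound _ 1 _ one_pos
  · refine Eventually.of_forall fun s => ?_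
    unfold airyInt
    fun_prop

theorem continuous_verticalPart (α : ℝ) (hα : |α| < 1) :
    Continuous fun x => verticalPart α x 1 := by
  rw [continuous_iff_continuousAt]
  intro x₀
  refine intervalIntegral.continuousAt_of_dominated_interval
    (bound := fun t => t ^ α * Real.exp (1 + |x₀| + 1)) ?_ ?_ ?_ ?_
  · refine Eventually.of_forall fun x => ?_
    exact ((measurable_id.pow_const α).mul (by fun_prop)).aestronglyMeasurable
  · have : ∀ᶠ x in 𝓝 x₀, |x| < |x₀| + 1 :=
      continuous_abs.continuousAt.eventually (gt_mem_nhds (by linarith))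
    filter_upwards [this] with x hx
    refine Eventually.of_forall fun t ht => ?_
    rw [Set.uIoc_of_le zero_le_one] at ht
    have ht0 : 0 < t := ht.1
    rw [Real.norm_of_nonneg (by positivity)]
    gcongr
    have h1 : t ^ 3 ≤ 1 := pow_le_one₀ ht0.le ht.2
    have h2 : -(x * t) ≤ |x| * 1 := by
      calc -(x * t) ≤ |x * t| := neg_le_abs _
        _ = |x| * t := by rw [abs_mul, abs_of_pos ht0]
        _ ≤ |x| * 1 := by gcongr; exact ht.2
    linarith
  · exact (intervalIntegral.intervalIntegrable_rpow' (by linarith [neg_abs_le α])).mul_const _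
  · exact Eventually.of_forall fun t _ => by fun_prop

theorem continuous_Ai (α : ℝ) (hα : |α| < 1) : Continuous (Ai α) := by
  have : Ai α = fun x => 1 / Real.pi * (horizontalPart α x 1).re := by
    ext x; exact (Ai_eq_Gi_eq α x hα one_pos).1
  rw [this]
  exact continuous_const.mul (Complex.continuous_re.comp (continuous_horizontalPart α hα))

theorem continuous_Gi (α : ℝ) (hα : |α| < 1) : Continuous (Gi α) := by
  have : Gi α = fun x => 1 / Real.pi * ((horizontalPart α x 1).im + verticalPart α x 1) := by
    ext x; exact (Ai_eq_Gi_eq α x hα one_pos).2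
  rw [this]
  exact continuous_const.mul ((Complex.continuous_im.comp (continuous_horizontalPart α hα)).add
    (continuous_verticalPart α hα))

/-- From `σ = 2(M + 1)` on the cubic term beats the linear ones; before that point `2(M + 1)²`
suffices. It provides an exponential majorant for the integrand of `Hi`, locally uniform in `x`. -/
theorem neg_cube_add_mul_le {σ M : ℝ} (hσ : 0 ≤ σ) (hM : 0 ≤ M) :
    -(σ ^ 3) / 3 + σ * M ≤ 2 * (M + 1) ^ 2 - σ := by
  rcases le_total σ (2 * (M + 1)) with h | h
  · have : 0 ≤ σ ^ 3 := by positivity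
    nlinarith
  · have h2 : (2 * (M + 1)) ^ 2 ≤ σ ^ 2 := by gcongr
    have : (2 * (M + 1)) ^ 2 * σ ≤ σ ^ 2 * σ := by gcongr
    nlinarith [sq_nonneg (M + 1), mul_nonneg hσ hM]

theorem integrableOn_rpow_mul_exp_neg {s b : ℝ} (hs : -1 < s) (hb : 0 < b) :
    IntegrableOn (fun σ : ℝ => σ ^ s * Real.exp (-b * σ)) (Set.Ioi 0) := by
  simpa using integrableOn_rpow_mul_exp_neg_mul_rpow hs one_pos hb

theorem measurable_Hi_integrand (α x : ℝ) :
    Measurable fun σ : ℝ => σ ^ α * Real.exp (-(σ ^ 3) / 3 + σ * x) :=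
  (measurable_id.pow_const α).mul (by fun_prop)

theorem continuous_Hi (α : ℝ) (hα : |α| < 1) : Continuous (Hi α) := by
  refine continuous_const.mul ?_
  rw [continuous_iff_continuousAt]
  intro x₀
  refine continuousAt_of_dominated
    (bound := fun σ => Real.exp (2 * (|x₀| + 1 + 1) ^ 2) * (σ ^ α * Real.exp (-1 * σ))) ?_ ?_ ?_ ?_
  · exact Eventually.of_forall fun x => (measurable_Hi_integrand α x).aestronglyMeasurable
  · have : ∀ᶠ x in 𝓝 x₀, |x| < |x₀| + 1 :=
      continuous_abs.continuousAt.eventually (gt_mem_nhds (by linarith))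
    filter_upwards [this] with x hx
    filter_upwards [ae_restrict_mem measurableSet_Ioi] with σ hσ
    have hσ' : (0 : ℝ) < σ := hσ
    rw [Real.norm_of_nonneg (by positivity), mul_left_comm, ← Real.exp_add]
    refine mul_le_mul_of_nonneg_left (Real.exp_le_exp.mpr ?_) (by positivity)
    have := neg_cube_add_mul_le hσ'.le (M := |x₀| + 1) (by positivity)
    have h2 : σ * x ≤ σ * (|x₀| + 1) := by gcongr; exact (le_abs_self x).trans hx.le
    linarith
  · exact (integrableOn_rpow_mul_exp_neg (by linarith [neg_abs_le α]) one_pos).const_mul _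
  · exact Eventually.of_forall fun σ => by fun_prop

/-! ### Rescaled integrals at the saddle, uniformly in the index. -/

/-- The range of indices for which the bounds are uniform. -/
def indexRange : Set ℝ := Set.Icc (-(5 / 8)) (5 / 8)

theorem abs_le_of_mem_indexRange {α : ℝ} (h : α ∈ indexRange) : |α| ≤ 5 / 8 := abs_le.mpr h

theorem abs_lt_one_of_mem_indexRange {α : ℝ} (h : α ∈ indexRange) : |α| < 1 :=
  (abs_le_of_mem_indexRange h).trans_lt (by norm_num)

theorem mul_cpow_of_pos {c : ℝ} (hc : 0 < c) {z : ℂ} (hz : z ≠ 0) (α : ℝ) :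
    ((c : ℂ) * z) ^ (α : ℂ) = ((c ^ α : ℝ) : ℂ) * z ^ (α : ℂ) := by
  have hc' : (c : ℂ) ≠ 0 := by exact_mod_cast hc.ne'
  rw [Complex.cpow_def_of_ne_zero (mul_ne_zero hc' hz), Complex.log_ofReal_mul hc hz,
    Complex.ofReal_cpow hc.le, Complex.cpow_def_of_ne_zero hc', Complex.cpow_def_of_ne_zero hz,
    ← Complex.exp_add, Complex.ofReal_log hc.le]
  ring_nf

theorem I_add_ofReal_ne_zero (r : ℝ) : I + (r : ℂ) ≠ 0 := by
  intro h0
  have := congrArg Complex.im h0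
  simp at this

/-- The integrand of the rescaled horizontal part. -/
def airyProfileInt (α ε τ : ℝ) : ℂ :=
  cexp (-I * (α * Real.pi / 2)) * (I + (ε * τ : ℝ)) ^ (α : ℂ)
    * cexp (-(τ ^ 2 : ℝ) + (ε * τ ^ 3 / 3 : ℝ) * I)

/-- The rescaled horizontal part. -/
def airyProfile (α ε : ℝ) : ℂ := ∫ τ in Set.Ioi (0 : ℝ), airyProfileInt α ε τ

/-- For `x = e⁴` the line `Im z = e² = √x` passes through the saddle `i√x`, where the exponent is
`-(2/3) x^{3/2}`. The substitution `s = τ / e` normalizes the Gaussian and leaves the small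
parameter `ε = e⁻³ = x^{-3/4}`. Writing `x` as a fourth power keeps all exponents integral. -/
theorem horizontalPart_eq (α : ℝ) {e : ℝ} (he : 0 < e) :
    horizontalPart α (e ^ 4) (e ^ 2)
      = (((e ^ 2) ^ α * e⁻¹ * Real.exp (-(2 / 3) * e ^ 6) : ℝ) : ℂ)
        * airyProfile α (e⁻¹ ^ 3) := by
  have h := integral_comp_mul_left_Ioi
    (fun s : ℝ => airyInt α (e ^ 4) (s + ((e ^ 2 : ℝ) : ℂ) * I)) 0 (inv_pos.mpr he)
  rw [mul_zero, inv_inv] at h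
  have h' : ∫ s in Set.Ioi (0 : ℝ), airyInt α (e ^ 4) (s + ((e ^ 2 : ℝ) : ℂ) * I)
      = (e⁻¹ : ℝ) • ∫ τ in Set.Ioi (0 : ℝ),
        airyInt α (e ^ 4) (((e⁻¹ * τ : ℝ) : ℂ) + ((e ^ 2 : ℝ) : ℂ) * I) := by
    rw [h, smul_smul, inv_mul_cancel₀ he.ne', one_smul]
  rw [horizontalPart, h', airyProfile, ← integral_smul, ← integral_const_mul,
    ← integral_const_mul]
  refine integral_congr_ae (Eventually.of_forall fun τ => ?_)
  have hz : (I + ((e⁻¹ ^ 3 * τ : ℝ) : ℂ)) ≠ 0 := I_add_ofReal_ne_zero _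
  have hfac : (((e⁻¹ * τ : ℝ) : ℂ) + ((e ^ 2 : ℝ) : ℂ) * I)
      = ((e ^ 2 : ℝ) : ℂ) * (I + ((e⁻¹ ^ 3 * τ : ℝ) : ℂ)) := by
    have : e⁻¹ * τ = e ^ 2 * (e⁻¹ ^ 3 * τ) := by field_simp
    rw [this]; push_cast; ring
  have hexp : cexp (I * ((((e⁻¹ * τ : ℝ) : ℂ) + ((e ^ 2 : ℝ) : ℂ) * I) ^ 3 / 3
      + ((e ^ 4 : ℝ) : ℂ) * (((e⁻¹ * τ : ℝ) : ℂ) + ((e ^ 2 : ℝ) : ℂ) * I)))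
      = ((Real.exp (-(2 / 3) * e ^ 6) : ℝ) : ℂ)
        * cexp (-(τ ^ 2 : ℝ) + (e⁻¹ ^ 3 * τ ^ 3 / 3 : ℝ) * I) := by
    rw [Complex.ofReal_exp, ← Complex.exp_add]
    congr 1
    have he' : (e : ℂ) ≠ 0 := by exact_mod_cast he.ne'
    have h3 : I ^ 3 = -I := I_pow_three
    have h4 : I ^ 4 = 1 := I_pow_four
    have h2 : I ^ 2 = -1 := I_sq
    push_cast
    field_simp
    ring_nf
    simp only [h2, h3, h4]
    ring
  simp only [airyInt, airyProfileInt, hexp, Complex.real_smul]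
  rw [hfac, mul_cpow_of_pos (by positivity) hz]
  push_cast
  ring

/-- The cubic term is purely imaginary, so only the Gaussian survives in modulus. The shape of the
bound is that of `integrableOn_horizontal_bound` with `A = 0` and `B = E = 1`. -/
theorem norm_airyProfileInt_le {α ε τ : ℝ} (hα : α ∈ indexRange) (hε : 0 < ε) (hε1 : ε ≤ 1)
    (hτ : 0 < τ) : ‖airyProfileInt α ε τ‖ ≤ (0 + (τ + 1)) * 1 * Real.exp (-1 * τ ^ 2) := by
  have h1 : ‖cexp (-(τ ^ 2 : ℝ) + (ε * τ ^ 3 / 3 : ℝ) * I)‖ = Real.exp (-1 * τ ^ 2) := by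
    rw [Complex.norm_exp, Complex.add_re, Complex.re_ofReal_mul, I_re, ← ofReal_neg, ofReal_re]
    ring_nf
  rw [airyProfileInt, norm_mul, norm_mul, norm_phase, h1, norm_cpow_real]
  have h2 : 1 ≤ ‖I + ((ε * τ : ℝ) : ℂ)‖ := by
    simpa using Complex.abs_im_le_norm (I + ((ε * τ : ℝ) : ℂ))
  have h3 : ‖I + ((ε * τ : ℝ) : ℂ)‖ ≤ τ + 1 := by
    refine (norm_add_le _ _).trans ?_
    rw [norm_I, Complex.norm_real, Real.norm_of_nonneg (by positivity)]
    nlinarith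
  have h4 : ‖I + ((ε * τ : ℝ) : ℂ)‖ ^ α ≤ ‖I + ((ε * τ : ℝ) : ℂ)‖ ^ (1 : ℝ) :=
    Real.rpow_le_rpow_of_exponent_le h2 (by linarith [hα.2])
  rw [Real.rpow_one] at h4
  rw [one_mul]
  gcongr
  linarith

theorem measurable_airyProfileInt (α ε : ℝ) : Measurable (airyProfileInt α ε) := by
  unfold airyProfileInt
  refine Measurable.mul (Measurable.mul measurable_const ?_) ?_
  · exact Measurable.pow_const (by fun_prop) _
  · fun_prop

theorem norm_airyProfile_le : ∃ C : ℝ, 0 < C ∧ ∀ α ∈ indexRange, ∀ ε : ℝ, 0 < ε → ε ≤ 1 →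
    ‖airyProfile α ε‖ ≤ C := by
  refine ⟨(∫ τ in Set.Ioi (0 : ℝ), (0 + (τ + 1)) * 1 * Real.exp (-1 * τ ^ 2)) + 1, ?_, ?_⟩
  · have : 0 ≤ ∫ τ in Set.Ioi (0 : ℝ), (0 + (τ + 1)) * 1 * Real.exp (-1 * τ ^ 2) := by
      refine setIntegral_nonneg measurableSet_Ioi fun τ hτ => ?_
      have : (0 : ℝ) < τ := hτ
      positivity
    linarith
  · intro α hα ε hε hε1
    have := norm_integral_le_of_norm_le (f := airyProfileInt α ε)
      (integrableOn_horizontal_bound 0 1 1 one_pos)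
      (by filter_upwards [ae_restrict_mem measurableSet_Ioi] with τ hτ
          exact norm_airyProfileInt_le hα hε hε1 hτ)
    rw [airyProfile]
    linarith

theorem eventually_small_pos_mem {A : Set ℝ} {b : ℝ} (hb : 0 < b) :
    ∀ᶠ q : ℝ × ℝ in 𝓝[>] 0 ×ˢ 𝓟 A, (0 < q.1 ∧ q.1 ≤ b) ∧ q.2 ∈ A :=
  Filter.Eventually.prod_mk (Ioc_mem_nhdsGT hb) (mem_principal_self A)

/-- The limit is half a Gaussian integral. The factor `𝓟 indexRange` in the filter encodes
uniformity in the index, since a limit along it does not let the index settle. -/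
theorem tendsto_airyProfile :
    Tendsto (fun q : ℝ × ℝ => airyProfile q.2 q.1) (𝓝[>] 0 ×ˢ 𝓟 indexRange)
      (𝓝 ((Real.sqrt Real.pi / 2 : ℝ) : ℂ)) := by
  have hlim : ((Real.sqrt Real.pi / 2 : ℝ) : ℂ)
      = ∫ τ in Set.Ioi (0 : ℝ), ((Real.exp (-1 * τ ^ 2) : ℝ) : ℂ) := by
    rw [integral_complex_ofReal, integral_gaussian_Ioi]; simp
  rw [hlim]
  have hmem := eventually_small_pos_mem (A := indexRange) one_pos
  refine tendsto_integral_filter_of_dominated_convergence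
    (fun τ => (0 + (τ + 1)) * 1 * Real.exp (-1 * τ ^ 2)) ?_ ?_
    (integrableOn_horizontal_bound 0 1 1 one_pos) ?_
  · exact Eventually.of_forall fun q => (measurable_airyProfileInt _ _).aestronglyMeasurable
  · filter_upwards [hmem] with q hq
    filter_upwards [ae_restrict_mem measurableSet_Ioi] with τ hτ
    exact norm_airyProfileInt_le hq.2 hq.1.1 hq.1.2 hτ
  · refine Eventually.of_forall fun τ => ?_
    have hε : Tendsto (fun q : ℝ × ℝ => q.1) (𝓝[>] 0 ×ˢ 𝓟 indexRange) (𝓝 0) :=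
      tendsto_fst.mono_right nhdsWithin_le_nhds
    have hI : I ∈ slitPlane := by simp [mem_slitPlane_iff]
    have hz : Tendsto (fun q : ℝ × ℝ => I + ((q.1 * τ : ℝ) : ℂ)) (𝓝[>] 0 ×ˢ 𝓟 indexRange)
        (𝓝 I) := by
      have hc : Continuous fun ε : ℝ => I + ((ε * τ : ℝ) : ℂ) := by fun_prop
      simpa [Function.comp_def] using (hc.tendsto 0).comp hε
    -- The phase times `(I + ετ)^α` is `exp(α (log(I + ετ) - iπ/2))`. The bracket tends to zero and
    -- `|α| < 1`, hence the convergence is uniform in the index.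
    have hlog : Tendsto (fun q : ℝ × ℝ => (q.2 : ℂ) *
        (Complex.log (I + ((q.1 * τ : ℝ) : ℂ)) - Real.pi / 2 * I))
        (𝓝[>] 0 ×ˢ 𝓟 indexRange) (𝓝 0) := by
      have h1 : Tendsto (fun q : ℝ × ℝ => Complex.log (I + ((q.1 * τ : ℝ) : ℂ)) - Real.pi / 2 * I)
          (𝓝[>] 0 ×ˢ 𝓟 indexRange) (𝓝 0) := by
        have := ((continuousAt_clog hI).tendsto.comp hz).sub_const (Real.pi / 2 * I : ℂ)
        rw [Complex.log_I, sub_self] at this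
        exact this
      refine squeeze_zero_norm' (a := fun q : ℝ × ℝ =>
        ‖Complex.log (I + ((q.1 * τ : ℝ) : ℂ)) - Real.pi / 2 * I‖) ?_ (by simpa using h1.norm)
      filter_upwards [hmem] with q hq
      rw [norm_mul, Complex.norm_real, Real.norm_eq_abs]
      exact mul_le_of_le_one_left (norm_nonneg _) (abs_lt_one_of_mem_indexRange hq.2).le
    have hexp2 : Tendsto (fun q : ℝ × ℝ => cexp (-(τ ^ 2 : ℝ) + (q.1 * τ ^ 3 / 3 : ℝ) * I))
        (𝓝[>] 0 ×ˢ 𝓟 indexRange) (𝓝 ((Real.exp (-1 * τ ^ 2) : ℝ) : ℂ)) := by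
      have hc : Continuous fun ε : ℝ => cexp (-(τ ^ 2 : ℝ) + (ε * τ ^ 3 / 3 : ℝ) * I) := by fun_prop
      simpa [Function.comp_def] using (hc.tendsto 0).comp hε
    have := ((Complex.continuous_exp.tendsto _).comp hlog).mul hexp2
    rw [Complex.exp_zero, one_mul] at this
    refine this.congr fun q => ?_
    have hne : I + ((q.1 * τ : ℝ) : ℂ) ≠ 0 := I_add_ofReal_ne_zero _
    simp only [Function.comp_apply, airyProfileInt]
    rw [Complex.cpow_def_of_ne_zero hne, ← Complex.exp_add (-I * _)]
    congr 2
    ring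

/-- The integrand of the rescaled main part of `Hi`. -/
def scorerProfileInt (α ε τ : ℝ) : ℝ :=
  (Set.Ioi (-(2 * ε)⁻¹)).indicator
    (fun τ => (1 + ε * τ) ^ α * Real.exp (-τ ^ 2 - ε * τ ^ 3 / 3)) τ

/-- The rescaled main part of `Hi`. -/
def scorerProfile (α ε : ℝ) : ℝ := ∫ τ, scorerProfileInt α ε τ

theorem measurable_scorerProfileInt (α ε : ℝ) : Measurable (scorerProfileInt α ε) := by
  refine Measurable.indicator ?_ measurableSet_Ioi
  exact Measurable.mul (Measurable.pow_const (by fun_prop) _) (by fun_prop)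

/-- The cut-off keeps `ετ > -1/2`: the cubic term then costs at most `τ²/6`, leaving `5/6` of the
Gaussian, and `1 + ετ` stays away from the singularity of the power. -/
theorem norm_scorerProfileInt_le {α ε τ : ℝ} (hα : α ∈ indexRange) (hε : 0 < ε) (hε1 : ε ≤ 1) :
    ‖scorerProfileInt α ε τ‖ ≤ (3 + |τ|) * Real.exp (-(5 / 6) * τ ^ 2) := by
  rw [scorerProfileInt]
  by_cases hτ : τ ∈ Set.Ioi (-(2 * ε)⁻¹)
  · rw [Set.indicator_of_mem hτ]
    have h1 : -(1 / 2) < ε * τ := by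
      have : -(2 * ε)⁻¹ < τ := hτ
      have := mul_lt_mul_of_pos_left this hε
      have e : ε * -(2 * ε)⁻¹ = -(1 / 2) := by field_simp
      linarith
    have h2 : (1 / 2 : ℝ) ≤ 1 + ε * τ := by linarith
    have h3 : (1 + ε * τ) ^ α ≤ 3 + |τ| := by
      have ha := rpow_le_rpow_neg_abs_add (α := α) (show 0 < 1 + ε * τ by linarith)
        (abs_lt_one_of_mem_indexRange hα)
      have hb : (1 + ε * τ) ^ (-|α|) ≤ (1 / 2 : ℝ) ^ (-|α|) :=
        Real.rpow_le_rpow_of_nonpos (by norm_num) h2 (by simp)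
      have hc : (1 / 2 : ℝ) ^ (-|α|) ≤ (1 / 2 : ℝ) ^ (-1 : ℝ) :=
        Real.rpow_le_rpow_of_exponent_ge (by norm_num) (by norm_num)
          (by linarith [abs_lt_one_of_mem_indexRange hα])
      have hd : (1 / 2 : ℝ) ^ (-1 : ℝ) = 2 := by rw [Real.rpow_neg_one]; norm_num
      have he : ε * τ ≤ |τ| := by
        calc ε * τ ≤ ε * |τ| := by gcongr; exact le_abs_self τ
          _ ≤ 1 * |τ| := by gcongr
          _ = |τ| := one_mul _
      linarith
    rw [Real.norm_of_nonneg (mul_nonneg (Real.rpow_nonneg (by linarith) _) (Real.exp_pos _).le)]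
    gcongr
    have : -(1 / 2) * τ ^ 2 ≤ ε * τ * τ ^ 2 := by gcongr
    nlinarith
  · rw [Set.indicator_of_notMem hτ]
    simp
    positivity

theorem integrable_scorer_bound :
    Integrable fun τ : ℝ => (3 + |τ|) * Real.exp (-(5 / 6) * τ ^ 2) := by
  have h1 := integrable_exp_neg_mul_sq (b := 5 / 6) (by norm_num)
  have h2 := (integrable_mul_exp_neg_mul_sq (b := 5 / 6) (by norm_num)).norm
  refine ((h1.const_mul 3).add h2).congr (Eventually.of_forall fun τ => ?_)
  simp
  ring

theorem scorerProfile_le : ∃ C : ℝ, 0 < C ∧ ∀ α ∈ indexRange, ∀ ε : ℝ, 0 < ε → ε ≤ 1 →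
    scorerProfile α ε ≤ C := by
  refine ⟨(∫ τ : ℝ, (3 + |τ|) * Real.exp (-(5 / 6) * τ ^ 2)) + 1, ?_, ?_⟩
  · have : 0 ≤ ∫ τ : ℝ, (3 + |τ|) * Real.exp (-(5 / 6) * τ ^ 2) :=
      integral_nonneg fun τ => by positivity
    linarith
  · intro α hα ε hε hε1
    have := norm_integral_le_of_norm_le (f := scorerProfileInt α ε) integrable_scorer_bound
      (Eventually.of_forall fun τ => norm_scorerProfileInt_le hα hε hε1)
    rw [scorerProfile]
    linarith [le_abs_self (∫ τ, scorerProfileInt α ε τ), Real.norm_eq_abs (∫ τ, scorerProfileInt α ε τ)]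

theorem tendsto_scorerProfile :
    Tendsto (fun q : ℝ × ℝ => scorerProfile q.2 q.1) (𝓝[>] 0 ×ˢ 𝓟 indexRange)
      (𝓝 (Real.sqrt Real.pi)) := by
  have hlim : Real.sqrt Real.pi = ∫ τ : ℝ, Real.exp (-1 * τ ^ 2) := by
    rw [integral_gaussian]; simp
  rw [hlim]
  have hmem := eventually_small_pos_mem (A := indexRange) one_pos
  refine tendsto_integral_filter_of_dominated_convergence _ ?_ ?_ integrable_scorer_bound ?_
  · exact Eventually.of_forall fun q => (measurable_scorerProfileInt _ _).aestronglyMeasurable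
  · filter_upwards [hmem] with q hq
    exact Eventually.of_forall fun τ => norm_scorerProfileInt_le hq.2 hq.1.1 hq.1.2
  · refine Eventually.of_forall fun τ => ?_
    have hε : Tendsto (fun q : ℝ × ℝ => q.1) (𝓝[>] 0 ×ˢ 𝓟 indexRange) (𝓝 0) :=
      tendsto_fst.mono_right nhdsWithin_le_nhds
    have hlog : Tendsto (fun q : ℝ × ℝ => Real.log (1 + q.1 * τ) * q.2)
        (𝓝[>] 0 ×ˢ 𝓟 indexRange) (𝓝 0) := by
      have h1 : Tendsto (fun q : ℝ × ℝ => Real.log (1 + q.1 * τ))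
          (𝓝[>] 0 ×ˢ 𝓟 indexRange) (𝓝 0) := by
        have hc : ContinuousAt (fun ε : ℝ => Real.log (1 + ε * τ)) 0 := by
          refine ContinuousAt.log (by fun_prop) (by simp)
        simpa [Function.comp_def] using hc.tendsto.comp hε
      refine squeeze_zero_norm' (a := fun q : ℝ × ℝ => ‖Real.log (1 + q.1 * τ)‖) ?_
        (by simpa using h1.norm)
      filter_upwards [hmem] with q hq
      rw [norm_mul, Real.norm_eq_abs q.2]
      exact mul_le_of_le_one_right (norm_nonneg _) (abs_lt_one_of_mem_indexRange hq.2).le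
    have hexp2 : Tendsto (fun q : ℝ × ℝ => Real.exp (-τ ^ 2 - q.1 * τ ^ 3 / 3))
        (𝓝[>] 0 ×ˢ 𝓟 indexRange) (𝓝 (Real.exp (-1 * τ ^ 2))) := by
      have hc : Continuous fun ε : ℝ => Real.exp (-τ ^ 2 - ε * τ ^ 3 / 3) := by fun_prop
      simpa [Function.comp_def] using (hc.tendsto 0).comp hε
    have := ((Real.continuous_exp.tendsto _).comp hlog).mul hexp2
    rw [Real.exp_zero, one_mul] at this
    refine this.congr' ?_
    have hsmall : ∀ᶠ q : ℝ × ℝ in 𝓝[>] 0 ×ˢ 𝓟 indexRange, -(1 / 2) < q.1 * τ := by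
      have hc : Tendsto (fun q : ℝ × ℝ => q.1 * τ) (𝓝[>] 0 ×ˢ 𝓟 indexRange) (𝓝 0) := by
        simpa using hε.mul_const τ
      exact hc.eventually (lt_mem_nhds (by norm_num))
    filter_upwards [hmem, hsmall] with q hq hs
    have hin : τ ∈ Set.Ioi (-(2 * q.1)⁻¹) := by
      have hq1 := hq.1.1
      have : -(2 * q.1)⁻¹ = -(1 / 2) / q.1 := by field_simp
      rw [Set.mem_Ioi, this, div_lt_iff₀ hq1]
      linarith
    simp only [Function.comp_apply]
    rw [scorerProfileInt, Set.indicator_of_mem hin, Real.rpow_def_of_pos (by linarith)]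

/-- Laplace's method: `-σ³/3 + σx` with `x = e⁴` has its maximum `(2/3) e⁶` at `σ = e²`. The
integral is cut at half of that point and the right piece rescaled by `σ = e² + τ / e`. -/
theorem Hi_eq (α : ℝ) (hα : |α| < 1) {e : ℝ} (he : 0 < e) :
    Hi α (e ^ 4) = 1 / Real.pi * ((∫ σ in (0 : ℝ)..(e ^ 2 / 2),
        σ ^ α * Real.exp (-(σ ^ 3) / 3 + σ * e ^ 4))
      + (e ^ 2) ^ α * e⁻¹ * Real.exp (2 / 3 * e ^ 6) * scorerProfile α (e⁻¹ ^ 3)) := by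
  set g : ℝ → ℝ := fun σ => σ ^ α * Real.exp (-(σ ^ 3) / 3 + σ * e ^ 4) with hg
  have hgi : IntegrableOn g (Set.Ioi 0) := by
    refine ((integrableOn_rpow_mul_exp_neg (s := α) (by linarith [neg_abs_le α]) one_pos).const_mul
      (Real.exp (2 * (e ^ 4 + 1) ^ 2))).mono' (measurable_Hi_integrand _ _).aestronglyMeasurable ?_
    filter_upwards [ae_restrict_mem measurableSet_Ioi] with σ hσ
    have hσ' : (0 : ℝ) < σ := hσ
    rw [Real.norm_of_nonneg (by positivity), mul_left_comm, ← Real.exp_add]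
    refine mul_le_mul_of_nonneg_left (Real.exp_le_exp.mpr ?_) (by positivity)
    have := neg_cube_add_mul_le hσ'.le (M := e ^ 4) (by positivity)
    linarith
  have hsplit : ∫ σ in Set.Ioi (0 : ℝ), g σ
      = (∫ σ in (0 : ℝ)..(e ^ 2 / 2), g σ) + ∫ σ in Set.Ioi (e ^ 2 / 2), g σ := by
    rw [intervalIntegral.integral_of_le (by positivity), ← setIntegral_union
      (by rw [Set.disjoint_left]; intro x hx hx'; exact absurd hx.2 (not_le.mpr hx'))
      measurableSet_Ioi (hgi.mono_set Set.Ioc_subset_Ioi_self)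
      (hgi.mono_set (Set.Ioi_subset_Ioi (by positivity))), Set.Ioc_union_Ioi_eq_Ioi (by positivity)]
  rw [Hi, hsplit]
  congr 2
  rw [scorerProfile, ← integral_const_mul, ← integral_indicator measurableSet_Ioi]
  set G := (Set.Ioi (e ^ 2 / 2)).indicator g
  have hsub : ∫ σ, G σ = e⁻¹ * ∫ τ, G (e ^ 2 + e⁻¹ * τ) := by
    have h1 := Measure.integral_comp_mul_left (fun s => G (e ^ 2 + s)) e⁻¹
    rw [h1, integral_add_left_eq_self, inv_inv, abs_of_pos he, smul_eq_mul, ← mul_assoc,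
      inv_mul_cancel₀ he.ne', one_mul]
  rw [hsub, ← integral_const_mul]
  refine integral_congr_ae (Eventually.of_forall fun τ => ?_)
  simp only [G, scorerProfileInt]
  have hiff : e ^ 2 + e⁻¹ * τ ∈ Set.Ioi (e ^ 2 / 2) ↔ τ ∈ Set.Ioi (-(2 * e⁻¹ ^ 3)⁻¹) := by
    have e1 : -(2 * e⁻¹ ^ 3)⁻¹ = -(e ^ 3 / 2) := by field_simp
    have e2 : e⁻¹ * τ = τ / e := by field_simp
    rw [Set.mem_Ioi, Set.mem_Ioi, e1, e2]
    constructor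
    · intro h
      have : -(e ^ 2 / 2) < τ / e := by linarith
      rw [lt_div_iff₀ he] at this
      nlinarith
    · intro h
      have : -(e ^ 2 / 2) < τ / e := by
        rw [lt_div_iff₀ he]
        nlinarith
      linarith
  by_cases hτ : τ ∈ Set.Ioi (-(2 * e⁻¹ ^ 3)⁻¹)
  · rw [Set.indicator_of_mem hτ, Set.indicator_of_mem (hiff.mpr hτ)]
    have hpos : 0 < 1 + e⁻¹ ^ 3 * τ := by
      have h1 : e ^ 2 / 2 < e ^ 2 + e⁻¹ * τ := hiff.mpr hτ
      have e3 : e ^ 2 + e⁻¹ * τ = e ^ 2 * (1 + e⁻¹ ^ 3 * τ) := by field_simp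
      rw [e3] at h1
      have : 0 < e ^ 2 := by positivity
      by_contra hneg
      nlinarith
    have e3 : e ^ 2 + e⁻¹ * τ = e ^ 2 * (1 + e⁻¹ ^ 3 * τ) := by field_simp
    have hexp : -((e ^ 2 + e⁻¹ * τ) ^ 3) / 3 + (e ^ 2 + e⁻¹ * τ) * e ^ 4
        = 2 / 3 * e ^ 6 + (-τ ^ 2 - e⁻¹ ^ 3 * τ ^ 3 / 3) := by
      field_simp
      ring
    simp only [hg]
    rw [hexp, e3, Real.mul_rpow (by positivity) hpos.le, Real.exp_add]
    ring
  · rw [Set.indicator_of_notMem hτ, Set.indicator_of_notMem (fun h => hτ (hiff.mp h))]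
    simp

/-! ### Bounds for `Ai`, `Gi` and `Hi` with constants independent of the index. -/

theorem rpow_le_two_mul {r c α : ℝ} (hc : 0 < c) (h1 : c / 2 ≤ r) (h2 : r ≤ 2 * c)
    (hα : |α| ≤ 1) : r ^ α ≤ 2 * c ^ α := by
  have hr : 0 < r := by linarith
  have h3 : r ^ α = (r / c) ^ α * c ^ α := by
    rw [← Real.mul_rpow (by positivity) hc.le, div_mul_cancel₀ _ hc.ne']
  rw [h3]
  gcongr
  have hα' := abs_le.mp hα
  rcases le_total 1 (r / c) with h | h
  · calc (r / c) ^ α ≤ (r / c) ^ (1 : ℝ) := Real.rpow_le_rpow_of_exponent_le h hα'.2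
      _ = r / c := Real.rpow_one _
      _ ≤ 2 := by rw [div_le_iff₀ hc]; exact h2
  · calc (r / c) ^ α ≤ (r / c) ^ (-1 : ℝ) :=
          Real.rpow_le_rpow_of_exponent_ge (by positivity) h hα'.1
      _ = c / r := by rw [Real.rpow_neg_one, inv_div]
      _ ≤ 2 := by rw [div_le_iff₀ hr]; linarith

theorem rpow_le_four_mul_one_add {ξ s : ℝ} (hξ : 1 ≤ ξ) (hs : |s| ≤ 2) :
    ξ ^ s ≤ 4 * (1 + ξ) ^ s := by
  have hξ0 : 0 < ξ := by linarith
  rcases le_total 0 s with h | h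
  · have h1 : ξ ^ s ≤ (1 + ξ) ^ s := Real.rpow_le_rpow hξ0.le (by linarith) h
    have h2 : 0 ≤ (1 + ξ) ^ s := by positivity
    linarith
  · have h1 : (2 * ξ) ^ s ≤ (1 + ξ) ^ s :=
      Real.rpow_le_rpow_of_nonpos (by linarith) (by linarith) h
    rw [Real.mul_rpow (by norm_num) hξ0.le] at h1
    have h2 : (2 : ℝ) ^ (-2 : ℝ) ≤ 2 ^ s :=
      Real.rpow_le_rpow_of_exponent_le (by norm_num) (abs_le.mp hs).1
    have h3 : (2 : ℝ) ^ (-2 : ℝ) = 1 / 4 := by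
      rw [Real.rpow_neg (by norm_num)]; norm_num
    rw [h3] at h2
    have h4 : 1 / 4 * ξ ^ s ≤ 2 ^ s * ξ ^ s := by gcongr
    linarith

theorem one_le_four_mul_one_add_rpow {ξ s : ℝ} (hξ : 0 ≤ ξ) (hξ1 : ξ ≤ 1) (hs : |s| ≤ 2) :
    1 ≤ 4 * (1 + ξ) ^ s := by
  have h1 : (1 + ξ) ^ (-2 : ℝ) ≤ (1 + ξ) ^ s :=
    Real.rpow_le_rpow_of_exponent_le (by linarith) (abs_le.mp hs).1
  have h2 : (2 : ℝ) ^ (-2 : ℝ) ≤ (1 + ξ) ^ (-2 : ℝ) :=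
    Real.rpow_le_rpow_of_nonpos (by linarith) (by linarith) (by norm_num)
  have h3 : (2 : ℝ) ^ (-2 : ℝ) = 1 / 4 := by
    rw [Real.rpow_neg (by norm_num)]; norm_num
  rw [h3] at h2
  linarith

/-- The integral equals `Γ(α + 1) b^{-1-α}`, and `Γ` is bounded on the compact set of indices
shifted by one. All algebraic tails come from here. -/
theorem integral_rpow_mul_exp_neg_le : ∃ G : ℝ, 0 < G ∧ ∀ α ∈ indexRange, ∀ b : ℝ, 0 < b →
    ∫ t in Set.Ioi (0 : ℝ), t ^ α * Real.exp (-b * t) ≤ G * b ^ (-1 - α) := by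
  have hc : ContinuousOn (fun α : ℝ => Real.Gamma (α + 1)) indexRange := by
    intro α hα
    refine ContinuousAt.continuousWithinAt ?_
    have hΓ : ContinuousAt Real.Gamma (α + 1) := by
      refine (Real.differentiableAt_Gamma fun m => ?_).continuousAt
      have := hα.1
      have hm : (0 : ℝ) ≤ m := m.cast_nonneg
      intro h
      linarith
    exact ContinuousAt.comp (f := fun α : ℝ => α + 1) hΓ (by fun_prop)
  obtain ⟨G, hG⟩ := isCompact_Icc.exists_bound_of_continuousOn hc
  refine ⟨|G| + 1, by positivity, fun α hα b hb => ?_⟩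
  have h1 := Real.integral_rpow_mul_exp_neg_mul_Ioi (a := α + 1) (r := b) (by linarith [hα.1]) hb
  have h2 : ∫ t in Set.Ioi (0 : ℝ), t ^ α * Real.exp (-b * t)
      = ∫ t in Set.Ioi (0 : ℝ), t ^ (α + 1 - 1) * Real.exp (-(b * t)) := by
    simp
  rw [h2, h1, one_div, Real.inv_rpow hb.le, ← Real.rpow_neg hb.le, mul_comm]
  have h3 : -(α + 1) = -1 - α := by ring
  rw [h3]
  gcongr
  have := hG α hα
  rw [Real.norm_eq_abs] at this
  linarith [le_abs_self (Real.Gamma (α + 1)), le_abs_self G]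

theorem norm_airyInt_mul_I (α x : ℝ) (t : ℝ) :
    ‖airyInt α x (t * I)‖ = |t| ^ α * Real.exp (t ^ 3 / 3 - x * t) := by
  have := norm_airyInt_add_mul_I α x 0 t
  simpa using this

theorem rpow_le_of_le_one {t α : ℝ} (ht : 0 < t) (ht1 : t ≤ 1) (hα : α ∈ indexRange) :
    t ^ α ≤ t ^ (-(5 / 8) : ℝ) :=
  Real.rpow_le_rpow_of_exponent_ge ht ht1 hα.1

/-- For bounded `x` no saddle is needed: the fixed contour at height `1` gives integrals bounded
uniformly in the index. -/
theorem abs_Ai_Gi_le_of_abs_le_one : ∃ C : ℝ, 0 < C ∧ ∀ α ∈ indexRange, ∀ x : ℝ, |x| ≤ 1 →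
    |Ai α x| ≤ C ∧ |Gi α x| ≤ C := by
  set B₁ := ∫ s in Set.Ioi (0 : ℝ), (1 + (s + 1)) * Real.exp (1 ^ 3 / 3 + 1) * Real.exp (-1 * s ^ 2)
  set B₂ := ∫ t in (0 : ℝ)..1, t ^ (-(5 / 8) : ℝ) * Real.exp 2
  have hB₁ : 0 ≤ B₁ := setIntegral_nonneg measurableSet_Ioi fun s hs => by
    have : (0 : ℝ) < s := hs
    positivity
  have hB₂ : 0 ≤ B₂ := intervalIntegral.integral_nonneg zero_le_one fun t ht => by
    have := ht.1
    positivity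
  refine ⟨B₁ + B₂ + 1, by linarith, fun α hα x hx => ?_⟩
  have hα1 := abs_lt_one_of_mem_indexRange hα
  have hx' := abs_le.mp hx
  have h1 : ‖∫ s in Set.Ioi (0 : ℝ), airyInt α x (s + (1 : ℝ) * I)‖ ≤ B₁ := by
    refine norm_integral_le_of_norm_le (integrableOn_horizontal_bound _ _ _ one_pos) ?_
    filter_upwards [ae_restrict_mem measurableSet_Ioi] with s hs
    have hs' : (0 : ℝ) < s := hs
    refine (norm_airyInt_horizontal_le α x hα1 hs'.le one_pos).trans ?_
    rw [Real.one_rpow]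
    gcongr
    linarith
  have h2 : ‖I * ∫ t in (0 : ℝ)..1, airyInt α x (t * I)‖ ≤ B₂ := by
    rw [norm_mul, norm_I, one_mul]
    refine intervalIntegral.norm_integral_le_of_norm_le zero_le_one
      (Eventually.of_forall fun t ht => ?_)
      ((intervalIntegral.intervalIntegrable_rpow' (by norm_num)).mul_const _)
    rw [norm_airyInt_mul_I, abs_of_pos ht.1]
    refine mul_le_mul (rpow_le_of_le_one ht.1 ht.2 hα) (Real.exp_le_exp.mpr ?_)
      (Real.exp_pos _).le (Real.rpow_nonneg ht.1.le _)
    have h3 : t ^ 3 ≤ 1 := pow_le_one₀ ht.1.le ht.2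
    nlinarith [ht.1, ht.2]
  have h3 := norm_add_le (∫ s in Set.Ioi (0 : ℝ), airyInt α x (s + (1 : ℝ) * I))
    (I * ∫ t in (0 : ℝ)..1, airyInt α x (t * I))
  have h4 := abs_Ai_le_abs_Gi_le hα1 (tendsto_integral_airyInt α x hα1 one_pos)
  exact ⟨by linarith [h4.1], by linarith [h4.2]⟩

theorem rpow_le_add_of_mem_indexRange {σ α : ℝ} (hσ : 0 < σ) (hα : α ∈ indexRange) :
    σ ^ α ≤ σ ^ (-(5 / 8) : ℝ) + σ := by
  rcases le_total σ 1 with h | h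
  · linarith [rpow_le_of_le_one hσ h hα]
  · have h1 : σ ^ α ≤ σ ^ (1 : ℝ) := Real.rpow_le_rpow_of_exponent_le h (by linarith [hα.2])
    rw [Real.rpow_one] at h1
    have : 0 ≤ σ ^ (-(5 / 8) : ℝ) := by positivity
    linarith

theorem Hi_nonneg (α x : ℝ) : 0 ≤ Hi α x := by
  refine mul_nonneg (by positivity) (setIntegral_nonneg measurableSet_Ioi fun σ hσ => ?_)
  have : (0 : ℝ) < σ := hσ
  positivity

theorem one_div_pi_le_one : 1 / Real.pi ≤ 1 := by
  rw [div_le_one Real.pi_pos]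
  linarith [Real.pi_gt_three]

theorem Hi_le_of_le_one : ∃ C : ℝ, 0 < C ∧ ∀ α ∈ indexRange, ∀ x : ℝ, x ≤ 1 → Hi α x ≤ C := by
  set B := ∫ σ in Set.Ioi (0 : ℝ), Real.exp 8 * ((σ ^ (-(5 / 8) : ℝ) + σ) * Real.exp (-1 * σ))
  have hB : 0 ≤ B := setIntegral_nonneg measurableSet_Ioi fun σ hσ => by
    have : (0 : ℝ) < σ := hσ
    positivity
  refine ⟨B + 1, by linarith, fun α hα x hx => ?_⟩
  have hint : IntegrableOn (fun σ : ℝ =>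
      Real.exp 8 * ((σ ^ (-(5 / 8) : ℝ) + σ) * Real.exp (-1 * σ))) (Set.Ioi 0) := by
    refine Integrable.const_mul ?_ _
    have h1 := integrableOn_rpow_mul_exp_neg (s := -(5 / 8)) (b := 1) (by norm_num) one_pos
    have h2 := integrableOn_rpow_mul_exp_neg (s := 1) (b := 1) (by norm_num) one_pos
    refine (h1.add h2).congr (Eventually.of_forall fun σ => ?_)
    simp
    ring
  have h1 : ∫ σ in Set.Ioi (0 : ℝ), σ ^ α * Real.exp (-(σ ^ 3) / 3 + σ * x) ≤ B := by
    refine (le_abs_self _).trans ?_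
    rw [← Real.norm_eq_abs]
    refine norm_integral_le_of_norm_le hint ?_
    filter_upwards [ae_restrict_mem measurableSet_Ioi] with σ hσ
    have hσ' : (0 : ℝ) < σ := hσ
    rw [Real.norm_of_nonneg (by positivity), mul_left_comm, ← Real.exp_add]
    refine mul_le_mul (rpow_le_add_of_mem_indexRange hσ' hα) (Real.exp_le_exp.mpr ?_)
      (Real.exp_pos _).le (by positivity)
    have h3 := neg_cube_add_mul_le hσ'.le (M := 1) (by norm_num)
    have h2 : σ * x ≤ σ * 1 := by gcongr
    linarith
  have h0 : 0 ≤ ∫ σ in Set.Ioi (0 : ℝ), σ ^ α * Real.exp (-(σ ^ 3) / 3 + σ * x) :=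
    setIntegral_nonneg measurableSet_Ioi fun σ hσ => by
      have : (0 : ℝ) < σ := hσ
      positivity
  rw [Hi]
  nlinarith [one_div_pi_le_one]

theorem Hi_le_of_neg : ∃ C : ℝ, 0 < C ∧ ∀ α ∈ indexRange, ∀ x : ℝ, x ≤ 0 →
    Hi α x ≤ C * (1 + |x|) ^ (-1 - α) := by
  obtain ⟨C₁, hC₁, h₁⟩ := Hi_le_of_le_one
  obtain ⟨G, hG, h₂⟩ := integral_rpow_mul_exp_neg_le
  refine ⟨4 * (C₁ + G), by positivity, fun α hα x hx => ?_⟩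
  have hs : |(-1 - α)| ≤ 2 := by
    rw [abs_le]; constructor <;> linarith [hα.1, hα.2]
  have hp : 0 ≤ (1 + |x|) ^ (-1 - α) := by positivity
  rcases le_total |x| 1 with h | h
  · have := one_le_four_mul_one_add_rpow (abs_nonneg x) h hs
    have h3 := h₁ α hα x (by linarith)
    nlinarith
  · have hxp : 0 < |x| := by linarith
    have h3 := h₂ α hα |x| hxp
    have h4 := rpow_le_four_mul_one_add h hs
    have hmono : ∫ σ in Set.Ioi (0 : ℝ), σ ^ α * Real.exp (-(σ ^ 3) / 3 + σ * x)
        ≤ ∫ t in Set.Ioi (0 : ℝ), t ^ α * Real.exp (-|x| * t) := by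
      refine integral_mono_of_nonneg ?_
        (integrableOn_rpow_mul_exp_neg (by linarith [hα.1]) hxp) ?_
      · filter_upwards [ae_restrict_mem measurableSet_Ioi] with σ hσ
        have : (0 : ℝ) < σ := hσ
        simp only [Pi.zero_apply]
        positivity
      · filter_upwards [ae_restrict_mem measurableSet_Ioi] with σ hσ
        have hσ' : (0 : ℝ) < σ := hσ
        refine mul_le_mul_of_nonneg_left (Real.exp_le_exp.mpr ?_) (by positivity)
        rw [abs_of_nonpos hx]
        have : 0 ≤ σ ^ 3 := by positivity
        linarith
    have h0 : 0 ≤ ∫ σ in Set.Ioi (0 : ℝ), σ ^ α * Real.exp (-(σ ^ 3) / 3 + σ * x) :=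
      setIntegral_nonneg measurableSet_Ioi fun σ hσ => by
        have : (0 : ℝ) < σ := hσ
        positivity
    have h5 : Hi α x ≤ ∫ σ in Set.Ioi (0 : ℝ), σ ^ α * Real.exp (-(σ ^ 3) / 3 + σ * x) := by
      rw [Hi]
      nlinarith [one_div_pi_le_one]
    nlinarith

theorem pow_mul_exp_neg_le (n : ℕ) {y : ℝ} (hy : 0 ≤ y) : y ^ n * Real.exp (-y) ≤ n.factorial := by
  have h := Real.pow_div_factorial_le_exp y hy n
  rw [div_le_iff₀ (by positivity)] at h
  calc y ^ n * Real.exp (-y) ≤ (Real.exp y * n.factorial) * Real.exp (-y) := by gcongr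
    _ = n.factorial := by rw [mul_right_comm, ← Real.exp_add]; simp

/-- Down the negative imaginary axis the exponent at `-it` is `-t³/3 - mt` for `x = -m`, so the
branch point at `0` contributes at most a Laplace integral of size `m^{-1-α}`. -/
theorem integral_vertical_below_le {G : ℝ} (hG : ∀ α ∈ indexRange, ∀ b : ℝ, 0 < b →
    ∫ t in Set.Ioi (0 : ℝ), t ^ α * Real.exp (-b * t) ≤ G * b ^ (-1 - α))
    {α m h : ℝ} (hα : α ∈ indexRange) (hm : 0 < m) (hh : 0 < h) :
    ‖∫ t in (0 : ℝ)..(-h), airyInt α (-m) (t * I)‖ ≤ G * m ^ (-1 - α) := by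
  have e1 : ∫ t in (0 : ℝ)..h, airyInt α (-m) (((-t : ℝ) : ℂ) * I)
      = - ∫ t in (0 : ℝ)..(-h), airyInt α (-m) (t * I) := by
    rw [intervalIntegral.integral_comp_neg (fun t : ℝ => airyInt α (-m) ((t : ℂ) * I)),
      neg_zero, intervalIntegral.integral_symm]
  rw [← norm_neg, ← e1]
  have hi := integrableOn_rpow_mul_exp_neg (s := α) (b := m) (by linarith [hα.1]) hm
  refine (intervalIntegral.norm_integral_le_of_norm_le hh.le (Eventually.of_forall fun t ht => ?_)
    (g := fun t => t ^ α * Real.exp (-m * t)) ?_).trans ?_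
  · rw [norm_airyInt_mul_I, abs_neg, abs_of_pos ht.1]
    refine mul_le_mul_of_nonneg_left (Real.exp_le_exp.mpr ?_) (Real.rpow_nonneg ht.1.le _)
    have : 0 ≤ t ^ 3 := pow_nonneg ht.1.le 3
    nlinarith
  · rw [intervalIntegrable_iff_integrableOn_Ioc_of_le hh.le]
    exact hi.mono_set Set.Ioc_subset_Ioi_self
  · refine le_trans ?_ (hG α hα m hm)
    rw [intervalIntegral.integral_of_le hh.le]
    refine setIntegral_mono_set hi ?_ (Set.Ioc_subset_Ioi_self).eventuallyLE
    filter_upwards [ae_restrict_mem measurableSet_Ioi] with t ht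
    have : (0 : ℝ) < t := ht
    simp only [Pi.zero_apply]
    positivity

theorem norm_add_mul_I_le (s t : ℝ) : ‖(s + t * I : ℂ)‖ ≤ |s| + |t| := by
  refine (norm_add_le _ _).trans ?_
  simp

theorem abs_le_norm_add_mul_I (s t : ℝ) : |s| ≤ ‖(s + t * I : ℂ)‖ := by
  simpa using Complex.abs_re_le_norm (s + t * I : ℂ)

/-- For `x = -e⁴` the saddle is `e²` on the real axis, and the path runs at depth `1/e` until it is
reached. The half next to the saddle gives the saddle contribution; the half next to `0` is
exponentially small and is absorbed in the endpoint term. -/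
theorem integral_horizontal_below_le {α e : ℝ} (hα : α ∈ indexRange) (he : 1 ≤ e) :
    ‖∫ s in (0 : ℝ)..(e ^ 2), airyInt α (-(e ^ 4)) (s + (-e⁻¹ : ℝ) * I)‖
      ≤ 2 * ((e ^ 2) ^ α * e⁻¹) + 2000 * (e ^ 4) ^ (-1 - α) := by
  have he0 : 0 < e := by linarith
  have hinv : e⁻¹ ≤ 1 := inv_le_one_of_one_le₀ he
  have hinv0 : 0 < e⁻¹ := by positivity
  have he2 : 1 ≤ e ^ 2 := one_le_pow₀ he
  have hb : ∀ s ∈ Set.Ioc 0 (e ^ 2), ‖airyInt α (-(e ^ 4)) (s + (-e⁻¹ : ℝ) * I)‖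
      ≤ 2 * (e ^ 2) ^ α * Real.exp (e * s - e ^ 3)
        + (s ^ (-(5 / 8) : ℝ) + 2 * e ^ 2) * Real.exp (-(e ^ 3 / 2)) := by
    intro s hs
    have hs0 : 0 < s := hs.1
    rw [norm_airyInt_add_mul_I]
    have n1 := norm_add_mul_I_le s (-e⁻¹)
    have n2 := abs_le_norm_add_mul_I s (-e⁻¹)
    rw [abs_of_pos hs0] at n1 n2
    rw [abs_neg, abs_of_pos hinv0] at n1
    set r := ‖((s : ℂ) + ((-e⁻¹ : ℝ) : ℂ) * I)‖
    have hr : r ≤ 2 * e ^ 2 := by linarith [hs.2]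
    have hE : -s ^ 2 * -e⁻¹ + (-e⁻¹) ^ 3 / 3 - -(e ^ 4) * -e⁻¹ ≤ e * s - e ^ 3 := by
      have h1 : e ^ 4 * e⁻¹ = e ^ 3 := by field_simp
      have h2 : s ^ 2 * e⁻¹ ≤ e * s := by
        have : s ^ 2 * e⁻¹ ≤ (e ^ 2 * s) * e⁻¹ := by
          gcongr; nlinarith [hs.2]
        have h3 : (e ^ 2 * s) * e⁻¹ = e * s := by field_simp
        linarith
      have h3 : 0 ≤ e⁻¹ ^ 3 := by positivity
      nlinarith
    -- For `s ≥ e²/2` the modulus is comparable to `e²` and the power can be frozen there. For `s ≤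
    -- e²/2` the power may be singular, but the exponent is at most `-e³/2`.
    rcases le_total (e ^ 2 / 2) s with h | h
    · have hp := rpow_le_two_mul (α := α) (by positivity : 0 < e ^ 2) (h.trans n2) hr
        (abs_lt_one_of_mem_indexRange hα).le
      have : 0 ≤ (s ^ (-(5 / 8) : ℝ) + 2 * e ^ 2) * Real.exp (-(e ^ 3 / 2)) := by positivity
      have h5 : r ^ α * Real.exp (-s ^ 2 * -e⁻¹ + (-e⁻¹) ^ 3 / 3 - -(e ^ 4) * -e⁻¹)
          ≤ 2 * (e ^ 2) ^ α * Real.exp (e * s - e ^ 3) := by gcongr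
      linarith
    · have hp : r ^ α ≤ s ^ (-(5 / 8) : ℝ) + 2 * e ^ 2 := by
        have hr0 : 0 < r := by linarith
        have hsp : 0 ≤ s ^ (-(5 / 8) : ℝ) := by positivity
        have := rpow_le_add_of_mem_indexRange hr0 hα
        have h6 : r ^ (-(5 / 8) : ℝ) ≤ s ^ (-(5 / 8) : ℝ) :=
          Real.rpow_le_rpow_of_nonpos hs0 n2 (by norm_num)
        linarith
      have : 0 ≤ 2 * (e ^ 2) ^ α * Real.exp (e * s - e ^ 3) := by positivity
      have h5 : r ^ α * Real.exp (-s ^ 2 * -e⁻¹ + (-e⁻¹) ^ 3 / 3 - -(e ^ 4) * -e⁻¹)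
          ≤ (s ^ (-(5 / 8) : ℝ) + 2 * e ^ 2) * Real.exp (-(e ^ 3 / 2)) := by
        gcongr
        nlinarith
      linarith
  have i1 : IntervalIntegrable (fun s : ℝ => 2 * (e ^ 2) ^ α * Real.exp (e * s - e ^ 3))
      volume 0 (e ^ 2) := Continuous.intervalIntegrable (by fun_prop) _ _
  have i2 : IntervalIntegrable (fun s : ℝ => s ^ (-(5 / 8) : ℝ)) volume 0 (e ^ 2) :=
    intervalIntegral.intervalIntegrable_rpow' (by norm_num)
  have i3 : IntervalIntegrable (fun _ : ℝ => 2 * e ^ 2) volume 0 (e ^ 2) := by simp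
  refine (intervalIntegral.norm_integral_le_of_norm_le (by positivity)
    (Eventually.of_forall hb) (i1.add ((i2.add i3).mul_const _))).trans ?_
  rw [intervalIntegral.integral_add i1 ((i2.add i3).mul_const _),
    intervalIntegral.integral_mul_const, intervalIntegral.integral_add i2 i3,
    intervalIntegral.integral_const_mul, integral_rpow (Or.inl (by norm_num)),
    intervalIntegral.integral_const]
  have e1 : ∫ s in (0 : ℝ)..(e ^ 2), Real.exp (e * s - e ^ 3) = e⁻¹ * (1 - Real.exp (-e ^ 3)) := by
    rw [intervalIntegral.integral_comp_mul_sub (fun y => Real.exp y) he0.ne', integral_exp]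
    simp
    left
    ring
  rw [e1]
  have e2 : (e ^ 2) ^ α * 2 * (e⁻¹ * (1 - Real.exp (-e ^ 3))) ≤ 2 * ((e ^ 2) ^ α * e⁻¹) := by
    have := Real.exp_pos (-e ^ 3)
    have : 0 < (e ^ 2) ^ α * e⁻¹ := by positivity
    nlinarith
  have e3 : ((e ^ 2) ^ ((-(5 / 8) : ℝ) + 1) - 0 ^ ((-(5 / 8) : ℝ) + 1)) / ((-(5 / 8) : ℝ) + 1)
      ≤ 3 * e ^ 4 := by
    have h1 : (e ^ 2) ^ ((-(5 / 8) : ℝ) + 1) ≤ (e ^ 2) ^ (1 : ℝ) :=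
      Real.rpow_le_rpow_of_exponent_le he2 (by norm_num)
    rw [Real.rpow_one] at h1
    rw [Real.zero_rpow (by norm_num), sub_zero, div_le_iff₀ (by norm_num)]
    nlinarith
  have e4 : (e ^ 2 - 0) • (2 * e ^ 2) ≤ 2 * e ^ 4 := by
    rw [smul_eq_mul]
    exact le_of_eq (by ring)
  -- The fourth term of the exponential series at `e³/2` gives `16 · 4! = 384`, and `5 · 384 ≤
  -- 2000`.
  have e5 : (5 * e ^ 4) * Real.exp (-(e ^ 3 / 2)) ≤ 2000 * (e ^ 4) ^ (-1 - α) := by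
    have h1 : (e ^ 4) ^ (-2 : ℝ) ≤ (e ^ 4) ^ (-1 - α) :=
      Real.rpow_le_rpow_of_exponent_le (one_le_pow₀ he) (by linarith [hα.2])
    have h2 : (e ^ 4) ^ (-2 : ℝ) = (e ^ 8)⁻¹ := by
      rw [Real.rpow_neg (by positivity)]
      norm_cast
      rw [← pow_mul]
    have h3 := pow_mul_exp_neg_le 4 (y := e ^ 3 / 2) (by positivity)
    have h4 : e ^ 12 * Real.exp (-(e ^ 3 / 2)) ≤ 384 := by
      have : (e ^ 3 / 2) ^ 4 = e ^ 12 / 16 := by ring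
      rw [this] at h3
      norm_num [Nat.factorial] at h3
      linarith
    have h5 : (5 * e ^ 4) * Real.exp (-(e ^ 3 / 2)) ≤ 2000 * (e ^ 8)⁻¹ := by
      rw [← div_eq_mul_inv, le_div_iff₀ (by positivity)]
      calc 5 * e ^ 4 * Real.exp (-(e ^ 3 / 2)) * e ^ 8
          = 5 * (e ^ 12 * Real.exp (-(e ^ 3 / 2))) := by ring
        _ ≤ _ := by linarith
    rw [h2] at h1
    linarith
  have e6 : (((e ^ 2) ^ ((-(5 / 8) : ℝ) + 1) - 0 ^ ((-(5 / 8) : ℝ) + 1)) / ((-(5 / 8) : ℝ) + 1)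
      + (e ^ 2 - 0) • (2 * e ^ 2)) * Real.exp (-(e ^ 3 / 2))
      ≤ (5 * e ^ 4) * Real.exp (-(e ^ 3 / 2)) := by
    gcongr
    linarith
  linarith

/-- On the vertical line through the saddle the terms linear in `t` cancel and the real part of the
exponent is `t³/3`, at most `1` on this segment. A bounded exponential times the length `2/e` gives
the bound. -/
theorem integral_vertical_saddle_le {α e : ℝ} (hα : α ∈ indexRange) (he : 1 ≤ e) :
    ‖∫ t in (-e⁻¹)..e⁻¹, airyInt α (-(e ^ 4)) ((e ^ 2 : ℝ) + t * I)‖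
      ≤ 12 * ((e ^ 2) ^ α * e⁻¹) := by
  have he0 : 0 < e := by linarith
  have hinv : e⁻¹ ≤ 1 := inv_le_one_of_one_le₀ he
  have hinv0 : 0 < e⁻¹ := by positivity
  have he2 : 1 ≤ e ^ 2 := one_le_pow₀ he
  have hb : ∀ t ∈ Set.uIoc (-e⁻¹) e⁻¹, ‖airyInt α (-(e ^ 4)) ((e ^ 2 : ℝ) + t * I)‖
      ≤ 2 * (e ^ 2) ^ α * 3 := by
    intro t ht
    rw [Set.uIoc_of_le (by linarith)] at ht
    have ht1 : |t| ≤ 1 := abs_le.mpr ⟨by linarith [ht.1], by linarith [ht.2]⟩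
    rw [norm_airyInt_add_mul_I]
    have n1 := norm_add_mul_I_le (e ^ 2) t
    have n2 := abs_le_norm_add_mul_I (e ^ 2) t
    rw [abs_of_pos (by positivity)] at n1 n2
    have hE : -(e ^ 2) ^ 2 * t + t ^ 3 / 3 - -(e ^ 4) * t ≤ 1 := by
      have h1 : t ^ 3 ≤ |t| ^ 3 := by rw [← abs_pow]; exact le_abs_self _
      have h2 : |t| ^ 3 ≤ 1 := pow_le_one₀ (abs_nonneg _) ht1
      nlinarith
    refine mul_le_mul (rpow_le_two_mul (by positivity) (by linarith) (by linarith)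
      (abs_lt_one_of_mem_indexRange hα).le) ?_ (Real.exp_pos _).le (by positivity)
    exact (Real.exp_le_exp.mpr hE).trans (by linarith [Real.exp_one_lt_d9])
  refine (intervalIntegral.norm_integral_le_of_norm_le_const hb).trans (le_of_eq ?_)
  rw [abs_of_pos (by linarith)]
  ring

/-- Past the saddle the exponent is at most `1 - 2e(s - e²)`. One half of this decay pays for the
growth of the power relative to `(e²)^α`; the other half is integrated and yields `1/e`. -/
theorem integral_horizontal_above_le {α e : ℝ} (hα : α ∈ indexRange) (he : 1 ≤ e) :
    ‖∫ s in Set.Ioi (e ^ 2), airyInt α (-(e ^ 4)) (s + (e⁻¹ : ℝ) * I)‖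
      ≤ 6 * ((e ^ 2) ^ α * e⁻¹) := by
  have he0 : 0 < e := by linarith
  have hinv : e⁻¹ ≤ 1 := inv_le_one_of_one_le₀ he
  have hinv0 : 0 < e⁻¹ := by positivity
  have he2 : 1 ≤ e ^ 2 := one_le_pow₀ he
  have hb : ∀ s ∈ Set.Ioi (e ^ 2), ‖airyInt α (-(e ^ 4)) (s + (e⁻¹ : ℝ) * I)‖
      ≤ 6 * (e ^ 2) ^ α * Real.exp (e ^ 3) * Real.exp (-e * s) := by
    intro s hs
    have hs' : e ^ 2 < s := hs
    have hs0 : 0 < s := by linarith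
    rw [norm_airyInt_add_mul_I]
    have n1 := norm_add_mul_I_le s e⁻¹
    have n2 := abs_le_norm_add_mul_I s e⁻¹
    rw [abs_of_pos hs0] at n1 n2
    rw [abs_of_pos hinv0] at n1
    set r := ‖((s : ℂ) + ((e⁻¹ : ℝ) : ℂ) * I)‖
    have hc : 0 < e ^ 2 := by positivity
    have hr1 : 1 ≤ r / e ^ 2 := by rw [le_div_iff₀ hc]; linarith
    have hr2 : r / e ^ 2 ≤ 2 * Real.exp (e * (s - e ^ 2)) := by
      rw [div_le_iff₀ hc]
      have h1 := Real.add_one_le_exp (e * (s - e ^ 2))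
      have h2 : s - e ^ 2 ≤ e * (s - e ^ 2) := by nlinarith
      have h3 : s ≤ (1 + e * (s - e ^ 2)) * e ^ 2 := by nlinarith
      have h4 : (1 + e * (s - e ^ 2)) * e ^ 2 ≤ Real.exp (e * (s - e ^ 2)) * e ^ 2 := by
        gcongr; linarith
      linarith
    have hp : r ^ α ≤ (2 * Real.exp (e * (s - e ^ 2))) * (e ^ 2) ^ α := by
      have h3 : r ^ α = (r / e ^ 2) ^ α * (e ^ 2) ^ α := by
        rw [← Real.mul_rpow (by positivity) hc.le, div_mul_cancel₀ _ hc.ne']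
      rw [h3]
      gcongr
      calc (r / e ^ 2) ^ α ≤ (r / e ^ 2) ^ (1 : ℝ) :=
            Real.rpow_le_rpow_of_exponent_le hr1 (by linarith [hα.2])
        _ = r / e ^ 2 := Real.rpow_one _
        _ ≤ _ := hr2
    have hE : -s ^ 2 * e⁻¹ + e⁻¹ ^ 3 / 3 - -(e ^ 4) * e⁻¹ ≤ 1 - 2 * (e * (s - e ^ 2)) := by
      have h1 : e⁻¹ ^ 3 ≤ 1 := pow_le_one₀ hinv0.le hinv
      have h2 : 2 * (e * (s - e ^ 2)) = 2 * (e ^ 2 * (s - e ^ 2)) * e⁻¹ := by field_simp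
      have h3 : 2 * (e ^ 2 * (s - e ^ 2)) * e⁻¹ ≤ (s ^ 2 - e ^ 4) * e⁻¹ := by
        gcongr; nlinarith [sq_nonneg (s - e ^ 2)]
      nlinarith
    calc r ^ α * Real.exp (-s ^ 2 * e⁻¹ + e⁻¹ ^ 3 / 3 - -(e ^ 4) * e⁻¹)
        ≤ ((2 * Real.exp (e * (s - e ^ 2))) * (e ^ 2) ^ α)
          * Real.exp (1 - 2 * (e * (s - e ^ 2))) := by gcongr
      _ = 2 * (e ^ 2) ^ α * Real.exp 1 * (Real.exp (e ^ 3) * Real.exp (-e * s)) := by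
          have : Real.exp (e * (s - e ^ 2)) * Real.exp (1 - 2 * (e * (s - e ^ 2)))
              = Real.exp 1 * (Real.exp (e ^ 3) * Real.exp (-e * s)) := by
            rw [← Real.exp_add, ← Real.exp_add, ← Real.exp_add]
            ring_nf
          linear_combination 2 * (e ^ 2) ^ α * this
      _ ≤ 2 * (e ^ 2) ^ α * 3 * (Real.exp (e ^ 3) * Real.exp (-e * s)) := by
          gcongr; linarith [Real.exp_one_lt_d9]
      _ = _ := by ring
  have hi : IntegrableOn (fun s : ℝ => 6 * (e ^ 2) ^ α * Real.exp (e ^ 3) * Real.exp (-e * s))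
      (Set.Ioi (e ^ 2)) := (exp_neg_integrableOn_Ioi _ he0).const_mul _
  refine (norm_integral_le_of_norm_le hi ?_).trans ?_
  · filter_upwards [ae_restrict_mem measurableSet_Ioi] with s hs using hb s hs
  · rw [integral_const_mul, integral_exp_mul_Ioi (by linarith)]
    have : Real.exp (e ^ 3) * Real.exp (-e * e ^ 2) = 1 := by
      rw [← Real.exp_add, ← Real.exp_zero]; ring_nf
    have h2 : 6 * (e ^ 2) ^ α * Real.exp (e ^ 3) * (-Real.exp (-e * e ^ 2) / -e)
        = 6 * (e ^ 2) ^ α * (Real.exp (e ^ 3) * Real.exp (-e * e ^ 2)) / e := by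
      field_simp
    rw [h2, this]
    exact le_of_eq (by field_simp)

theorem fourth_root {ξ : ℝ} (hξ : 1 ≤ ξ) : ∃ e : ℝ, 1 ≤ e ∧ ξ = e ^ 4 :=
  ⟨ξ ^ (1 / 4 : ℝ), Real.one_le_rpow hξ (by norm_num), by
    rw [← Real.rpow_natCast, ← Real.rpow_mul (by linarith)]; norm_num⟩

theorem rpow_fourth {e : ℝ} (he : 0 < e) (α : ℝ) :
    (e ^ 4) ^ (α / 2 - 1 / 4) = (e ^ 2) ^ α * e⁻¹ := by
  rw [← Real.rpow_natCast, ← Real.rpow_natCast, ← Real.rpow_mul he.le, ← Real.rpow_mul he.le,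
    ← Real.rpow_neg_one, ← Real.rpow_add he]
  congr 1
  push_cast
  ring

theorem rpow_three_halves {e : ℝ} (he : 0 < e) : (e ^ 4) ^ (3 / 2 : ℝ) = e ^ 6 := by
  rw [← Real.rpow_natCast, ← Real.rpow_natCast, ← Real.rpow_mul he.le]
  norm_num

/-- The first power is the oscillation from the saddle `√|x|`, the second the contribution of the
branch point `0`; neither dominates the other over the whole index range. -/
theorem abs_Ai_Gi_le_of_neg : ∃ C : ℝ, 0 < C ∧ ∀ α ∈ indexRange, ∀ x : ℝ, x ≤ 0 →
    |Ai α x| ≤ C * ((1 + |x|) ^ (α / 2 - 1 / 4) + (1 + |x|) ^ (-1 - α)) ∧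
    |Gi α x| ≤ C * ((1 + |x|) ^ (α / 2 - 1 / 4) + (1 + |x|) ^ (-1 - α)) := by
  obtain ⟨C₁, hC₁, h₁⟩ := abs_Ai_Gi_le_of_abs_le_one
  obtain ⟨G, hG, h₂⟩ := integral_rpow_mul_exp_neg_le
  refine ⟨4 * (C₁ + 20 + G + 2000), by positivity, fun α hα x hx => ?_⟩
  have hs : |(-1 - α)| ≤ 2 := by
    rw [abs_le]; constructor <;> linarith [hα.1, hα.2]
  have hs2 : |α / 2 - 1 / 4| ≤ 2 := by
    rw [abs_le]; constructor <;> linarith [hα.1, hα.2]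
  have hp : 0 ≤ (1 + |x|) ^ (-1 - α) := by positivity
  have hp2 : 0 ≤ (1 + |x|) ^ (α / 2 - 1 / 4) := by positivity
  rcases le_total |x| 1 with h | h
  · have := one_le_four_mul_one_add_rpow (abs_nonneg x) h hs
    have h3 := h₁ α hα x h
    constructor <;> nlinarith
  · obtain ⟨e, he, hxe⟩ := fourth_root h
    have he0 : 0 < e := by linarith
    have hx' : x = -(e ^ 4) := by rw [← hxe, abs_of_nonpos hx, neg_neg]
    have h4 := rpow_le_four_mul_one_add h hs
    have h5 := rpow_le_four_mul_one_add h hs2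
    have hL := tendsto_integral_airyInt_staircase α x (h := e⁻¹) (b := e ^ 2)
      (abs_lt_one_of_mem_indexRange hα) (by positivity) (by positivity)
    have b1 := integral_horizontal_above_le hα he
    have b2 := integral_vertical_saddle_le hα he
    have b3 := integral_horizontal_below_le hα he
    have b4 := integral_vertical_below_le h₂ hα (m := e ^ 4) (h := e⁻¹) (by positivity)
      (by positivity)
    rw [← hx'] at b1 b2 b3 b4
    rw [← rpow_fourth he0, ← hxe] at b1 b2 b3
    rw [← hxe] at b4
    have hn : ‖(∫ s in Set.Ioi (e ^ 2), airyInt α x (s + (e⁻¹ : ℝ) * I))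
        + I * (∫ t in (-e⁻¹)..e⁻¹, airyInt α x ((e ^ 2 : ℝ) + t * I))
        + (∫ s in (0 : ℝ)..(e ^ 2), airyInt α x (s + (-e⁻¹ : ℝ) * I))
        + I * ∫ t in (0 : ℝ)..(-e⁻¹), airyInt α x (t * I)‖
        ≤ (20 + G + 2000) * (|x| ^ (α / 2 - 1 / 4) + |x| ^ (-1 - α)) := by
      refine (norm_add₄_le).trans ?_
      rw [norm_mul, norm_mul, norm_I, one_mul, one_mul]
      have p1 : 0 ≤ |x| ^ (α / 2 - 1 / 4) := by positivity
      have p2 : 0 ≤ |x| ^ (-1 - α) := by positivity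
      nlinarith
    have h6 := abs_Ai_le_abs_Gi_le (abs_lt_one_of_mem_indexRange hα) hL
    have h7 : (20 + G + 2000) * (|x| ^ (α / 2 - 1 / 4) + |x| ^ (-1 - α))
        ≤ (20 + G + 2000) * (4 * ((1 + |x|) ^ (α / 2 - 1 / 4) + (1 + |x|) ^ (-1 - α))) := by
      gcongr; linarith
    have h8 : 0 ≤ C₁ * ((1 + |x|) ^ (α / 2 - 1 / 4) + (1 + |x|) ^ (-1 - α)) := by positivity
    constructor
    · linarith [h6.1]
    · linarith [h6.2]

theorem norm_horizontalPart_le {C : ℝ}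
    (hC : ∀ α ∈ indexRange, ∀ ε : ℝ, 0 < ε → ε ≤ 1 → ‖airyProfile α ε‖ ≤ C)
    {α e : ℝ} (hα : α ∈ indexRange) (he : 1 ≤ e) :
    ‖horizontalPart α (e ^ 4) (e ^ 2)‖
      ≤ C * ((e ^ 2) ^ α * e⁻¹ * Real.exp (-(2 / 3) * e ^ 6)) := by
  have he0 : 0 < e := by linarith
  rw [horizontalPart_eq α he0, norm_mul, Complex.norm_real, Real.norm_of_nonneg (by positivity),
    mul_comm]
  gcongr
  exact hC α hα _ (by positivity) (pow_le_one₀ (by positivity) (inv_le_one_of_one_le₀ he))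

theorem abs_one_div_pi_mul_le (r : ℝ) : |1 / Real.pi * r| ≤ |r| := by
  rw [abs_mul, abs_of_pos (by positivity : 0 < 1 / Real.pi)]
  exact mul_le_of_le_one_left (abs_nonneg _) one_div_pi_le_one

theorem exp_neg_two_le_exp {ξ : ℝ} (hξ : 0 ≤ ξ) (hξ1 : ξ ≤ 1) :
    Real.exp (-2) ≤ Real.exp (-(2 / 3) * ξ ^ (3 / 2 : ℝ)) := by
  have h : ξ ^ (3 / 2 : ℝ) ≤ 1 := Real.rpow_le_one hξ hξ1 (by norm_num)
  exact Real.exp_le_exp.mpr (by linarith)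

theorem one_le_exp_two_mul {ξ : ℝ} (hξ : 0 ≤ ξ) (hξ1 : ξ ≤ 1) :
    1 ≤ Real.exp 2 * Real.exp (-(2 / 3) * ξ ^ (3 / 2 : ℝ)) := by
  calc (1 : ℝ) = Real.exp 2 * Real.exp (-2) := by rw [← Real.exp_add]; simp
    _ ≤ _ := mul_le_mul_of_nonneg_left (exp_neg_two_le_exp hξ hξ1) (Real.exp_pos _).le

theorem abs_le_two_of_mem {α : ℝ} (hα : α ∈ indexRange) :
    |α / 2 - 1 / 4| ≤ 2 ∧ |(-1 - α)| ≤ 2 := by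
  constructor <;> (rw [abs_le]; constructor <;> linarith [hα.1, hα.2])

/-- `Ai` consists of the horizontal part alone, which at the saddle height `√ξ` is a bounded profile
times an explicit prefactor. -/
theorem abs_Ai_le_of_nonneg : ∃ C : ℝ, 0 < C ∧ ∀ α ∈ indexRange, ∀ ξ : ℝ, 0 ≤ ξ →
    |Ai α ξ| ≤ C * ((1 + ξ) ^ (α / 2 - 1 / 4) * Real.exp (-(2 / 3) * ξ ^ (3 / 2 : ℝ))) := by
  obtain ⟨C₁, hC₁, h₁⟩ := abs_Ai_Gi_le_of_abs_le_one
  obtain ⟨C₂, hC₂, h₂⟩ := norm_airyProfile_le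
  refine ⟨4 * (C₁ * Real.exp 2 + C₂), by positivity, fun α hα ξ hξ => ?_⟩
  obtain ⟨hs, -⟩ := abs_le_two_of_mem hα
  have hp : 0 ≤ (1 + ξ) ^ (α / 2 - 1 / 4) := by positivity
  set E := Real.exp (-(2 / 3) * ξ ^ (3 / 2 : ℝ)) with hE
  have hE0 : 0 < E := Real.exp_pos _
  rcases le_total ξ 1 with h | h
  · have h3 := (h₁ α hα ξ (by rwa [abs_of_nonneg hξ])).1
    have h4 := one_le_four_mul_one_add_rpow hξ h hs
    have h5 := one_le_exp_two_mul hξ h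
    calc |Ai α ξ| ≤ C₁ * 1 * 1 := by linarith
      _ ≤ C₁ * (4 * (1 + ξ) ^ (α / 2 - 1 / 4)) * (Real.exp 2 * E) := by gcongr
      _ = 4 * (C₁ * Real.exp 2) * ((1 + ξ) ^ (α / 2 - 1 / 4) * E) := by ring
      _ ≤ _ := by gcongr; linarith
  · obtain ⟨e, he, hxe⟩ := fourth_root h
    have he0 : 0 < e := by linarith
    have h3 := norm_horizontalPart_le h₂ hα he
    rw [← rpow_fourth he0, ← rpow_three_halves he0, ← hxe] at h3
    have h4 := rpow_le_four_mul_one_add h hs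
    rw [(Ai_eq_Gi_eq α ξ (h := e ^ 2) (abs_lt_one_of_mem_indexRange hα) (by positivity)).1]
    calc _ ≤ C₂ * (ξ ^ (α / 2 - 1 / 4) * E) :=
          (abs_one_div_pi_mul_le _).trans ((abs_re_le_norm _).trans h3)
      _ ≤ C₂ * ((4 * (1 + ξ) ^ (α / 2 - 1 / 4)) * E) := by gcongr
      _ = 4 * C₂ * ((1 + ξ) ^ (α / 2 - 1 / 4) * E) := by ring
      _ ≤ _ := by
        gcongr
        have : 0 < C₁ * Real.exp 2 := by positivity
        linarith

/-- Up to the saddle `t² ≤ x`, so `t³/3 - xt ≤ -(2/3) xt` and the integral is dominated by a Laplace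
integral with rate `2x/3`. -/
theorem verticalPart_nonneg_le {G : ℝ} (hG : ∀ α ∈ indexRange, ∀ b : ℝ, 0 < b →
    ∫ t in Set.Ioi (0 : ℝ), t ^ α * Real.exp (-b * t) ≤ G * b ^ (-1 - α)) (hG0 : 0 < G)
    {α e : ℝ} (hα : α ∈ indexRange) (he : 1 ≤ e) :
    |verticalPart α (e ^ 4) (e ^ 2)| ≤ 3 * G * (e ^ 4) ^ (-1 - α) := by
  have he0 : 0 < e := by linarith
  have hc : 0 < e ^ 2 := by positivity
  have hb : 0 < 2 / 3 * e ^ 4 := by positivity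
  have hi := integrableOn_rpow_mul_exp_neg (s := α) (b := 2 / 3 * e ^ 4) (by linarith [hα.1]) hb
  rw [verticalPart, ← Real.norm_eq_abs]
  refine (intervalIntegral.norm_integral_le_of_norm_le hc.le (Eventually.of_forall fun t ht => ?_)
    (g := fun t => t ^ α * Real.exp (-(2 / 3 * e ^ 4) * t)) ?_).trans ?_
  · have ht0 := ht.1
    rw [Real.norm_of_nonneg (by positivity)]
    refine mul_le_mul_of_nonneg_left (Real.exp_le_exp.mpr ?_) (Real.rpow_nonneg ht0.le _)
    have h1 : t ^ 2 ≤ (e ^ 2) ^ 2 := pow_le_pow_left₀ ht0.le ht.2 2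
    nlinarith
  · rw [intervalIntegrable_iff_integrableOn_Ioc_of_le hc.le]
    exact hi.mono_set Set.Ioc_subset_Ioi_self
  · have h1 : ∫ t in (0 : ℝ)..(e ^ 2), t ^ α * Real.exp (-(2 / 3 * e ^ 4) * t)
        ≤ G * (2 / 3 * e ^ 4) ^ (-1 - α) := by
      refine le_trans ?_ (hG α hα _ hb)
      rw [intervalIntegral.integral_of_le hc.le]
      refine setIntegral_mono_set hi ?_ (Set.Ioc_subset_Ioi_self).eventuallyLE
      filter_upwards [ae_restrict_mem measurableSet_Ioi] with t ht
      have : (0 : ℝ) < t := ht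
      simp only [Pi.zero_apply]
      positivity
    have h2 : (2 / 3 : ℝ) ^ (-1 - α) ≤ 3 := by
      calc (2 / 3 : ℝ) ^ (-1 - α) ≤ (2 / 3 : ℝ) ^ (-2 : ℝ) :=
            Real.rpow_le_rpow_of_exponent_ge (by norm_num) (by norm_num) (by linarith [hα.2])
        _ ≤ 3 := by rw [Real.rpow_neg (by norm_num)]; norm_num
    rw [Real.mul_rpow (by norm_num) (by positivity)] at h1
    refine h1.trans ?_
    calc G * ((2 / 3) ^ (-1 - α) * (e ^ 4) ^ (-1 - α)) ≤ G * (3 * (e ^ 4) ^ (-1 - α)) := by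
          gcongr
      _ = _ := by ring

/-- The two exponents differ by at most `3`, that is by `e¹²`, which the exponential absorbs. In
`Gi` the saddle term is thus swallowed by the algebraic one. -/
theorem rpow_mul_exp_le {e α : ℝ} (hα : α ∈ indexRange) (he : 1 ≤ e) :
    (e ^ 4) ^ (α / 2 - 1 / 4) * Real.exp (-(2 / 3) * e ^ 6) ≤ 5 * (e ^ 4) ^ (-1 - α) := by
  have he0 : 0 < e := by linarith
  have h1 : (e ^ 4) ^ (α / 2 - 1 / 4) ≤ (e ^ 4) ^ (-1 - α) * e ^ 12 := by
    have h2 : e ^ 12 = (e ^ 4) ^ (3 : ℝ) := by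
      have : (e ^ 4) ^ (3 : ℝ) = (e ^ 4) ^ 3 := by norm_cast
      rw [this]; ring
    rw [h2, ← Real.rpow_add (by positivity)]
    exact Real.rpow_le_rpow_of_exponent_le (one_le_pow₀ he) (by linarith [hα.2])
  have h3 := pow_mul_exp_neg_le 2 (y := 2 / 3 * e ^ 6) (by positivity)
  have h4 : e ^ 12 * Real.exp (-(2 / 3) * e ^ 6) ≤ 5 := by
    have : (2 / 3 * e ^ 6) ^ 2 = 4 / 9 * e ^ 12 := by ring
    rw [this] at h3
    norm_num [Nat.factorial] at h3
    rw [neg_mul]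
    linarith
  calc _ ≤ (e ^ 4) ^ (-1 - α) * e ^ 12 * Real.exp (-(2 / 3) * e ^ 6) := by gcongr
    _ = (e ^ 12 * Real.exp (-(2 / 3) * e ^ 6)) * (e ^ 4) ^ (-1 - α) := by ring
    _ ≤ _ := by gcongr

theorem abs_Gi_le_of_nonneg : ∃ C : ℝ, 0 < C ∧ ∀ α ∈ indexRange, ∀ ξ : ℝ, 0 ≤ ξ →
    |Gi α ξ| ≤ C * (1 + ξ) ^ (-1 - α) := by
  obtain ⟨C₁, hC₁, h₁⟩ := abs_Ai_Gi_le_of_abs_le_one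
  obtain ⟨C₂, hC₂, h₂⟩ := norm_airyProfile_le
  obtain ⟨G, hG, h₃⟩ := integral_rpow_mul_exp_neg_le
  refine ⟨4 * (C₁ + 5 * C₂ + 3 * G), by positivity, fun α hα ξ hξ => ?_⟩
  obtain ⟨hs2, hs⟩ := abs_le_two_of_mem hα
  have hp : 0 ≤ (1 + ξ) ^ (-1 - α) := by positivity
  rcases le_total ξ 1 with h | h
  · have h3 := (h₁ α hα ξ (by rwa [abs_of_nonneg hξ])).2
    have h4 := one_le_four_mul_one_add_rpow hξ h hs
    calc |Gi α ξ| ≤ C₁ * 1 := by linarith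
      _ ≤ C₁ * (4 * (1 + ξ) ^ (-1 - α)) := by gcongr
      _ = 4 * C₁ * (1 + ξ) ^ (-1 - α) := by ring
      _ ≤ _ := by gcongr; linarith
  · obtain ⟨e, he, hxe⟩ := fourth_root h
    have he0 : 0 < e := by linarith
    have h3 := norm_horizontalPart_le h₂ hα he
    have h5 := rpow_mul_exp_le hα he
    have h6 := verticalPart_nonneg_le h₃ hG hα he
    rw [← rpow_fourth he0, ← hxe] at h3
    rw [← hxe] at h5 h6
    have h4 := rpow_le_four_mul_one_add h hs
    rw [(Ai_eq_Gi_eq α ξ (h := e ^ 2) (abs_lt_one_of_mem_indexRange hα) (by positivity)).2]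
    have h7 : ‖horizontalPart α ξ (e ^ 2)‖ ≤ C₂ * (5 * ξ ^ (-1 - α)) := h3.trans (by gcongr)
    calc _ ≤ |(horizontalPart α ξ (e ^ 2)).im| + |verticalPart α ξ (e ^ 2)| :=
          (abs_one_div_pi_mul_le _).trans (abs_add_le _ _)
      _ ≤ C₂ * (5 * ξ ^ (-1 - α)) + 3 * G * ξ ^ (-1 - α) :=
          add_le_add ((abs_im_le_norm _).trans h7) h6
      _ = (5 * C₂ + 3 * G) * ξ ^ (-1 - α) := by ring
      _ ≤ (5 * C₂ + 3 * G) * (4 * (1 + ξ) ^ (-1 - α)) := by gcongr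
      _ = 4 * (5 * C₂ + 3 * G) * (1 + ξ) ^ (-1 - α) := by ring
      _ ≤ _ := by gcongr; linarith

/-- Below half the maximum point the exponent is at most `e⁶/2`, which misses the maximum `(2/3) e⁶`
by `e⁶/6`. The factor `3` bounds `1/(α + 1) ≤ 8/3`. -/
theorem Hi_remainder_bounds {α e : ℝ} (hα : α ∈ indexRange) (he : 1 ≤ e) :
    0 ≤ ∫ σ in (0 : ℝ)..(e ^ 2 / 2), σ ^ α * Real.exp (-(σ ^ 3) / 3 + σ * e ^ 4) ∧
    ∫ σ in (0 : ℝ)..(e ^ 2 / 2), σ ^ α * Real.exp (-(σ ^ 3) / 3 + σ * e ^ 4)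
      ≤ (e ^ 2) ^ α * e⁻¹ * Real.exp (2 / 3 * e ^ 6) * (3 * (e ^ 3 * Real.exp (-(e ^ 6 / 6)))) := by
  have he0 : 0 < e := by linarith
  have hc : 0 < e ^ 2 / 2 := by positivity
  have hα1 : -1 < α := by linarith [hα.1]
  have hi : IntervalIntegrable (fun σ : ℝ => σ ^ α) volume 0 (e ^ 2 / 2) :=
    intervalIntegral.intervalIntegrable_rpow' hα1
  refine ⟨intervalIntegral.integral_nonneg hc.le fun σ hσ => ?_, ?_⟩
  · have := hσ.1
    positivity
  · have h1 : ∫ σ in (0 : ℝ)..(e ^ 2 / 2), σ ^ α * Real.exp (-(σ ^ 3) / 3 + σ * e ^ 4)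
        ≤ ∫ σ in (0 : ℝ)..(e ^ 2 / 2), σ ^ α * Real.exp (e ^ 6 / 2) := by
      refine intervalIntegral.integral_mono_on hc.le
        (hi.mul_continuousOn (by fun_prop)) (hi.mul_const _) fun σ hσ => ?_
      refine mul_le_mul_of_nonneg_left (Real.exp_le_exp.mpr ?_) (Real.rpow_nonneg hσ.1 _)
      have h3 : 0 ≤ σ ^ 3 := pow_nonneg hσ.1 3
      have h4 : σ * e ^ 4 ≤ e ^ 2 / 2 * e ^ 4 := by gcongr; exact hσ.2
      nlinarith
    refine h1.trans ?_
    rw [intervalIntegral.integral_mul_const, integral_rpow (Or.inl hα1),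
      Real.zero_rpow (by linarith), sub_zero]
    have h2 : (e ^ 2 / 2) ^ (α + 1) / (α + 1) ≤ 3 * (e ^ 2) ^ (α + 1) := by
      rw [div_le_iff₀ (by linarith)]
      have h5 : (e ^ 2 / 2) ^ (α + 1) ≤ (e ^ 2) ^ (α + 1) :=
        Real.rpow_le_rpow hc.le (by linarith) (by linarith)
      have h6 : 0 ≤ (e ^ 2) ^ (α + 1) := by positivity
      nlinarith [hα.1]
    have h7 : Real.exp (2 / 3 * e ^ 6) * Real.exp (-(e ^ 6 / 6)) = Real.exp (e ^ 6 / 2) := by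
      rw [← Real.exp_add]; ring_nf
    calc _ ≤ 3 * (e ^ 2) ^ (α + 1) * Real.exp (e ^ 6 / 2) := by gcongr
      _ = 3 * ((e ^ 2) ^ α * e ^ 2) * (Real.exp (2 / 3 * e ^ 6) * Real.exp (-(e ^ 6 / 6))) := by
          rw [h7, Real.rpow_add (by positivity), Real.rpow_one]
      _ = _ := by field_simp

theorem Hi_le_of_nonneg : ∃ C : ℝ, 0 < C ∧ ∀ α ∈ indexRange, ∀ ξ : ℝ, 0 ≤ ξ →
    Hi α ξ ≤ C * ((1 + ξ) ^ (α / 2 - 1 / 4) * Real.exp (2 / 3 * ξ ^ (3 / 2 : ℝ))) := by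
  obtain ⟨C₁, hC₁, h₁⟩ := Hi_le_of_le_one
  obtain ⟨C₂, hC₂, h₂⟩ := scorerProfile_le
  refine ⟨4 * (C₁ + (C₂ + 18)), by positivity, fun α hα ξ hξ => ?_⟩
  obtain ⟨hs, -⟩ := abs_le_two_of_mem hα
  have hp : 0 ≤ (1 + ξ) ^ (α / 2 - 1 / 4) := by positivity
  set E := Real.exp (2 / 3 * ξ ^ (3 / 2 : ℝ)) with hE
  have hE0 : 0 < E := Real.exp_pos _
  rcases le_total ξ 1 with h | h
  · have h3 := h₁ α hα ξ h
    have h4 := one_le_four_mul_one_add_rpow hξ h hs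
    have h5 : 1 ≤ E := Real.one_le_exp (by positivity)
    calc Hi α ξ ≤ C₁ * 1 * 1 := by linarith
      _ ≤ C₁ * (4 * (1 + ξ) ^ (α / 2 - 1 / 4)) * E := by gcongr
      _ = 4 * C₁ * ((1 + ξ) ^ (α / 2 - 1 / 4) * E) := by ring
      _ ≤ _ := by gcongr; linarith
  · obtain ⟨e, he, hxe⟩ := fourth_root h
    have he0 : 0 < e := by linarith
    have h4 := rpow_le_four_mul_one_add h hs
    obtain ⟨r0, r1⟩ := Hi_remainder_bounds hα he
    have h5 := h₂ α hα (e⁻¹ ^ 3) (by positivity)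
      (pow_le_one₀ (by positivity) (inv_le_one_of_one_le₀ he))
    have h6 : 3 * (e ^ 3 * Real.exp (-(e ^ 6 / 6))) ≤ 18 := by
      have := pow_mul_exp_neg_le 1 (y := e ^ 6 / 6) (by positivity)
      simp at this
      have h7 : e ^ 3 ≤ e ^ 6 := pow_le_pow_right₀ he (by norm_num)
      have h8 : e ^ 3 * Real.exp (-(e ^ 6 / 6)) ≤ e ^ 6 * Real.exp (-(e ^ 6 / 6)) := by gcongr
      linarith
    have h9 := Hi_eq α (abs_lt_one_of_mem_indexRange hα) he0
    set A := (e ^ 2) ^ α * e⁻¹ * Real.exp (2 / 3 * e ^ 6) with hA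
    have hA0 : 0 < A := by positivity
    have hAE : A = ξ ^ (α / 2 - 1 / 4) * E := by
      rw [hA, hE, hxe, rpow_fourth he0, rpow_three_halves he0]
    have h10 : Hi α (e ^ 4) ≤ A * (C₂ + 18) := by
      have h11 := abs_one_div_pi_mul_le ((∫ σ in (0 : ℝ)..(e ^ 2 / 2),
        σ ^ α * Real.exp (-(σ ^ 3) / 3 + σ * e ^ 4)) + A * scorerProfile α (e⁻¹ ^ 3))
      have hsp : 0 ≤ scorerProfile α (e⁻¹ ^ 3) := by
        refine integral_nonneg fun τ => Set.indicator_nonneg (fun τ hτ => ?_) τ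
        have hτ' : -(2 * e⁻¹ ^ 3)⁻¹ < τ := hτ
        have h12 : -(2 * e⁻¹ ^ 3)⁻¹ = -(1 / 2) / e⁻¹ ^ 3 := by field_simp
        rw [h12, div_lt_iff₀ (by positivity)] at hτ'
        exact mul_nonneg (Real.rpow_nonneg (by linarith) _) (Real.exp_pos _).le
      rw [abs_of_nonneg (add_nonneg r0 (by positivity))] at h11
      rw [h9]
      refine ((le_abs_self _).trans h11).trans ?_
      nlinarith
    rw [hxe]
    refine h10.trans ?_
    rw [hAE, ← hxe]
    calc ξ ^ (α / 2 - 1 / 4) * E * (C₂ + 18)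
        ≤ (4 * (1 + ξ) ^ (α / 2 - 1 / 4)) * E * (C₂ + 18) := by gcongr
      _ = 4 * (C₂ + 18) * ((1 + ξ) ^ (α / 2 - 1 / 4) * E) := by ring
      _ ≤ _ := mul_le_mul_of_nonneg_right (by linarith) (by positivity)

/-! ### Leading asymptotics of `Ai` and `Hi`, uniform in the index. -/

theorem tendsto_rescale : Tendsto (fun q : ℝ × ℝ => ((q.1 ^ (1 / 4 : ℝ))⁻¹ ^ 3, q.2))
    (atTop ×ˢ 𝓟 indexRange) (𝓝[>] 0 ×ˢ 𝓟 indexRange) := by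
  refine Tendsto.prodMk ?_ tendsto_snd
  have h1 : Tendsto (fun x : ℝ => (x ^ (1 / 4 : ℝ))⁻¹ ^ 3) atTop (𝓝 0) := by
    have := ((tendsto_rpow_atTop (y := 1 / 4) (by norm_num)).inv_tendsto_atTop).pow 3
    simpa using this
  have h2 : Tendsto (fun x : ℝ => (x ^ (1 / 4 : ℝ))⁻¹ ^ 3) atTop (𝓝[>] 0) := by
    refine tendsto_nhdsWithin_iff.mpr ⟨h1, ?_⟩
    filter_upwards [eventually_gt_atTop 0] with x hx
    exact Set.mem_Ioi.mpr (by positivity)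
  exact h2.comp tendsto_fst

theorem eventually_large_mem (b : ℝ) :
    ∀ᶠ q : ℝ × ℝ in atTop ×ˢ 𝓟 indexRange, b ≤ q.1 ∧ q.2 ∈ indexRange :=
  Filter.Eventually.prod_mk (eventually_ge_atTop b) (mem_principal_self _)

theorem rpow_quarter {ξ : ℝ} (hξ : 0 ≤ ξ) : (ξ ^ (1 / 4 : ℝ)) ^ 4 = ξ := by
  rw [← Real.rpow_natCast, ← Real.rpow_mul hξ]; norm_num

/-- Upper bounds do not determine the limit kernel; the exact constants do. This limit `1/(2√π)` and
the limit `1/√π` for `Hi` multiply with `π` to `1/2`, the constant of the Green's function of `1 -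
∂²`. -/
theorem tendsto_Ai_mul : Tendsto (fun q : ℝ × ℝ =>
    Ai q.2 q.1 * (q.1 ^ (1 / 4 - q.2 / 2) * Real.exp (2 / 3 * q.1 ^ (3 / 2 : ℝ))))
    (atTop ×ˢ 𝓟 indexRange) (𝓝 (1 / Real.pi * (Real.sqrt Real.pi / 2))) := by
  have h := (((Complex.continuous_re.tendsto _).comp
    (tendsto_airyProfile.comp tendsto_rescale)).const_mul (1 / Real.pi))
  rw [ofReal_re] at h
  refine h.congr' ?_
  filter_upwards [eventually_large_mem 1] with q hq
  obtain ⟨hq1, hq2⟩ := hq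
  have he0 : 0 < q.1 ^ (1 / 4 : ℝ) := Real.rpow_pos_of_pos (by linarith) _
  have he4 := rpow_quarter (ξ := q.1) (by linarith)
  simp only [Function.comp_apply]
  generalize q.1 ^ (1 / 4 : ℝ) = e at he0 he4 ⊢
  rw [(Ai_eq_Gi_eq q.2 q.1 (h := e ^ 2) (abs_lt_one_of_mem_indexRange hq2) (by positivity)).1,
    ← he4, horizontalPart_eq _ he0, Complex.re_ofReal_mul, ← rpow_fourth he0,
    rpow_three_halves he0]
  have h1 : (e ^ 4) ^ (q.2 / 2 - 1 / 4) * (e ^ 4) ^ (1 / 4 - q.2 / 2) = 1 := by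
    rw [← Real.rpow_add (by positivity)]; simp
  have h2 : Real.exp (-(2 / 3) * e ^ 6) * Real.exp (2 / 3 * e ^ 6) = 1 := by
    rw [← Real.exp_add]; simp
  linear_combination (-(1 / Real.pi * (airyProfile q.2 (e⁻¹ ^ 3)).re
    * (Real.exp (-(2 / 3) * e ^ 6) * Real.exp (2 / 3 * e ^ 6)))) * h1
    - (1 / Real.pi * (airyProfile q.2 (e⁻¹ ^ 3)).re) * h2

theorem tendsto_Hi_mul : Tendsto (fun q : ℝ × ℝ =>
    Hi q.2 q.1 * (q.1 ^ (1 / 4 - q.2 / 2) * Real.exp (-(2 / 3) * q.1 ^ (3 / 2 : ℝ))))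
    (atTop ×ˢ 𝓟 indexRange) (𝓝 (1 / Real.pi * Real.sqrt Real.pi)) := by
  have h := ((tendsto_scorerProfile.comp tendsto_rescale).const_mul (1 / Real.pi))
  have hrem : Tendsto (fun q : ℝ × ℝ => Hi q.2 q.1 *
      (q.1 ^ (1 / 4 - q.2 / 2) * Real.exp (-(2 / 3) * q.1 ^ (3 / 2 : ℝ)))
      - 1 / Real.pi * scorerProfile q.2 ((q.1 ^ (1 / 4 : ℝ))⁻¹ ^ 3))
      (atTop ×ˢ 𝓟 indexRange) (𝓝 0) := by
    have hz : Tendsto (fun x : ℝ => 3 * (72 * (x ^ (1 / 4 : ℝ))⁻¹)) atTop (𝓝 0) := by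
      have := (((tendsto_rpow_atTop (y := 1 / 4) (by norm_num)).inv_tendsto_atTop).const_mul
        (72 : ℝ)).const_mul 3
      simpa using this
    refine squeeze_zero_norm' ?_ (hz.comp (tendsto_fst (g := 𝓟 indexRange)))
    filter_upwards [eventually_large_mem 1] with q hq
    obtain ⟨hq1, hq2⟩ := hq
    have he1 : 1 ≤ q.1 ^ (1 / 4 : ℝ) := Real.one_le_rpow hq1 (by norm_num)
    have he4 := rpow_quarter (ξ := q.1) (by linarith)
    simp only [Function.comp_apply]
    generalize q.1 ^ (1 / 4 : ℝ) = e at he1 he4 ⊢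
    have he0 : 0 < e := by linarith
    obtain ⟨r0, r1⟩ := Hi_remainder_bounds hq2 he1
    rw [← he4, Hi_eq q.2 (abs_lt_one_of_mem_indexRange hq2) he0, rpow_three_halves he0]
    rw [← rpow_fourth he0] at r1 ⊢
    set R := ∫ σ in (0 : ℝ)..(e ^ 2 / 2), σ ^ q.2 * Real.exp (-(σ ^ 3) / 3 + σ * e ^ 4)
    have h1 : (e ^ 4) ^ (q.2 / 2 - 1 / 4) * (e ^ 4) ^ (1 / 4 - q.2 / 2) = 1 := by
      rw [← Real.rpow_add (by positivity)]; simp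
    have h2 : Real.exp (2 / 3 * e ^ 6) * Real.exp (-(2 / 3) * e ^ 6) = 1 := by
      rw [← Real.exp_add]; simp
    set P := (e ^ 4) ^ (q.2 / 2 - 1 / 4)
    set P' := (e ^ 4) ^ (1 / 4 - q.2 / 2)
    have hP' : 0 ≤ P' := Real.rpow_nonneg (by positivity) _
    set E := Real.exp (2 / 3 * e ^ 6)
    set E' := Real.exp (-(2 / 3) * e ^ 6)
    have hE' : 0 ≤ E' := (Real.exp_pos _).le
    have e1 : 1 / Real.pi * (R + P * E * scorerProfile q.2 (e⁻¹ ^ 3)) * (P' * E')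
        - 1 / Real.pi * scorerProfile q.2 (e⁻¹ ^ 3) = 1 / Real.pi * (R * (P' * E')) := by
      linear_combination (1 / Real.pi * scorerProfile q.2 (e⁻¹ ^ 3) * (E * E')) * h1
        + (1 / Real.pi * scorerProfile q.2 (e⁻¹ ^ 3)) * h2
    rw [e1, Real.norm_eq_abs]
    refine (abs_one_div_pi_mul_le _).trans ?_
    rw [abs_of_nonneg (by positivity)]
    calc R * (P' * E') ≤ (P * E * (3 * (e ^ 3 * Real.exp (-(e ^ 6 / 6))))) * (P' * E') := by
          gcongr
      _ = 3 * (e ^ 3 * Real.exp (-(e ^ 6 / 6))) := by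
          linear_combination (3 * (e ^ 3 * Real.exp (-(e ^ 6 / 6))) * (E * E')) * h1
            + (3 * (e ^ 3 * Real.exp (-(e ^ 6 / 6)))) * h2
      _ ≤ 3 * (72 * e⁻¹) := by
          refine mul_le_mul_of_nonneg_left ?_ (by norm_num)
          rw [← div_eq_mul_inv, le_div_iff₀ he0]
          have h3 := pow_mul_exp_neg_le 2 (y := e ^ 6 / 6) (by positivity)
          norm_num [Nat.factorial] at h3
          have h4 : e ^ 4 ≤ e ^ 12 := pow_le_pow_right₀ he1 (by norm_num)
          have h5 : e ^ 4 * Real.exp (-(e ^ 6 / 6)) ≤ e ^ 12 * Real.exp (-(e ^ 6 / 6)) := by gcongr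
          have h6 : (e ^ 6 / 6) ^ 2 = e ^ 12 / 36 := by ring
          rw [h6] at h3
          calc e ^ 3 * Real.exp (-(e ^ 6 / 6)) * e = e ^ 4 * Real.exp (-(e ^ 6 / 6)) := by ring
            _ ≤ 72 := by linarith
  have := h.add hrem
  rw [add_zero] at this
  refine this.congr fun q => ?_
  simp only [Function.comp_apply]
  ring

end GKdV

end

noncomputable section

open Filter Topology MeasureTheory

namespace GKdV

/-! ### Phase, weight and kernel in the variable `b = a^{1/3}`. -/

/-- The range of the parameter `γ`. -/
def gammaRange : Set ℝ := Set.Icc (-(5 / 8)) (-(3 / 8))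

theorem mem_indexRange_of_mem {γ : ℝ} (h : γ ∈ gammaRange) :
    γ ∈ indexRange ∧ -γ ∈ indexRange :=
  ⟨⟨h.1, by linarith [h.2]⟩, ⟨by linarith [h.2], by linarith [h.1]⟩⟩

/-- The rescaled variable `a^{1/3}(x + 1/a)` for `a = b³`. -/
def xi (b x : ℝ) : ℝ := b * (x + (b ^ 3)⁻¹)

/-- A regularization of `|1 + ax|` for `a = b³`, equal to `b²(1 + |xi b x|)`. -/
def envBase (b x : ℝ) : ℝ := b ^ 2 + |1 + b ^ 3 * x|

/-- The phase `(2/(3a))((1 + ax)^{3/2} - 1)` for `a = b³`. -/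
def phase (b x : ℝ) : ℝ := 2 / 3 * (b ^ 3)⁻¹ * ((1 + b ^ 3 * x) ^ (3 / 2 : ℝ) - 1)

theorem xi_eq {b : ℝ} (hb : 0 < b) (x : ℝ) : xi b x = (1 + b ^ 3 * x) / b ^ 2 := by
  rw [xi]; field_simp; ring

theorem one_add_abs_xi {b : ℝ} (hb : 0 < b) (x : ℝ) : 1 + |xi b x| = envBase b x / b ^ 2 := by
  rw [xi_eq hb, abs_div, abs_of_pos (by positivity : 0 < b ^ 2), envBase]
  field_simp

theorem xi_nonneg {b x : ℝ} (hb : 0 < b) (hx : 0 ≤ 1 + b ^ 3 * x) : 0 ≤ xi b x := by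
  rw [xi_eq hb]; positivity

theorem xi_nonpos {b x : ℝ} (hb : 0 < b) (hx : 1 + b ^ 3 * x ≤ 0) : xi b x ≤ 0 := by
  rw [xi_eq hb]; exact div_nonpos_of_nonpos_of_nonneg hx (by positivity)

theorem envBase_pos {b : ℝ} (hb : 0 < b) (x : ℝ) : 0 < envBase b x := by
  rw [envBase]; positivity

theorem xi_rpow {b x : ℝ} (hb : 0 < b) (hx : 0 ≤ 1 + b ^ 3 * x) :
    2 / 3 * xi b x ^ (3 / 2 : ℝ) = phase b x + 2 / 3 * (b ^ 3)⁻¹ := by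
  have h : (b ^ 2) ^ (3 / 2 : ℝ) = b ^ 3 := by
    rw [← Real.rpow_natCast, ← Real.rpow_mul hb.le, ← Real.rpow_natCast]; norm_num
  rw [xi_eq hb, Real.div_rpow hx (by positivity), h, phase]
  field_simp
  ring

/-- The phase is convex with value `0` and slope `1` at the origin; this is the tangent line, by
Bernoulli's inequality. -/
theorem le_phase {b x : ℝ} (hb : 0 < b) (hx : 0 ≤ 1 + b ^ 3 * x) : x ≤ phase b x := by
  have h := one_add_mul_self_le_rpow_one_add (s := b ^ 3 * x) (by linarith)
    (p := 3 / 2) (by norm_num)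
  rw [phase]
  have hb3 : 0 < (b ^ 3)⁻¹ := by positivity
  have : x = 2 / 3 * (b ^ 3)⁻¹ * (3 / 2 * (b ^ 3 * x)) := by field_simp
  calc x = 2 / 3 * (b ^ 3)⁻¹ * (3 / 2 * (b ^ 3 * x)) := this
    _ ≤ _ := by gcongr; linarith

/-- The chord of the convex phase between `-1/a` and `0` has slope `2/3`: on `[0, 1]` one has
`r^{3/2} ≤ r`. -/
theorem phase_le {b x : ℝ} (hb : 0 < b) (hx : 0 ≤ 1 + b ^ 3 * x) (hx0 : x ≤ 0) :
    phase b x ≤ 2 / 3 * x := by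
  have h1 : 1 + b ^ 3 * x ≤ 1 := by nlinarith [pow_pos hb 3]
  have h : (1 + b ^ 3 * x) ^ (3 / 2 : ℝ) ≤ 1 + b ^ 3 * x := by
    rcases hx.eq_or_lt with h0 | h0
    · rw [← h0, Real.zero_rpow (by norm_num)]
    · calc (1 + b ^ 3 * x) ^ (3 / 2 : ℝ) ≤ (1 + b ^ 3 * x) ^ (1 : ℝ) :=
          Real.rpow_le_rpow_of_exponent_ge h0 h1 (by norm_num)
        _ = _ := Real.rpow_one _
  rw [phase]
  have hb3 : 0 < (b ^ 3)⁻¹ := by positivity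
  calc _ ≤ 2 / 3 * (b ^ 3)⁻¹ * (1 + b ^ 3 * x - 1) := by gcongr
    _ = 2 / 3 * x := by field_simp; ring

/-- To the right of the origin the slope `(1 + ax)^{1/2}` of the phase is at least `1`. Bernoulli's
inequality is applied to the ratio of `1 + ay` and `1 + ax`. -/
theorem sub_le_phase_sub {b x y : ℝ} (hb : 0 < b) (hx : 0 ≤ x) (hxy : x ≤ y) :
    y - x ≤ phase b y - phase b x := by
  have hb3 : 0 < b ^ 3 := by positivity
  set r := 1 + b ^ 3 * x
  set s := 1 + b ^ 3 * y
  have hr : 1 ≤ r := by simp only [r]; nlinarith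
  have hrs : r ≤ s := by simp only [r, s]; gcongr
  have hr0 : 0 < r := by linarith
  have hs0 : 0 < s := by linarith
  have h1 := one_add_mul_self_le_rpow_one_add (s := s / r - 1)
    (by rw [le_sub_iff_add_le]; have : 0 ≤ s / r := by positivity
        linarith) (p := 3 / 2) (by norm_num)
  have h2 : s ^ (3 / 2 : ℝ) = r ^ (3 / 2 : ℝ) * (1 + (s / r - 1)) ^ (3 / 2 : ℝ) := by
    rw [← Real.mul_rpow hr0.le (by rw [add_sub_cancel]; positivity)]
    congr 1
    field_simp
    ring
  have h3 : r ≤ r ^ (3 / 2 : ℝ) := by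
    calc r = r ^ (1 : ℝ) := (Real.rpow_one r).symm
      _ ≤ _ := Real.rpow_le_rpow_of_exponent_le hr (by norm_num)
  have h4 : 0 ≤ s / r - 1 := by rw [sub_nonneg, le_div_iff₀ hr0]; linarith
  have h5 : 3 / 2 * (s - r) ≤ s ^ (3 / 2 : ℝ) - r ^ (3 / 2 : ℝ) := by
    have h6 : r ^ (3 / 2 : ℝ) * (3 / 2 * (s / r - 1)) ≤ s ^ (3 / 2 : ℝ) - r ^ (3 / 2 : ℝ) := by
      rw [h2]
      have : 0 < r ^ (3 / 2 : ℝ) := by positivity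
      nlinarith
    have h7 : r * (3 / 2 * (s / r - 1)) ≤ r ^ (3 / 2 : ℝ) * (3 / 2 * (s / r - 1)) := by gcongr
    have h8 : r * (3 / 2 * (s / r - 1)) = 3 / 2 * (s - r) := by field_simp
    linarith
  have h9 : y - x = 2 / 3 * (b ^ 3)⁻¹ * (3 / 2 * (s - r)) := by
    simp only [r, s]; field_simp; ring
  calc y - x = 2 / 3 * (b ^ 3)⁻¹ * (3 / 2 * (s - r)) := h9
    _ ≤ 2 / 3 * (b ^ 3)⁻¹ * (s ^ (3 / 2 : ℝ) - r ^ (3 / 2 : ℝ)) := by gcongr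
    _ = _ := by simp only [phase, r, s]; ring

theorem neg_le_phase {b x : ℝ} (hb : 0 < b) (hx : 0 ≤ 1 + b ^ 3 * x) :
    -(2 / 3 * (b ^ 3)⁻¹) ≤ phase b x := by
  have h := xi_rpow hb hx
  have : 0 ≤ xi b x ^ (3 / 2 : ℝ) := Real.rpow_nonneg (xi_nonneg hb hx) _
  linarith

theorem weight_of_far {b x : ℝ} (hb : 0 < b) (γ : ℝ) (hx : 1 + b ^ 3 * x ≤ 0) :
    weight (b ^ 3) γ x = Real.exp (-(1 / 3 * (b ^ 3)⁻¹)) * (1 + |xi b x|) ^ (-(3 / 8) : ℝ) := by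
  have hb3 : 0 < b ^ 3 := by positivity
  have hx' : x ≤ -(b ^ 3)⁻¹ := by
    have : b ^ 3 * x ≤ b ^ 3 * -(b ^ 3)⁻¹ := by
      rw [mul_neg, mul_inv_cancel₀ hb3.ne']; linarith
    exact le_of_mul_le_mul_left this hb3
  have e1 : (b ^ 3) ^ (-(2 / 3) : ℝ) = (b ^ 2)⁻¹ := by
    rw [← Real.rpow_natCast, ← Real.rpow_mul hb.le, ← Real.rpow_natCast, ← Real.rpow_neg hb.le]
    norm_num
  rw [weight, if_neg hb3.ne', if_pos hx', e1, xi_eq hb, abs_div,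
    abs_of_pos (by positivity : 0 < b ^ 2)]
  congr 2
  · field_simp
  · ring

theorem weight_of_near {b x : ℝ} (hb : 0 < b) (γ : ℝ) (hx : 0 ≤ 1 + b ^ 3 * x) (hx0 : x ≤ 0) :
    weight (b ^ 3) γ x = Real.exp (phase b x / 2) := by
  have hb3 : 0 < b ^ 3 := by positivity
  rcases hx.eq_or_lt with h | h
  · rw [weight_of_far hb γ h.symm.le, xi_eq hb, phase, ← h]
    rw [Real.zero_rpow (by norm_num)]
    simp
    ring
  · have hx' : ¬ x ≤ -(b ^ 3)⁻¹ := by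
      intro h1
      have := mul_le_mul_of_nonneg_left h1 hb3.le
      rw [mul_neg, mul_inv_cancel₀ hb3.ne'] at this
      linarith
    rw [weight, if_neg hb3.ne', if_neg hx', if_pos hx0, phase]
    congr 1
    field_simp

theorem weight_of_nonneg {b x : ℝ} (hb : 0 < b) (γ : ℝ) (hx : 0 ≤ x) :
    weight (b ^ 3) γ x = (1 + b ^ 3 * x) ^ (-1 - γ) := by
  rcases hx.eq_or_lt with h | h
  · subst h
    rw [weight_of_near hb γ (by simp) le_rfl, phase]
    simp
  · have hb3 : 0 < b ^ 3 := by positivity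
    have hx' : ¬ x ≤ -(b ^ 3)⁻¹ := by
      have : 0 < (b ^ 3)⁻¹ := by positivity
      intro h1
      linarith
    rw [weight, if_neg hb3.ne', if_neg hx', if_neg (not_le.mpr h)]

theorem kernel_eq {b : ℝ} (hb : 0 < b) (γ x y : ℝ) :
    kernel (b ^ 3) γ x y = Real.pi * b⁻¹ *
      (if x < y then Ai (-γ) (xi b y) * Hi γ (xi b x)
        else
          Hi (-γ) (xi b y) * Ai γ (xi b x)
            - Real.sin (γ * Real.pi) * (Gi (-γ) (xi b y) * Gi γ (xi b x)
              + Ai (-γ) (xi b y) * Ai γ (xi b x))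
            - Real.cos (γ * Real.pi) * (Ai (-γ) (xi b y) * Gi γ (xi b x)
              - Gi (-γ) (xi b y) * Ai γ (xi b x))) := by
  have e1 : (b ^ 3) ^ (1 / 3 : ℝ) = b := by
    rw [← Real.rpow_natCast, ← Real.rpow_mul hb.le]; norm_num
  have e2 : (b ^ 3) ^ (-(1 / 3) : ℝ) = b⁻¹ := by
    rw [Real.rpow_neg (by positivity), e1]
  have hb3 : b ^ 3 ≠ 0 := by positivity
  rw [kernel, if_neg hb3, e1, e2]
  rfl

theorem abs_kernel_le_of_lt {b : ℝ} (hb : 0 < b) (γ : ℝ) {x y : ℝ} (h : x < y) :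
    |kernel (b ^ 3) γ x y| ≤ 4 * b⁻¹ * (|Ai (-γ) (xi b y)| * |Hi γ (xi b x)|) := by
  rw [kernel_eq hb, if_pos h, abs_mul, abs_of_pos (by positivity : 0 < Real.pi * b⁻¹), abs_mul]
  gcongr
  exact Real.pi_le_four

/-- Products containing `Ai γ` at `x` are charged to `S * A`, where `S` may grow exponentially.
Products containing `Gi γ` at `x`, which decays only algebraically, must be charged to the small
bound `g` in the variable `y`. The constant is `3 · 4`, with `π ≤ 4`. -/
theorem abs_kernel_le_of_le {b : ℝ} (hb : 0 < b) (γ : ℝ) {x y : ℝ} (h : y ≤ x) {S A g G : ℝ}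
    (h1 : |Hi (-γ) (xi b y)| ≤ S) (h2 : |Ai (-γ) (xi b y)| ≤ S) (h3 : |Gi (-γ) (xi b y)| ≤ S)
    (h4 : |Ai γ (xi b x)| ≤ A) (h5 : |Gi γ (xi b x)| ≤ G)
    (h6 : |Ai (-γ) (xi b y)| ≤ g) (h7 : |Gi (-γ) (xi b y)| ≤ g) :
    |kernel (b ^ 3) γ x y| ≤ 12 * b⁻¹ * (S * A + g * G) := by
  rw [kernel_eq hb, if_neg (not_lt.mpr h), abs_mul, abs_of_pos (by positivity : 0 < Real.pi * b⁻¹)]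
  have hs := Real.abs_sin_le_one (γ * Real.pi)
  have hc := Real.abs_cos_le_one (γ * Real.pi)
  generalize Hi (-γ) (xi b y) = hy at *
  generalize Ai (-γ) (xi b y) = ay at *
  generalize Gi (-γ) (xi b y) = gy at *
  generalize Ai γ (xi b x) = ax at *
  generalize Gi γ (xi b x) = gx at *
  generalize Real.sin (γ * Real.pi) = s at *
  generalize Real.cos (γ * Real.pi) = c at *
  have hS : 0 ≤ S := (abs_nonneg _).trans h1
  have hA : 0 ≤ A := (abs_nonneg _).trans h4
  have hG : 0 ≤ G := (abs_nonneg _).trans h5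
  have hg : 0 ≤ g := (abs_nonneg _).trans h6
  have b1 : |hy * ax| ≤ S * A := by rw [abs_mul]; gcongr
  have b2 : |gy * gx| ≤ g * G := by rw [abs_mul]; gcongr
  have b3 : |ay * ax| ≤ S * A := by rw [abs_mul]; gcongr
  have b4 : |ay * gx| ≤ g * G := by rw [abs_mul]; gcongr
  have b5 : |gy * ax| ≤ S * A := by rw [abs_mul]; gcongr
  have c1 : |s * (gy * gx + ay * ax)| ≤ g * G + S * A := by
    rw [abs_mul]
    calc |s| * |gy * gx + ay * ax| ≤ 1 * (|gy * gx| + |ay * ax|) := by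
          gcongr; exact abs_add_le _ _
      _ ≤ _ := by linarith
  have c2 : |c * (ay * gx - gy * ax)| ≤ g * G + S * A := by
    rw [abs_mul]
    calc |c| * |ay * gx - gy * ax| ≤ 1 * (|ay * gx| + |gy * ax|) := by
          gcongr; exact abs_sub _ _
      _ ≤ _ := by linarith
  have c3 : |hy * ax - s * (gy * gx + ay * ax) - c * (ay * gx - gy * ax)|
      ≤ 3 * (S * A + g * G) := by
    have d1 := abs_sub (hy * ax - s * (gy * gx + ay * ax)) (c * (ay * gx - gy * ax))
    have d2 := abs_sub (hy * ax) (s * (gy * gx + ay * ax))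
    have d3 : 0 ≤ g * G := by positivity
    linarith
  calc _ ≤ 4 * b⁻¹ * (3 * (S * A + g * G)) := by gcongr; exact Real.pi_le_four
    _ = _ := by ring

/-- The exponents on the negative side are worst cases over `γ`, attained at `γ = -5/8`: `-1 - γ ≤
-3/8`, which is the exponent of the weight, and `-γ/2 - 1/4 ≤ 1/16`. On the positive side `Ai` also
gets algebraic bounds, to stand next to `Gi`. -/
theorem airy_envelopes : ∃ C : ℝ, 0 < C ∧ ∀ γ ∈ gammaRange,
    (∀ ξ : ℝ, 0 ≤ ξ →
      |Ai γ ξ| ≤ C * ((1 + ξ) ^ (γ / 2 - 1 / 4) * Real.exp (-(2 / 3 * ξ ^ (3 / 2 : ℝ)))) ∧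
      |Hi γ ξ| ≤ C * ((1 + ξ) ^ (γ / 2 - 1 / 4) * Real.exp (2 / 3 * ξ ^ (3 / 2 : ℝ))) ∧
      |Ai γ ξ| ≤ C * (1 + ξ) ^ (-1 - γ) ∧
      |Gi γ ξ| ≤ C * (1 + ξ) ^ (-1 - γ) ∧
      |Ai (-γ) ξ| ≤ C * ((1 + ξ) ^ (-γ / 2 - 1 / 4) * Real.exp (-(2 / 3 * ξ ^ (3 / 2 : ℝ)))) ∧
      |Hi (-γ) ξ| ≤ C * ((1 + ξ) ^ (-γ / 2 - 1 / 4) * Real.exp (2 / 3 * ξ ^ (3 / 2 : ℝ))) ∧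
      |Gi (-γ) ξ| ≤ C * ((1 + ξ) ^ (-γ / 2 - 1 / 4) * Real.exp (2 / 3 * ξ ^ (3 / 2 : ℝ))) ∧
      |Ai (-γ) ξ| ≤ C * (1 + ξ) ^ (γ - 1) ∧
      |Gi (-γ) ξ| ≤ C * (1 + ξ) ^ (γ - 1)) ∧
    (∀ ξ : ℝ, ξ ≤ 0 →
      |Ai γ ξ| ≤ C * (1 + |ξ|) ^ (-(3 / 8) : ℝ) ∧
      |Gi γ ξ| ≤ C * (1 + |ξ|) ^ (-(3 / 8) : ℝ) ∧
      |Hi γ ξ| ≤ C * (1 + |ξ|) ^ (-(3 / 8) : ℝ) ∧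
      |Ai (-γ) ξ| ≤ C * (1 + |ξ|) ^ (1 / 16 : ℝ) ∧
      |Gi (-γ) ξ| ≤ C * (1 + |ξ|) ^ (1 / 16 : ℝ) ∧
      |Hi (-γ) ξ| ≤ C * (1 + |ξ|) ^ (1 / 16 : ℝ)) := by
  obtain ⟨C₁, hC₁, h₁⟩ := abs_Ai_le_of_nonneg
  obtain ⟨C₂, hC₂, h₂⟩ := Hi_le_of_nonneg
  obtain ⟨C₃, hC₃, h₃⟩ := abs_Gi_le_of_nonneg
  obtain ⟨C₄, hC₄, h₄⟩ := abs_Ai_Gi_le_of_neg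
  obtain ⟨C₅, hC₅, h₅⟩ := Hi_le_of_neg
  have poly : ∀ ξ : ℝ, 0 ≤ ξ → (1 + ξ) ^ (2 : ℝ) * Real.exp (-(2 / 3 * ξ ^ (3 / 2 : ℝ))) ≤ 24 := by
    intro ξ hξ
    have e1 : (1 + ξ) ^ (2 : ℝ) = (1 + ξ) ^ 2 := by norm_cast
    have e2 : 2 / 3 * (ξ - 1) ≤ 2 / 3 * ξ ^ (3 / 2 : ℝ) := by
      rcases le_total ξ 1 with h | h
      · have : 0 ≤ ξ ^ (3 / 2 : ℝ) := by positivity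
        linarith
      · have : ξ ^ (1 : ℝ) ≤ ξ ^ (3 / 2 : ℝ) :=
          Real.rpow_le_rpow_of_exponent_le h (by norm_num)
        rw [Real.rpow_one] at this
        linarith
    have e3 := pow_mul_exp_neg_le 2 (y := 2 / 3 * (1 + ξ)) (by positivity)
    norm_num [Nat.factorial] at e3
    have e4 : Real.exp (-(2 / 3 * ξ ^ (3 / 2 : ℝ)))
        ≤ Real.exp (4 / 3) * Real.exp (-(2 / 3 * (1 + ξ))) := by
      rw [← Real.exp_add]
      exact Real.exp_le_exp.mpr (by linarith)
    have e5 : Real.exp (4 / 3) ≤ 5 := by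
      have h1 : Real.exp (4 / 3) ^ 3 = Real.exp 1 ^ 4 := by
        rw [← Real.exp_nat_mul, ← Real.exp_nat_mul]; norm_num
      have h2 : Real.exp 1 ^ 4 ≤ 2.72 ^ 4 :=
        pow_le_pow_left₀ (Real.exp_pos _).le (by linarith [Real.exp_one_lt_d9]) 4
      by_contra h3
      push Not at h3
      have h4 : (5 : ℝ) ^ 3 ≤ Real.exp (4 / 3) ^ 3 := pow_le_pow_left₀ (by norm_num) h3.le 3
      have h5 : (2.72 : ℝ) ^ 4 < 5 ^ 3 := by norm_num
      linarith
    rw [e1]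
    calc (1 + ξ) ^ 2 * Real.exp (-(2 / 3 * ξ ^ (3 / 2 : ℝ)))
        ≤ (1 + ξ) ^ 2 * (5 * Real.exp (-(2 / 3 * (1 + ξ)))) := by
          gcongr
          exact e4.trans (by gcongr)
      _ = 5 * (9 / 4) * ((2 / 3 * (1 + ξ)) ^ 2 * Real.exp (-(2 / 3 * (1 + ξ)))) := by ring
      _ ≤ 24 := by rw [mul_pow]; linarith
  set C := 24 * C₁ + C₂ + C₃ + 2 * C₄ + C₅ with hC
  have c1 : C₁ ≤ C := by linarith
  have c1' : 24 * C₁ ≤ C := by linarith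
  have c2 : C₂ ≤ C := by linarith
  have c3 : C₃ ≤ C := by linarith
  have c4 : 2 * C₄ ≤ C := by linarith
  have c5 : C₅ ≤ C := by linarith
  have hCpos : 0 < C := by linarith
  refine ⟨C, hCpos, fun γ hγ => ?_⟩
  obtain ⟨m1, m2⟩ := mem_indexRange_of_mem hγ
  have g1 := hγ.1
  have g2 := hγ.2
  -- The exponential in the bound for `Ai` is traded for two powers of `1 + ξ`.
  have decay : ∀ α ∈ indexRange, ∀ s : ℝ, α / 2 - 1 / 4 - 2 ≤ s → ∀ ξ : ℝ, 0 ≤ ξ →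
      |Ai α ξ| ≤ C * (1 + ξ) ^ s := by
    intro α hα s hs ξ hξ
    have p := poly ξ hξ
    have q := h₁ α hα ξ hξ
    have e1 : (1 + ξ) ^ (α / 2 - 1 / 4) ≤ (1 + ξ) ^ s * (1 + ξ) ^ (2 : ℝ) := by
      rw [← Real.rpow_add (by linarith)]
      exact Real.rpow_le_rpow_of_exponent_le (by linarith) (by linarith)
    rw [neg_mul] at q
    calc |Ai α ξ| ≤ C₁ * (((1 + ξ) ^ s * (1 + ξ) ^ (2 : ℝ))
          * Real.exp (-(2 / 3 * ξ ^ (3 / 2 : ℝ)))) := q.trans (by gcongr)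
      _ = C₁ * ((1 + ξ) ^ s * ((1 + ξ) ^ (2 : ℝ) * Real.exp (-(2 / 3 * ξ ^ (3 / 2 : ℝ))))) := by
          ring
      _ ≤ C₁ * ((1 + ξ) ^ s * 24) := by gcongr
      _ = 24 * C₁ * (1 + ξ) ^ s := by ring
      _ ≤ _ := by gcongr
  constructor
  · intro ξ hξ
    have hG : |Gi (-γ) ξ| ≤ C * (1 + ξ) ^ (γ - 1) := by
      have := h₃ (-γ) m2 ξ hξ
      rw [show -1 - -γ = γ - 1 by ring] at this
      exact this.trans (by gcongr)
    refine ⟨?_, ?_, decay γ m1 _ (by linarith) ξ hξ, ?_, ?_, ?_, ?_,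
      decay (-γ) m2 _ (by linarith) ξ hξ, hG⟩
    · rw [← neg_mul]; exact (h₁ γ m1 ξ hξ).trans (by gcongr)
    · rw [abs_of_nonneg (Hi_nonneg _ _)]; exact (h₂ γ m1 ξ hξ).trans (by gcongr)
    · exact (h₃ γ m1 ξ hξ).trans (by gcongr)
    · rw [← neg_mul]; exact (h₁ (-γ) m2 ξ hξ).trans (by gcongr)
    · rw [abs_of_nonneg (Hi_nonneg _ _)]; exact (h₂ (-γ) m2 ξ hξ).trans (by gcongr)
    · refine hG.trans ?_
      gcongr
      calc (1 + ξ) ^ (γ - 1) ≤ (1 + ξ) ^ (-γ / 2 - 1 / 4) * 1 := by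
            rw [mul_one]
            exact Real.rpow_le_rpow_of_exponent_le (by linarith) (by linarith)
        _ ≤ _ := by gcongr; exact Real.one_le_exp (by positivity)
  · intro ξ hξ
    have hu : 1 ≤ 1 + |ξ| := by linarith [abs_nonneg ξ]
    have p1 : (1 + |ξ|) ^ (γ / 2 - 1 / 4) ≤ (1 + |ξ|) ^ (-(3 / 8) : ℝ) :=
      Real.rpow_le_rpow_of_exponent_le hu (by linarith)
    have p2 : (1 + |ξ|) ^ (-1 - γ) ≤ (1 + |ξ|) ^ (-(3 / 8) : ℝ) :=
      Real.rpow_le_rpow_of_exponent_le hu (by linarith)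
    have p3 : (1 + |ξ|) ^ (-γ / 2 - 1 / 4) ≤ (1 + |ξ|) ^ (1 / 16 : ℝ) :=
      Real.rpow_le_rpow_of_exponent_le hu (by linarith)
    have p4 : (1 + |ξ|) ^ (-1 - -γ) ≤ (1 + |ξ|) ^ (1 / 16 : ℝ) :=
      Real.rpow_le_rpow_of_exponent_le hu (by linarith)
    have comb : ∀ u v w : ℝ, 0 ≤ w → u ≤ w → v ≤ w → C₄ * (u + v) ≤ C * w := by
      intro u v w hw hu hv
      calc C₄ * (u + v) ≤ C₄ * (w + w) := by gcongr
        _ = 2 * C₄ * w := by ring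
        _ ≤ C * w := by gcongr
    have w1 : 0 ≤ (1 + |ξ|) ^ (-(3 / 8) : ℝ) := by positivity
    have w2 : 0 ≤ (1 + |ξ|) ^ (1 / 16 : ℝ) := by positivity
    refine ⟨(h₄ γ m1 ξ hξ).1.trans (comb _ _ _ w1 p1 p2),
      (h₄ γ m1 ξ hξ).2.trans (comb _ _ _ w1 p1 p2), ?_,
      (h₄ (-γ) m2 ξ hξ).1.trans (comb _ _ _ w2 p3 p4),
      (h₄ (-γ) m2 ξ hξ).2.trans (comb _ _ _ w2 p3 p4), ?_⟩
    · rw [abs_of_nonneg (Hi_nonneg _ _)]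
      exact (h₅ γ m1 ξ hξ).trans (by gcongr)
    · rw [abs_of_nonneg (Hi_nonneg _ _)]
      exact (h₅ (-γ) m2 ξ hξ).trans (by gcongr)

/-- Exponents of total `-1/2` scale as `(b²)^{1/2}`, which cancels the factor `b⁻¹` of the kernel:
the exponential part has size one. -/
theorem scale_mul {b : ℝ} (hb : 0 < b) {u v s t : ℝ} (hu : 0 < u) (hv : 0 < v)
    (hst : s + t = -(1 / 2)) :
    b⁻¹ * ((u / b ^ 2) ^ s * (v / b ^ 2) ^ t) = u ^ s * v ^ t := by
  have h : (b ^ 2) ^ s * (b ^ 2) ^ t = b⁻¹ := by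
    rw [← Real.rpow_add (by positivity), hst, ← Real.rpow_natCast, ← Real.rpow_mul hb.le]
    norm_num
    exact Real.rpow_neg_one b
  rw [Real.div_rpow hu.le (by positivity), Real.div_rpow hv.le (by positivity), div_mul_div_comm, h]
  field_simp

/-- Exponents of total `-2` give `b⁴`, so `b⁻¹` becomes `b³ = a`: the products of `Gi` type carry a
factor `a`. -/
theorem scale_mul_cube {b : ℝ} (hb : 0 < b) {u v s t : ℝ} (hu : 0 < u) (hv : 0 < v)
    (hst : s + t = -2) :
    b⁻¹ * ((u / b ^ 2) ^ s * (v / b ^ 2) ^ t) = b ^ 3 * (u ^ s * v ^ t) := by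
  have h : (b ^ 2) ^ s * (b ^ 2) ^ t = (b ^ 4)⁻¹ := by
    rw [← Real.rpow_add (by positivity), hst, Real.rpow_neg (by positivity)]
    norm_cast
    rw [← pow_mul]
  rw [Real.div_rpow hu.le (by positivity), Real.div_rpow hv.le (by positivity), div_mul_div_comm, h]
  field_simp

/-- The zones are cut at the turning point `-1/a`. When `x` or `y` lies beyond it the weight at `x`
is split off and the rest depends on `y` only. For `y` beyond it the factor `e^{1/(3a)}` is
affordable, because there both `e^{-|y|} ≤ e^{-1/a}` and the fourth power of the weight are much
smaller. -/
theorem kernel_zone_bounds : ∃ C : ℝ, 0 < C ∧ ∀ γ ∈ gammaRange, ∀ b : ℝ, 0 < b → b ≤ 1 →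
    ∀ x y : ℝ,
    (0 ≤ 1 + b ^ 3 * x → 0 ≤ 1 + b ^ 3 * y → x < y → |kernel (b ^ 3) γ x y| ≤
      C * (envBase b y ^ (-γ / 2 - 1 / 4) * envBase b x ^ (γ / 2 - 1 / 4)
        * Real.exp (phase b x - phase b y))) ∧
    (0 ≤ 1 + b ^ 3 * x → 0 ≤ 1 + b ^ 3 * y → y ≤ x → |kernel (b ^ 3) γ x y| ≤
      C * (envBase b y ^ (-γ / 2 - 1 / 4) * envBase b x ^ (γ / 2 - 1 / 4)
        * Real.exp (phase b y - phase b x)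
        + b ^ 3 * (envBase b y ^ (γ - 1) * envBase b x ^ (-1 - γ)))) ∧
    (1 + b ^ 3 * x ≤ 0 → 0 ≤ 1 + b ^ 3 * y → x < y → |kernel (b ^ 3) γ x y| ≤
      C * (weight (b ^ 3) γ x * (b⁻¹ * (1 + xi b y) ^ (1 / 16 : ℝ)
        * Real.exp (-(1 / 3 * (b ^ 3)⁻¹) - phase b y)))) ∧
    (1 + b ^ 3 * y ≤ 0 → |kernel (b ^ 3) γ x y| ≤
      C * (weight (b ^ 3) γ x * (Real.exp (1 / 3 * (b ^ 3)⁻¹) * b⁻¹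
        * (1 + |xi b y|) ^ (1 / 16 : ℝ)))) := by
  obtain ⟨C, hC, henv⟩ := airy_envelopes
  refine ⟨24 * C ^ 2, by positivity, fun γ hγ b hb hb1 x y => ?_⟩
  obtain ⟨hpos, hneg⟩ := henv γ hγ
  have Nx := envBase_pos hb x
  have Ny := envBase_pos hb y
  have ex := one_add_abs_xi hb x
  have ey := one_add_abs_xi hb y
  have hb3 : 0 < (b ^ 3)⁻¹ := by positivity
  refine ⟨fun hx hy hxy => ?_, fun hx hy hxy => ?_, fun hx hy hxy => ?_, fun hy => ?_⟩
  · have ξ0 := xi_nonneg hb hx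
    have η0 := xi_nonneg hb hy
    rw [abs_of_nonneg ξ0] at ex
    rw [abs_of_nonneg η0] at ey
    obtain ⟨-, p2, -, -, -, -⟩ := hpos _ ξ0
    obtain ⟨-, -, -, -, p5, -⟩ := hpos _ η0
    rw [ex, xi_rpow hb hx] at p2
    rw [ey, xi_rpow hb hy] at p5
    refine (abs_kernel_le_of_lt hb γ hxy).trans ?_
    have hexp : Real.exp (-(phase b y + 2 / 3 * (b ^ 3)⁻¹)) * Real.exp (phase b x + 2 / 3 * (b ^ 3)⁻¹)
        = Real.exp (phase b x - phase b y) := by rw [← Real.exp_add]; ring_nf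
    have hsc := scale_mul hb Ny Nx (s := -γ / 2 - 1 / 4) (t := γ / 2 - 1 / 4) (by ring)
    rw [← hexp, ← hsc]
    set U := (envBase b y / b ^ 2) ^ (-γ / 2 - 1 / 4)
    set V := (envBase b x / b ^ 2) ^ (γ / 2 - 1 / 4)
    have hU : 0 ≤ U := by positivity
    have hV : 0 ≤ V := by positivity
    calc _ ≤ 4 * b⁻¹ * ((C * (U * Real.exp (-(phase b y + 2 / 3 * (b ^ 3)⁻¹))))
          * (C * (V * Real.exp (phase b x + 2 / 3 * (b ^ 3)⁻¹)))) := by gcongr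
      _ = 4 * C ^ 2 * (b⁻¹ * (U * V) * (Real.exp (-(phase b y + 2 / 3 * (b ^ 3)⁻¹))
          * Real.exp (phase b x + 2 / 3 * (b ^ 3)⁻¹))) := by ring
      _ ≤ _ := by gcongr; norm_num
  · have ξ0 := xi_nonneg hb hx
    have η0 := xi_nonneg hb hy
    rw [abs_of_nonneg ξ0] at ex
    rw [abs_of_nonneg η0] at ey
    obtain ⟨p1, -, -, p4, -, -⟩ := hpos _ ξ0
    obtain ⟨-, -, -, -, p5, p6, p7, p8, p9⟩ := hpos _ η0
    rw [ex, xi_rpow hb hx] at p1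
    rw [ex] at p4
    rw [ey, xi_rpow hb hy] at p5 p6 p7
    rw [ey] at p8 p9
    have p5' : |Ai (-γ) (xi b y)| ≤ C * ((envBase b y / b ^ 2) ^ (-γ / 2 - 1 / 4) *
        Real.exp (phase b y + 2 / 3 * (b ^ 3)⁻¹)) := by
      refine p5.trans ?_
      gcongr
      have := neg_le_phase hb hy
      linarith
    refine (abs_kernel_le_of_le hb γ hxy p6 p5' p7 p1 p4 p8 p9).trans ?_
    have hexp : Real.exp (phase b y + 2 / 3 * (b ^ 3)⁻¹) * Real.exp (-(phase b x + 2 / 3 * (b ^ 3)⁻¹))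
        = Real.exp (phase b y - phase b x) := by rw [← Real.exp_add]; ring_nf
    have hsc := scale_mul hb Ny Nx (s := -γ / 2 - 1 / 4) (t := γ / 2 - 1 / 4) (by ring)
    have hsc3 := scale_mul_cube hb Ny Nx (s := γ - 1) (t := -1 - γ) (by ring)
    rw [← hexp, ← hsc, ← hsc3]
    set U := (envBase b y / b ^ 2) ^ (-γ / 2 - 1 / 4)
    set V := (envBase b x / b ^ 2) ^ (γ / 2 - 1 / 4)
    set U' := (envBase b y / b ^ 2) ^ (γ - 1)
    set V' := (envBase b x / b ^ 2) ^ (-1 - γ)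
    have hU : 0 ≤ U := by positivity
    have hV : 0 ≤ V := by positivity
    have hU' : 0 ≤ U' := by positivity
    have hV' : 0 ≤ V' := by positivity
    calc _ = 12 * C ^ 2 * (b⁻¹ * (U * V) * (Real.exp (phase b y + 2 / 3 * (b ^ 3)⁻¹)
          * Real.exp (-(phase b x + 2 / 3 * (b ^ 3)⁻¹))) + b⁻¹ * (U' * V')) := by ring
      _ ≤ _ := by gcongr; norm_num
  · have η0 := xi_nonneg hb hy
    obtain ⟨-, -, n3, -⟩ := hneg _ (xi_nonpos hb hx)
    obtain ⟨-, -, -, -, p5, -⟩ := hpos _ η0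
    rw [xi_rpow hb hy] at p5
    have p5' : |Ai (-γ) (xi b y)| ≤ C * ((1 + xi b y) ^ (1 / 16 : ℝ)
        * Real.exp (-(phase b y + 2 / 3 * (b ^ 3)⁻¹))) := by
      refine p5.trans ?_
      gcongr
      · linarith
      · linarith [hγ.1]
    refine (abs_kernel_le_of_lt hb γ hxy).trans ?_
    rw [weight_of_far hb γ hx]
    have hexp : Real.exp (-(phase b y + 2 / 3 * (b ^ 3)⁻¹))
        = Real.exp (-(1 / 3 * (b ^ 3)⁻¹)) * Real.exp (-(1 / 3 * (b ^ 3)⁻¹) - phase b y) := by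
      rw [← Real.exp_add]; ring_nf
    rw [hexp] at p5'
    set V := (1 + |xi b x|) ^ (-(3 / 8) : ℝ)
    have hV : 0 ≤ V := by positivity
    calc _ ≤ 4 * b⁻¹ * ((C * ((1 + xi b y) ^ (1 / 16 : ℝ) * (Real.exp (-(1 / 3 * (b ^ 3)⁻¹))
          * Real.exp (-(1 / 3 * (b ^ 3)⁻¹) - phase b y)))) * (C * V)) := by gcongr
      _ = 4 * C ^ 2 * (Real.exp (-(1 / 3 * (b ^ 3)⁻¹)) * V * (b⁻¹ * (1 + xi b y) ^ (1 / 16 : ℝ)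
          * Real.exp (-(1 / 3 * (b ^ 3)⁻¹) - phase b y))) := by ring
      _ ≤ _ := by gcongr; norm_num
  · obtain ⟨-, -, -, q4, q5, q6⟩ := hneg _ (xi_nonpos hb hy)
    set S := (1 + |xi b y|) ^ (1 / 16 : ℝ)
    have hS : 0 ≤ S := by positivity
    rcases le_total (1 + b ^ 3 * x) 0 with hx | hx
    · obtain ⟨n1, n2, n3, -⟩ := hneg _ (xi_nonpos hb hx)
      set V := (1 + |xi b x|) ^ (-(3 / 8) : ℝ) with hVdef
      have hV : 0 ≤ V := by positivity
      have hw : weight (b ^ 3) γ x * Real.exp (1 / 3 * (b ^ 3)⁻¹) = V := by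
        rw [weight_of_far hb γ hx, ← hVdef, mul_right_comm, ← Real.exp_add]
        simp
      have hK : |kernel (b ^ 3) γ x y| ≤ 24 * C ^ 2 * (V * (b⁻¹ * S)) := by
        rcases lt_or_ge x y with h | h
        · refine (abs_kernel_le_of_lt hb γ h).trans ?_
          calc _ ≤ 4 * b⁻¹ * ((C * S) * (C * V)) := by gcongr
            _ = 4 * C ^ 2 * (V * (b⁻¹ * S)) := by ring
            _ ≤ _ := by gcongr; norm_num
        · refine (abs_kernel_le_of_le hb γ h q6 q4 q5 n1 n2 q4 q5).trans (le_of_eq ?_)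
          ring
      refine hK.trans (le_of_eq ?_)
      rw [← hw]
      ring
    · have ξ0 := xi_nonneg hb hx
      obtain ⟨-, -, n1, n2, -⟩ := hpos _ ξ0
      have hyx : y ≤ x := by
        have : b ^ 3 * y ≤ b ^ 3 * x := by linarith
        exact le_of_mul_le_mul_left this (by positivity)
      set V := (1 + xi b x) ^ (-1 - γ) with hVdef
      have hV : 0 ≤ V := by positivity
      have hexp1 : 1 ≤ Real.exp (1 / 3 * (b ^ 3)⁻¹) := Real.one_le_exp (by positivity)
      have hw : V ≤ weight (b ^ 3) γ x * Real.exp (1 / 3 * (b ^ 3)⁻¹) := by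
        rcases le_total x 0 with h0 | h0
        · rw [weight_of_near hb γ hx h0, ← Real.exp_add]
          have h1 : V ≤ 1 :=
            Real.rpow_le_one_of_one_le_of_nonpos (by linarith) (by linarith [hγ.1])
          refine h1.trans (Real.one_le_exp ?_)
          have := neg_le_phase hb hx
          linarith
        · rw [weight_of_nonneg hb γ h0]
          have h1 : (1 + b ^ 3 * x) ≤ 1 + xi b x := by
            rw [xi_eq hb]
            have : 1 + b ^ 3 * x ≤ (1 + b ^ 3 * x) / b ^ 2 := by
              rw [le_div_iff₀ (by positivity)]
              exact mul_le_of_le_one_right hx (pow_le_one₀ hb.le hb1)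
            linarith
          have h2 : V ≤ (1 + b ^ 3 * x) ^ (-1 - γ) :=
            Real.rpow_le_rpow_of_nonpos (by positivity) h1 (by linarith [hγ.1])
          have h3 : 0 ≤ (1 + b ^ 3 * x) ^ (-1 - γ) := by positivity
          nlinarith
      refine (abs_kernel_le_of_le hb γ hyx q6 q4 q5 n1 n2 q4 q5).trans ?_
      calc _ = 24 * C ^ 2 * (V * (b⁻¹ * S)) := by ring
        _ ≤ 24 * C ^ 2 * ((weight (b ^ 3) γ x * Real.exp (1 / 3 * (b ^ 3)⁻¹)) * (b⁻¹ * S)) := by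
            gcongr
        _ = _ := by ring

/-- Negative powers are large only near the turning point, where they can reach `b⁻⁴`; but there
`|x| ≥ 1/(2a)`, so a slowly growing exponential pays for them. The rate `1/64` is small against
every decay rate used later. -/
theorem envBase_rpow_le {b : ℝ} (hb : 0 < b) (hb1 : b ≤ 1) (x : ℝ) {s : ℝ} (hs : |s| ≤ 2) :
    envBase b x ^ s ≤ 10 ^ 5 * Real.exp (|x| / 64) := by
  have hN := envBase_pos hb x
  have hb3 : b ^ 3 ≤ 1 := pow_le_one₀ hb.le hb1
  have hb2 : b ^ 2 ≤ 1 := pow_le_one₀ hb.le hb1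
  have hb3' : 0 < b ^ 3 := by positivity
  have hs' := abs_le.mp hs
  have hE : |x| ^ 2 ≤ 8192 * Real.exp (|x| / 64) := by
    have h := Real.pow_div_factorial_le_exp (|x| / 64) (by positivity) 2
    norm_num [Nat.factorial] at h
    have e : (|x| / 64) ^ 2 / 2 = |x| ^ 2 / 8192 := by ring
    have h' : |x| ^ 2 / 8192 ≤ Real.exp (|x| / 64) := by
      rw [← e]; simpa using h
    linarith
  have hE1 : 1 ≤ Real.exp (|x| / 64) := Real.one_le_exp (by positivity)
  rcases le_total 1 (envBase b x) with h | h
  · have h1 : envBase b x ≤ 2 + |x| := by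
      rw [envBase]
      have h2 : |1 + b ^ 3 * x| ≤ 1 + |x| := by
        refine (abs_add_le _ _).trans ?_
        rw [abs_one, abs_mul, abs_of_pos hb3']
        have : b ^ 3 * |x| ≤ 1 * |x| := by gcongr
        linarith
      linarith
    calc envBase b x ^ s ≤ envBase b x ^ (2 : ℝ) := Real.rpow_le_rpow_of_exponent_le h hs'.2
      _ = envBase b x ^ 2 := by norm_cast
      _ ≤ (2 + |x|) ^ 2 := by gcongr
      _ ≤ 8 + 2 * |x| ^ 2 := by nlinarith [sq_nonneg (2 - |x|)]
      _ ≤ _ := by linarith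
  · have h1 : envBase b x ^ s ≤ envBase b x ^ (-2 : ℝ) :=
      Real.rpow_le_rpow_of_exponent_ge hN h hs'.1
    have h2 : envBase b x ^ (-2 : ℝ) = (envBase b x ^ 2)⁻¹ := by
      rw [Real.rpow_neg hN.le]; norm_cast
    rw [h2] at h1
    refine h1.trans ?_
    rcases le_total (b ^ 3 * |x|) (1 / 2) with h3 | h3
    · have h4 : 1 / 2 ≤ envBase b x := by
        rw [envBase]
        have h5 : 1 + b ^ 3 * x ≤ |1 + b ^ 3 * x| := le_abs_self _
        have h6 : -(b ^ 3 * |x|) ≤ b ^ 3 * x := by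
          have := mul_le_mul_of_nonneg_left (neg_abs_le x) hb3'.le
          linarith
        have : 0 < b ^ 2 := by positivity
        linarith
      calc (envBase b x ^ 2)⁻¹ ≤ ((1 / 2 : ℝ) ^ 2)⁻¹ := by gcongr
        _ = 4 := by norm_num
        _ ≤ _ := by linarith
    · have h4 : b ^ 2 ≤ envBase b x := by
        rw [envBase]; linarith [abs_nonneg (1 + b ^ 3 * x)]
      have h5 : (b ^ 3)⁻¹ ≤ 2 * |x| := by
        rw [inv_le_iff_one_le_mul₀ hb3']; linarith
      calc (envBase b x ^ 2)⁻¹ ≤ ((b ^ 2) ^ 2)⁻¹ := by gcongr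
        _ ≤ ((b ^ 3) ^ 2)⁻¹ := by
          rw [← pow_mul, ← pow_mul]
          gcongr ?_⁻¹
          exact pow_le_pow_of_le_one hb.le hb1 (by norm_num)
        _ = ((b ^ 3)⁻¹) ^ 2 := by rw [inv_pow]
        _ ≤ (2 * |x|) ^ 2 := by gcongr
        _ = 4 * |x| ^ 2 := by ring
        _ ≤ _ := by linarith

/-- An exponential in `-1/a` beats any power of `b`; it is kept in the form of a spare factor `a`.
-/
theorem inv_mul_exp_le {b : ℝ} (hb : 0 < b) (hb1 : b ≤ 1) :
    b⁻¹ * Real.exp (-((b ^ 3)⁻¹ / 12)) ≤ 288 * b ^ 3 := by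
  have h := pow_mul_exp_neg_le 2 (y := (b ^ 3)⁻¹ / 12) (by positivity)
  norm_num [Nat.factorial] at h
  have e1 : ((b ^ 3)⁻¹ / 12) ^ 2 = (b ^ 6)⁻¹ / 144 := by field_simp; norm_num
  rw [e1] at h
  have e2 : b⁻¹ ≤ b ^ 3 * (b ^ 6)⁻¹ := by
    have : b ^ 3 * (b ^ 6)⁻¹ = b⁻¹ * (b ^ 2)⁻¹ := by field_simp
    rw [this]
    exact le_mul_of_one_le_right (by positivity) ((one_le_inv₀ (by positivity)).mpr
      (pow_le_one₀ hb.le hb1))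
  calc b⁻¹ * Real.exp (-((b ^ 3)⁻¹ / 12))
      ≤ b ^ 3 * (b ^ 6)⁻¹ * Real.exp (-((b ^ 3)⁻¹ / 12)) := by gcongr
    _ = 144 * b ^ 3 * ((b ^ 6)⁻¹ / 144 * Real.exp (-((b ^ 3)⁻¹ / 12))) := by ring
    _ ≤ 144 * b ^ 3 * 2 := by gcongr
    _ = _ := by ring

theorem weight_le_one {b γ : ℝ} (hb : 0 < b) (hγ : γ ∈ gammaRange) (x : ℝ) :
    weight (b ^ 3) γ x ≤ 1 := by
  have hb3 : 0 < b ^ 3 := by positivity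
  rcases le_total (1 + b ^ 3 * x) 0 with hx | hx
  · rw [weight_of_far hb γ hx]
    have h1 : Real.exp (-(1 / 3 * (b ^ 3)⁻¹)) ≤ 1 :=
      Real.exp_le_one_iff.mpr (by have : 0 < (b ^ 3)⁻¹ := by positivity
                                  linarith)
    have h2 : (1 + |xi b x|) ^ (-(3 / 8) : ℝ) ≤ 1 :=
      Real.rpow_le_one_of_one_le_of_nonpos (by linarith [abs_nonneg (xi b x)]) (by norm_num)
    exact mul_le_one₀ h1 (by positivity) h2
  · rcases le_total x 0 with h0 | h0
    · rw [weight_of_near hb γ hx h0, Real.exp_le_one_iff]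
      linarith [phase_le hb hx h0]
    · rw [weight_of_nonneg hb γ h0]
      exact Real.rpow_le_one_of_one_le_of_nonpos (by nlinarith) (by linarith [hγ.1])

theorem weight_pos {b γ : ℝ} (hb : 0 < b) (x : ℝ) : 0 < weight (b ^ 3) γ x := by
  have hb3 : 0 < b ^ 3 := by positivity
  rcases le_total (1 + b ^ 3 * x) 0 with hx | hx
  · rw [weight_of_far hb γ hx]; positivity
  · rcases le_total x 0 with h0 | h0
    · rw [weight_of_near hb γ hx h0]; positivity
    · rw [weight_of_nonneg hb γ h0]
      have : 0 < 1 + b ^ 3 * x := by positivity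
      positivity

theorem rpow_sixteenth_le {u v : ℝ} (hu : 0 ≤ u) (huv : u ≤ v) :
    (1 + u) ^ (1 / 16 : ℝ) ≤ Real.exp (v / 16) := by
  calc (1 + u) ^ (1 / 16 : ℝ) ≤ (Real.exp v) ^ (1 / 16 : ℝ) := by
        gcongr
        linarith [Real.add_one_le_exp v]
    _ = Real.exp (v / 16) := by rw [← Real.exp_mul]; ring_nf

theorem le_neg_of_far {b y : ℝ} (hb : 0 < b) (hy : 1 + b ^ 3 * y ≤ 0) : (b ^ 3)⁻¹ ≤ -y := by
  have hb3 : 0 < b ^ 3 := by positivity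
  rw [inv_le_iff_one_le_mul₀ hb3]; linarith

theorem neg_le_of_near {b y : ℝ} (hb : 0 < b) (hy : 0 ≤ 1 + b ^ 3 * y) : -y ≤ (b ^ 3)⁻¹ := by
  have hb3 : 0 < b ^ 3 := by positivity
  rw [← one_div, le_div_iff₀ hb3]; linarith

theorem far_decay {b y : ℝ} (hb : 0 < b) (hb1 : b ≤ 1) (hy : 1 + b ^ 3 * y ≤ 0) :
    Real.exp (1 / 3 * (b ^ 3)⁻¹) * b⁻¹ * (1 + |xi b y|) ^ (1 / 16 : ℝ) * Real.exp (-|y|)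
      ≤ 288 * (b ^ 3 * Real.exp (-|y| / 16)) := by
  have ht := le_neg_of_far hb hy
  have hb3 : 0 < (b ^ 3)⁻¹ := by positivity
  have hy0 : y < 0 := by linarith
  have h1 : |xi b y| ≤ |y| := by
    rw [xi, abs_mul, abs_of_pos hb, abs_of_nonpos hy0.le, abs_of_nonpos (by linarith)]
    nlinarith
  have h2 := rpow_sixteenth_le (abs_nonneg (xi b y)) h1
  have h3 := inv_mul_exp_le hb hb1
  rw [abs_of_neg hy0] at *
  calc _ ≤ Real.exp (1 / 3 * (b ^ 3)⁻¹) * b⁻¹ * Real.exp (-y / 16) * Real.exp (- -y) := by gcongr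
    _ = b⁻¹ * Real.exp (1 / 3 * (b ^ 3)⁻¹ + -y / 16 - -y) := by
        rw [sub_eq_add_neg, Real.exp_add, Real.exp_add]; ring
    _ ≤ b⁻¹ * Real.exp (-((b ^ 3)⁻¹ / 12) + - -y / 16) := by gcongr; linarith
    _ = (b⁻¹ * Real.exp (-((b ^ 3)⁻¹ / 12))) * Real.exp (- -y / 16) := by
        rw [Real.exp_add]; ring
    _ ≤ (288 * b ^ 3) * Real.exp (- -y / 16) := by gcongr
    _ = _ := by ring

/-- The fourth power turns the exponent `-3/8` of the weight into `-3/2`, which after the loss of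
`1/16` still leaves more than `11/8 > 1`, hence integrability at `-∞`. The exponential factor
`e^{-4/(3a)}` outweighs `e^{1/(3a)}`. -/
theorem far_weight_decay {b y γ : ℝ} (hb : 0 < b) (hb1 : b ≤ 1) (hy : 1 + b ^ 3 * y ≤ 0) :
    Real.exp (1 / 3 * (b ^ 3)⁻¹) * b⁻¹ * (1 + |xi b y|) ^ (1 / 16 : ℝ) * weight (b ^ 3) γ y ^ 4
      ≤ 1152 * (b ^ 3 * (1 + b ^ 3 * |y|) ^ (-(11 / 8) : ℝ)) := by
  have ht := le_neg_of_far hb hy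
  have hb3' : 0 < b ^ 3 := by positivity
  have hb3 : 0 < (b ^ 3)⁻¹ := by positivity
  have hy0 : y < 0 := by linarith
  have h3 := inv_mul_exp_le hb hb1
  set u := 1 + |xi b y|
  have hu : 1 ≤ u := by simp only [u]; linarith [abs_nonneg (xi b y)]
  have hu2 : (1 + b ^ 3 * |y|) / 2 ≤ u := by
    have : b ^ 3 * |y| - 1 ≤ |xi b y| := by
      rw [xi_eq hb, abs_div, abs_of_pos (by positivity : 0 < b ^ 2), abs_of_nonpos hy,
        abs_of_neg hy0, le_div_iff₀ (by positivity)]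
      have : b ^ 2 ≤ 1 := pow_le_one₀ hb.le hb1
      nlinarith
    simp only [u]
    linarith
  have e1 : weight (b ^ 3) γ y ^ 4 = Real.exp (-(4 / 3 * (b ^ 3)⁻¹)) * u ^ (-(3 / 2) : ℝ) := by
    rw [weight_of_far hb γ hy, mul_pow, ← Real.exp_nat_mul,
      ← Real.rpow_natCast ((1 + |xi b y|) ^ (-(3 / 8) : ℝ)) 4, ← Real.rpow_mul (by linarith)]
    congr 2
    · push_cast; ring
    · norm_num
  have e2 : u ^ (1 / 16 : ℝ) * u ^ (-(3 / 2) : ℝ) ≤ u ^ (-(11 / 8) : ℝ) := by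
    rw [← Real.rpow_add (by linarith)]
    exact Real.rpow_le_rpow_of_exponent_le hu (by norm_num)
  have e3 : u ^ (-(11 / 8) : ℝ) ≤ 4 * (1 + b ^ 3 * |y|) ^ (-(11 / 8) : ℝ) := by
    have h4 : u ^ (-(11 / 8) : ℝ) ≤ ((1 + b ^ 3 * |y|) / 2) ^ (-(11 / 8) : ℝ) :=
      Real.rpow_le_rpow_of_nonpos (by positivity) hu2 (by norm_num)
    rw [Real.div_rpow (by positivity) (by norm_num)] at h4
    have h5 : (2 : ℝ) ^ (-2 : ℝ) ≤ 2 ^ (-(11 / 8) : ℝ) :=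
      Real.rpow_le_rpow_of_exponent_le (by norm_num) (by norm_num)
    have h6 : (2 : ℝ) ^ (-2 : ℝ) = 1 / 4 := by
      rw [Real.rpow_neg (by norm_num)]; norm_num
    rw [h6] at h5
    refine h4.trans ?_
    rw [div_le_iff₀ (by positivity)]
    have h7 : 0 ≤ (1 + b ^ 3 * |y|) ^ (-(11 / 8) : ℝ) := by positivity
    nlinarith
  rw [e1]
  calc _ = b⁻¹ * (Real.exp (1 / 3 * (b ^ 3)⁻¹) * Real.exp (-(4 / 3 * (b ^ 3)⁻¹)))
          * (u ^ (1 / 16 : ℝ) * u ^ (-(3 / 2) : ℝ)) := by ring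
    _ ≤ b⁻¹ * Real.exp (-((b ^ 3)⁻¹ / 12)) * (4 * (1 + b ^ 3 * |y|) ^ (-(11 / 8) : ℝ)) := by
        rw [← Real.exp_add]
        refine mul_le_mul ?_ (e2.trans e3) (by positivity) (by positivity)
        gcongr
        linarith
    _ ≤ 288 * b ^ 3 * (4 * (1 + b ^ 3 * |y|) ^ (-(11 / 8) : ℝ)) := by gcongr
    _ = _ := by ring

theorem near_far_decay {b y : ℝ} (hb : 0 < b) (hb1 : b ≤ 1) (hy : 0 ≤ 1 + b ^ 3 * y) :
    b⁻¹ * (1 + xi b y) ^ (1 / 16 : ℝ) * Real.exp (-(1 / 3 * (b ^ 3)⁻¹) - phase b y)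
      * Real.exp (min y 0) ≤ 288 * (b ^ 3 * Real.exp (-|y| / 16)) := by
  have hb3 : 0 < (b ^ 3)⁻¹ := by positivity
  have h3 := inv_mul_exp_le hb hb1
  have hp := le_phase hb hy
  have hn := neg_le_of_near hb hy
  have h1 : xi b y ≤ max y 0 + (b ^ 3)⁻¹ := by
    rw [xi]
    have h0 : 0 ≤ y + (b ^ 3)⁻¹ := by linarith
    calc b * (y + (b ^ 3)⁻¹) ≤ 1 * (y + (b ^ 3)⁻¹) := by gcongr
      _ ≤ _ := by linarith [le_max_left y 0]
  have h2 := rpow_sixteenth_le (xi_nonneg hb hy) h1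
  calc _ ≤ b⁻¹ * Real.exp ((max y 0 + (b ^ 3)⁻¹) / 16)
          * Real.exp (-(1 / 3 * (b ^ 3)⁻¹) - phase b y) * Real.exp (min y 0) := by gcongr
    _ = b⁻¹ * Real.exp ((max y 0 + (b ^ 3)⁻¹) / 16
          + (-(1 / 3 * (b ^ 3)⁻¹) - phase b y) + min y 0) := by
        rw [Real.exp_add, Real.exp_add]; ring
    _ ≤ b⁻¹ * Real.exp (-((b ^ 3)⁻¹ / 12) + -|y| / 16) := by
        refine mul_le_mul_of_nonneg_left (Real.exp_le_exp.mpr ?_) (by positivity)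
        rcases le_total y 0 with h | h
        · rw [max_eq_right h, min_eq_left h, abs_of_nonpos h]; linarith
        · rw [max_eq_left h, min_eq_right h, abs_of_nonneg h]; linarith
    _ = (b⁻¹ * Real.exp (-((b ^ 3)⁻¹ / 12))) * Real.exp (-|y| / 16) := by
        rw [Real.exp_add]; ring
    _ ≤ (288 * b ^ 3) * Real.exp (-|y| / 16) := by gcongr
    _ = _ := by ring

theorem mul_mul_exp_le {U V u v E F : ℝ} (hU : U ≤ 10 ^ 5 * Real.exp u)
    (hV : V ≤ 10 ^ 5 * Real.exp v) (hV0 : 0 ≤ V) (h : u + v + E ≤ F) :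
    U * V * Real.exp E ≤ 10 ^ 10 * Real.exp F := by
  calc U * V * Real.exp E ≤ (10 ^ 5 * Real.exp u) * (10 ^ 5 * Real.exp v) * Real.exp E := by
        gcongr
    _ = 10 ^ 10 * Real.exp (u + v + E) := by rw [Real.exp_add, Real.exp_add]; ring
    _ ≤ _ := by gcongr

theorem abs_exponents {γ : ℝ} (hγ : γ ∈ gammaRange) :
    |(-γ / 2 - 1 / 4)| ≤ 2 ∧ |γ / 2 - 1 / 4| ≤ 2 ∧ |γ - 1| ≤ 2 ∧ |(-1 - γ)| ≤ 2 ∧ |1 + γ| ≤ 2 := by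
  have h1 := hγ.1
  have h2 := hγ.2
  refine ⟨?_, ?_, ?_, ?_, ?_⟩ <;> (rw [abs_le]; constructor <;> linarith)

/-! ### Kernel estimates against localized and weighted densities. -/

/-- Decay of the kernel for `x ≤ 0` and `y ≥ -1/a`. -/
theorem kernel_decay_neg : ∃ C : ℝ, 0 < C ∧ ∀ γ ∈ gammaRange, ∀ b : ℝ, 0 < b → b ≤ 1 →
    ∀ x y : ℝ, x ≤ 0 → 0 ≤ 1 + b ^ 3 * y →
    (x < y → |kernel (b ^ 3) γ x y| * Real.exp (min y 0)
      ≤ C * (weight (b ^ 3) γ x * ((Real.exp (-|x| / 16) + b ^ 3) * Real.exp (-|y| / 16)))) ∧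
    (y ≤ x → |kernel (b ^ 3) γ x y| * Real.exp (min y 0)
      ≤ C * (weight (b ^ 3) γ x * ((Real.exp (-|x| / 16) + b ^ 3) * Real.exp (-|y| / 16)))) := by
  obtain ⟨C, hC, hz⟩ := kernel_zone_bounds
  refine ⟨C * 10 ^ 10, by positivity, fun γ hγ b hb hb1 x y hx0 hy => ?_⟩
  obtain ⟨z1, z2, z3, -⟩ := hz γ hγ b hb hb1 x y
  obtain ⟨s1, s2, s3, s4, s5⟩ := abs_exponents hγ
  have hb3 : 0 < b ^ 3 := by positivity
  have hw := weight_pos (γ := γ) hb x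
  have hpy := le_phase hb hy
  refine ⟨fun hxy => ?_, fun hyx => ?_⟩
  · rcases le_total (1 + b ^ 3 * x) 0 with hx | hx
    · have h1 := near_far_decay hb hb1 hy
      calc _ ≤ C * (weight (b ^ 3) γ x * (b⁻¹ * (1 + xi b y) ^ (1 / 16 : ℝ)
            * Real.exp (-(1 / 3 * (b ^ 3)⁻¹) - phase b y))) * Real.exp (min y 0) := by
            gcongr; exact z3 hx hy hxy
        _ = C * (weight (b ^ 3) γ x * (b⁻¹ * (1 + xi b y) ^ (1 / 16 : ℝ)
            * Real.exp (-(1 / 3 * (b ^ 3)⁻¹) - phase b y) * Real.exp (min y 0))) := by ring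
        _ ≤ C * (weight (b ^ 3) γ x * (288 * (b ^ 3 * Real.exp (-|y| / 16)))) := by gcongr
        _ = C * 288 * (weight (b ^ 3) γ x * ((0 + b ^ 3) * Real.exp (-|y| / 16))) := by ring
        _ ≤ _ := by gcongr <;> first | positivity | norm_num
    -- Half of `phase b x ≤ 2x/3` is the logarithm of the weight; the other half gives decay in `x`.
    -- For `x < y ≤ 0` it also gives decay in `y`, since then `|y| ≤ |x|`; for `y ≥ 0` that comes
    -- from the phase at `y`.
    · have h1 := mul_mul_exp_le (envBase_rpow_le hb hb1 y s1) (envBase_rpow_le hb hb1 x s2)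
        (by have := envBase_pos hb x; positivity)
        (E := phase b x - phase b y + min y 0) (F := phase b x / 2 + (-|x| / 16 + -|y| / 16)) (by
          have hpx := phase_le hb hx hx0
          rw [abs_of_nonpos hx0]
          rcases le_total y 0 with h | h
          · rw [min_eq_left h, abs_of_nonpos h]; linarith
          · rw [min_eq_right h, abs_of_nonneg h]; linarith)
      rw [weight_of_near hb γ hx hx0]
      calc _ ≤ C * (envBase b y ^ (-γ / 2 - 1 / 4) * envBase b x ^ (γ / 2 - 1 / 4)
            * Real.exp (phase b x - phase b y)) * Real.exp (min y 0) := by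
            gcongr; exact z1 hx hy hxy
        _ = C * (envBase b y ^ (-γ / 2 - 1 / 4) * envBase b x ^ (γ / 2 - 1 / 4)
            * Real.exp (phase b x - phase b y + min y 0)) := by
            rw [Real.exp_add]; ring
        _ ≤ C * (10 ^ 10 * Real.exp (phase b x / 2 + (-|x| / 16 + -|y| / 16))) := by gcongr
        _ = C * 10 ^ 10 * (Real.exp (phase b x / 2) * ((Real.exp (-|x| / 16) + 0)
            * Real.exp (-|y| / 16))) := by
            rw [Real.exp_add, Real.exp_add]; ring
        _ ≤ _ := by gcongr
  · have hx : 0 ≤ 1 + b ^ 3 * x := by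
      have : b ^ 3 * y ≤ b ^ 3 * x := by gcongr
      linarith
    have hy0 : y ≤ 0 := hyx.trans hx0
    have hpx := le_phase hb hx
    have hpy' := phase_le hb hy hy0
    have Nx := envBase_pos hb x
    rw [weight_of_near hb γ hx hx0, min_eq_left hy0, abs_of_nonpos hx0, abs_of_nonpos hy0]
    have b1 := envBase_rpow_le hb hb1 y s1
    have b2 := envBase_rpow_le hb hb1 x s2
    have b3 := envBase_rpow_le hb hb1 y s3
    have b4 := envBase_rpow_le hb hb1 x s4
    rw [abs_of_nonpos hx0] at b2 b4
    rw [abs_of_nonpos hy0] at b1 b3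
    have h1 := mul_mul_exp_le b1 b2 (by positivity)
        (E := phase b y - phase b x + y) (F := phase b x / 2 + (- -x / 16 + - -y / 16))
        (by linarith)
    have h2 := mul_mul_exp_le b3 b4 (by positivity)
        (E := y) (F := phase b x / 2 + - -y / 16) (by linarith)
    calc _ ≤ C * (envBase b y ^ (-γ / 2 - 1 / 4) * envBase b x ^ (γ / 2 - 1 / 4)
        * Real.exp (phase b y - phase b x)
        + b ^ 3 * (envBase b y ^ (γ - 1) * envBase b x ^ (-1 - γ))) * Real.exp y := by
            gcongr; exact z2 hx hy hyx
      _ = C * (envBase b y ^ (-γ / 2 - 1 / 4) * envBase b x ^ (γ / 2 - 1 / 4)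
            * Real.exp (phase b y - phase b x + y)
            + b ^ 3 * (envBase b y ^ (γ - 1) * envBase b x ^ (-1 - γ) * Real.exp y)) := by
            rw [Real.exp_add]; ring
      _ ≤ C * (10 ^ 10 * Real.exp (phase b x / 2 + (- -x / 16 + - -y / 16))
            + b ^ 3 * (10 ^ 10 * Real.exp (phase b x / 2 + - -y / 16))) := by gcongr
      _ = _ := by
            rw [Real.exp_add, Real.exp_add, Real.exp_add]; ring

/-- Decay of the kernel for `x ≥ 0` and `y ≥ -1/a`. -/
theorem kernel_decay_pos : ∃ C : ℝ, 0 < C ∧ ∀ γ ∈ gammaRange, ∀ b : ℝ, 0 < b → b ≤ 1 →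
    ∀ x y : ℝ, 0 ≤ x → 0 ≤ 1 + b ^ 3 * y →
    |kernel (b ^ 3) γ x y| * Real.exp (-|y|)
      ≤ C * (weight (b ^ 3) γ x * ((Real.exp (-|x| / 16) + b ^ 3) * Real.exp (-|y| / 16))) := by
  obtain ⟨C, hC, hz⟩ := kernel_zone_bounds
  refine ⟨C * 10 ^ 15, by positivity, fun γ hγ b hb hb1 x y hx0 hy => ?_⟩
  obtain ⟨z1, z2, -, -⟩ := hz γ hγ b hb hb1 x y
  obtain ⟨s1, s2, s3, s4, s5⟩ := abs_exponents hγ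
  have hb3 : 0 < b ^ 3 := by positivity
  have hx : 0 ≤ 1 + b ^ 3 * x := by positivity
  have hr0 : 0 < 1 + b ^ 3 * x := by positivity
  have Nx := envBase_pos hb x
  have Ny := envBase_pos hb y
  have b1 := envBase_rpow_le hb hb1 y s1
  have b2 := envBase_rpow_le hb hb1 x s2
  have b3 := envBase_rpow_le hb hb1 y s3
  have b5 := envBase_rpow_le hb hb1 x s5
  have hrN : 1 + b ^ 3 * x ≤ envBase b x := by
    rw [envBase, abs_of_nonneg hx]
    have : 0 ≤ b ^ 2 := by positivity
    linarith
  -- For `x ≥ 0` the weight is only algebraically small, so it can be inserted at the cost of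
  -- `e^{|x|/64}`.
  have hwr : 1 ≤ weight (b ^ 3) γ x * (10 ^ 5 * Real.exp (|x| / 64)) := by
    rw [weight_of_nonneg hb γ hx0]
    calc (1 : ℝ) = (1 + b ^ 3 * x) ^ (-1 - γ) * (1 + b ^ 3 * x) ^ (1 + γ) := by
          rw [← Real.rpow_add hr0]; simp
      _ ≤ (1 + b ^ 3 * x) ^ (-1 - γ) * envBase b x ^ (1 + γ) := by
          gcongr; linarith [hγ.1]
      _ ≤ _ := by gcongr
  have hw := weight_pos (γ := γ) hb x
  set w := weight (b ^ 3) γ x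
  have main : ∀ E : ℝ, E - |y| + (|x| + |y|) / 64 + |x| / 64 ≤ -|x| / 16 + -|y| / 16 →
      envBase b y ^ (-γ / 2 - 1 / 4) * envBase b x ^ (γ / 2 - 1 / 4) * Real.exp E
        * Real.exp (-|y|) ≤ 10 ^ 15 * (w * (Real.exp (-|x| / 16) * Real.exp (-|y| / 16))) := by
    intro E hE
    have h1 := mul_mul_exp_le b1 b2 (by positivity) (E := E - |y|)
      (F := -|x| / 16 + -|y| / 16 - |x| / 64) (by linarith)
    calc _ = envBase b y ^ (-γ / 2 - 1 / 4) * envBase b x ^ (γ / 2 - 1 / 4)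
          * Real.exp (E - |y|) * 1 := by
            have : Real.exp (E - |y|) = Real.exp E * Real.exp (-|y|) := by
              rw [← Real.exp_add, sub_eq_add_neg]
            rw [this]; ring
      _ ≤ 10 ^ 10 * Real.exp (-|x| / 16 + -|y| / 16 - |x| / 64)
          * (w * (10 ^ 5 * Real.exp (|x| / 64))) := by gcongr
      _ = 10 ^ 15 * (w * (Real.exp (-|x| / 16 + -|y| / 16 - |x| / 64) * Real.exp (|x| / 64))) := by
          ring
      _ = _ := by rw [← Real.exp_add, ← Real.exp_add]; ring_nf
  rcases lt_or_ge x y with hxy | hyx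
  · have hd := sub_le_phase_sub hb hx0 hxy.le
    have := main (phase b x - phase b y) (by
      rw [abs_of_nonneg hx0, abs_of_nonneg (by linarith : 0 ≤ y)]; linarith)
    calc _ ≤ C * (envBase b y ^ (-γ / 2 - 1 / 4) * envBase b x ^ (γ / 2 - 1 / 4)
        * Real.exp (phase b x - phase b y)) * Real.exp (-|y|) := by
            gcongr; exact z1 hx hy hxy
      _ = C * (envBase b y ^ (-γ / 2 - 1 / 4) * envBase b x ^ (γ / 2 - 1 / 4)
        * Real.exp (phase b x - phase b y) * Real.exp (-|y|)) := by ring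
      _ ≤ C * (10 ^ 15 * (w * ((Real.exp (-|x| / 16) + 0) * Real.exp (-|y| / 16)))) := by
          rw [add_zero]; gcongr
      _ = C * 10 ^ 15 * (w * ((Real.exp (-|x| / 16) + 0) * Real.exp (-|y| / 16))) := by ring
      _ ≤ _ := by gcongr
  · have hm := main (phase b y - phase b x) (by
      rcases le_total y 0 with h | h
      · have p1 := le_phase hb hx
        have p2 := phase_le hb hy h
        rw [abs_of_nonneg hx0, abs_of_nonpos h]; linarith
      · have hd := sub_le_phase_sub hb h hyx
        rw [abs_of_nonneg hx0, abs_of_nonneg h]; linarith)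
    have hV : envBase b x ^ (-1 - γ) ≤ w := by
      have : w = (1 + b ^ 3 * x) ^ (-1 - γ) := weight_of_nonneg hb γ hx0
      rw [this]
      exact Real.rpow_le_rpow_of_nonpos hr0 hrN (by linarith [hγ.1])
    have h3 : envBase b y ^ (γ - 1) * Real.exp (-|y|) ≤ 10 ^ 15 * Real.exp (-|y| / 16) := by
      calc _ ≤ 10 ^ 5 * Real.exp (|y| / 64) * Real.exp (-|y|) := by gcongr
        _ = 10 ^ 5 * Real.exp (|y| / 64 + -|y|) := by rw [Real.exp_add]; ring
        _ ≤ 10 ^ 15 * Real.exp (-|y| / 16) := by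
            gcongr
            · norm_num
            · norm_num
            · linarith [abs_nonneg y]
    calc _ ≤ C * (envBase b y ^ (-γ / 2 - 1 / 4) * envBase b x ^ (γ / 2 - 1 / 4)
        * Real.exp (phase b y - phase b x)
        + b ^ 3 * (envBase b y ^ (γ - 1) * envBase b x ^ (-1 - γ))) * Real.exp (-|y|) := by
            gcongr; exact z2 hx hy hyx
      _ = C * (envBase b y ^ (-γ / 2 - 1 / 4) * envBase b x ^ (γ / 2 - 1 / 4)
            * Real.exp (phase b y - phase b x) * Real.exp (-|y|)
            + b ^ 3 * (envBase b x ^ (-1 - γ) * (envBase b y ^ (γ - 1) * Real.exp (-|y|)))) := by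
            ring
      _ ≤ C * (10 ^ 15 * (w * (Real.exp (-|x| / 16) * Real.exp (-|y| / 16)))
            + b ^ 3 * (w * (10 ^ 15 * Real.exp (-|y| / 16)))) := by gcongr
      _ = _ := by ring

theorem weight_zero_of_neg {γ x : ℝ} (hx : x ≤ 0) : weight 0 γ x = Real.exp (x / 2) := by
  rcases hx.eq_or_lt with rfl | h
  · simp [weight]
  · rw [weight, if_pos rfl, if_pos h, abs_of_neg h, neg_neg]

theorem weight_zero_of_nonneg {γ x : ℝ} (hx : 0 ≤ x) : weight 0 γ x = 1 := by
  rw [weight, if_pos rfl, if_neg (not_lt.mpr hx)]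

theorem kernel_zero (γ x y : ℝ) : kernel 0 γ x y = 1 / 2 * Real.exp (-|x - y|) := by
  rw [kernel, if_pos rfl]

theorem exists_cube_eq {a : ℝ} (ha : 0 < a) (ha1 : a ≤ 1) : ∃ b : ℝ, 0 < b ∧ b ≤ 1 ∧ b ^ 3 = a := by
  refine ⟨a ^ (1 / 3 : ℝ), by positivity, Real.rpow_le_one ha.le ha1 (by norm_num), ?_⟩
  rw [← Real.rpow_natCast, ← Real.rpow_mul ha.le]
  norm_num

theorem weight_pos' {a γ : ℝ} (ha : 0 ≤ a) (ha1 : a ≤ 1) (x : ℝ) : 0 < weight a γ x := by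
  rcases ha.eq_or_lt with rfl | h
  · rcases le_total x 0 with hx | hx
    · rw [weight_zero_of_neg hx]; positivity
    · rw [weight_zero_of_nonneg hx]; norm_num
  · obtain ⟨b, hb, -, rfl⟩ := exists_cube_eq h ha1
    exact weight_pos hb x

theorem weight_le_one' {a γ : ℝ} (hγ : γ ∈ gammaRange) (ha : 0 ≤ a) (ha1 : a ≤ 1) (x : ℝ) :
    weight a γ x ≤ 1 := by
  rcases ha.eq_or_lt with rfl | h
  · rcases le_total x 0 with hx | hx
    · rw [weight_zero_of_neg hx, Real.exp_le_one_iff]; linarith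
    · rw [weight_zero_of_nonneg hx]
  · obtain ⟨b, hb, -, rfl⟩ := exists_cube_eq h ha1
    exact weight_le_one hb hγ x

/-- Against exponentially localized densities the weighted kernel decays in `x` up to an error of
order `a`. This makes the operator norm of the tail `|x| > M` small as `a → 0`. -/
theorem abs_kernel_mul_exp_le : ∃ C : ℝ, 0 < C ∧ ∀ γ ∈ gammaRange, ∀ a : ℝ, 0 ≤ a → a ≤ 1 →
    ∀ x y : ℝ, |kernel a γ x y| * Real.exp (-|y|)
      ≤ C * (weight a γ x * ((Real.exp (-|x| / 16) + a) * Real.exp (-|y| / 16))) := by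
  obtain ⟨C1, hC1, h1⟩ := kernel_zone_bounds
  obtain ⟨C2, hC2, h2⟩ := kernel_decay_neg
  obtain ⟨C3, hC3, h3⟩ := kernel_decay_pos
  refine ⟨max (max 1 (C1 * 288)) (max C2 C3), by positivity, fun γ hγ a ha ha1 x y => ?_⟩
  have hw := weight_pos' (γ := γ) ha ha1 x
  set R := weight a γ x * ((Real.exp (-|x| / 16) + a) * Real.exp (-|y| / 16)) with hR
  have hR0 : 0 ≤ R := by positivity
  rcases ha.eq_or_lt with rfl | h
  · have : |kernel 0 γ x y| * Real.exp (-|y|) ≤ 1 * R := by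
      have t1 : |x| ≤ |x - y| + |y| := by
        calc |x| = |(x - y) + y| := by ring_nf
          _ ≤ _ := abs_add_le _ _
      rw [kernel_zero, abs_of_pos (by positivity), mul_assoc, ← Real.exp_add, hR, add_zero,
        ← Real.exp_add, one_mul]
      have hx1 : Real.exp (-|x| / 2) ≤ weight 0 γ x := by
        rcases le_total x 0 with hx | hx
        · rw [weight_zero_of_neg hx, abs_of_nonpos hx, neg_neg]
        · rw [weight_zero_of_nonneg hx, Real.exp_le_one_iff]; linarith [abs_nonneg x]
      calc _ ≤ 1 * Real.exp (-|x| / 2 + (-|x| / 16 + -|y| / 16)) := by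
            refine mul_le_mul (by norm_num) (Real.exp_le_exp.mpr ?_) (by positivity) (by norm_num)
            linarith [abs_nonneg x, abs_nonneg (x - y), abs_nonneg y]
        _ = Real.exp (-|x| / 2) * Real.exp (-|x| / 16 + -|y| / 16) := by
            rw [one_mul, Real.exp_add]
        _ ≤ _ := by gcongr
    exact this.trans (by gcongr; exact (le_max_left _ _).trans (le_max_left _ _))
  · obtain ⟨b, hb, hb1, rfl⟩ := exists_cube_eq h ha1
    rcases le_total (1 + b ^ 3 * y) 0 with hy | hy
    · have h4 := (h1 γ hγ b hb hb1 x y).2.2.2 hy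
      have h5 := far_decay hb hb1 hy
      calc _ ≤ C1 * (weight (b ^ 3) γ x * (Real.exp (1 / 3 * (b ^ 3)⁻¹) * b⁻¹
            * (1 + |xi b y|) ^ (1 / 16 : ℝ))) * Real.exp (-|y|) := by gcongr
        _ = C1 * (weight (b ^ 3) γ x * (Real.exp (1 / 3 * (b ^ 3)⁻¹) * b⁻¹
            * (1 + |xi b y|) ^ (1 / 16 : ℝ) * Real.exp (-|y|))) := by ring
        _ ≤ C1 * (weight (b ^ 3) γ x * (288 * (b ^ 3 * Real.exp (-|y| / 16)))) := by gcongr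
        _ = C1 * 288 * (weight (b ^ 3) γ x * ((0 + b ^ 3) * Real.exp (-|y| / 16))) := by ring
        _ ≤ C1 * 288 * R := by rw [hR]; gcongr; positivity
        _ ≤ _ := by gcongr; exact (le_max_right _ _).trans (le_max_left _ _)
    · rcases le_total x 0 with hx | hx
      · have h4 := h2 γ hγ b hb hb1 x y hx hy
        have h5 : |kernel (b ^ 3) γ x y| * Real.exp (min y 0) ≤ C2 * R := by
          rcases lt_or_ge x y with hxy | hxy
          · exact h4.1 hxy
          · exact h4.2 hxy
        calc _ ≤ |kernel (b ^ 3) γ x y| * Real.exp (min y 0) := by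
              gcongr
              rcases le_total y 0 with h0 | h0
              · rw [min_eq_left h0, abs_of_nonpos h0, neg_neg]
              · rw [min_eq_right h0]; linarith [abs_nonneg y]
          _ ≤ C2 * R := h5
          _ ≤ _ := by gcongr; exact (le_max_left _ _).trans (le_max_right _ _)
      · calc _ ≤ C3 * R := h3 γ hγ b hb hb1 x y hx hy
          _ ≤ _ := by gcongr; exact (le_max_right _ _).trans (le_max_right _ _)

/-- The kernel against the fourth power of the weight, in the region where both arguments are
nonnegative. -/
theorem kernel_mul_weight_pos : ∃ C : ℝ, 0 < C ∧ ∀ γ ∈ gammaRange, ∀ b : ℝ, 0 < b → b ≤ 1 →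
    ∀ x y : ℝ, 0 ≤ x → 0 ≤ y → |kernel (b ^ 3) γ x y| * weight (b ^ 3) γ y ^ 4
      ≤ C * (weight (b ^ 3) γ x * (Real.exp (-|x - y| / 2)
        + b ^ 3 * (1 + b ^ 3 * |y|) ^ (-(11 / 8) : ℝ))) := by
  obtain ⟨C, hC, hz⟩ := kernel_zone_bounds
  refine ⟨4 * C, by positivity, fun γ hγ b hb hb1 x y hx0 hy0 => ?_⟩
  obtain ⟨z1, z2, -, -⟩ := hz γ hγ b hb hb1 x y
  have g1 := hγ.1
  have g2 := hγ.2
  have hb3 : 0 < b ^ 3 := by positivity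
  have hb3' : b ^ 3 ≤ 1 := pow_le_one₀ hb.le hb1
  have Nx : ∀ z : ℝ, 0 ≤ z → 1 + b ^ 3 * z ≤ envBase b z ∧ envBase b z ≤ 2 * (1 + b ^ 3 * z) := by
    intro z hz
    have h1 : 0 ≤ b ^ 3 * z := by positivity
    have h2 : b ^ 2 ≤ 1 := pow_le_one₀ hb.le hb1
    rw [envBase, abs_of_nonneg (by linarith)]
    constructor
    · have := sq_nonneg b; linarith
    · linarith
  obtain ⟨rN, Nr⟩ := Nx x hx0
  obtain ⟨sN, Ns⟩ := Nx y hy0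
  have ex := envBase_pos hb x
  have ey := envBase_pos hb y
  rw [weight_of_nonneg hb γ hx0, weight_of_nonneg hb γ hy0, abs_of_nonneg hy0]
  have er : (1 : ℝ) ≤ 1 + b ^ 3 * x := by nlinarith
  have es : (1 : ℝ) ≤ 1 + b ^ 3 * y := by nlinarith
  have hx1 : 0 ≤ 1 + b ^ 3 * x := by linarith
  have hy1 : 0 ≤ 1 + b ^ 3 * y := by linarith
  -- The ratio of the prefactors at `x` and `y` grows at most like `e^{x-y}`; its square root costs
  -- half of the exponential decay of the kernel.
  have hsr : 1 + b ^ 3 * x ≤ (1 + b ^ 3 * y) * Real.exp (x - y) ∨ x < y := by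
    rcases lt_or_ge x y with h | h
    · exact Or.inr h
    · left
      have := Real.add_one_le_exp (x - y)
      have : b ^ 3 * (x - y) ≤ 1 * (x - y) := by gcongr
      calc 1 + b ^ 3 * x = 1 + b ^ 3 * y + b ^ 3 * (x - y) := by ring
        _ ≤ (1 + b ^ 3 * y) * (x - y + 1) := by nlinarith
        _ ≤ _ := by gcongr
  set r := 1 + b ^ 3 * x with hr
  set s := 1 + b ^ 3 * y with hs
  have hr0 : 0 < r := by linarith
  have hs0 : 0 < s := by linarith
  have n1 : envBase b y ^ (-γ / 2 - 1 / 4) ≤ 2 * s ^ (-γ / 2 - 1 / 4) :=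
    rpow_le_two_mul hs0 (by linarith) Ns (by rw [abs_le]; constructor <;> linarith)
  have n2 : envBase b x ^ (γ / 2 - 1 / 4) ≤ 2 * r ^ (γ / 2 - 1 / 4) :=
    rpow_le_two_mul hr0 (by linarith) Nr (by rw [abs_le]; constructor <;> linarith)
  have e4 : (s ^ (-1 - γ)) ^ 4 = s ^ (4 * (-1 - γ)) := by
    rw [← Real.rpow_natCast, ← Real.rpow_mul hs0.le]; congr 1; push_cast; ring
  have main : ∀ E : ℝ, s ^ (-γ / 2 - 1 / 4 + 4 * (-1 - γ)) * r ^ (γ / 2 - 1 / 4) * Real.exp E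
      ≤ r ^ (-1 - γ) * Real.exp (-|x - y| / 2) →
      envBase b y ^ (-γ / 2 - 1 / 4) * envBase b x ^ (γ / 2 - 1 / 4) * Real.exp E
        * (s ^ (-1 - γ)) ^ 4 ≤ 4 * (r ^ (-1 - γ) * Real.exp (-|x - y| / 2)) := by
    intro E hE
    calc _ ≤ (2 * s ^ (-γ / 2 - 1 / 4)) * (2 * r ^ (γ / 2 - 1 / 4)) * Real.exp E
          * (s ^ (-1 - γ)) ^ 4 := by gcongr
      _ = 4 * (s ^ (-γ / 2 - 1 / 4 + 4 * (-1 - γ)) * r ^ (γ / 2 - 1 / 4) * Real.exp E) := by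
          rw [e4, Real.rpow_add hs0]; ring
      _ ≤ _ := by gcongr
  rcases lt_or_ge x y with hxy | hyx
  · have hrs : r ≤ s := by simp only [hr, hs]; gcongr
    have h1 := main (phase b x - phase b y) (by
      have h2 : s ^ (-γ / 2 - 1 / 4 + 4 * (-1 - γ)) ≤ r ^ (-γ / 2 - 1 / 4 + 4 * (-1 - γ)) :=
        Real.rpow_le_rpow_of_nonpos hr0 hrs (by linarith)
      calc _ ≤ r ^ (-γ / 2 - 1 / 4 + 4 * (-1 - γ)) * r ^ (γ / 2 - 1 / 4)
            * Real.exp (-|x - y| / 2) := by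
            gcongr
            have := sub_le_phase_sub hb hx0 hxy.le
            rw [abs_of_neg (by linarith)]; linarith
        _ = r ^ (-1 / 2 + 4 * (-1 - γ)) * Real.exp (-|x - y| / 2) := by
            rw [← Real.rpow_add hr0]; ring_nf
        _ ≤ _ := by
            gcongr
            linarith)
    calc _ ≤ C * (envBase b y ^ (-γ / 2 - 1 / 4) * envBase b x ^ (γ / 2 - 1 / 4)
        * Real.exp (phase b x - phase b y)) * (s ^ (-1 - γ)) ^ 4 := by
            gcongr; exact z1 hx1 hy1 hxy
      _ = C * (envBase b y ^ (-γ / 2 - 1 / 4) * envBase b x ^ (γ / 2 - 1 / 4)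
        * Real.exp (phase b x - phase b y) * (s ^ (-1 - γ)) ^ 4) := by ring
      _ ≤ C * (4 * (r ^ (-1 - γ) * (Real.exp (-|x - y| / 2) + 0))) := by
          rw [add_zero]; gcongr
      _ = 4 * C * (r ^ (-1 - γ) * (Real.exp (-|x - y| / 2) + 0)) := by ring
      _ ≤ _ := by gcongr; positivity
  · have hrs : r ≤ s * Real.exp (x - y) := hsr.resolve_right (not_lt.mpr hyx)
    have hd := sub_le_phase_sub hb hy0 hyx
    have h1 := main (phase b y - phase b x) (by
      have h2 : s ^ (-γ / 2 - 1 / 4 + 4 * (-1 - γ)) ≤ s ^ (-(1 / 2) : ℝ) :=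
        Real.rpow_le_rpow_of_exponent_le es (by linarith)
      have h3 : r ^ (γ / 2 - 1 / 4) ≤ r ^ (-1 - γ) * r ^ (1 / 2 : ℝ) := by
        rw [← Real.rpow_add hr0]
        exact Real.rpow_le_rpow_of_exponent_le er (by linarith)
      have h4 : r ^ (1 / 2 : ℝ) ≤ s ^ (1 / 2 : ℝ) * Real.exp ((x - y) / 2) := by
        calc r ^ (1 / 2 : ℝ) ≤ (s * Real.exp (x - y)) ^ (1 / 2 : ℝ) := by gcongr
          _ = _ := by
            rw [Real.mul_rpow hs0.le (by positivity), ← Real.exp_mul]; ring_nf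
      have h5 : s ^ (-(1 / 2) : ℝ) * s ^ (1 / 2 : ℝ) = 1 := by
        rw [← Real.rpow_add hs0]; norm_num
      rw [abs_of_nonneg (by linarith : 0 ≤ x - y)]
      calc _ ≤ s ^ (-(1 / 2) : ℝ) * (r ^ (-1 - γ) * (s ^ (1 / 2 : ℝ) * Real.exp ((x - y) / 2)))
            * Real.exp (-(x - y)) := by
            gcongr
            · exact h3.trans (by gcongr)
            · linarith
        _ = (s ^ (-(1 / 2) : ℝ) * s ^ (1 / 2 : ℝ)) * (r ^ (-1 - γ)
            * (Real.exp ((x - y) / 2) * Real.exp (-(x - y)))) := by ring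
        _ = r ^ (-1 - γ) * Real.exp (-(x - y) / 2) := by
            rw [h5, ← Real.exp_add]; ring_nf
        _ ≤ _ := le_rfl)
    have h6 : envBase b y ^ (γ - 1) ≤ s ^ (-(11 / 8) : ℝ) :=
      (Real.rpow_le_rpow_of_nonpos hs0 sN (by linarith)).trans
        (Real.rpow_le_rpow_of_exponent_le es (by linarith))
    have h7 : envBase b x ^ (-1 - γ) ≤ r ^ (-1 - γ) :=
      Real.rpow_le_rpow_of_nonpos hr0 rN (by linarith)
    have h8 : (s ^ (-1 - γ)) ^ 4 ≤ 1 :=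
      pow_le_one₀ (by positivity) (Real.rpow_le_one_of_one_le_of_nonpos es (by linarith))
    calc _ ≤ C * (envBase b y ^ (-γ / 2 - 1 / 4) * envBase b x ^ (γ / 2 - 1 / 4)
        * Real.exp (phase b y - phase b x)
        + b ^ 3 * (envBase b y ^ (γ - 1) * envBase b x ^ (-1 - γ))) * (s ^ (-1 - γ)) ^ 4 := by
            gcongr; exact z2 hx1 hy1 hyx
      _ = C * (envBase b y ^ (-γ / 2 - 1 / 4) * envBase b x ^ (γ / 2 - 1 / 4)
        * Real.exp (phase b y - phase b x) * (s ^ (-1 - γ)) ^ 4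
        + b ^ 3 * (envBase b y ^ (γ - 1) * envBase b x ^ (-1 - γ)) * (s ^ (-1 - γ)) ^ 4) := by ring
      _ ≤ C * (4 * (r ^ (-1 - γ) * Real.exp (-|x - y| / 2))
        + b ^ 3 * (s ^ (-(11 / 8) : ℝ) * r ^ (-1 - γ)) * 1) := by
          gcongr
      _ ≤ C * (4 * (r ^ (-1 - γ) * Real.exp (-|x - y| / 2))
        + b ^ 3 * (s ^ (-(11 / 8) : ℝ) * r ^ (-1 - γ)) * 4) := by
          gcongr; norm_num
      _ = _ := by ring

/-- For `-1/a ≤ y ≤ 0` the fourth power of the weight is below `e^{-|y|}`, which is the localized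
case. For `x, y ≥ 0` the kernel is like a convolution kernel plus an algebraic term of size `a`, and
`y < -1/a` contributes only such a term. -/
theorem abs_kernel_mul_weight_le : ∃ C : ℝ, 0 < C ∧ ∀ γ ∈ gammaRange, ∀ a : ℝ, 0 ≤ a → a ≤ 1 →
    ∀ x y : ℝ, |kernel a γ x y| * weight a γ y ^ 4
      ≤ C * (weight a γ x * (Real.exp (-|y| / 16) + Real.exp (-|x - y| / 2)
        + a * (1 + a * |y|) ^ (-(11 / 8) : ℝ))) := by
  obtain ⟨C1, hC1, h1⟩ := kernel_zone_bounds
  obtain ⟨C2, hC2, h2⟩ := kernel_decay_neg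
  obtain ⟨C3, hC3, h3⟩ := kernel_mul_weight_pos
  obtain ⟨C4, hC4, h4⟩ := abs_kernel_mul_exp_le
  refine ⟨max (max (max 1 (2 * C4)) (C1 * 1152)) (max (2 * C2) C3), by positivity,
    fun γ hγ a ha ha1 x y => ?_⟩
  have hw := weight_pos' (γ := γ) ha ha1 x
  have hwy := weight_pos' (γ := γ) ha ha1 y
  set R := weight a γ x * (Real.exp (-|y| / 16) + Real.exp (-|x - y| / 2)
        + a * (1 + a * |y|) ^ (-(11 / 8) : ℝ)) with hR
  have hR0 : 0 ≤ R := by positivity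
  have k1 : 1 * R ≤ max (max (max 1 (2 * C4)) (C1 * 1152)) (max (2 * C2) C3) * R := by
    gcongr; simp
  have k2 : 2 * C4 * R ≤ max (max (max 1 (2 * C4)) (C1 * 1152)) (max (2 * C2) C3) * R := by
    gcongr; simp
  have k3 : C1 * 1152 * R ≤ max (max (max 1 (2 * C4)) (C1 * 1152)) (max (2 * C2) C3) * R := by
    gcongr; simp
  have k4 : 2 * C2 * R ≤ max (max (max 1 (2 * C4)) (C1 * 1152)) (max (2 * C2) C3) * R := by
    gcongr; simp
  have k5 : C3 * R ≤ max (max (max 1 (2 * C4)) (C1 * 1152)) (max (2 * C2) C3) * R := by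
    gcongr; simp
  have m1 : weight a γ x * Real.exp (-|y| / 16) ≤ R := by
    rw [hR]; gcongr
    have : 0 ≤ Real.exp (-|x - y| / 2) := by positivity
    have : 0 ≤ a * (1 + a * |y|) ^ (-(11 / 8) : ℝ) := by positivity
    linarith
  have m2 : weight a γ x * Real.exp (-|x - y| / 2) ≤ R := by
    rw [hR]; gcongr
    have : 0 ≤ Real.exp (-|y| / 16) := by positivity
    have : 0 ≤ a * (1 + a * |y|) ^ (-(11 / 8) : ℝ) := by positivity
    linarith
  have m3 : weight a γ x * (a * (1 + a * |y|) ^ (-(11 / 8) : ℝ)) ≤ R := by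
    rw [hR]; gcongr
    have : 0 ≤ Real.exp (-|y| / 16) := by positivity
    have : 0 ≤ Real.exp (-|x - y| / 2) := by positivity
    linarith
  have hxa : Real.exp (-|x| / 16) + a ≤ 2 := by
    have : Real.exp (-|x| / 16) ≤ 1 := Real.exp_le_one_iff.mpr (by linarith [abs_nonneg x])
    linarith
  have near : weight a γ y ^ 4 ≤ Real.exp (-|y|) → |kernel a γ x y| * weight a γ y ^ 4 ≤
      2 * C4 * R := by
    intro h
    calc _ ≤ |kernel a γ x y| * Real.exp (-|y|) := by gcongr
      _ ≤ _ := h4 γ hγ a ha ha1 x y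
      _ ≤ C4 * (weight a γ x * (2 * Real.exp (-|y| / 16))) := by gcongr
      _ = 2 * C4 * (weight a γ x * Real.exp (-|y| / 16)) := by ring
      _ ≤ _ := by gcongr
  rcases ha.eq_or_lt with rfl | h
  · rcases le_total y 0 with hy | hy
    · refine (near ?_).trans k2
      rw [weight_zero_of_neg hy, abs_of_nonpos hy, ← Real.exp_nat_mul]
      gcongr
      push_cast
      linarith
    · refine le_trans ?_ k1
      rw [kernel_zero, abs_of_pos (by positivity), weight_zero_of_nonneg hy, one_pow, mul_one,
        one_mul]
      refine le_trans ?_ m2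
      rcases le_total x 0 with hx | hx
      · rw [weight_zero_of_neg hx, ← Real.exp_add, abs_of_nonpos (by linarith : x - y ≤ 0)]
        calc _ ≤ 1 * Real.exp (- -(x - y)) := by gcongr; norm_num
          _ ≤ _ := by rw [one_mul]; gcongr; linarith
      · rw [weight_zero_of_nonneg hx]
        gcongr
        · norm_num
        · linarith [abs_nonneg (x - y)]
  · obtain ⟨b, hb, hb1, rfl⟩ := exists_cube_eq h ha1
    rcases le_total (1 + b ^ 3 * y) 0 with hy | hy
    · refine le_trans ?_ k3
      have f1 := (h1 γ hγ b hb hb1 x y).2.2.2 hy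
      have f2 := far_weight_decay (γ := γ) hb hb1 hy
      calc _ ≤ C1 * (weight (b ^ 3) γ x * (Real.exp (1 / 3 * (b ^ 3)⁻¹) * b⁻¹
            * (1 + |xi b y|) ^ (1 / 16 : ℝ))) * weight (b ^ 3) γ y ^ 4 := by gcongr
        _ = C1 * (weight (b ^ 3) γ x * (Real.exp (1 / 3 * (b ^ 3)⁻¹) * b⁻¹
            * (1 + |xi b y|) ^ (1 / 16 : ℝ) * weight (b ^ 3) γ y ^ 4)) := by ring
        _ ≤ C1 * (weight (b ^ 3) γ x * (1152 * (b ^ 3 * (1 + b ^ 3 * |y|) ^ (-(11 / 8) : ℝ)))) := by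
            gcongr
        _ = C1 * 1152 * (weight (b ^ 3) γ x * (b ^ 3 * (1 + b ^ 3 * |y|) ^ (-(11 / 8) : ℝ))) := by
            ring
        _ ≤ _ := by gcongr
    · rcases le_total y 0 with hy0 | hy0
      · refine (near ?_).trans k2
        rw [weight_of_near hb γ hy hy0, abs_of_nonpos hy0, ← Real.exp_nat_mul]
        gcongr
        push_cast
        linarith [phase_le hb hy hy0]
      · rcases le_total x 0 with hx | hx
        · refine le_trans ?_ k4
          have f1 := h2 γ hγ b hb hb1 x y hx hy
          have f2 : |kernel (b ^ 3) γ x y| * Real.exp (min y 0) ≤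
              C2 * (weight (b ^ 3) γ x * ((Real.exp (-|x| / 16) + b ^ 3)
                * Real.exp (-|y| / 16))) := by
            rcases lt_or_ge x y with hxy | hxy
            · exact f1.1 hxy
            · exact f1.2 hxy
          have f3 : weight (b ^ 3) γ y ^ 4 ≤ 1 := pow_le_one₀ hwy.le (weight_le_one hb hγ y)
          rw [min_eq_right hy0, Real.exp_zero] at f2
          calc _ ≤ |kernel (b ^ 3) γ x y| * 1 := by gcongr
            _ ≤ _ := f2
            _ ≤ C2 * (weight (b ^ 3) γ x * (2 * Real.exp (-|y| / 16))) := by gcongr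
            _ = 2 * C2 * (weight (b ^ 3) γ x * Real.exp (-|y| / 16)) := by ring
            _ ≤ _ := by gcongr
        · refine le_trans ?_ k5
          refine (h3 γ hγ b hb hb1 x y hx hy0).trans ?_
          rw [hR]; gcongr
          have : 0 ≤ Real.exp (-|y| / 16) := by positivity
          linarith

/-! ### The limit `a → 0` of phase, weight and kernel. -/

theorem tendsto_rpow_of_tendsto_one {ι : Type*} {l : Filter ι} {r e : ι → ℝ}
    (hr : Tendsto r l (𝓝 1)) (he : ∀ᶠ i in l, |e i| ≤ 2) :
    Tendsto (fun i => r i ^ e i) l (𝓝 1) := by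
  have h1 : Tendsto (fun i => Real.log (r i) * e i) l (𝓝 0) := by
    have h2 : Tendsto (fun i => Real.log (r i)) l (𝓝 0) := by
      have := (Real.continuousAt_log (one_ne_zero)).tendsto.comp hr
      rwa [Real.log_one] at this
    refine squeeze_zero_norm' (a := fun i => 2 * |Real.log (r i)|) ?_ ?_
    · filter_upwards [he] with i hi
      rw [Real.norm_eq_abs, abs_mul, mul_comm]
      gcongr
    · simpa using (h2.abs.const_mul 2)
  have h3 := (Real.continuous_exp.tendsto 0).comp h1
  rw [Real.exp_zero] at h3
  refine h3.congr' ?_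
  filter_upwards [hr.eventually (lt_mem_nhds one_pos)] with i hi
  rw [Real.rpow_def_of_pos hi]
  rfl

/-- Together with `le_phase` this confines the phase to `x + O(a x²)`. It follows by comparing
squares, which removes the fractional power. -/
theorem phase_le_add {b x : ℝ} (hb : 0 < b) (hx : 0 ≤ 1 + b ^ 3 * x) :
    phase b x ≤ x + 2 / 3 * b ^ 3 * x ^ 2 := by
  have h1 : (1 + b ^ 3 * x) ^ (3 / 2 : ℝ) ≤ 1 + 3 / 2 * (b ^ 3 * x) + (b ^ 3 * x) ^ 2 := by
    set h := b ^ 3 * x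
    have h2 : ((1 + h) ^ (3 / 2 : ℝ)) ^ 2 = (1 + h) ^ 3 := by
      rw [← Real.rpow_natCast, ← Real.rpow_mul hx, ← Real.rpow_natCast]; norm_num
    refine abs_le_of_sq_le_sq' ?_ (by nlinarith [sq_nonneg (h + 3 / 4)]) |>.2
    rw [h2]
    nlinarith [mul_nonneg (sq_nonneg h) (sq_nonneg (1 + h)), sq_nonneg h]
  rw [phase]
  have hb3 : 0 < (b ^ 3)⁻¹ := by positivity
  calc _ ≤ 2 / 3 * (b ^ 3)⁻¹ * ((1 + 3 / 2 * (b ^ 3 * x) + (b ^ 3 * x) ^ 2) - 1) := by gcongr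
    _ = _ := by field_simp; ring

section limits

variable {ι : Type*} {l : Filter ι} {B X : ι → ℝ} {x₀ : ℝ}

theorem tendsto_one_add (hB : Tendsto B l (𝓝[>] 0)) (hX : Tendsto X l (𝓝 x₀)) :
    Tendsto (fun i => 1 + B i ^ 3 * X i) l (𝓝 1) := by
  have hB' : Tendsto B l (𝓝 0) := hB.mono_right nhdsWithin_le_nhds
  have := ((hB'.pow 3).mul hX).const_add 1
  simpa using this

theorem eventually_pos_scale (hB : Tendsto B l (𝓝[>] 0)) : ∀ᶠ i in l, 0 < B i :=
  hB.eventually self_mem_nhdsWithin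

theorem tendsto_phase (hB : Tendsto B l (𝓝[>] 0)) (hX : Tendsto X l (𝓝 x₀)) :
    Tendsto (fun i => phase (B i) (X i)) l (𝓝 x₀) := by
  have hB' : Tendsto B l (𝓝 0) := hB.mono_right nhdsWithin_le_nhds
  have h1 : Tendsto (fun i => X i + 2 / 3 * B i ^ 3 * X i ^ 2) l (𝓝 x₀) := by
    have := hX.add (((hB'.pow 3).const_mul (2 / 3)).mul (hX.pow 2))
    simpa using this
  have h2 := (tendsto_one_add hB hX).eventually (lt_mem_nhds one_pos)
  refine tendsto_of_tendsto_of_tendsto_of_le_of_le' hX h1 ?_ ?_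
  · filter_upwards [h2, eventually_pos_scale hB] with i hi hb using le_phase hb hi.le
  · filter_upwards [h2, eventually_pos_scale hB] with i hi hb using phase_le_add hb hi.le

theorem tendsto_xi (hB : Tendsto B l (𝓝[>] 0)) (hX : Tendsto X l (𝓝 x₀)) :
    Tendsto (fun i => xi (B i) (X i)) l atTop := by
  have h1 : Tendsto (fun b : ℝ => (b ^ 2)⁻¹) (𝓝[>] 0) atTop := by
    refine tendsto_inv_nhdsGT_zero.comp ?_
    refine tendsto_nhdsWithin_iff.mpr ⟨?_, ?_⟩
    · have : Tendsto (fun b : ℝ => b ^ 2) (𝓝 0) (𝓝 (0 ^ 2)) := (continuous_pow 2).tendsto 0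
      rw [zero_pow two_ne_zero] at this
      exact this.mono_left nhdsWithin_le_nhds
    · filter_upwards [self_mem_nhdsWithin] with b hb
      have : (0 : ℝ) < b := hb
      exact Set.mem_Ioi.mpr (by positivity)
  have h2 := (tendsto_one_add hB hX).pos_mul_atTop one_pos (h1.comp hB)
  refine h2.congr' ?_
  filter_upwards [eventually_pos_scale hB] with i hi
  rw [xi_eq hi, div_eq_mul_inv]; rfl

theorem weight_near_formula {b : ℝ} (hb : 0 < b) (γ : ℝ) {x : ℝ} (hx : 0 ≤ 1 + b ^ 3 * x) :
    weight (b ^ 3) γ x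
      = Real.exp (phase b (min x 0) / 2) * (1 + b ^ 3 * max x 0) ^ (-1 - γ) := by
  rcases le_total x 0 with h | h
  · rw [weight_of_near hb γ hx h, min_eq_left h, max_eq_right h]; simp
  · rw [weight_of_nonneg hb γ h, min_eq_right h, max_eq_left h, phase]; simp

theorem weight_zero_formula (γ x : ℝ) : weight 0 γ x = Real.exp (min x 0 / 2) := by
  rcases le_total x 0 with h | h
  · rw [weight_zero_of_neg h, min_eq_left h]
  · rw [weight_zero_of_nonneg h, min_eq_right h]; simp

/-- The index `G i` need not converge: the weight at `a = 0` does not depend on it, so `γ₀` is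
arbitrary. The same holds for the kernel. -/
theorem tendsto_weight_cube {G : ι → ℝ} (γ₀ : ℝ) (hB : Tendsto B l (𝓝[>] 0))
    (hX : Tendsto X l (𝓝 x₀)) (hG : ∀ᶠ i in l, G i ∈ gammaRange) :
    Tendsto (fun i => weight (B i ^ 3) (G i) (X i)) l (𝓝 (weight 0 γ₀ x₀)) := by
  have h1 := tendsto_phase hB (hX.min (tendsto_const_nhds (x := (0 : ℝ))))
  have h2 : Tendsto (fun i => (1 + B i ^ 3 * max (X i) 0) ^ (-1 - G i)) l (𝓝 1) := by
    refine tendsto_rpow_of_tendsto_one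
      (tendsto_one_add hB (hX.max (tendsto_const_nhds (x := (0 : ℝ))))) ?_
    filter_upwards [hG] with i hi using (abs_exponents hi).2.2.2.1
  have h3 := ((Real.continuous_exp.tendsto _).comp (h1.div_const 2)).mul h2
  rw [mul_one] at h3
  rw [weight_zero_formula]
  refine h3.congr' ?_
  filter_upwards [(tendsto_one_add hB hX).eventually (lt_mem_nhds one_pos),
    eventually_pos_scale hB] with i hi hb
  rw [weight_near_formula hb _ hi.le]
  rfl

/-- The algebra of prefactors: `π b⁻¹ ξ^… η^… ` tends to `1` up to exponentials. -/
theorem tendsto_scaled_product {Y f g α : ι → ℝ} {y₀ E F : ℝ} (hB : Tendsto B l (𝓝[>] 0))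
    (hX : Tendsto X l (𝓝 x₀)) (hY : Tendsto Y l (𝓝 y₀)) (hα : ∀ᶠ i in l, α i ∈ indexRange)
    (σ : ℝ)
    (hf : Tendsto (fun i => f i * (xi (B i) (X i) ^ (1 / 4 - α i / 2)
      * Real.exp (σ * (2 / 3 * xi (B i) (X i) ^ (3 / 2 : ℝ))))) l (𝓝 E))
    (hg : Tendsto (fun i => g i * (xi (B i) (Y i) ^ (1 / 4 + α i / 2)
      * Real.exp (-σ * (2 / 3 * xi (B i) (Y i) ^ (3 / 2 : ℝ))))) l (𝓝 F)) :
    Tendsto (fun i => (B i)⁻¹ * (g i * f i)) l (𝓝 (E * F * Real.exp (σ * (y₀ - x₀)))) := by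
  have r1 := tendsto_one_add hB hX
  have r2 := tendsto_one_add hB hY
  have p1 := tendsto_rpow_of_tendsto_one (e := fun i => -(1 / 4 - α i / 2)) r1 (by
    filter_upwards [hα] with i hi
    rw [abs_le]; constructor <;> linarith [hi.1, hi.2])
  have p2 := tendsto_rpow_of_tendsto_one (e := fun i => -(1 / 4 + α i / 2)) r2 (by
    filter_upwards [hα] with i hi
    rw [abs_le]; constructor <;> linarith [hi.1, hi.2])
  have p3 := (Real.continuous_exp.tendsto _).comp
    (((tendsto_phase hB hY).sub (tendsto_phase hB hX)).const_mul σ)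
  have h := (((hf.mul hg).mul p1).mul p2).mul p3
  rw [mul_one, mul_one] at h
  refine h.congr' ?_
  filter_upwards [r1.eventually (lt_mem_nhds one_pos), r2.eventually (lt_mem_nhds one_pos),
    eventually_pos_scale hB] with i h1 h2 hb
  have e1 : Real.exp (σ * (2 / 3 * xi (B i) (X i) ^ (3 / 2 : ℝ)))
      * Real.exp (-σ * (2 / 3 * xi (B i) (Y i) ^ (3 / 2 : ℝ)))
      * Real.exp (σ * (phase (B i) (Y i) - phase (B i) (X i))) = 1 := by
    rw [xi_rpow hb h1.le, xi_rpow hb h2.le, ← Real.exp_add, ← Real.exp_add, Real.exp_eq_one_iff]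
    ring
  have e2 : xi (B i) (X i) ^ (1 / 4 - α i / 2) * (1 + B i ^ 3 * X i) ^ (-(1 / 4 - α i / 2))
      * (xi (B i) (Y i) ^ (1 / 4 + α i / 2) * (1 + B i ^ 3 * Y i) ^ (-(1 / 4 + α i / 2)))
      = (B i)⁻¹ := by
    have e3 : ∀ e z : ℝ, 0 < z → (z / B i ^ 2) ^ e * z ^ (-e) = (B i ^ 2) ^ (-e) := by
      intro e z hz
      rw [Real.div_rpow hz.le (by positivity), Real.rpow_neg hz.le, Real.rpow_neg (by positivity)]
      have : z ^ e ≠ 0 := by positivity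
      field_simp
    rw [xi_eq hb, xi_eq hb, e3 _ _ h1, e3 _ _ h2, ← Real.rpow_add (by positivity),
      ← Real.rpow_natCast, ← Real.rpow_mul hb.le, ← Real.rpow_neg_one]
    congr 1
    push_cast
    ring
  simp only [Function.comp]
  rw [← e2]
  linear_combination (xi (B i) (X i) ^ (1 / 4 - α i / 2)
    * (1 + B i ^ 3 * X i) ^ (-(1 / 4 - α i / 2)) * (xi (B i) (Y i) ^ (1 / 4 + α i / 2)
    * (1 + B i ^ 3 * Y i) ^ (-(1 / 4 + α i / 2))) * f i * g i) * e1

/-- Off the diagonal one branch of the kernel is eventually fixed. Its `Ai · Hi` product converges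
to `½ e^{-|x₀-y|}` by the leading asymptotics and the limit of the phase. -/
theorem tendsto_kernel_cube {G : ι → ℝ} {y : ℝ} (γ₀ : ℝ) (hB : Tendsto B l (𝓝[>] 0))
    (hX : Tendsto X l (𝓝 x₀)) (hG : ∀ᶠ i in l, G i ∈ gammaRange) (hne : x₀ ≠ y) :
    Tendsto (fun i => kernel (B i ^ 3) (G i) (X i) y) l (𝓝 (kernel 0 γ₀ x₀ y)) := by
  have hY : Tendsto (fun _ : ι => y) l (𝓝 y) := tendsto_const_nhds
  have tX := tendsto_xi hB hX
  have tY := tendsto_xi hB hY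
  have hG1 : ∀ᶠ i in l, G i ∈ indexRange := hG.mono fun i hi => (mem_indexRange_of_mem hi).1
  have hG2 : ∀ᶠ i in l, -G i ∈ indexRange := hG.mono fun i hi => (mem_indexRange_of_mem hi).2
  have cX : Tendsto (fun i => (xi (B i) (X i), G i)) l (atTop ×ˢ 𝓟 indexRange) :=
    tX.prodMk (tendsto_principal.mpr hG1)
  have cY : Tendsto (fun i => (xi (B i) y, -G i)) l (atTop ×ˢ 𝓟 indexRange) :=
    tY.prodMk (tendsto_principal.mpr hG2)
  have aX := tendsto_Ai_mul.comp cX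
  have aY := tendsto_Ai_mul.comp cY
  have hHX := tendsto_Hi_mul.comp cX
  have hHY := tendsto_Hi_mul.comp cY
  simp only [Function.comp_def] at aX aY hHX hHY
  have hpi : Real.pi * (1 / Real.pi * √Real.pi * (1 / Real.pi * (√Real.pi / 2))) = 1 / 2 := by
    have := Real.mul_self_sqrt Real.pi_pos.le
    have hp := Real.pi_pos
    field_simp
    linarith
  rcases lt_or_gt_of_ne hne with h | h
  · have key := tendsto_scaled_product (f := fun i => Hi (G i) (xi (B i) (X i)))
      (g := fun i => Ai (-G i) (xi (B i) y)) hB hX hY hG1 (-1) (hHX.congr fun i => by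
        congr 3; ring) (aY.congr fun i => by
        congr 3 <;> ring)
    have key2 := key.const_mul Real.pi
    have : kernel 0 γ₀ x₀ y = Real.pi * (1 / Real.pi * √Real.pi * (1 / Real.pi * (√Real.pi / 2))
        * Real.exp (-1 * (y - x₀))) := by
      rw [kernel_zero, abs_of_neg (by linarith), ← mul_assoc, hpi]; ring_nf
    rw [this]
    refine key2.congr' ?_
    filter_upwards [eventually_pos_scale hB, hX.eventually (gt_mem_nhds h)] with i hb hi
    rw [kernel_eq hb, if_pos hi, mul_assoc]
  · have key := tendsto_scaled_product (f := fun i => Ai (G i) (xi (B i) (X i)))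
      (g := fun i => Hi (-G i) (xi (B i) y)) hB hX hY hG1 1 (aX.congr fun i => by
        congr 3; ring) (hHY.congr fun i => by
        congr 3 <;> ring)
    have key2 := key.const_mul Real.pi
    have hval : kernel 0 γ₀ x₀ y = Real.pi * (1 / Real.pi * (√Real.pi / 2)
        * (1 / Real.pi * √Real.pi) * Real.exp (1 * (y - x₀))) := by
      rw [kernel_zero, abs_of_pos (by linarith), ← mul_assoc,
        mul_comm (1 / Real.pi * (√Real.pi / 2)), hpi]; ring_nf
    rw [hval]
    obtain ⟨C, hC, henv⟩ := airy_envelopes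
    -- The remaining products are bounded by `(1 + η)^{γ-1} ≤ (1 + η)⁻¹ = O(b²)`, where `η` is the
    -- rescaled `y`, so with the factor `b⁻¹` they are `O(b)`.
    have key3 := key2.sub (show Tendsto (fun i => Real.pi * (B i)⁻¹ *
        (Real.sin (G i * Real.pi) * (Gi (-G i) (xi (B i) y) * Gi (G i) (xi (B i) (X i))
              + Ai (-G i) (xi (B i) y) * Ai (G i) (xi (B i) (X i)))
          + Real.cos (G i * Real.pi) * (Ai (-G i) (xi (B i) y) * Gi (G i) (xi (B i) (X i))
              - Gi (-G i) (xi (B i) y) * Ai (G i) (xi (B i) (X i))))) l (𝓝 0) by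
      have hb0 : Tendsto (fun i => Real.pi * (8 * C ^ 2) * B i) l (𝓝 0) := by
        have := (hB.mono_right nhdsWithin_le_nhds).const_mul (Real.pi * (8 * C ^ 2))
        simpa using this
      refine squeeze_zero_norm' ?_ hb0
      filter_upwards [hG, eventually_pos_scale hB,
        (tendsto_one_add hB hY).eventually (lt_mem_nhds (by norm_num : (1 / 2 : ℝ) < 1)),
        (tendsto_one_add hB hX).eventually (lt_mem_nhds one_pos)] with i hγ hb hs hr
      have η0 := xi_nonneg hb (by linarith : 0 ≤ 1 + B i ^ 3 * y)
      have ξ0 := xi_nonneg hb hr.le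
      obtain ⟨-, -, a1, g1, -⟩ := (henv _ hγ).1 _ ξ0
      obtain ⟨-, -, -, -, -, -, -, a2, g2⟩ := (henv _ hγ).1 _ η0
      have m1 : (1 + xi (B i) (X i)) ^ (-1 - G i) ≤ 1 :=
        Real.rpow_le_one_of_one_le_of_nonpos (by linarith) (by linarith [hγ.1])
      have m2 : (1 + xi (B i) y) ^ (G i - 1) ≤ 2 * B i ^ 2 := by
        calc _ ≤ (1 + xi (B i) y) ^ (-1 : ℝ) :=
              Real.rpow_le_rpow_of_exponent_le (by linarith) (by linarith [hγ.2])
          _ = (1 + xi (B i) y)⁻¹ := Real.rpow_neg_one _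
          _ ≤ (1 / 2 / B i ^ 2)⁻¹ := by
              gcongr
              rw [xi_eq hb]
              have : 1 / 2 / B i ^ 2 ≤ (1 + B i ^ 3 * y) / B i ^ 2 := by gcongr
              linarith
          _ = _ := by field_simp
      replace a1 := a1.trans (mul_le_mul_of_nonneg_left m1 hC.le)
      replace g1 := g1.trans (mul_le_mul_of_nonneg_left m1 hC.le)
      replace a2 := a2.trans (mul_le_mul_of_nonneg_left m2 hC.le)
      replace g2 := g2.trans (mul_le_mul_of_nonneg_left m2 hC.le)
      have pr : ∀ s t : ℝ, |s| ≤ C * (2 * B i ^ 2) → |t| ≤ C * 1 →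
          |s * t| ≤ 2 * C ^ 2 * B i ^ 2 := by
        intro s t h1 h2
        rw [abs_mul]
        calc _ ≤ (C * (2 * B i ^ 2)) * (C * 1) := by gcongr
          _ = _ := by ring
      have q1 := pr _ _ g2 g1
      have q2 := pr _ _ a2 a1
      have q3 := pr _ _ a2 g1
      have q4 := pr _ _ g2 a1
      have hs := Real.abs_sin_le_one (G i * Real.pi)
      have hc := Real.abs_cos_le_one (G i * Real.pi)
      rw [Real.norm_eq_abs, abs_mul, abs_of_pos (by positivity : 0 < Real.pi * (B i)⁻¹)]
      calc _ ≤ Real.pi * (B i)⁻¹ * (1 * (2 * C ^ 2 * B i ^ 2 + 2 * C ^ 2 * B i ^ 2)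
            + 1 * (2 * C ^ 2 * B i ^ 2 + 2 * C ^ 2 * B i ^ 2)) := by
            gcongr
            refine (abs_add_le _ _).trans (add_le_add ?_ ?_)
            · rw [abs_mul]
              exact mul_le_mul hs ((abs_add_le _ _).trans (add_le_add q1 q2)) (abs_nonneg _)
                zero_le_one
            · rw [abs_mul]
              exact mul_le_mul hc ((abs_sub _ _).trans (add_le_add q3 q4)) (abs_nonneg _)
                zero_le_one
        _ = _ := by field_simp; ring)
    rw [sub_zero] at key3
    refine key3.congr' ?_
    filter_upwards [eventually_pos_scale hB, hX.eventually (lt_mem_nhds h)] with i hb hi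
    rw [kernel_eq hb, if_neg (not_lt.mpr hi.le)]
    ring

end limits

theorem continuous_weight {a γ : ℝ} (ha : 0 ≤ a) (ha1 : a ≤ 1) : Continuous (weight a γ) := by
  rcases ha.eq_or_lt with rfl | h
  · rw [funext (weight_zero_formula γ)]; fun_prop
  · obtain ⟨b, hb, -, rfl⟩ := exists_cube_eq h ha1
    have e : weight (b ^ 3) γ = fun x => if 0 ≤ 1 + b ^ 3 * x then
        Real.exp (phase b (min x 0) / 2) * (1 + b ^ 3 * max x 0) ^ (-1 - γ)
      else Real.exp (-(1 / 3 * (b ^ 3)⁻¹)) * (1 + |xi b x|) ^ (-(3 / 8) : ℝ) := by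
      funext x
      split_ifs with hx
      · exact weight_near_formula hb γ hx
      · exact weight_of_far hb γ (not_le.mp hx).le
    rw [e]
    refine Continuous.if_le ?_ ?_ continuous_const (by fun_prop) ?_
    · refine Continuous.mul ?_ ?_
      · have : Continuous (phase b) := by
          unfold phase
          exact continuous_const.mul (((Real.continuous_rpow_const (by norm_num)).comp
            (by fun_prop : Continuous fun x : ℝ => 1 + b ^ 3 * x)).sub continuous_const)
        fun_prop
      · refine Continuous.rpow_const (by fun_prop) fun x => Or.inl ?_
        have : 0 ≤ b ^ 3 * max x 0 := by positivity
        linarith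
    · refine continuous_const.mul (Continuous.rpow_const ?_ fun x => Or.inl ?_)
      · unfold xi; fun_prop
      · have := abs_nonneg (xi b x)
        linarith
    · intro x hx
      rw [← weight_near_formula hb γ hx.le, ← weight_of_far hb γ hx.symm.le]

section limits

variable {ι : Type*} {l : Filter ι} {A G X : ι → ℝ} {x₀ : ℝ}

/-- The parameter may vanish along the filter, and the formulas for `a = 0` and `a > 0` are
unrelated. The filter is split accordingly, and `b = a^{1/3}` is used on the positive part. -/
theorem tendsto_of_scale {Z : ℝ → ℝ → ℝ → ℝ} {z : ℝ} (hA : Tendsto A l (𝓝[≥] 0))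
    (hX : Tendsto X l (𝓝 x₀)) (hG : ∀ᶠ i in l, G i ∈ gammaRange)
    (h0 : ∀ l' : Filter ι, Tendsto X l' (𝓝 x₀) → Tendsto (fun i => Z 0 (G i) (X i)) l' (𝓝 z))
    (h1 : ∀ (l' : Filter ι) (B : ι → ℝ), Tendsto B l' (𝓝[>] 0) → Tendsto X l' (𝓝 x₀) →
      (∀ᶠ i in l', G i ∈ gammaRange) → Tendsto (fun i => Z (B i ^ 3) (G i) (X i)) l' (𝓝 z)) :
    Tendsto (fun i => Z (A i) (G i) (X i)) l (𝓝 z) := by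
  have hsplit : l = (l ⊓ 𝓟 {i | A i = 0}) ⊔ (l ⊓ 𝓟 {i | A i = 0}ᶜ) := by
    rw [← inf_sup_left, sup_principal, Set.union_compl_self, principal_univ, inf_top_eq]
  rw [hsplit, tendsto_sup]
  constructor
  · refine (h0 _ (hX.mono_left inf_le_left)).congr' ?_
    filter_upwards [mem_inf_of_right (mem_principal_self _)] with i hi
    rw [show A i = 0 from hi]
  · have hA' : Tendsto A (l ⊓ 𝓟 {i | A i = 0}ᶜ) (𝓝[>] 0) := by
      refine tendsto_nhdsWithin_iff.mpr
        ⟨(hA.mono_left inf_le_left).mono_right nhdsWithin_le_nhds, ?_⟩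
      filter_upwards [mem_inf_of_left (hA.eventually self_mem_nhdsWithin),
        mem_inf_of_right (mem_principal_self _)] with i hi hi'
      exact lt_of_le_of_ne hi (Ne.symm hi')
    have hB : Tendsto (fun i => A i ^ (1 / 3 : ℝ)) (l ⊓ 𝓟 {i | A i = 0}ᶜ) (𝓝[>] 0) := by
      refine tendsto_nhdsWithin_iff.mpr ⟨?_, ?_⟩
      · have : Tendsto (fun a : ℝ => a ^ (1 / 3 : ℝ)) (𝓝 0) (𝓝 (0 ^ (1 / 3 : ℝ))) :=
          (Real.continuousAt_rpow_const 0 (1 / 3) (Or.inr (by norm_num)))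
        rw [Real.zero_rpow (by norm_num)] at this
        exact this.comp (hA'.mono_right nhdsWithin_le_nhds)
      · filter_upwards [hA'.eventually self_mem_nhdsWithin] with i hi
        exact Real.rpow_pos_of_pos hi _
    refine (h1 _ _ hB (hX.mono_left inf_le_left) (hG.filter_mono inf_le_left)).congr' ?_
    filter_upwards [hA'.eventually self_mem_nhdsWithin] with i hi
    have : 0 < A i := hi
    rw [← Real.rpow_natCast, ← Real.rpow_mul this.le]
    norm_num

theorem tendsto_weight (γ₀ : ℝ) (hA : Tendsto A l (𝓝[≥] 0)) (hX : Tendsto X l (𝓝 x₀))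
    (hG : ∀ᶠ i in l, G i ∈ gammaRange) :
    Tendsto (fun i => weight (A i) (G i) (X i)) l (𝓝 (weight 0 γ₀ x₀)) := by
  refine tendsto_of_scale hA hX hG (fun l' h => ?_) fun l' B hB h hG' =>
    tendsto_weight_cube γ₀ hB h hG'
  have := ((continuous_weight (γ := γ₀) le_rfl zero_le_one).tendsto x₀).comp h
  refine this.congr fun i => ?_
  simp only [Function.comp, weight_zero_formula]

theorem tendsto_kernel {y : ℝ} (γ₀ : ℝ) (hA : Tendsto A l (𝓝[≥] 0)) (hX : Tendsto X l (𝓝 x₀))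
    (hG : ∀ᶠ i in l, G i ∈ gammaRange) (hne : x₀ ≠ y) :
    Tendsto (fun i => kernel (A i) (G i) (X i) y) l (𝓝 (kernel 0 γ₀ x₀ y)) := by
  refine tendsto_of_scale (Z := fun a γ x => kernel a γ x y) hA hX hG (fun l' h => ?_)
    fun l' B hB h hG' => tendsto_kernel_cube γ₀ hB h hG' hne
  simp only [kernel_zero]
  exact (by fun_prop : Continuous fun x : ℝ => 1 / 2 * Real.exp (-|x - y|)).tendsto x₀ |>.comp h

end limits

/-! ### Regularity of the kernel and its integrable majorant. -/

theorem continuous_airy_comp {b γ : ℝ} (hγ : γ ∈ gammaRange) :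
    Continuous (fun x => Ai γ (xi b x)) ∧ Continuous (fun x => Gi γ (xi b x)) ∧
    Continuous (fun x => Hi γ (xi b x)) ∧ Continuous (fun x => Ai (-γ) (xi b x)) ∧
    Continuous (fun x => Gi (-γ) (xi b x)) ∧ Continuous (fun x => Hi (-γ) (xi b x)) := by
  have h1 : |γ| < 1 := abs_lt_one_of_mem_indexRange (mem_indexRange_of_mem hγ).1
  have h2 : |(-γ)| < 1 := abs_lt_one_of_mem_indexRange (mem_indexRange_of_mem hγ).2
  have hx : Continuous (xi b) := by unfold xi; fun_prop
  exact ⟨(continuous_Ai _ h1).comp hx, (continuous_Gi _ h1).comp hx, (continuous_Hi _ h1).comp hx,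
    (continuous_Ai _ h2).comp hx, (continuous_Gi _ h2).comp hx, (continuous_Hi _ h2).comp hx⟩

theorem continuousAt_kernel {a γ x₀ y : ℝ} (hγ : γ ∈ gammaRange) (ha : 0 ≤ a) (ha1 : a ≤ 1)
    (hne : x₀ ≠ y) : ContinuousAt (fun x => kernel a γ x y) x₀ := by
  rcases ha.eq_or_lt with rfl | h
  · simp only [kernel_zero]; fun_prop
  · obtain ⟨b, hb, -, rfl⟩ := exists_cube_eq h ha1
    obtain ⟨c1, c2, c3, -, -, -⟩ := continuous_airy_comp (b := b) hγ
    simp only [kernel_eq hb]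
    refine continuousAt_const.mul ?_
    rcases lt_or_gt_of_ne hne with hlt | hgt
    · refine ContinuousAt.congr (f := fun x => Ai (-γ) (xi b y) * Hi γ (xi b x))
        (continuousAt_const.mul c3.continuousAt) ?_
      filter_upwards [gt_mem_nhds hlt] with x hx
      rw [if_pos hx]
    · refine ContinuousAt.congr (f := fun x => Hi (-γ) (xi b y) * Ai γ (xi b x)
            - Real.sin (γ * Real.pi) * (Gi (-γ) (xi b y) * Gi γ (xi b x)
              + Ai (-γ) (xi b y) * Ai γ (xi b x))
            - Real.cos (γ * Real.pi) * (Ai (-γ) (xi b y) * Gi γ (xi b x)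
              - Gi (-γ) (xi b y) * Ai γ (xi b x))) (by fun_prop) ?_
      filter_upwards [lt_mem_nhds hgt] with x hx
      rw [if_neg (not_lt.mpr (le_of_lt hx))]

theorem measurable_kernel {a γ : ℝ} (hγ : γ ∈ gammaRange) (ha : 0 ≤ a) (ha1 : a ≤ 1) (x : ℝ) :
    Measurable (fun y => kernel a γ x y) := by
  rcases ha.eq_or_lt with rfl | h
  · simp only [kernel_zero]; fun_prop
  · obtain ⟨b, hb, -, rfl⟩ := exists_cube_eq h ha1
    obtain ⟨-, -, -, c4, c5, c6⟩ := continuous_airy_comp (b := b) hγ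
    simp only [kernel_eq hb]
    refine Measurable.const_mul (Measurable.ite measurableSet_Ioi ?_ ?_) _
    · exact (c4.mul continuous_const).measurable
    · exact Continuous.measurable (by fun_prop)

theorem integrable_exp_neg_abs : Integrable (fun y : ℝ => Real.exp (-|y|)) := by
  have h : Integrable (fun y : ℝ => 2 * (1 + ‖y‖) ^ (-2 : ℝ)) :=
    (integrable_one_add_norm (by simp)).const_mul 2
  refine h.mono' (Continuous.aestronglyMeasurable (by fun_prop)) (Eventually.of_forall fun y => ?_)
  rw [Real.norm_eq_abs, Real.norm_eq_abs, abs_of_pos (Real.exp_pos _), Real.exp_neg,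
    Real.rpow_neg (by positivity), ← div_eq_mul_inv, inv_eq_one_div,
    div_le_div_iff₀ (by positivity) (by positivity)]
  have := Real.quadratic_le_exp_of_nonneg (abs_nonneg y)
  norm_cast
  nlinarith

theorem integrable_exp_neg_abs_div {c : ℝ} (hc : 0 < c) :
    Integrable (fun y : ℝ => Real.exp (-|y| / c)) := by
  refine (integrable_exp_neg_abs.comp_mul_left' (inv_pos.mpr hc).ne').congr
    (Eventually.of_forall fun y => ?_)
  simp only [abs_mul, abs_of_pos (inv_pos.mpr hc)]
  congr 1
  field_simp

/-- The majorant of the weighted kernel. -/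
def majorant (a x y : ℝ) : ℝ :=
  Real.exp (-|y| / 16) + Real.exp (-|x - y| / 2) + a * (1 + a * |y|) ^ (-(11 / 8) : ℝ)

/-- Comparability for neighbouring `x` supplies a common dominating function when `x` varies, hence
continuity of the image functions. -/
theorem majorant_le {a x x' y : ℝ} (ha : 0 ≤ a) (h : |x - x'| ≤ 1) :
    majorant a x y ≤ 2 * majorant a x' y := by
  have h1 : Real.exp (-|x - y| / 2) ≤ 2 * Real.exp (-|x' - y| / 2) := by
    have h2 : Real.exp (1 / 2) ≤ 2 := by
      have := Real.exp_bound_div_one_sub_of_interval (x := 1 / 2) (by norm_num) (by norm_num)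
      norm_num at this
      norm_num
      exact this
    have h3 : |x' - y| ≤ |x - y| + 1 := by
      calc |x' - y| = |(x - y) - (x - x')| := by ring_nf
        _ ≤ |x - y| + |x - x'| := abs_sub _ _
        _ ≤ _ := by linarith
    calc _ ≤ Real.exp (1 / 2 + -|x' - y| / 2) := by gcongr; linarith
      _ = Real.exp (1 / 2) * Real.exp (-|x' - y| / 2) := Real.exp_add _ _
      _ ≤ _ := by gcongr
  unfold majorant
  have : 0 ≤ Real.exp (-|y| / 16) := by positivity
  have : 0 ≤ a * (1 + a * |y|) ^ (-(11 / 8) : ℝ) := by positivity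
  linarith

theorem integrable_majorant_terms {a : ℝ} (ha : 0 ≤ a) (x : ℝ) :
    Integrable (fun y : ℝ => Real.exp (-|y| / 16)) ∧
    Integrable (fun y : ℝ => Real.exp (-|x - y| / 2)) ∧
    Integrable (fun y : ℝ => a * (1 + a * |y|) ^ (-(11 / 8) : ℝ)) := by
  refine ⟨integrable_exp_neg_abs_div (by norm_num),
    (integrable_exp_neg_abs_div (c := 2) (by norm_num)).comp_sub_left x, ?_⟩
  rcases ha.eq_or_lt with rfl | h
  · simp
  · have h1 : Integrable (fun y : ℝ => (1 + ‖y‖) ^ (-(11 / 8) : ℝ)) :=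
      integrable_one_add_norm (by simp; norm_num)
    refine ((h1.comp_mul_left' h.ne').const_mul a).congr (Eventually.of_forall fun y => ?_)
    simp only [Real.norm_eq_abs, abs_mul, abs_of_pos h]

theorem integrable_majorant {a : ℝ} (ha : 0 ≤ a) (x : ℝ) : Integrable (majorant a x) := by
  obtain ⟨h1, h2, h3⟩ := integrable_majorant_terms ha x
  exact (h1.add h2).add h3

/-- The last term looks like a perturbation of size `a`, but by scaling its integral does not depend
on `a > 0`: it is bounded and not small. Operator norm convergence therefore has to use the
localized bound instead. -/
theorem integral_majorant_le : ∃ N : ℝ, 0 < N ∧ ∀ a : ℝ, 0 ≤ a → ∀ x : ℝ,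
    ∫ y, majorant a x y ≤ N := by
  have i3 : 0 ≤ ∫ y : ℝ, (1 + ‖y‖) ^ (-(11 / 8) : ℝ) :=
    integral_nonneg fun y => by positivity
  have i1 : 0 ≤ ∫ y : ℝ, Real.exp (-|y| / 16) := integral_nonneg fun y => by positivity
  have i2 : 0 ≤ ∫ y : ℝ, Real.exp (-|y| / 2) := integral_nonneg fun y => by positivity
  refine ⟨(∫ y : ℝ, Real.exp (-|y| / 16)) + (∫ y : ℝ, Real.exp (-|y| / 2))
    + (∫ y : ℝ, (1 + ‖y‖) ^ (-(11 / 8) : ℝ)) + 1, by positivity, fun a ha x => ?_⟩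
  obtain ⟨h1, h2, h3⟩ := integrable_majorant_terms ha x
  unfold majorant
  have h12 : Integrable (fun y : ℝ => Real.exp (-|y| / 16) + Real.exp (-|x - y| / 2)) := h1.add h2
  rw [integral_add h12 h3, integral_add h1 h2,
    integral_sub_left_eq_self (fun z : ℝ => Real.exp (-|z| / 2)) volume x]
  have : ∫ y : ℝ, a * (1 + a * |y|) ^ (-(11 / 8) : ℝ) ≤ ∫ y : ℝ, (1 + ‖y‖) ^ (-(11 / 8) : ℝ) := by
    rcases ha.eq_or_lt with rfl | h
    · simpa using i3
    · have e : ∀ y : ℝ, (1 + a * |y|) ^ (-(11 / 8) : ℝ) = (1 + ‖a * y‖) ^ (-(11 / 8) : ℝ) := by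
        intro y
        rw [Real.norm_eq_abs, abs_mul, abs_of_pos h]
      rw [integral_const_mul]
      simp only [e]
      rw [Measure.integral_comp_mul_left (fun z : ℝ => (1 + ‖z‖) ^ (-(11 / 8) : ℝ)) a,
        abs_of_pos (inv_pos.mpr h), smul_eq_mul, ← mul_assoc, mul_inv_cancel₀ h.ne', one_mul]
  linarith

/-- The kernel conjugated by the weight. -/
def wkernel (a γ x y : ℝ) : ℝ := (weight a γ x)⁻¹ * kernel a γ x y

/-- The size of admissible densities. -/
def envelope (a γ y : ℝ) : ℝ := Real.exp (-|y|) + weight a γ y ^ 4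

theorem wkernel_bounds : ∃ C : ℝ, 0 < C ∧ ∀ γ ∈ gammaRange, ∀ a : ℝ, 0 ≤ a → a ≤ 1 →
    ∀ x y : ℝ, |wkernel a γ x y| * envelope a γ y ≤ C * majorant a x y ∧
      |wkernel a γ x y| * Real.exp (-|y|)
        ≤ C * ((Real.exp (-|x| / 16) + a) * Real.exp (-|y| / 16)) := by
  obtain ⟨C1, hC1, h1⟩ := abs_kernel_mul_exp_le
  obtain ⟨C2, hC2, h2⟩ := abs_kernel_mul_weight_le
  refine ⟨2 * C1 + C2, by positivity, fun γ hγ a ha ha1 x y => ?_⟩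
  have hw := weight_pos' (γ := γ) ha ha1 x
  have key : ∀ s R : ℝ, |kernel a γ x y| * s ≤ weight a γ x * R → |wkernel a γ x y| * s ≤ R := by
    intro s R h
    rw [wkernel, abs_mul, abs_of_pos (inv_pos.mpr hw), mul_assoc, inv_mul_le_iff₀ hw]
    exact h
  have k1 := key _ (C1 * ((Real.exp (-|x| / 16) + a) * Real.exp (-|y| / 16)))
    ((h1 γ hγ a ha ha1 x y).trans_eq (by ring))
  have k2 := key _ (C2 * majorant a x y) ((h2 γ hγ a ha ha1 x y).trans_eq (by
    unfold majorant; ring))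
  have hxa : Real.exp (-|x| / 16) + a ≤ 2 := by
    have : Real.exp (-|x| / 16) ≤ 1 := Real.exp_le_one_iff.mpr (by linarith [abs_nonneg x])
    linarith
  have hm : Real.exp (-|y| / 16) ≤ majorant a x y := by
    have : 0 ≤ Real.exp (-|x - y| / 2) := by positivity
    have : 0 ≤ a * (1 + a * |y|) ^ (-(11 / 8) : ℝ) := by positivity
    unfold majorant
    linarith
  constructor
  · rw [envelope, mul_add]
    calc _ ≤ C1 * (2 * majorant a x y) + C2 * majorant a x y := by
          refine add_le_add (k1.trans ?_) k2
          gcongr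
      _ = _ := by ring
  · refine k1.trans ?_
    gcongr
    linarith

/-! ### The soliton: its differential equation and decay. -/

theorem Q_pos {p : ℝ} (hp : 0 < p) (x : ℝ) : 0 < Q p x := by
  have := Real.cosh_pos (p * x / 2)
  unfold Q; positivity

theorem hasDerivAt_Q {p : ℝ} (hp : 0 < p) (x : ℝ) :
    HasDerivAt (Q p) (-(Q p x * Real.tanh (p * x / 2))) x := by
  have hc := Real.cosh_pos (p * x / 2)
  have h0 : HasDerivAt (fun x : ℝ => p * x / 2) (p / 2) x := by
    simpa using ((hasDerivAt_id x).const_mul p).div_const 2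
  have h1 : HasDerivAt (fun x => 1 / Real.cosh (p * x / 2))
      (-(Real.sinh (p * x / 2) * (p / 2)) / Real.cosh (p * x / 2) ^ 2) x := by
    simp only [one_div]
    exact (h0.cosh).inv hc.ne'
  have h2 := (h1.rpow_const (p := 2 / p) (Or.inl (by positivity))).const_mul
    (((p + 2) / 2) ^ (1 / p))
  refine h2.congr_deriv ?_
  rw [Real.rpow_sub_one (by positivity), Q, Real.tanh_eq_sinh_div_cosh]
  field_simp

theorem deriv_Q {p : ℝ} (hp : 0 < p) : deriv (Q p) = fun x => -(Q p x * Real.tanh (p * x / 2)) :=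
  funext fun x => (hasDerivAt_Q hp x).deriv

theorem Q_rpow {p : ℝ} (hp : 0 < p) (x : ℝ) :
    Q p x ^ p = (p + 2) / 2 * (1 / Real.cosh (p * x / 2)) ^ 2 := by
  have hc := Real.cosh_pos (p * x / 2)
  rw [Q, Real.mul_rpow (by positivity) (by positivity), ← Real.rpow_mul (by positivity),
    ← Real.rpow_mul (by positivity), one_div_mul_cancel hp.ne', div_mul_cancel₀ _ hp.ne',
    Real.rpow_one]
  norm_cast

theorem hasDerivAt_tanh_half (p x : ℝ) : HasDerivAt (fun x => Real.tanh (p * x / 2))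
    (p / 2 * (1 / Real.cosh (p * x / 2)) ^ 2) x := by
  have hc := Real.cosh_pos (p * x / 2)
  have h0 : HasDerivAt (fun x : ℝ => p * x / 2) (p / 2) x := by
    simpa using ((hasDerivAt_id x).const_mul p).div_const 2
  have h1 := (h0.sinh).div (h0.cosh) hc.ne'
  refine (h1.congr_of_eventuallyEq (Eventually.of_forall fun y => ?_)).congr_deriv ?_
  · simp [Real.tanh_eq_sinh_div_cosh]
  · have := Real.cosh_sq (p * x / 2)
    field_simp
    linear_combination p * this

/-- This is the profile equation `Q'' = Q - Q^{p+1}`. -/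
theorem hasDerivAt_deriv_Q {p : ℝ} (hp : 0 < p) (x : ℝ) :
    HasDerivAt (deriv (Q p)) (Q p x - Q p x ^ p * Q p x) x := by
  rw [deriv_Q hp]
  refine (((hasDerivAt_Q hp x).mul (hasDerivAt_tanh_half p x)).neg).congr_deriv ?_
  have hc := Real.cosh_pos (p * x / 2)
  have := Real.cosh_sq (p * x / 2)
  rw [Q_rpow hp, Real.tanh_eq_sinh_div_cosh]
  field_simp
  linear_combination (-2 : ℝ) * Q p x * this

theorem continuous_Q {p : ℝ} (hp : 0 < p) : Continuous (Q p) :=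
  continuous_iff_continuousAt.mpr fun x => (hasDerivAt_Q hp x).continuousAt

theorem continuous_deriv_Q {p : ℝ} (hp : 0 < p) : Continuous (deriv (Q p)) :=
  continuous_iff_continuousAt.mpr fun x => (hasDerivAt_deriv_Q hp x).continuousAt

theorem abs_tanh_le_one (x : ℝ) : |Real.tanh x| ≤ 1 :=
  abs_le.mpr ⟨(Real.neg_one_lt_tanh x).le, (Real.tanh_lt_one x).le⟩

theorem one_div_cosh_le (z : ℝ) : 1 / Real.cosh z ≤ 2 * Real.exp (-|z|) := by
  have hc := Real.cosh_pos z
  rw [div_le_iff₀ hc, ← Real.cosh_abs, Real.cosh_eq]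
  have : Real.exp (-|z|) * Real.exp |z| = 1 := by rw [← Real.exp_add]; simp
  nlinarith [sq_nonneg (Real.exp (-|z|))]

theorem Q_le {p : ℝ} (hp : 2 ≤ p) (x : ℝ) : Q p x ≤ (p + 2) * Real.exp (-|x|) := by
  have hp0 : 0 < p := by linarith
  have hc := Real.cosh_pos (p * x / 2)
  have h1 : ((p + 2) / 2) ^ (1 / p) ≤ (p + 2) / 2 := by
    calc _ ≤ ((p + 2) / 2) ^ (1 : ℝ) :=
          Real.rpow_le_rpow_of_exponent_le (by linarith) (by rw [div_le_one hp0]; linarith)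
      _ = _ := Real.rpow_one _
  have h2 : (1 / Real.cosh (p * x / 2)) ^ (2 / p) ≤ 2 * Real.exp (-|x|) := by
    calc _ ≤ (2 * Real.exp (-|p * x / 2|)) ^ (2 / p) := by gcongr; exact one_div_cosh_le _
      _ = 2 ^ (2 / p) * Real.exp (-|x|) := by
        rw [Real.mul_rpow (by norm_num) (by positivity), ← Real.exp_mul, abs_div, abs_mul,
          abs_of_pos hp0, abs_of_pos (by norm_num : (0 : ℝ) < 2)]
        congr 2
        field_simp
      _ ≤ 2 ^ (1 : ℝ) * Real.exp (-|x|) := by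
        gcongr
        · norm_num
        · rw [div_le_one hp0]; exact hp
      _ = _ := by rw [Real.rpow_one]
  calc Q p x ≤ (p + 2) / 2 * (2 * Real.exp (-|x|)) := by unfold Q; gcongr
    _ = _ := by ring

theorem abs_deriv_Q_le {p : ℝ} (hp : 2 ≤ p) (x : ℝ) :
    |deriv (Q p) x| ≤ (p + 2) * Real.exp (-|x|) := by
  have hp0 : 0 < p := by linarith
  rw [deriv_Q hp0, abs_neg, abs_mul, abs_of_pos (Q_pos hp0 x)]
  calc _ ≤ Q p x * 1 := by gcongr; exacts [(Q_pos hp0 x).le, abs_tanh_le_one _]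
    _ ≤ _ := by rw [mul_one]; exact Q_le hp x

theorem Q_rpow_le {p : ℝ} (hp : 2 ≤ p) (x : ℝ) :
    Q p x ^ p ≤ 2 * (p + 2) * Real.exp (-|x|) := by
  have hp0 : 0 < p := by linarith
  have hc := Real.cosh_pos (p * x / 2)
  have h1 := one_div_cosh_le (p * x / 2)
  have h2 : (1 / Real.cosh (p * x / 2)) ^ 2 ≤ 4 * Real.exp (-|x|) := by
    calc _ ≤ (2 * Real.exp (-|p * x / 2|)) ^ 2 := by gcongr
      _ = 4 * Real.exp (-(p * |x|)) := by
        rw [mul_pow, ← Real.exp_nat_mul, abs_div, abs_mul, abs_of_pos hp0,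
          abs_of_pos (by norm_num : (0 : ℝ) < 2)]
        norm_num
        ring
      _ ≤ _ := by gcongr; nlinarith [abs_nonneg x]
  rw [Q_rpow hp0]
  calc _ ≤ (p + 2) / 2 * (4 * Real.exp (-|x|)) := by gcongr
    _ = _ := by ring

section limits

variable {ι : Type*} {l : Filter ι} {P : ι → ℝ} {p₀ : ℝ}

theorem tendsto_Q (hP : Tendsto P l (𝓝 p₀)) (hp : 0 < p₀) (x : ℝ) :
    Tendsto (fun i => Q (P i) x) l (𝓝 (Q p₀ x)) := by
  have hc := Real.cosh_pos (p₀ * x / 2)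
  have h : ContinuousAt (fun p => Q p x) p₀ := by
    unfold Q
    refine ContinuousAt.mul (ContinuousAt.rpow (by fun_prop) ?_ (Or.inl (by positivity)))
      (ContinuousAt.rpow ?_ ?_ (Or.inl (by positivity)))
    · exact continuousAt_const.div continuousAt_id hp.ne'
    · refine continuousAt_const.div ?_ hc.ne'
      exact (Real.continuous_cosh.comp (by fun_prop : Continuous fun p : ℝ => p * x / 2)).continuousAt
    · exact continuousAt_const.div continuousAt_id hp.ne'
  exact h.tendsto.comp hP

theorem tendsto_deriv_Q (hP : Tendsto P l (𝓝 p₀)) (hp : 0 < p₀) (x : ℝ) :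
    Tendsto (fun i => deriv (Q (P i)) x) l (𝓝 (deriv (Q p₀) x)) := by
  have h1 : Tendsto (fun i => Real.tanh (P i * x / 2)) l (𝓝 (Real.tanh (p₀ * x / 2))) := by
    have h2 : ContinuousAt (fun p : ℝ => Real.tanh (x * p / 2)) p₀ :=
      (hasDerivAt_tanh_half x p₀).continuousAt
    have := h2.tendsto.comp hP
    simpa only [mul_comm x, Function.comp_def] using this
  rw [deriv_Q hp]
  refine ((tendsto_Q hP hp x).mul h1).neg.congr' ?_
  filter_upwards [hP.eventually (lt_mem_nhds hp)] with i hi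
  rw [deriv_Q hi]

theorem tendsto_Q_rpow (hP : Tendsto P l (𝓝 p₀)) (hp : 0 < p₀) (x : ℝ) :
    Tendsto (fun i => Q (P i) x ^ P i) l (𝓝 (Q p₀ x ^ p₀)) :=
  (tendsto_Q hP hp x).rpow hP (Or.inl (Q_pos hp x).ne')

end limits

end GKdV

end

noncomputable section

open Filter Topology MeasureTheory BoundedContinuousFunction

namespace GKdV

/-! ### Integral operators on bounded continuous functions. -/

theorem integrable_mul_bcf {φ : ℝ → ℝ} (hφ : Integrable φ) (u : ℝ →ᵇ ℝ) :
    Integrable (fun y => φ y * u y) :=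
  hφ.mul_bdd (c := ‖u‖) u.continuous.aestronglyMeasurable (Eventually.of_forall u.norm_coe_le_norm)

theorem abs_integral_mul_bcf_le {φ : ℝ → ℝ} (hφ : Integrable φ) (u : ℝ →ᵇ ℝ) :
    |∫ y, φ y * u y| ≤ (∫ y, |φ y|) * ‖u‖ := by
  rw [← integral_mul_const]
  refine (abs_integral_le_integral_abs).trans (integral_mono (integrable_mul_bcf hφ u).abs
    (hφ.abs.mul_const _) fun y => ?_)
  simp only [abs_mul]
  gcongr
  exact u.norm_coe_le_norm y

/-- Integration against an integrable function, as a functional on bounded continuous functions. -/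
def pairing (φ : ℝ → ℝ) (hφ : Integrable φ) : (ℝ →ᵇ ℝ) →L[ℝ] ℝ :=
  LinearMap.mkContinuous
    { toFun := fun u => ∫ y, φ y * u y
      map_add' := fun u v => by
        rw [← integral_add (integrable_mul_bcf hφ u) (integrable_mul_bcf hφ v)]
        simp only [BoundedContinuousFunction.add_apply, mul_add]
      map_smul' := fun c u => by
        simp only [BoundedContinuousFunction.coe_smul, smul_eq_mul, RingHom.id_apply]
        rw [← integral_const_mul]
        congr 1
        funext y
        ring } (∫ y, |φ y|) (abs_integral_mul_bcf_le hφ)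

theorem pairing_apply {φ : ℝ → ℝ} (hφ : Integrable φ) (u : ℝ →ᵇ ℝ) :
    pairing φ hφ u = ∫ y, φ y * u y := rfl

theorem norm_pairing_sub_le {φ ψ : ℝ → ℝ} (hφ : Integrable φ) (hψ : Integrable ψ) :
    ‖pairing φ hφ - pairing ψ hψ‖ ≤ ∫ y, |φ y - ψ y| := by
  refine ContinuousLinearMap.opNorm_le_bound _ (integral_nonneg fun y => abs_nonneg _) fun u => ?_
  rw [_root_.sub_apply, pairing_apply, pairing_apply,
    ← integral_sub (integrable_mul_bcf hφ u) (integrable_mul_bcf hψ u)]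
  simp only [← sub_mul]
  exact abs_integral_mul_bcf_le (hφ.sub hψ) u

/-- Continuity of the image is dominated convergence. The diagonal `y = x₀` is a null set, so
continuity of the kernel away from it is enough; for `a > 0` the kernel is defined by cases there.
-/
theorem exists_clm_of_kernel {k bd : ℝ → ℝ → ℝ} {N : ℝ}
    (hm : ∀ x, AEStronglyMeasurable (k x)) (hc : ∀ x₀ y, x₀ ≠ y → ContinuousAt (fun x => k x y) x₀)
    (hb : ∀ x y, |k x y| ≤ bd x y) (hloc : ∀ x x' y, |x - x'| ≤ 1 → bd x y ≤ 2 * bd x' y)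
    (hi : ∀ x, Integrable (bd x)) (hN : ∀ x, ∫ y, bd x y ≤ N) :
    ∃ A : (ℝ →ᵇ ℝ) →L[ℝ] (ℝ →ᵇ ℝ), ∀ u x, A u x = ∫ y, k x y * u y := by
  have hk : ∀ x, Integrable (k x) := fun x => (hi x).mono' (hm x) (Eventually.of_forall (hb x))
  have hle : ∀ (u : ℝ →ᵇ ℝ) (x : ℝ), |∫ y, k x y * u y| ≤ N * ‖u‖ := fun u x => by
    refine (abs_integral_mul_bcf_le (hk x) u).trans ?_
    gcongr
    exact (integral_mono (hk x).abs (hi x) (hb x)).trans (hN x)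
  have hcont : ∀ u : ℝ →ᵇ ℝ, Continuous fun x => ∫ y, k x y * u y := by
    intro u
    refine continuous_iff_continuousAt.mpr fun x₀ => ?_
    refine tendsto_integral_filter_of_dominated_convergence (fun y => 2 * bd x₀ y * ‖u‖)
      (Eventually.of_forall fun x => (integrable_mul_bcf (hk x) u).aestronglyMeasurable) ?_
      (((hi x₀).const_mul 2).mul_const _) ?_
    · filter_upwards [Metric.ball_mem_nhds x₀ one_pos] with x hx
      refine Eventually.of_forall fun y => ?_
      rw [norm_mul]
      gcongr
      · exact (abs_nonneg _).trans ((hb x y).trans (hloc x x₀ y (le_of_lt hx)))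
      · exact (hb x y).trans (hloc x x₀ y (le_of_lt hx))
      · exact u.norm_coe_le_norm y
    · have : ∀ᵐ y : ℝ, y ≠ x₀ := by simp [ae_iff]
      filter_upwards [this] with y hy
      exact ((hc x₀ y hy.symm).tendsto).mul_const _
  let T (u : ℝ →ᵇ ℝ) : ℝ →ᵇ ℝ := BoundedContinuousFunction.ofNormedAddCommGroup
    (fun x => ∫ y, k x y * u y) (hcont u) (N * ‖u‖) (hle u)
  have hN0 : 0 ≤ N := (integral_nonneg fun y => (abs_nonneg _).trans (hb 0 y)).trans (hN 0)
  refine ⟨LinearMap.mkContinuous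
    { toFun := T
      map_add' := fun u v => by
        ext x
        change ∫ y, k x y * (u + v) y = (∫ y, k x y * u y) + ∫ y, k x y * v y
        rw [← integral_add (integrable_mul_bcf (hk x) u) (integrable_mul_bcf (hk x) v)]
        simp only [BoundedContinuousFunction.add_apply, mul_add]
      map_smul' := fun c u => by
        ext x
        change ∫ y, k x y * (c • u) y = c * ∫ y, k x y * u y
        rw [← integral_const_mul]
        congr 1
        funext y
        simp only [BoundedContinuousFunction.coe_smul, smul_eq_mul]
        ring } N fun u => ?_, fun u x => rfl⟩
  exact (BoundedContinuousFunction.norm_le (by positivity)).mpr (hle u)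

theorem norm_sub_le_of_kernel {k₁ k₂ : ℝ → ℝ → ℝ} {A₁ A₂ : (ℝ →ᵇ ℝ) →L[ℝ] (ℝ →ᵇ ℝ)} {ε : ℝ}
    (h₁ : ∀ u x, A₁ u x = ∫ y, k₁ x y * u y) (h₂ : ∀ u x, A₂ u x = ∫ y, k₂ x y * u y)
    (i₁ : ∀ x, Integrable (k₁ x)) (i₂ : ∀ x, Integrable (k₂ x))
    (hε : ∀ x, ∫ y, |k₁ x y - k₂ x y| ≤ ε) : ‖A₁ - A₂‖ ≤ ε := by
  have hε0 : 0 ≤ ε := (integral_nonneg fun y => abs_nonneg _).trans (hε 0)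
  refine ContinuousLinearMap.opNorm_le_bound _ hε0 fun u => ?_
  refine (BoundedContinuousFunction.norm_le (by positivity)).mpr fun x => ?_
  rw [_root_.sub_apply, BoundedContinuousFunction.sub_apply, h₁, h₂,
    ← integral_sub (integrable_mul_bcf (i₁ x) u) (integrable_mul_bcf (i₂ x) u)]
  simp only [← sub_mul]
  exact (abs_integral_mul_bcf_le ((i₁ x).sub (i₂ x)) u).trans (by gcongr; exact hε x)

/-- Continuous functions dominated by the envelope. -/
def IsDensity (a γ : ℝ) (F : ℝ → ℝ) : Prop :=
  Continuous F ∧ ∃ β : ℝ, ∀ y, |F y| ≤ β * envelope a γ y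

theorem envelope_pos (a γ y : ℝ) : 0 < envelope a γ y := by
  unfold envelope
  have := Real.exp_pos (-|y|)
  positivity

theorem exp_le_envelope (a γ y : ℝ) : Real.exp (-|y|) ≤ envelope a γ y := by
  unfold envelope
  have : 0 ≤ weight a γ y ^ 4 := by positivity
  linarith

theorem isDensity_of_le_exp {a γ : ℝ} {F : ℝ → ℝ} (hF : Continuous F) {β : ℝ}
    (h : ∀ y, |F y| ≤ β * Real.exp (-|y|)) : IsDensity a γ F := by
  have hβ : 0 ≤ β := by
    have := (abs_nonneg _).trans (h 0)
    simpa using this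
  exact ⟨hF, β, fun y => (h y).trans (by gcongr; exact exp_le_envelope a γ y)⟩

theorem wkernel_density_bound {a γ : ℝ} (hγ : γ ∈ gammaRange) (ha : 0 ≤ a) (ha1 : a ≤ 1)
    {F : ℝ → ℝ} (hF : IsDensity a γ F) :
    ∃ D : ℝ, ∀ x y, |wkernel a γ x y * F y| ≤ D * majorant a x y := by
  obtain ⟨C, hC, h⟩ := wkernel_bounds
  obtain ⟨-, β, hβ⟩ := hF
  have hβ0 : 0 ≤ β := by
    have := (abs_nonneg _).trans (hβ 0)
    exact nonneg_of_mul_nonneg_left this (envelope_pos a γ 0)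
  refine ⟨β * C, fun x y => ?_⟩
  rw [abs_mul]
  calc _ ≤ |wkernel a γ x y| * (β * envelope a γ y) := by gcongr; exact hβ y
    _ = β * (|wkernel a γ x y| * envelope a γ y) := by ring
    _ ≤ β * (C * majorant a x y) := by exact mul_le_mul_of_nonneg_left (h γ hγ a ha ha1 x y).1 (by positivity)
    _ = _ := by ring

theorem measurable_wkernel {a γ : ℝ} (hγ : γ ∈ gammaRange) (ha : 0 ≤ a) (ha1 : a ≤ 1) (x : ℝ) :
    Measurable (fun y => wkernel a γ x y) := (measurable_kernel hγ ha ha1 x).const_mul _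

theorem integrable_wkernel_mul {a γ : ℝ} (hγ : γ ∈ gammaRange) (ha : 0 ≤ a) (ha1 : a ≤ 1)
    {F : ℝ → ℝ} (hF : IsDensity a γ F) (x : ℝ) :
    Integrable (fun y => wkernel a γ x y * F y) := by
  obtain ⟨D, hD⟩ := wkernel_density_bound hγ ha ha1 hF
  exact ((integrable_majorant ha x).const_mul D).mono'
    ((measurable_wkernel hγ ha ha1 x).mul hF.1.measurable).aestronglyMeasurable
    (Eventually.of_forall (hD x))

theorem exists_kernelOp {a γ : ℝ} (hγ : γ ∈ gammaRange) (ha : 0 ≤ a) (ha1 : a ≤ 1)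
    {F : ℝ → ℝ} (hF : IsDensity a γ F) : ∃ A : (ℝ →ᵇ ℝ) →L[ℝ] (ℝ →ᵇ ℝ),
      ∀ u x, A u x = ∫ y, wkernel a γ x y * F y * u y := by
  obtain ⟨D, hD⟩ := wkernel_density_bound hγ ha ha1 hF
  obtain ⟨N, hN0, hN⟩ := integral_majorant_le
  have hD0 : 0 ≤ D := by
    have := (abs_nonneg _).trans (hD 0 0)
    have hm : 0 < majorant a 0 0 := by
      have : 0 < Real.exp (-|(0 : ℝ)| / 16) := Real.exp_pos _
      unfold majorant; positivity
    exact nonneg_of_mul_nonneg_left this hm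
  refine exists_clm_of_kernel (k := fun x y => wkernel a γ x y * F y)
    (bd := fun x y => D * majorant a x y) (N := D * N)
    (fun x => (integrable_wkernel_mul hγ ha ha1 hF x).aestronglyMeasurable) ?_ hD ?_
    (fun x => (integrable_majorant ha x).const_mul D) ?_
  · intro x₀ y hne
    have h1 : ContinuousAt (fun x => (weight a γ x)⁻¹) x₀ :=
      (continuous_weight ha ha1).continuousAt.inv₀ (weight_pos' ha ha1 x₀).ne'
    exact (h1.mul (continuousAt_kernel hγ ha ha1 hne)).mul continuousAt_const
  · intro x x' y h
    have := majorant_le (y := y) ha h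
    nlinarith
  · intro x
    rw [integral_const_mul]
    gcongr
    exact hN a ha x

open Classical in
/-- The operator with kernel `w⁻¹(x) K(x, y) F(y)`. -/
def kernelOp (a γ : ℝ) (F : ℝ → ℝ) : (ℝ →ᵇ ℝ) →L[ℝ] (ℝ →ᵇ ℝ) :=
  if h : ∃ A : (ℝ →ᵇ ℝ) →L[ℝ] (ℝ →ᵇ ℝ), ∀ u x, A u x = ∫ y, wkernel a γ x y * F y * u y
  -- The value `0` is a default: for admissible parameters and densities the first case holds by
  -- `exists_kernelOp`.
  then h.choose else 0

theorem kernelOp_apply {a γ : ℝ} (hγ : γ ∈ gammaRange) (ha : 0 ≤ a) (ha1 : a ≤ 1)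
    {F : ℝ → ℝ} (hF : IsDensity a γ F) (u : ℝ →ᵇ ℝ) (x : ℝ) :
    kernelOp a γ F u x = ∫ y, wkernel a γ x y * F y * u y := by
  have h := exists_kernelOp hγ ha ha1 hF
  rw [kernelOp, dif_pos h]
  exact h.choose_spec u x

/-- The norm on `C_b` is controlled by the supremum over `x` of the integral of the kernel in `y`,
and the majorant bounds this uniformly. -/
theorem norm_kernelOp_sub_le : ∃ C : ℝ, 0 < C ∧ ∀ γ ∈ gammaRange, ∀ a : ℝ, 0 ≤ a → a ≤ 1 →
    ∀ F F' : ℝ → ℝ, IsDensity a γ F → IsDensity a γ F' → ∀ β : ℝ,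
    (∀ y, |F y - F' y| ≤ β * envelope a γ y) →
    ‖kernelOp a γ F - kernelOp a γ F'‖ ≤ C * β := by
  obtain ⟨C, hC, h⟩ := wkernel_bounds
  obtain ⟨N, hN0, hN⟩ := integral_majorant_le
  refine ⟨C * N, by positivity, fun γ hγ a ha ha1 F F' hF hF' β hβ => ?_⟩
  have hβ0 : 0 ≤ β := nonneg_of_mul_nonneg_left ((abs_nonneg _).trans (hβ 0)) (envelope_pos a γ 0)
  refine norm_sub_le_of_kernel (kernelOp_apply hγ ha ha1 hF) (kernelOp_apply hγ ha ha1 hF')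
    (integrable_wkernel_mul hγ ha ha1 hF) (integrable_wkernel_mul hγ ha ha1 hF') fun x => ?_
  calc _ ≤ ∫ y, C * β * majorant a x y := by
        refine integral_mono ((integrable_wkernel_mul hγ ha ha1 hF x).sub
          (integrable_wkernel_mul hγ ha ha1 hF' x)).abs ((integrable_majorant ha x).const_mul _)
          fun y => ?_
        simp only [← mul_sub, abs_mul]
        calc _ ≤ |wkernel a γ x y| * (β * envelope a γ y) := by gcongr; exact hβ y
          _ = β * (|wkernel a γ x y| * envelope a γ y) := by ring
          _ ≤ β * (C * majorant a x y) := by exact mul_le_mul_of_nonneg_left (h γ hγ a ha ha1 x y).1 (by positivity)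
          _ = _ := by ring
    _ = C * β * ∫ y, majorant a x y := integral_const_mul _ _
    _ ≤ C * β * N := by gcongr; exact hN a ha x
    _ = _ := by ring

/-- Norm convergence requires `∫ |k_i - k_0| dy → 0` uniformly in `x`. Large `|x|` is covered by the
bound `e^{-|x|/16} + a`, compact sets of `x` by dominated convergence; the latter is why the filter
is countably generated. -/
theorem tendsto_kernelOp {ι : Type*} {l : Filter ι} [l.IsCountablyGenerated] {A G : ι → ℝ}
    {γ₀ β : ℝ} (hγ₀ : γ₀ ∈ gammaRange) (hA : Tendsto A l (𝓝[≥] 0))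
    (hG : ∀ᶠ i in l, G i ∈ gammaRange) {F : ι → ℝ → ℝ} {F₀ : ℝ → ℝ}
    (hFc : ∀ᶠ i in l, Continuous (F i)) (hFb : ∀ᶠ i in l, ∀ y, |F i y| ≤ β * Real.exp (-|y|))
    (hF₀c : Continuous F₀) (hF₀b : ∀ y, |F₀ y| ≤ β * Real.exp (-|y|))
    (hF : ∀ y, Tendsto (fun i => F i y) l (𝓝 (F₀ y))) :
    Tendsto (fun i => kernelOp (A i) (G i) (F i)) l (𝓝 (kernelOp 0 γ₀ F₀)) := by
  obtain ⟨C, hC, hbd⟩ := wkernel_bounds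
  have hβ : 0 ≤ β := by simpa using (abs_nonneg _).trans (hF₀b 0)
  have hA0 : ∀ᶠ i in l, 0 ≤ A i := hA.eventually self_mem_nhdsWithin
  have hA' : Tendsto A l (𝓝 0) := hA.mono_right nhdsWithin_le_nhds
  have hA1 : ∀ᶠ i in l, A i ≤ 1 := hA'.eventually (ge_mem_nhds one_pos)
  have i16 : Integrable fun y : ℝ => Real.exp (-|y| / 16) := integrable_exp_neg_abs_div (by norm_num)
  set J := ∫ y : ℝ, Real.exp (-|y| / 16)
  have hJ : 0 ≤ J := integral_nonneg fun y => by positivity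
  have hpt : ∀ a : ℝ, 0 ≤ a → a ≤ 1 → ∀ γ ∈ gammaRange, ∀ f : ℝ → ℝ,
      (∀ y, |f y| ≤ β * Real.exp (-|y|)) → ∀ x y : ℝ,
      |wkernel a γ x y * f y| ≤ β * C * ((Real.exp (-|x| / 16) + a) * Real.exp (-|y| / 16)) := by
    intro a ha ha1 γ hγ f hf x y
    rw [abs_mul]
    calc _ ≤ |wkernel a γ x y| * (β * Real.exp (-|y|)) := by gcongr; exact hf y
      _ = β * (|wkernel a γ x y| * Real.exp (-|y|)) := by ring
      _ ≤ β * (C * ((Real.exp (-|x| / 16) + a) * Real.exp (-|y| / 16))) := by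
          exact mul_le_mul_of_nonneg_left (hbd γ hγ a ha ha1 x y).2 hβ
      _ = _ := by ring
  have hdiff : ∀ᶠ i in l, ∀ x y, |wkernel (A i) (G i) x y * F i y - wkernel 0 γ₀ x y * F₀ y|
      ≤ 2 * (β * C) * ((Real.exp (-|x| / 16) + A i) * Real.exp (-|y| / 16)) := by
    filter_upwards [hA0, hA1, hG, hFb] with i h0 h1 hg hf x y
    have e1 := hpt _ h0 h1 _ hg _ hf x y
    have e2 := hpt 0 le_rfl zero_le_one _ hγ₀ _ hF₀b x y
    have e3 : β * C * ((Real.exp (-|x| / 16) + 0) * Real.exp (-|y| / 16))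
        ≤ β * C * ((Real.exp (-|x| / 16) + A i) * Real.exp (-|y| / 16)) := by gcongr
    refine (abs_sub _ _).trans ?_
    linarith
  have hint : ∀ᶠ i in l, ∀ x, Integrable
      (fun y => wkernel (A i) (G i) x y * F i y - wkernel 0 γ₀ x y * F₀ y) := by
    filter_upwards [hA0, hA1, hG, hFb, hFc] with i h0 h1 hg hf hc x
    exact (integrable_wkernel_mul hg h0 h1 (isDensity_of_le_exp hc hf) x).sub
      (integrable_wkernel_mul hγ₀ le_rfl zero_le_one (isDensity_of_le_exp hF₀c hF₀b) x)
  have hunif : ∀ ε > 0, ∀ᶠ i in l, ∀ x,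
      ∫ y, |wkernel (A i) (G i) x y * F i y - wkernel 0 γ₀ x y * F₀ y| ≤ ε := by
    intro ε hε
    have hlim : ∀ᶠ q in (𝓝[≥] (0 : ℝ)) ×ˢ (atTop : Filter ℝ),
        2 * (β * C) * ((Real.exp (-q.2 / 16) + q.1) * J) ≤ ε := by
      have t1 : Tendsto (fun q : ℝ × ℝ => Real.exp (-q.2 / 16)) (𝓝[≥] (0 : ℝ) ×ˢ atTop) (𝓝 0) := by
        refine Real.tendsto_exp_atBot.comp ?_
        have : Tendsto (fun m : ℝ => -m / 16) atTop atBot :=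
          tendsto_neg_atTop_atBot.atBot_div_const (by norm_num)
        exact this.comp tendsto_snd
      have t2 : Tendsto (fun q : ℝ × ℝ => q.1) (𝓝[≥] (0 : ℝ) ×ˢ atTop) (𝓝 0) :=
        tendsto_fst.mono_right nhdsWithin_le_nhds
      have t3 := ((t1.add t2).mul_const J).const_mul (2 * (β * C))
      rw [add_zero, zero_mul, mul_zero] at t3
      exact t3.eventually (ge_mem_nhds hε)
    -- For `|x| ≥ M` the integral is small as soon as `a` is small; only `[-M, M]` remains.
    obtain ⟨M, hM⟩ : ∃ M : ℝ, ∀ᶠ i in l,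
        2 * (β * C) * ((Real.exp (-M / 16) + A i) * J) ≤ ε := by
      obtain ⟨pa, hpa, pb, hpb, hab⟩ := eventually_prod_iff.mp hlim
      obtain ⟨M, hM⟩ := hpb.exists
      exact ⟨M, (hA.eventually hpa).mono fun i hi => hab hi hM⟩
    -- The limit is taken jointly in the parameters and in `x → x₀`, so the estimate holds on a
    -- neighbourhood of each `x₀`, and compactness patches these together.
    have hcomp : ∀ x₀ ∈ Set.Icc (-M) M, {q : ι × ℝ |
        ∫ y, |wkernel (A q.1) (G q.1) q.2 y * F q.1 y - wkernel 0 γ₀ q.2 y * F₀ y| ≤ ε}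
        ∈ l ×ˢ 𝓝 x₀ := by
      intro x₀ _
      have ht : Tendsto (fun q : ι × ℝ => ∫ y, |wkernel (A q.1) (G q.1) q.2 y * F q.1 y
          - wkernel 0 γ₀ q.2 y * F₀ y|) (l ×ˢ 𝓝 x₀) (𝓝 (∫ _ : ℝ, (0 : ℝ))) := by
        refine tendsto_integral_filter_of_dominated_convergence
          (fun y => 2 * (β * C) * (2 * Real.exp (-|y| / 16))) ?_ ?_
          ((i16.const_mul 2).const_mul _) ?_
        · filter_upwards [tendsto_fst.eventually hint] with q hq
          exact (hq q.2).abs.aestronglyMeasurable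
        · filter_upwards [tendsto_fst.eventually hdiff, tendsto_fst.eventually hA1,
            tendsto_fst.eventually hA0] with q hq h1 h0
          refine Eventually.of_forall fun y => ?_
          rw [Real.norm_eq_abs, abs_abs]
          refine (hq q.2 y).trans ?_
          gcongr
          have : Real.exp (-|q.2| / 16) ≤ 1 :=
            Real.exp_le_one_iff.mpr (by linarith [abs_nonneg q.2])
          linarith
        · have : ∀ᵐ y : ℝ, y ≠ x₀ := by simp [ae_iff]
          filter_upwards [this] with y hy
          have hAq : Tendsto (fun q : ι × ℝ => A q.1) (l ×ˢ 𝓝 x₀) (𝓝[≥] 0) := hA.comp tendsto_fst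
          have hXq : Tendsto (fun q : ι × ℝ => q.2) (l ×ˢ 𝓝 x₀) (𝓝 x₀) := tendsto_snd
          have hGq : ∀ᶠ q : ι × ℝ in l ×ˢ 𝓝 x₀, G q.1 ∈ gammaRange := tendsto_fst.eventually hG
          have w0 : weight 0 γ₀ x₀ ≠ 0 := (weight_pos' le_rfl zero_le_one x₀).ne'
          have k1 := ((tendsto_weight γ₀ hAq hXq hGq).inv₀ w0).mul
            (tendsto_kernel γ₀ hAq hXq hGq hy.symm)
          have k2 : Tendsto (fun q : ι × ℝ => wkernel 0 γ₀ q.2 y) (l ×ˢ 𝓝 x₀)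
              (𝓝 (wkernel 0 γ₀ x₀ y)) := by
            have : ContinuousAt (fun x => wkernel 0 γ₀ x y) x₀ :=
              ((continuous_weight le_rfl zero_le_one).continuousAt.inv₀ w0).mul
                (continuousAt_kernel hγ₀ le_rfl zero_le_one hy.symm)
            exact this.tendsto.comp hXq
          have k3 := ((k1.mul ((hF y).comp tendsto_fst)).sub (k2.mul_const (F₀ y))).abs
          rw [← wkernel, sub_self, abs_zero] at k3
          exact k3
      rw [integral_zero] at ht
      exact ht.eventually (ge_mem_nhds hε)
    have hset := isCompact_Icc.mem_prod_nhdsSet_of_forall hcomp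
    obtain ⟨t1, ht1, t2, ht2, hsub⟩ := mem_prod_iff.mp hset
    filter_upwards [ht1, hM, hdiff, hint, hA0] with i hi hMi hd hin h0 x
    by_cases hx : x ∈ Set.Icc (-M) M
    · exact hsub (Set.mk_mem_prod hi (subset_of_mem_nhdsSet ht2 hx))
    · have hxM : M ≤ |x| := by
        by_contra hcon
        exact hx (abs_le.mp (not_le.mp hcon).le)
      calc _ ≤ ∫ y, 2 * (β * C) * ((Real.exp (-|x| / 16) + A i) * Real.exp (-|y| / 16)) :=
            integral_mono (hin x).abs ((i16.const_mul _).const_mul _) (hd x)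
        _ = 2 * (β * C) * ((Real.exp (-|x| / 16) + A i) * J) := by
            rw [integral_const_mul, integral_const_mul]
        _ ≤ 2 * (β * C) * ((Real.exp (-M / 16) + A i) * J) := by gcongr
        _ ≤ ε := hMi
  refine (tendsto_iff_norm_sub_tendsto_zero (E := (ℝ →ᵇ ℝ) →L[ℝ] (ℝ →ᵇ ℝ))).mpr
    (Metric.tendsto_nhds.mpr fun ε hε => ?_)
  filter_upwards [hunif (ε / 2) (by positivity), hA0, hA1, hG, hFb, hFc] with i hi h0 h1 hg hf hc
  rw [dist_zero_right, norm_norm]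
  have d1 : IsDensity (A i) (G i) (F i) := isDensity_of_le_exp hc hf
  have d2 : IsDensity 0 γ₀ F₀ := isDensity_of_le_exp hF₀c hF₀b
  refine (norm_sub_le_of_kernel (kernelOp_apply hg h0 h1 d1)
    (kernelOp_apply hγ₀ le_rfl zero_le_one d2) (integrable_wkernel_mul hg h0 h1 d1)
    (integrable_wkernel_mul hγ₀ le_rfl zero_le_one d2) hi).trans_lt (by linarith)

/-! ### Compactness in the unperturbed case. -/

theorem isCompactOperator_smulRight (ℓ : (ℝ →ᵇ ℝ) →L[ℝ] ℝ) (g : ℝ →ᵇ ℝ) :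
    IsCompactOperator (ℓ.smulRight g) :=
  ((isCompactOperator_id (E := ℝ)).comp_clm ℓ).clm_comp
    ((ContinuousLinearMap.id ℝ ℝ).smulRight g)

theorem abs_wkernel_zero_mul_exp_le {γ : ℝ} (hγ : γ ∈ gammaRange) : ∃ C : ℝ, 0 < C ∧ ∀ x y : ℝ,
    |wkernel 0 γ x y| * Real.exp (-|y|) ≤ C * Real.exp (-|y| / 16) := by
  obtain ⟨C, hC, h⟩ := wkernel_bounds
  refine ⟨C, hC, fun x y => ((h γ hγ 0 le_rfl zero_le_one x y).2).trans ?_⟩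
  have h1 : Real.exp (-|x| / 16) ≤ 1 := Real.exp_le_one_iff.mpr (by linarith [abs_nonneg x])
  have h2 : (Real.exp (-|x| / 16) + 0) * Real.exp (-|y| / 16) ≤ 1 * Real.exp (-|y| / 16) := by
    gcongr; linarith
  rw [one_mul] at h2
  gcongr

theorem continuous_wkernel_zero (γ y : ℝ) : Continuous (fun x => wkernel 0 γ x y) := by
  unfold wkernel
  simp only [kernel_zero]
  exact ((continuous_weight le_rfl zero_le_one).inv₀ fun x =>
    (weight_pos' le_rfl zero_le_one x).ne').mul (by fun_prop)

theorem exists_wkernel_slice {γ : ℝ} (hγ : γ ∈ gammaRange) (y : ℝ) :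
    ∃ g : ℝ →ᵇ ℝ, ∀ x, g x = wkernel 0 γ x y := by
  obtain ⟨C, hC, h⟩ := abs_wkernel_zero_mul_exp_le hγ
  refine ⟨BoundedContinuousFunction.ofNormedAddCommGroup (fun x => wkernel 0 γ x y)
    (continuous_wkernel_zero γ y) (C * Real.exp (-|y| / 16) / Real.exp (-|y|)) fun x => ?_,
    fun x => rfl⟩
  rw [le_div_iff₀ (Real.exp_pos _)]
  exact h x y

/-- A shift of `y` by `η` changes `e^{-|x-y|}` by a factor between `e^{-η}` and `e^η`. The relative
form of the bound makes the weight in `x` irrelevant. -/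
theorem wkernel_zero_sub_le (γ x : ℝ) {y z η : ℝ} (h : |y - z| ≤ η) :
    |wkernel 0 γ x y - wkernel 0 γ x z| ≤ (Real.exp η - 1) * |wkernel 0 γ x y| := by
  have hw : 0 < (weight 0 γ x)⁻¹ := inv_pos.mpr (weight_pos' le_rfl zero_le_one x)
  have hη : 0 ≤ η := (abs_nonneg _).trans h
  have key : |Real.exp (-|x - y|) - Real.exp (-|x - z|)|
      ≤ (Real.exp η - 1) * Real.exp (-|x - y|) := by
    have e1 : Real.exp (-|x - z|) ≤ Real.exp η * Real.exp (-|x - y|) := by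
      rw [← Real.exp_add]
      gcongr
      have : |x - y| ≤ |x - z| + |y - z| := by
        calc |x - y| = |(x - z) - (y - z)| := by ring_nf
          _ ≤ _ := abs_sub _ _
      linarith
    have e2 : Real.exp (-η) * Real.exp (-|x - y|) ≤ Real.exp (-|x - z|) := by
      rw [← Real.exp_add]
      gcongr
      have : |x - z| ≤ |x - y| + |y - z| := by
        calc |x - z| = |(x - y) + (y - z)| := by ring_nf
          _ ≤ _ := abs_add_le _ _
      linarith
    have e3 : 1 - Real.exp (-η) ≤ Real.exp η - 1 := by
      have := Real.add_one_le_exp η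
      have := Real.add_one_le_exp (-η)
      linarith
    have e4 : (1 - Real.exp (-η)) * Real.exp (-|x - y|)
        ≤ (Real.exp η - 1) * Real.exp (-|x - y|) := by gcongr
    rw [abs_le]
    constructor <;> nlinarith
  have e : ∀ s, wkernel 0 γ x s = (weight 0 γ x)⁻¹ * (1 / 2) * Real.exp (-|x - s|) := by
    intro s
    rw [wkernel, kernel_zero]; ring
  have hc : 0 < (weight 0 γ x)⁻¹ * (1 / 2) := by positivity
  rw [e, e, ← mul_sub, abs_mul, abs_mul _ (Real.exp _), abs_of_pos hc, abs_of_pos (Real.exp_pos _)]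
  calc _ ≤ (weight 0 γ x)⁻¹ * (1 / 2) * ((Real.exp η - 1) * Real.exp (-|x - y|)) :=
        mul_le_mul_of_nonneg_left key hc.le
    _ = _ := by ring

/-- The part of `F` living on the cell `{y | ⌊n y⌋ = j}`. -/
def cell (F : ℝ → ℝ) (n : ℕ) (j : ℤ) : ℝ → ℝ :=
  Set.indicator {y | ⌊(n : ℝ) * y⌋ = j} F

theorem measurableSet_cell (n : ℕ) (j : ℤ) : MeasurableSet {y : ℝ | ⌊(n : ℝ) * y⌋ = j} :=
  measurableSet_eq_fun (by fun_prop) measurable_const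

theorem sum_cell (F : ℝ → ℝ) (n : ℕ) (s : Finset ℤ) (m : ℤ → ℝ) (y : ℝ) :
    ∑ j ∈ s, m j * cell F n j y
      = if ⌊(n : ℝ) * y⌋ ∈ s then m ⌊(n : ℝ) * y⌋ * F y else 0 := by
  have h : ∀ j, m j * cell F n j y = if ⌊(n : ℝ) * y⌋ = j then m j * F y else 0 := by
    intro j
    by_cases hj : ⌊(n : ℝ) * y⌋ = j
    · rw [cell, Set.indicator_of_mem (by exact hj), if_pos hj]
    · rw [cell, Set.indicator_of_notMem (by exact hj), if_neg hj, mul_zero]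
  simp only [h, Finset.sum_ite_eq]

/-- The kernel is frozen in `y` on cells of length `1/n`, which gives finite rank operators `B n`
built from the slices `x ↦ wkernel 0 γ x (j/n)`. They converge in norm because the density is
exponentially localized. -/
theorem isCompactOperator_kernelOp_zero {γ β : ℝ} (hγ : γ ∈ gammaRange) {F : ℝ → ℝ}
    (hFc : Continuous F) (hF : ∀ y, |F y| ≤ β * Real.exp (-|y|)) :
    IsCompactOperator (kernelOp 0 γ F) := by
  obtain ⟨C, hC, hk⟩ := abs_wkernel_zero_mul_exp_le hγ
  have hβ : 0 ≤ β := by simpa using (abs_nonneg _).trans (hF 0)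
  have hFi : Integrable F := (integrable_exp_neg_abs.const_mul β).mono'
    hFc.aestronglyMeasurable (Eventually.of_forall hF)
  have hci : ∀ n j, Integrable (cell F n j) := fun n j => hFi.indicator (measurableSet_cell n j)
  choose g hg using fun y => exists_wkernel_slice hγ y
  have i32 : Integrable fun y : ℝ => Real.exp (-|y| / 32) := integrable_exp_neg_abs_div (by norm_num)
  -- With cells of length `1/n`, the indices from `-n²` to `n² - 1` cover exactly `[-n, n)`.
  set s : ℕ → Finset ℤ := fun n => Finset.Ico (-(n ^ 2 : ℤ)) (n ^ 2)
  let B (n : ℕ) : (ℝ →ᵇ ℝ) →L[ℝ] (ℝ →ᵇ ℝ) :=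
    ∑ j ∈ s n, (pairing (cell F n j) (hci n j)).smulRight (g (j / n))
  have hBc : ∀ n, IsCompactOperator (B n) := fun n =>
    Submodule.sum_mem (compactOperator (RingHom.id ℝ) (ℝ →ᵇ ℝ) (ℝ →ᵇ ℝ))
      fun j _ => isCompactOperator_smulRight _ _
  let k (n : ℕ) (x y : ℝ) : ℝ := ∑ j ∈ s n, wkernel 0 γ x (j / n) * cell F n j y
  have hki : ∀ n x, Integrable (k n x) := fun n x =>
    integrable_finsetSum _ fun j _ => (hci n j).const_mul _
  have hB : ∀ n u x, B n u x = ∫ y, k n x y * u y := by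
    intro n u x
    simp only [B, k, Finset.sum_mul, mul_assoc]
    rw [integral_finsetSum _ fun j _ => (integrable_mul_bcf (hci n j) u).const_mul _]
    simp only [_root_.sum_apply, BoundedContinuousFunction.sum_apply,
      ContinuousLinearMap.smulRight_apply, BoundedContinuousFunction.coe_smul, hg, pairing_apply,
      integral_const_mul, smul_eq_mul]
    exact Finset.sum_congr rfl fun j _ => mul_comm _ _
  have hd : IsDensity 0 γ F := isDensity_of_le_exp hFc hF
  have hAi := integrable_wkernel_mul hγ le_rfl zero_le_one hd
  have hAF : ∀ x y, |wkernel 0 γ x y * F y| ≤ β * C * Real.exp (-|y| / 16) := by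
    intro x y
    rw [abs_mul]
    calc _ ≤ |wkernel 0 γ x y| * (β * Real.exp (-|y|)) := by gcongr; exact hF y
      _ = β * (|wkernel 0 γ x y| * Real.exp (-|y|)) := by ring
      _ ≤ β * (C * Real.exp (-|y| / 16)) := mul_le_mul_of_nonneg_left (hk x y) hβ
      _ = _ := by ring
  -- The term `e^{1/n} - 1` is the freezing error inside the cells; `e^{-n/32}` is half of the decay
  -- rate `1/16`, spent where `|y| ≥ n`.
  have hpt : ∀ n : ℕ, 0 < n → ∀ x y, |wkernel 0 γ x y * F y - k n x y|
      ≤ β * C * (Real.exp (n : ℝ)⁻¹ - 1 + Real.exp (-n / 32)) * Real.exp (-|y| / 32) := by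
    intro n hn x y
    have hn' : (0 : ℝ) < n := by exact_mod_cast hn
    have e0 : 0 ≤ Real.exp (n : ℝ)⁻¹ - 1 := by
      have := Real.one_le_exp (inv_pos.mpr hn').le
      linarith
    have ek : k n x y = if ⌊(n : ℝ) * y⌋ ∈ s n
        then wkernel 0 γ x ((⌊(n : ℝ) * y⌋ : ℤ) / n) * F y else 0 :=
      sum_cell F n (s n) (fun j => wkernel 0 γ x (j / n)) y
    rw [ek]
    split_ifs with hmem
    · have hz : |y - (⌊(n : ℝ) * y⌋ : ℤ) / n| ≤ (n : ℝ)⁻¹ := by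
        have h1 := Int.floor_le ((n : ℝ) * y)
        have h2 := Int.lt_floor_add_one ((n : ℝ) * y)
        have : y - (⌊(n : ℝ) * y⌋ : ℤ) / n = (n * y - ⌊(n : ℝ) * y⌋) * (n : ℝ)⁻¹ := by
          field_simp
        rw [this, abs_of_nonneg (mul_nonneg (by linarith) (by positivity))]
        calc _ ≤ 1 * (n : ℝ)⁻¹ := by gcongr; linarith
          _ = _ := one_mul _
      rw [← sub_mul, abs_mul]
      calc _ ≤ ((Real.exp (n : ℝ)⁻¹ - 1) * |wkernel 0 γ x y|) * |F y| := by
            gcongr; exact wkernel_zero_sub_le γ x hz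
        _ = (Real.exp (n : ℝ)⁻¹ - 1) * |wkernel 0 γ x y * F y| := by rw [abs_mul]; ring
        _ ≤ (Real.exp (n : ℝ)⁻¹ - 1) * (β * C * Real.exp (-|y| / 16)) :=
            mul_le_mul_of_nonneg_left (hAF x y) e0
        _ = β * C * (Real.exp (n : ℝ)⁻¹ - 1 + 0) * Real.exp (-|y| / 16) := by ring
        _ ≤ _ := by
            refine mul_le_mul ?_ (Real.exp_le_exp.mpr (by linarith [abs_nonneg y]))
              (by positivity) (by positivity)
            gcongr
            positivity
    · have hy : (n : ℝ) ≤ |y| := by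
        by_contra hcon
        have hlt := abs_lt.mp (not_le.mp hcon)
        apply hmem
        rw [Finset.mem_Ico]
        constructor
        · rw [Int.le_floor]; push_cast; nlinarith
        · rw [Int.floor_lt]; push_cast; nlinarith
      rw [sub_zero]
      calc _ ≤ β * C * Real.exp (-|y| / 16) := hAF x y
        _ ≤ β * C * Real.exp (-n / 32 + -|y| / 32) := by
            refine mul_le_mul_of_nonneg_left (Real.exp_le_exp.mpr ?_) (by positivity)
            linarith
        _ = β * C * (0 + Real.exp (-n / 32)) * Real.exp (-|y| / 32) := by
            rw [Real.exp_add]; ring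
        _ ≤ _ := by gcongr
  have hlim : Tendsto (fun n : ℕ => β * C * (Real.exp (n : ℝ)⁻¹ - 1 + Real.exp (-n / 32))
      * ∫ y : ℝ, Real.exp (-|y| / 32)) atTop (𝓝 0) := by
    have t1 : Tendsto (fun n : ℕ => Real.exp (n : ℝ)⁻¹) atTop (𝓝 1) := by
      have := (Real.continuous_exp.tendsto 0).comp (tendsto_inv_atTop_nhds_zero_nat (𝕜 := ℝ))
      rwa [Real.exp_zero] at this
    have t2 : Tendsto (fun n : ℕ => Real.exp (-(n : ℝ) / 32)) atTop (𝓝 0) :=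
      Real.tendsto_exp_atBot.comp ((tendsto_neg_atTop_atBot.comp
        tendsto_natCast_atTop_atTop).atBot_div_const (by norm_num))
    have := (((t1.sub_const 1).add t2).const_mul (β * C)).mul_const
      (∫ y : ℝ, Real.exp (-|y| / 32))
    simpa using this
  refine isCompactOperator_of_tendsto (l := atTop) (F := B) ?_ (Eventually.of_forall hBc)
  refine (tendsto_iff_norm_sub_tendsto_zero (E := (ℝ →ᵇ ℝ) →L[ℝ] (ℝ →ᵇ ℝ))).mpr ?_
  refine squeeze_zero' (Eventually.of_forall fun n => norm_nonneg (B n - kernelOp 0 γ F)) ?_ hlim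
  filter_upwards [eventually_gt_atTop 0] with n hn
  refine norm_sub_le_of_kernel (hB n) (kernelOp_apply hγ le_rfl zero_le_one hd) (hki n) hAi
    fun x => ?_
  rw [← integral_const_mul]
  refine integral_mono ((hki n x).sub (hAi x)).abs (i32.const_mul _) fun y => ?_
  simp only [abs_sub_comm (k n x y)]
  exact hpt n hn x y

/-! ### Injectivity of the linearization at the soliton. -/

/-- A bounded solution of `U - U'' = h` given by the Green's function is twice differentiable, with
bounded derivative. -/
theorem green_function_derivatives {h U : ℝ → ℝ} (hc : Continuous h) (hi : Integrable h)
    (hU : ∀ x, U x = ∫ y, 1 / 2 * Real.exp (-|x - y|) * h y) :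
    ∃ V : ℝ → ℝ, (∀ x, HasDerivAt U (V x) x) ∧ (∀ x, HasDerivAt V (U x - h x) x) ∧
      ∀ x, |V x| ≤ ∫ y, |h y| := by
  have hcl : Continuous fun y => Real.exp y * h y := by fun_prop
  have hcr : Continuous fun y => Real.exp (-y) * h y := by fun_prop
  have hl : ∀ x, IntegrableOn (fun y => Real.exp y * h y) (Set.Iic x) := fun x => by
    refine ((hi.norm.const_mul (Real.exp x)).integrableOn (s := Set.Iic x)).mono'
      hcl.aestronglyMeasurable ?_
    filter_upwards [ae_restrict_mem measurableSet_Iic] with y hy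
    rw [norm_mul, Real.norm_eq_abs (Real.exp y), abs_of_pos (Real.exp_pos _)]
    gcongr
    exact hy
  have hr : ∀ x, IntegrableOn (fun y => Real.exp (-y) * h y) (Set.Ioi x) := fun x => by
    refine ((hi.norm.const_mul (Real.exp (-x))).integrableOn (s := Set.Ioi x)).mono'
      hcr.aestronglyMeasurable ?_
    filter_upwards [ae_restrict_mem measurableSet_Ioi] with y hy
    rw [norm_mul, Real.norm_eq_abs (Real.exp (-y)), abs_of_pos (Real.exp_pos _)]
    gcongr
    exact le_of_lt hy
  set p : ℝ → ℝ := fun x => ∫ y in Set.Iic x, Real.exp y * h y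
  set q : ℝ → ℝ := fun x => ∫ y in Set.Ioi x, Real.exp (-y) * h y
  have dp : ∀ x, HasDerivAt p (Real.exp x * h x) x := fun x => by
    have e : p = fun z => p 0 + ∫ y in (0 : ℝ)..z, Real.exp y * h y := by
      funext z
      rw [← intervalIntegral.integral_Iic_sub_Iic (hl 0) (hl z)]
      ring
    rw [e]
    exact (hcl.integral_hasStrictDerivAt 0 x).hasDerivAt.const_add _
  have dq : ∀ x, HasDerivAt q (-(Real.exp (-x) * h x)) x := fun x => by
    have e : q = fun z => q 0 - ∫ y in (0 : ℝ)..z, Real.exp (-y) * h y := by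
      funext z
      rw [← intervalIntegral.integral_Ioi_sub_Ioi' (hr 0) (hr z)]
      ring
    rw [e]
    exact (hcr.integral_hasStrictDerivAt 0 x).hasDerivAt.const_sub _
  have de : ∀ x : ℝ, HasDerivAt (fun x => Real.exp (-x)) (-Real.exp (-x)) x := fun x => by
    simpa using (hasDerivAt_neg x).exp
  have eU : U = fun x => 1 / 2 * (Real.exp (-x) * p x + Real.exp x * q x) := by
    funext x
    have hint : Integrable fun y => 1 / 2 * Real.exp (-|x - y|) * h y := by
      refine hi.bdd_mul (c := 1 / 2) (Continuous.aestronglyMeasurable (by fun_prop))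
        (Eventually.of_forall fun y => ?_)
      rw [Real.norm_eq_abs, abs_of_pos (by positivity)]
      have : Real.exp (-|x - y|) ≤ 1 := Real.exp_le_one_iff.mpr (by linarith [abs_nonneg (x - y)])
      linarith
    rw [hU, ← integral_add_compl (measurableSet_Iic (a := x)) hint, Set.compl_Iic, mul_add,
      ← mul_assoc, ← mul_assoc, ← integral_const_mul, ← integral_const_mul]
    congr 1
    · refine setIntegral_congr_fun measurableSet_Iic fun y hy => ?_
      have hy' : y ≤ x := hy
      rw [abs_of_nonneg (by linarith), show -(x - y) = -x + y by ring, Real.exp_add]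
      ring
    · refine setIntegral_congr_fun measurableSet_Ioi fun y hy => ?_
      have hy' : x < y := hy
      rw [abs_of_neg (by linarith), show - -(x - y) = x + -y by ring, Real.exp_add]
      ring
  have ee : ∀ x : ℝ, Real.exp (-x) * Real.exp x = 1 := fun x => by rw [← Real.exp_add]; simp
  have bp : ∀ x, |Real.exp (-x) * p x| ≤ ∫ y, |h y| := fun x => by
    rw [← integral_const_mul]
    refine (abs_integral_le_integral_abs).trans ((setIntegral_mono_on
      ((hl x).const_mul _).abs hi.abs.integrableOn measurableSet_Iic fun y hy => ?_).trans
      (setIntegral_le_integral hi.abs (Eventually.of_forall fun y => abs_nonneg _)))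
    have hy' : y ≤ x := hy
    rw [← mul_assoc, ← Real.exp_add, abs_mul, abs_of_pos (Real.exp_pos _)]
    have : Real.exp (-x + y) ≤ 1 := Real.exp_le_one_iff.mpr (by linarith)
    nlinarith [abs_nonneg (h y)]
  have bq : ∀ x, |Real.exp x * q x| ≤ ∫ y, |h y| := fun x => by
    rw [← integral_const_mul]
    refine (abs_integral_le_integral_abs).trans ((setIntegral_mono_on
      ((hr x).const_mul _).abs hi.abs.integrableOn measurableSet_Ioi fun y hy => ?_).trans
      (setIntegral_le_integral hi.abs (Eventually.of_forall fun y => abs_nonneg _)))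
    have hy' : x < y := hy
    rw [← mul_assoc, ← Real.exp_add, abs_mul, abs_of_pos (Real.exp_pos _)]
    have : Real.exp (x + -y) ≤ 1 := Real.exp_le_one_iff.mpr (by linarith)
    nlinarith [abs_nonneg (h y)]
  -- The derivatives of the limits of integration cancel in `U'`, whereas in `U''` they add up to
  -- `-h`.
  refine ⟨fun x => 1 / 2 * (-(Real.exp (-x) * p x) + Real.exp x * q x), fun x => ?_, fun x => ?_,
    fun x => ?_⟩
  · rw [eU]
    refine ((((de x).mul (dp x)).add ((Real.hasDerivAt_exp x).mul (dq x))).const_mul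
      (1 / 2)).congr_deriv ?_
    linear_combination (0 : ℝ) * ee x
  · refine ((((de x).mul (dp x)).neg.add ((Real.hasDerivAt_exp x).mul (dq x))).const_mul
      (1 / 2)).congr_deriv ?_
    rw [eU]
    linear_combination (-h x) * ee x
  · have h1 := abs_le.mp (bp x)
    have h2 := abs_le.mp (bq x)
    rw [abs_le]
    constructor <;> linarith

theorem eq_zero_of_monotone {W : ℝ → ℝ} (hm : Monotone W) (h1 : Tendsto W atTop (𝓝 0))
    (h2 : Tendsto W atBot (𝓝 0)) (x : ℝ) : W x = 0 :=
  le_antisymm (hm.ge_of_tendsto h1 x) (hm.le_of_tendsto h2 x)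

theorem tendsto_zero_of_abs_le_exp {W : ℝ → ℝ} {B : ℝ} (h : ∀ x, |W x| ≤ B * Real.exp (-|x|)) :
    Tendsto W atTop (𝓝 0) ∧ Tendsto W atBot (𝓝 0) := by
  constructor
  · refine squeeze_zero_norm h ?_
    have := (Real.tendsto_exp_atBot.comp (tendsto_neg_atTop_atBot.comp
      (tendsto_abs_atTop_atTop (G := ℝ)))).const_mul B
    simpa using this
  · refine squeeze_zero_norm h ?_
    have := (Real.tendsto_exp_atBot.comp (tendsto_neg_atTop_atBot.comp
      (tendsto_abs_atBot_atTop (G := ℝ)))).const_mul B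
    simpa using this

theorem deriv_Q_ne_zero {p : ℝ} (hp : 0 < p) {x : ℝ} (hx : x ≠ 0) : deriv (Q p) x ≠ 0 := by
  rw [deriv_Q hp]
  have h1 := (Q_pos hp x).ne'
  have h2 : Real.tanh (p * x / 2) ≠ 0 := by
    rw [Real.tanh_eq_sinh_div_cosh]
    refine div_ne_zero ?_ (Real.cosh_pos _).ne'
    rw [Ne, Real.sinh_eq_zero]
    have := hp.ne'
    positivity
  exact neg_ne_zero.mpr (mul_ne_zero h1 h2)

theorem hasDerivAt_deriv_deriv_Q {p : ℝ} (hp : 0 < p) (x : ℝ) :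
    HasDerivAt (fun x => Q p x - Q p x ^ p * Q p x)
      (deriv (Q p) x - (p + 1) * Q p x ^ p * deriv (Q p) x) x := by
  have h1 : HasDerivAt (Q p) (deriv (Q p) x) x := by
    rw [deriv_Q hp]; exact hasDerivAt_Q hp x
  have h2 := h1.rpow_const (p := p) (Or.inl (Q_pos hp x).ne')
  refine (h1.sub (h2.mul h1)).congr_deriv ?_
  have : Q p x ^ (p - 1) * Q p x = Q p x ^ p := by
    rw [Real.rpow_sub_one (Q_pos hp x).ne']
    have := (Q_pos hp x).ne'
    field_simp
  linear_combination (-(p * deriv (Q p) x)) * this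

theorem continuous_Q_rpow {p : ℝ} (hp : 0 < p) : Continuous fun x => Q p x ^ p :=
  (continuous_Q hp).rpow_const fun x => Or.inl (Q_pos hp x).ne'

theorem integrable_of_le_exp {F : ℝ → ℝ} {β : ℝ} (hF : Continuous F)
    (h : ∀ y, |F y| ≤ β * Real.exp (-|y|)) : Integrable F :=
  (integrable_exp_neg_abs.const_mul β).mono' hF.aestronglyMeasurable (Eventually.of_forall h)

/-- The linearization at the soliton has no kernel once the translation mode is removed. -/
theorem eq_zero_of_linearized {p : ℝ} (hp : 2 ≤ p) {U : ℝ → ℝ} (hUc : Continuous U) {B : ℝ}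
    (hUb : ∀ x, |U x| ≤ B) {c : ℝ} (hU : ∀ x, U x = ∫ y, 1 / 2 * Real.exp (-|x - y|)
      * ((p + 1) * Q p y ^ p * U y - c * deriv (Q p) y))
    (hc : c = ∫ y, U y * deriv (Q p) y) (x : ℝ) : U x = 0 := by
  have hp0 : 0 < p := by linarith
  have hB : 0 ≤ B := (abs_nonneg _).trans (hUb 0)
  have cQ := continuous_Q hp0
  have cQ' := continuous_deriv_Q hp0
  have cQp := continuous_Q_rpow hp0
  have hhc : Continuous fun y => (p + 1) * Q p y ^ p * U y - c * deriv (Q p) y := by fun_prop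
  have hQp0 : ∀ y, 0 ≤ Q p y ^ p := fun y => Real.rpow_nonneg (Q_pos hp0 y).le _
  have hhi : Integrable fun y => (p + 1) * Q p y ^ p * U y - c * deriv (Q p) y := by
    refine integrable_of_le_exp (β := (p + 1) * (2 * (p + 2)) * B + |c| * (p + 2)) hhc fun y => ?_
    refine (abs_sub _ _).trans ?_
    rw [abs_mul, abs_mul c, abs_of_nonneg (mul_nonneg (by linarith) (hQp0 y))]
    calc _ ≤ (p + 1) * (2 * (p + 2) * Real.exp (-|y|)) * B
          + |c| * ((p + 2) * Real.exp (-|y|)) := by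
          gcongr
          · exact Q_rpow_le hp y
          · exact hUb y
          · exact abs_deriv_Q_le hp y
      _ = _ := by ring
  obtain ⟨V, dU, dV, bV⟩ := green_function_derivatives hhc hhi hU
  set B' := ∫ y, |(p + 1) * Q p y ^ p * U y - c * deriv (Q p) y|
  -- The Wronskian of `U` and `Q'`. Since `Q'` solves the homogeneous linearized equation, only the
  -- forcing survives and `W' = c Q'²` has a fixed sign.
  set W : ℝ → ℝ := fun x => V x * deriv (Q p) x - U x * (Q p x - Q p x ^ p * Q p x) with hW
  have dW : ∀ x, HasDerivAt W (c * deriv (Q p) x ^ 2) x := fun x => by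
    refine (((dV x).mul (hasDerivAt_deriv_Q hp0 x)).sub
      ((dU x).mul (hasDerivAt_deriv_deriv_Q hp0 x))).congr_deriv ?_
    ring
  have hWb : ∀ x, |W x| ≤ (B' * (p + 2) + B * (p + 2 + 2 * (p + 2) * (p + 2)))
      * Real.exp (-|x|) := fun x => by
    have e1 := abs_deriv_Q_le hp x
    have e2 := Q_le hp x
    have e3 := Q_rpow_le hp x
    have e4 : Real.exp (-|x|) ≤ 1 := Real.exp_le_one_iff.mpr (by linarith [abs_nonneg x])
    have e5 := (Q_pos hp0 x).le
    have e6 : |Q p x - Q p x ^ p * Q p x| ≤ (p + 2 + 2 * (p + 2) * (p + 2)) * Real.exp (-|x|) := by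
      refine (abs_sub _ _).trans ?_
      rw [abs_of_nonneg e5, abs_of_nonneg (mul_nonneg (hQp0 x) e5)]
      calc _ ≤ (p + 2) * Real.exp (-|x|)
            + (2 * (p + 2) * 1) * ((p + 2) * Real.exp (-|x|)) := by
            gcongr
            exact e3.trans (by gcongr)
        _ = _ := by ring
    refine (abs_sub _ _).trans ?_
    rw [abs_mul, abs_mul (U x)]
    calc _ ≤ B' * ((p + 2) * Real.exp (-|x|))
          + B * ((p + 2 + 2 * (p + 2) * (p + 2)) * Real.exp (-|x|)) := by
          refine add_le_add (mul_le_mul (bV x) e1 (abs_nonneg _) ((abs_nonneg _).trans (bV x)))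
            (mul_le_mul (hUb x) e6 (abs_nonneg _) hB)
      _ = _ := by ring
  obtain ⟨lt, lb⟩ := tendsto_zero_of_abs_le_exp hWb
  have Wdiff : Differentiable ℝ W := fun x => (dW x).differentiableAt
  -- `W` is monotone, increasing or decreasing according to the sign of `c`, and tends to zero at
  -- both ends.
  have W0 : ∀ x, W x = 0 := by
    rcases le_total 0 c with h | h
    · refine eq_zero_of_monotone (monotone_of_deriv_nonneg Wdiff fun x => ?_) lt lb
      rw [(dW x).deriv]; positivity
    · intro x
      have hm : Monotone fun x => -W x := by
        refine (antitone_of_deriv_nonpos Wdiff fun x => ?_).neg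
        rw [(dW x).deriv]
        exact mul_nonpos_of_nonpos_of_nonneg h (sq_nonneg _)
      have := eq_zero_of_monotone hm (by simpa using lt.neg) (by simpa using lb.neg) x
      simpa using this
  have c0 : c = 0 := by
    have h1 : HasDerivAt W 0 1 := by
      rw [show W = fun _ => 0 from funext W0]; exact hasDerivAt_const _ _
    have h2 := (dW 1).unique h1
    exact (mul_eq_zero.mp h2).resolve_right (pow_ne_zero _ (deriv_Q_ne_zero hp0 one_ne_zero))
  -- `Q'` vanishes only at the origin, so `W = 0` makes `U / Q'` constant on each half-line; the two
  -- constants must still be matched across `0`.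
  have ratio : ∀ s : Set ℝ, IsOpen s → IsPreconnected s → (0 : ℝ) ∉ s →
      ∃ d, ∀ x ∈ s, U x = d * deriv (Q p) x := by
    intro s hs hs' h0
    have hne : ∀ x ∈ s, deriv (Q p) x ≠ 0 := fun x hx =>
      deriv_Q_ne_zero hp0 (ne_of_mem_of_not_mem hx h0)
    have hd : ∀ x ∈ s, HasDerivAt (fun x => U x / deriv (Q p) x) 0 x := fun x hx => by
      refine ((dU x).div (hasDerivAt_deriv_Q hp0 x) (hne x hx)).congr_deriv ?_
      rw [div_eq_zero_iff]
      exact Or.inl (W0 x)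
    obtain ⟨d, hd'⟩ := hs.exists_is_const_of_deriv_eq_zero hs'
      (fun x hx => (hd x hx).differentiableAt.differentiableWithinAt) fun x hx => (hd x hx).deriv
    exact ⟨d, fun x hx => (div_eq_iff (hne x hx)).mp (hd' x hx)⟩
  obtain ⟨d, hd⟩ := ratio (Set.Ioi 0) isOpen_Ioi isPreconnected_Ioi (by simp)
  obtain ⟨d', hd'⟩ := ratio (Set.Iio 0) isOpen_Iio isPreconnected_Iio (by simp)
  have Q'0 : deriv (Q p) 0 = 0 := by rw [deriv_Q hp0]; simp
  have Q''0 : Q p 0 - Q p 0 ^ p * Q p 0 ≠ 0 := by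
    have : Q p 0 ^ p = (p + 2) / 2 := by rw [Q_rpow hp0]; simp
    rw [this, show Q p 0 - (p + 2) / 2 * Q p 0 = -(Q p 0 * (p / 2)) by ring]
    exact neg_ne_zero.mpr (mul_ne_zero (Q_pos hp0 0).ne' (by positivity))
  have U0 : U 0 = 0 := by
    have := W0 0
    rw [hW] at this
    simp only [Q'0, mul_zero, zero_sub, neg_eq_zero] at this
    exact (mul_eq_zero.mp this).resolve_right Q''0
  have cV : Continuous V := continuous_iff_continuousAt.mpr fun x => (dV x).continuousAt
  -- Each constant is read off from `U'(0) = e Q''(0)`, where `Q''(0) ≠ 0`.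
  have limit : ∀ (s : Set ℝ) (e : ℝ), (𝓝[s] (0 : ℝ)).NeBot → (0 : ℝ) ∉ s →
      (∀ x ∈ s, U x = e * deriv (Q p) x) → V 0 = e * (Q p 0 - Q p 0 ^ p * Q p 0) := by
    intro s e hs h0 h
    have l1 : Tendsto V (𝓝[s] 0) (𝓝 (V 0)) := (cV.tendsto 0).mono_left nhdsWithin_le_nhds
    have hcc : Continuous fun x => e * (Q p x - Q p x ^ p * Q p x) := by fun_prop
    have l2 : Tendsto (fun x => e * (Q p x - Q p x ^ p * Q p x)) (𝓝[s] 0)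
        (𝓝 (e * (Q p 0 - Q p 0 ^ p * Q p 0))) := (hcc.tendsto 0).mono_left nhdsWithin_le_nhds
    refine tendsto_nhds_unique l1 (l2.congr' ?_)
    filter_upwards [self_mem_nhdsWithin] with x hx
    have h1 := W0 x
    rw [hW] at h1
    simp only [h x hx] at h1
    have h2 := deriv_Q_ne_zero hp0 (ne_of_mem_of_not_mem hx h0)
    have h3 : (V x - e * (Q p x - Q p x ^ p * Q p x)) * deriv (Q p) x = 0 := by
      linear_combination h1
    linarith [(mul_eq_zero.mp h3).resolve_right h2]
  have hdd : d' = d := by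
    have h1 := limit (Set.Ioi 0) d inferInstance (by simp) hd
    have h2 := limit (Set.Iio 0) d' inferInstance (by simp) hd'
    exact mul_right_cancel₀ Q''0 (h2.symm.trans h1)
  have hUd : ∀ x, U x = d * deriv (Q p) x := fun x => by
    rcases lt_trichotomy x 0 with h | h | h
    · rw [← hdd]; exact hd' x h
    · rw [h, U0, Q'0, mul_zero]
    · exact hd x h
  have d0 : d = 0 := by
    rw [c0] at hc
    have h1 : ∫ y, d * deriv (Q p) y ^ 2 = 0 := by
      rw [hc]
      congr 1
      funext y
      rw [hUd y]; ring
    rw [integral_const_mul] at h1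
    refine (mul_eq_zero.mp h1).resolve_right fun h2 => ?_
    have hi : Integrable fun y => deriv (Q p) y ^ 2 := by
      refine integrable_of_le_exp (β := (p + 2) * (p + 2)) (by fun_prop) fun y => ?_
      have e1 := abs_deriv_Q_le hp y
      have e4 : Real.exp (-|y|) ≤ 1 := Real.exp_le_one_iff.mpr (by linarith [abs_nonneg y])
      rw [abs_pow, sq]
      calc _ ≤ ((p + 2) * 1) * ((p + 2) * Real.exp (-|y|)) := by
            gcongr
            exact e1.trans (by gcongr)
        _ = _ := by ring
    have h3 := (integral_eq_zero_iff_of_nonneg (fun y => sq_nonneg _) hi).mp h2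
    have h4 := (Continuous.ae_eq_iff_eq volume (cQ'.pow 2) continuous_const).mp h3
    have h5 := congrFun h4 1
    exact pow_ne_zero _ (deriv_Q_ne_zero hp0 one_ne_zero) h5
  rw [hUd, d0, zero_mul]

/-! ### Perturbation of the density and of the operator; uniform invertibility. -/

/-- The density `(p + 1) w^{p+1} |v|^p`. -/
def density (a γ p : ℝ) (v : ℝ → ℝ) (y : ℝ) : ℝ := (p + 1) * weight a γ y ^ (p + 1) * |v y| ^ p

/-- The density for `v = Q / w`. -/
def solitonDensity (a γ p : ℝ) (y : ℝ) : ℝ := (p + 1) * weight a γ y * Q p y ^ p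

theorem abs_rpow_sub_rpow_le {s t m p : ℝ} (hs : 0 ≤ s) (ht : 0 ≤ t) (hsm : s ≤ m) (htm : t ≤ m)
    (hp : 1 ≤ p) : |s ^ p - t ^ p| ≤ p * m ^ (p - 1) * |s - t| := by
  refine (convex_Icc 0 m).norm_image_sub_le_of_norm_hasDerivWithin_le (𝕜 := ℝ)
    (f := fun x : ℝ => x ^ p) (f' := fun x => p * x ^ (p - 1))
    (fun x _ => (Real.hasDerivAt_rpow_const (Or.inr hp)).hasDerivWithinAt) (fun x hx => ?_)
    ⟨ht, htm⟩ ⟨hs, hsm⟩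
  have h0 : 0 ≤ x ^ (p - 1) := Real.rpow_nonneg hx.1 _
  rw [Real.norm_eq_abs, abs_of_nonneg (by positivity)]
  gcongr
  · exact hx.1
  · exact hx.2

/-- With `t = Q / w` the mean value theorem leaves `w^{p+1} (t + 1)^{p-1} = w² (Q + w)^{p-1}`, free
of negative powers of `w`. As `p ≥ 3` this is at most a constant times `w² (Q + w)²`, and `Q²` and
`w⁴` are the two parts of the envelope. -/
theorem abs_density_sub_le {q : ℝ} : ∃ C : ℝ, 0 < C ∧ ∀ p : ℝ, 3 ≤ p → p ≤ q →
    ∀ γ ∈ gammaRange, ∀ a : ℝ, 0 ≤ a → a ≤ 1 → ∀ δ : ℝ, δ ≤ 1 → ∀ v : ℝ → ℝ,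
    (∀ x, |v x - Q p x / weight a γ x| ≤ δ) →
    ∀ y, |density a γ p v y - solitonDensity a γ p y| ≤ C * δ * envelope a γ y := by
  refine ⟨max 1 (2 * ((q + 1) * q * ((q + 3) ^ q * (q + 2) ^ 2))), by positivity,
    fun p hp3 hpq γ hγ a ha ha1 δ hδ1 v hv y => ?_⟩
  have hδ : 0 ≤ δ := (abs_nonneg _).trans (hv y)
  have hp0 : 0 < p := by linarith
  have hw := weight_pos' (γ := γ) ha ha1 y
  have hw1 := weight_le_one' hγ ha ha1 y
  have hQ := Q_pos hp0 y
  have hQle := Q_le (by linarith : 2 ≤ p) y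
  have hE : Real.exp (-|y|) ≤ 1 := Real.exp_le_one_iff.mpr (by linarith [abs_nonneg y])
  have henv := envelope_pos a γ y
  have hvy := hv y
  refine le_trans ?_ (mul_le_mul_of_nonneg_right (mul_le_mul_of_nonneg_right
    (le_max_right _ _) hδ) henv.le)
  set w := weight a γ y with hwdef
  set t := Q p y / w with ht
  have ht0 : 0 < t := by positivity
  have e1 : solitonDensity a γ p y = (p + 1) * w ^ (p + 1) * t ^ p := by
    rw [solitonDensity, ← hwdef, ht, Real.div_rpow hQ.le hw.le, Real.rpow_add_one hw.ne']
    have : w ^ p ≠ 0 := by positivity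
    field_simp
  have e2 : |(|v y| ^ p - t ^ p)| ≤ p * (t + 1) ^ (p - 1) * δ := by
    have h1 : |(|v y| - t)| ≤ δ := by
      have := abs_abs_sub_abs_le_abs_sub (v y) t
      rw [abs_of_pos ht0] at this
      exact this.trans hvy
    refine (abs_rpow_sub_rpow_le (abs_nonneg _) ht0.le (m := t + 1) ?_ (by linarith)
      (by linarith)).trans (by gcongr)
    linarith [(abs_le.mp h1).2]
  have e3 : w ^ (p + 1) * (t + 1) ^ (p - 1) = w ^ 2 * (Q p y + w) ^ (p - 1) := by
    have h1 : Q p y + w = w * (t + 1) := by rw [ht]; field_simp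
    have h2 : w ^ (p + 1) = w ^ 2 * w ^ (p - 1) := by
      rw [← Real.rpow_natCast, ← Real.rpow_add hw]; congr 1; push_cast; ring
    rw [h1, Real.mul_rpow hw.le (by positivity), h2]
    ring
  have e4 : (Q p y + w) ^ (p - 1) ≤ (Q p y + w) ^ 2 * (q + 3) ^ q := by
    have h1 : (Q p y + w) ^ (p - 1) = (Q p y + w) ^ 2 * (Q p y + w) ^ (p - 3) := by
      rw [← Real.rpow_natCast, ← Real.rpow_add (by positivity)]; congr 1; push_cast; ring
    rw [h1]
    gcongr
    calc (Q p y + w) ^ (p - 3) ≤ (q + 3) ^ (p - 3) := by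
          have : (p + 2) * Real.exp (-|y|) ≤ (q + 2) * 1 := by gcongr; linarith
          exact Real.rpow_le_rpow (by positivity) (by linarith) (by linarith)
      _ ≤ _ := Real.rpow_le_rpow_of_exponent_le (by linarith) (by linarith)
  have e5 : w ^ 2 * (Q p y + w) ^ 2 ≤ 2 * ((q + 2) ^ 2 * envelope a γ y) := by
    have h1 : Q p y ^ 2 ≤ (q + 2) ^ 2 * Real.exp (-|y|) := by
      calc Q p y ^ 2 ≤ ((q + 2) * Real.exp (-|y|)) ^ 2 := by
            gcongr; exact hQle.trans (by gcongr)
        _ = (q + 2) ^ 2 * (Real.exp (-|y|) * Real.exp (-|y|)) := by ring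
        _ ≤ (q + 2) ^ 2 * (Real.exp (-|y|) * 1) := by gcongr
        _ = _ := by ring
    have h2 : w ^ 2 * Q p y ^ 2 ≤ 1 * Q p y ^ 2 := by
      gcongr
      exact pow_le_one₀ hw.le hw1
    have h3 : 1 * w ^ 4 ≤ (q + 2) ^ 2 * w ^ 4 := by
      gcongr
      nlinarith
    rw [envelope, ← hwdef]
    nlinarith [sq_nonneg (w * (Q p y - w))]
  have hq3 : 0 ≤ (q + 3) ^ q := by
    have : 0 ≤ q + 3 := by linarith
    positivity
  have hq0 : 0 ≤ q := by linarith
  rw [e1, density, ← hwdef, ← mul_sub, abs_mul, abs_of_nonneg (by positivity)]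
  calc _ ≤ (p + 1) * w ^ (p + 1) * (p * (t + 1) ^ (p - 1) * δ) := by gcongr
    _ = (p + 1) * p * (w ^ (p + 1) * (t + 1) ^ (p - 1)) * δ := by ring
    _ = (p + 1) * p * (w ^ 2 * (Q p y + w) ^ (p - 1)) * δ := by rw [e3]
    _ ≤ (q + 1) * q * (w ^ 2 * ((Q p y + w) ^ 2 * (q + 3) ^ q)) * δ := by gcongr
    _ = (q + 1) * q * ((q + 3) ^ q * (w ^ 2 * (Q p y + w) ^ 2)) * δ := by ring
    _ ≤ (q + 1) * q * ((q + 3) ^ q * (2 * ((q + 2) ^ 2 * envelope a γ y))) * δ := by gcongr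
    _ = _ := by ring

theorem continuous_solitonDensity {a γ p : ℝ} (ha : 0 ≤ a) (ha1 : a ≤ 1) (hp : 0 < p) :
    Continuous (solitonDensity a γ p) := by
  have h1 := continuous_Q_rpow hp
  have h2 := continuous_weight (γ := γ) ha ha1
  unfold solitonDensity
  fun_prop

theorem abs_solitonDensity_le {a γ p q : ℝ} (hγ : γ ∈ gammaRange) (ha : 0 ≤ a) (ha1 : a ≤ 1)
    (hp : 2 ≤ p) (hpq : p ≤ q) (y : ℝ) :
    |solitonDensity a γ p y| ≤ 2 * (q + 1) * (q + 2) * Real.exp (-|y|) := by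
  have hw := weight_pos' (γ := γ) ha ha1 y
  have hw1 := weight_le_one' hγ ha ha1 y
  have hQ : 0 ≤ Q p y ^ p := Real.rpow_nonneg (Q_pos (by linarith) y).le _
  rw [solitonDensity, abs_of_nonneg (mul_nonneg (mul_nonneg (by linarith) hw.le) hQ)]
  calc _ ≤ (q + 1) * 1 * (2 * (q + 2) * Real.exp (-|y|)) := by
        refine mul_le_mul (mul_le_mul (by linarith) hw1 hw.le (by linarith))
          ((Q_rpow_le hp y).trans ?_) hQ (by linarith)
        gcongr
    _ = _ := by ring

theorem isDensity_solitonDensity {a γ p : ℝ} (hγ : γ ∈ gammaRange) (ha : 0 ≤ a) (ha1 : a ≤ 1)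
    (hp : 2 ≤ p) : IsDensity a γ (solitonDensity a γ p) :=
  isDensity_of_le_exp (continuous_solitonDensity ha ha1 (by linarith))
    (abs_solitonDensity_le hγ ha ha1 hp le_rfl)

theorem isDensity_density {a γ p δ : ℝ} (hγ : γ ∈ gammaRange) (ha : 0 ≤ a) (ha1 : a ≤ 1)
    (hp : 3 ≤ p) (hδ : δ ≤ 1) {v : ℝ → ℝ} (hvc : Continuous v)
    (hv : ∀ x, |v x - Q p x / weight a γ x| ≤ δ) : IsDensity a γ (density a γ p v) := by
  obtain ⟨C, hC, h⟩ := abs_density_sub_le (q := p)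
  obtain ⟨-, β, hβ⟩ := isDensity_solitonDensity hγ ha ha1 (by linarith : 2 ≤ p)
  refine ⟨?_, C * δ + β, fun y => ?_⟩
  · have h2 := continuous_weight (γ := γ) ha ha1
    unfold density
    refine (continuous_const.mul (h2.rpow_const fun y =>
      Or.inl (weight_pos' ha ha1 y).ne')).mul (hvc.abs.rpow_const fun y => Or.inr (by linarith))
  · have h1 := h p hp le_rfl γ hγ a ha ha1 δ hδ v hv y
    have h2 := hβ y
    calc |density a γ p v y| = |(density a γ p v y - solitonDensity a γ p y)
          + solitonDensity a γ p y| := by ring_nf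
      _ ≤ _ := (abs_add_le _ _).trans (add_le_add h1 h2)
      _ = _ := by ring

theorem isDensity_deriv_Q {a γ p : ℝ} (hp : 2 ≤ p) : IsDensity a γ (deriv (Q p)) :=
  isDensity_of_le_exp (continuous_deriv_Q (by linarith)) (abs_deriv_Q_le hp)

theorem abs_weight_mul_deriv_Q_le {a γ p q : ℝ} (hγ : γ ∈ gammaRange) (ha : 0 ≤ a) (ha1 : a ≤ 1)
    (hp : 2 ≤ p) (hpq : p ≤ q) (y : ℝ) :
    |weight a γ y * deriv (Q p) y| ≤ (q + 2) * Real.exp (-|y|) := by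
  have hw := weight_pos' (γ := γ) ha ha1 y
  rw [abs_mul, abs_of_pos hw]
  calc _ ≤ 1 * ((p + 2) * Real.exp (-|y|)) := by
        gcongr
        exacts [weight_le_one' hγ ha ha1 y, abs_deriv_Q_le hp y]
    _ ≤ _ := by rw [one_mul]; gcongr

theorem integrable_weight_mul_deriv_Q {a γ p : ℝ} (hγ : γ ∈ gammaRange) (ha : 0 ≤ a) (ha1 : a ≤ 1)
    (hp : 2 ≤ p) : Integrable (fun y => weight a γ y * deriv (Q p) y) :=
  integrable_of_le_exp ((continuous_weight ha ha1).mul (continuous_deriv_Q (by linarith)))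
    (abs_weight_mul_deriv_Q_le hγ ha ha1 hp le_rfl)

open Classical in
/-- The functional `u ↦ ⟨u, w Q'⟩`. -/
def modePairing (a γ p : ℝ) : (ℝ →ᵇ ℝ) →L[ℝ] ℝ :=
  if h : Integrable (fun y => weight a γ y * deriv (Q p) y) then pairing _ h else 0

/-- The operator `u ↦ w⁻¹ T[F u - ⟨u, w Q'⟩ Q']`. -/
def linOp (a γ p : ℝ) (F : ℝ → ℝ) : (ℝ →ᵇ ℝ) →L[ℝ] (ℝ →ᵇ ℝ) :=
  kernelOp a γ F - (modePairing a γ p).smulRight (kernelOp a γ (deriv (Q p)) 1)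

theorem modePairing_apply {a γ p : ℝ} (hγ : γ ∈ gammaRange) (ha : 0 ≤ a) (ha1 : a ≤ 1)
    (hp : 2 ≤ p) (u : ℝ →ᵇ ℝ) :
    modePairing a γ p u = ∫ y, weight a γ y * deriv (Q p) y * u y := by
  rw [modePairing, dif_pos (integrable_weight_mul_deriv_Q hγ ha ha1 hp), pairing_apply]

theorem linOp_apply {a γ p : ℝ} (hγ : γ ∈ gammaRange) (ha : 0 ≤ a) (ha1 : a ≤ 1)
    (hp : 2 ≤ p) {F : ℝ → ℝ} (hF : IsDensity a γ F) (u : ℝ →ᵇ ℝ) (x : ℝ) :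
    linOp a γ p F u x = ∫ y, wkernel a γ x y *
      (F y * u y - (∫ z, weight a γ z * deriv (Q p) z * u z) * deriv (Q p) y) := by
  have h1 := integrable_mul_bcf (integrable_wkernel_mul hγ ha ha1 hF x) u
  have h2 := integrable_wkernel_mul hγ ha ha1 (isDensity_deriv_Q (a := a) (γ := γ) hp) x
  have e : ∀ y c, wkernel a γ x y * (F y * u y - c * deriv (Q p) y)
      = wkernel a γ x y * F y * u y - c * (wkernel a γ x y * deriv (Q p) y) := by
    intro y c; ring
  simp only [e]
  rw [integral_sub h1 (h2.const_mul _), integral_const_mul, linOp, _root_.sub_apply,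
    BoundedContinuousFunction.sub_apply, kernelOp_apply hγ ha ha1 hF,
    ContinuousLinearMap.smulRight_apply, BoundedContinuousFunction.smul_apply,
    kernelOp_apply hγ ha ha1 (isDensity_deriv_Q hp), modePairing_apply hγ ha ha1 hp]
  simp

theorem tendsto_sub_smulRight {ι E : Type*} [NormedAddCommGroup E] [NormedSpace ℝ E]
    {l : Filter ι} {K : ι → E →L[ℝ] E} {K₀ : E →L[ℝ] E} {ℓ : ι → E →L[ℝ] ℝ} {ℓ₀ : E →L[ℝ] ℝ}
    {g : ι → E} {g₀ : E} (hK : Tendsto K l (𝓝 K₀)) (hℓ : Tendsto ℓ l (𝓝 ℓ₀))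
    (hg : Tendsto g l (𝓝 g₀)) :
    Tendsto (fun i => K i - (ℓ i).smulRight (g i)) l (𝓝 (K₀ - ℓ₀.smulRight g₀)) :=
  hK.sub (((ContinuousLinearMap.smulRightL ℝ E E).continuous₂.tendsto (ℓ₀, g₀)).comp
    (hℓ.prodMk_nhds hg))

theorem norm_one_sub_sub_lt {E : Type*} [NormedAddCommGroup E] [NormedSpace ℝ E]
    {K K' R T₀ : E →L[ℝ] E} {ε : ℝ} (hε : 0 < ε) (h₁ : ‖K - K'‖ ≤ ε / 4)
    (h₂ : ‖(K' - R) - T₀‖ < ε / 2) : ‖(1 - (K - R)) - (1 - T₀)‖ < ε := by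
  have e : (1 - (K - R)) - (1 - T₀) = -(K - K') - ((K' - R) - T₀) := by abel
  rw [e]
  refine (norm_sub_le _ _).trans_lt ?_
  rw [norm_neg]
  linarith

/-- The soliton density, `Q'` and `w Q'` all have `p`-uniform bounds by `e^{-|y|}`, so each
ingredient converges in norm. -/
theorem tendsto_linOp {ι : Type*} {l : Filter ι} [l.IsCountablyGenerated] {A G P : ι → ℝ}
    {γ₀ p₀ : ℝ} (hγ₀ : γ₀ ∈ gammaRange) (hp₀ : 3 ≤ p₀) (hA : Tendsto A l (𝓝[≥] 0))
    (hG : ∀ᶠ i in l, G i ∈ gammaRange) (hP : Tendsto P l (𝓝 p₀)) :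
    Tendsto (fun i => linOp (A i) (G i) (P i) (solitonDensity (A i) (G i) (P i))) l
      (𝓝 (linOp 0 γ₀ p₀ (solitonDensity 0 γ₀ p₀))) := by
  have hp2 : 2 ≤ p₀ := by linarith
  have hp0 : 0 < p₀ := by linarith
  have hA0 : ∀ᶠ i in l, 0 ≤ A i := hA.eventually self_mem_nhdsWithin
  have hA1 : ∀ᶠ i in l, A i ≤ 1 :=
    (hA.mono_right nhdsWithin_le_nhds).eventually (ge_mem_nhds one_pos)
  have hP2 : ∀ᶠ i in l, 2 ≤ P i := hP.eventually (le_mem_nhds (by linarith))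
  have hPq : ∀ᶠ i in l, P i ≤ p₀ + 1 := hP.eventually (ge_mem_nhds (by linarith))
  have hw : ∀ y, Tendsto (fun i => weight (A i) (G i) y) l (𝓝 (weight 0 γ₀ y)) := fun y =>
    tendsto_weight γ₀ hA tendsto_const_nhds hG
  have t1 : Tendsto (fun i => kernelOp (A i) (G i) (solitonDensity (A i) (G i) (P i))) l
      (𝓝 (kernelOp 0 γ₀ (solitonDensity 0 γ₀ p₀))) := by
    refine tendsto_kernelOp hγ₀ hA hG (β := 2 * (p₀ + 1 + 1) * (p₀ + 1 + 2)) ?_ ?_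
      (continuous_solitonDensity le_rfl zero_le_one hp0)
      (abs_solitonDensity_le hγ₀ le_rfl zero_le_one hp2 (by linarith)) fun y => ?_
    · filter_upwards [hA0, hA1, hP2] with i h0 h1 h2
      exact continuous_solitonDensity h0 h1 (by linarith)
    · filter_upwards [hA0, hA1, hP2, hPq, hG] with i h0 h1 h2 h3 h4
      exact abs_solitonDensity_le h4 h0 h1 h2 h3
    · exact ((hP.add_const 1).mul (hw y)).mul (tendsto_Q_rpow hP hp0 y)
  have t2 : Tendsto (fun i => kernelOp (A i) (G i) (deriv (Q (P i)))) l
      (𝓝 (kernelOp 0 γ₀ (deriv (Q p₀)))) := by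
    refine tendsto_kernelOp hγ₀ hA hG (β := p₀ + 1 + 2) ?_ ?_ (continuous_deriv_Q hp0) ?_
      (tendsto_deriv_Q hP hp0)
    · filter_upwards [hP2] with i h2
      exact continuous_deriv_Q (by linarith)
    · filter_upwards [hP2, hPq] with i h2 h3 y
      exact (abs_deriv_Q_le h2 y).trans (by gcongr)
    · intro y
      exact (abs_deriv_Q_le hp2 y).trans (by gcongr; linarith)
  have t2' : Tendsto (fun i => kernelOp (A i) (G i) (deriv (Q (P i))) 1) l
      (𝓝 (kernelOp 0 γ₀ (deriv (Q p₀)) 1)) :=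
    ((ContinuousLinearMap.apply ℝ (ℝ →ᵇ ℝ) (1 : ℝ →ᵇ ℝ)).continuous.tendsto _).comp t2
  have i0 := integrable_weight_mul_deriv_Q hγ₀ le_rfl zero_le_one hp2
  have t3 : Tendsto (fun i => modePairing (A i) (G i) (P i)) l (𝓝 (modePairing 0 γ₀ p₀)) := by
    have hlim : Tendsto (fun i => ∫ y, |weight (A i) (G i) y * deriv (Q (P i)) y
        - weight 0 γ₀ y * deriv (Q p₀) y|) l (𝓝 (∫ _ : ℝ, (0 : ℝ))) := by
      refine tendsto_integral_filter_of_dominated_convergence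
        (fun y => 2 * ((p₀ + 1 + 2) * Real.exp (-|y|))) ?_ ?_
        ((integrable_exp_neg_abs.const_mul _).const_mul _) (Eventually.of_forall fun y => ?_)
      · filter_upwards [hA0, hA1, hP2, hG] with i h0 h1 h2 h4
        exact ((integrable_weight_mul_deriv_Q h4 h0 h1 h2).sub i0).abs.aestronglyMeasurable
      · filter_upwards [hA0, hA1, hP2, hPq, hG] with i h0 h1 h2 h3 h4
        refine Eventually.of_forall fun y => ?_
        rw [Real.norm_eq_abs, abs_abs, two_mul]
        exact (abs_sub _ _).trans (add_le_add (abs_weight_mul_deriv_Q_le h4 h0 h1 h2 h3 y)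
          (abs_weight_mul_deriv_Q_le hγ₀ le_rfl zero_le_one hp2 (by linarith) y))
      · have := (((hw y).mul (tendsto_deriv_Q hP hp0 y)).sub_const
          (weight 0 γ₀ y * deriv (Q p₀) y)).abs
        simpa using this
    rw [integral_zero] at hlim
    refine (tendsto_iff_norm_sub_tendsto_zero (E := (ℝ →ᵇ ℝ) →L[ℝ] ℝ)).mpr
      (squeeze_zero' (Eventually.of_forall fun i => norm_nonneg
        (modePairing (A i) (G i) (P i) - modePairing 0 γ₀ p₀)) ?_ hlim)
    filter_upwards [hA0, hA1, hP2, hG] with i h0 h1 h2 h4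
    rw [modePairing, dif_pos (integrable_weight_mul_deriv_Q h4 h0 h1 h2), modePairing, dif_pos i0]
    exact norm_pairing_sub_le _ _
  exact tendsto_sub_smulRight t1 t3 t2'

/-- Fredholm alternative for a compact operator: `1` is either an eigenvalue or in the resolvent
set. Multiplying an eigenvector by the weight produces a bounded solution of the linearized
equation, which vanishes. -/
theorem isUnit_one_sub_linOp {γ p : ℝ} (hγ : γ ∈ gammaRange) (hp : 3 ≤ p) :
    IsUnit (1 - linOp 0 γ p (solitonDensity 0 γ p)) := by
  have hp2 : 2 ≤ p := by linarith
  have hp0 : 0 < p := by linarith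
  have hd := isDensity_solitonDensity hγ le_rfl zero_le_one hp2
  have hcomp : IsCompactOperator (linOp 0 γ p (solitonDensity 0 γ p)) :=
    (isCompactOperator_kernelOp_zero hγ hd.1
      (abs_solitonDensity_le hγ le_rfl zero_le_one hp2 le_rfl)).sub
      (isCompactOperator_smulRight _ _)
  rcases hcomp.hasEigenvalue_or_mem_resolventSet (one_ne_zero (α := ℝ)) with h | h
  · exfalso
    obtain ⟨u, hu⟩ := h.exists_hasEigenvector
    have hu1 : linOp 0 γ p (solitonDensity 0 γ p) u = u := by
      have := hu.apply_eq_smul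
      rw [one_smul] at this
      exact this
    refine hu.2 (BoundedContinuousFunction.ext fun x => ?_)
    have hw : ∀ x, 0 < weight 0 γ x := weight_pos' le_rfl zero_le_one
    have key : ∀ x, weight 0 γ x * u x = 0 := by
      refine eq_zero_of_linearized hp2 (B := ‖u‖)
        (c := ∫ z, weight 0 γ z * deriv (Q p) z * u z) ?_ ?_ ?_ ?_
      · exact (continuous_weight le_rfl zero_le_one).mul u.continuous
      · intro x
        rw [abs_mul, abs_of_pos (hw x)]
        calc _ ≤ 1 * ‖u‖ := by
              gcongr
              exacts [weight_le_one' hγ le_rfl zero_le_one x, u.norm_coe_le_norm x]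
          _ = _ := one_mul _
      · intro x
        conv_lhs => rw [← hu1]
        rw [linOp_apply hγ le_rfl zero_le_one hp2 hd, ← integral_const_mul]
        congr 1
        funext y
        have h1 := (hw x).ne'
        rw [wkernel, kernel_zero, solitonDensity]
        field_simp
      · congr 1
        funext y
        ring
    exact (mul_eq_zero.mp (key x)).resolve_left (hw x).ne'
  · have h1 := spectrum.mem_resolventSet_iff.mp h
    rwa [map_one] at h1

/-- The units of a Banach algebra are open and inversion is continuous at a unit, which gives both
the ball and the bound on the inverse. -/
theorem exists_equiv_of_norm_sub_le {E : Type*} [NormedAddCommGroup E] [NormedSpace ℝ E]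
    [CompleteSpace E] {T₀ : E →L[ℝ] E} (h : IsUnit T₀) : ∃ ε > 0, ∃ C : ℝ, ∀ T : E →L[ℝ] E,
      ‖T - T₀‖ < ε → ∃ Φ : E ≃L[ℝ] E, (∀ u, Φ u = T u) ∧ ‖(Φ.symm : E →L[ℝ] E)‖ ≤ C := by
  obtain ⟨x, rfl⟩ := h
  have h1 : ∀ᶠ T : E →L[ℝ] E in 𝓝 (x : E →L[ℝ] E), IsUnit T := Units.nhds x
  have h2 : ∀ᶠ T : E →L[ℝ] E in 𝓝 (x : E →L[ℝ] E),
      ‖Ring.inverse T‖ < ‖Ring.inverse (x : E →L[ℝ] E)‖ + 1 :=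
    (NormedRing.inverse_continuousAt x).norm.eventually (gt_mem_nhds (by linarith))
  obtain ⟨ε, hε, hball⟩ := Metric.eventually_nhds_iff.mp (h1.and h2)
  refine ⟨ε, hε, ‖Ring.inverse (x : E →L[ℝ] E)‖ + 1, fun T hT => ?_⟩
  obtain ⟨⟨y, rfl⟩, hy⟩ := hball (by rwa [dist_eq_norm])
  refine ⟨ContinuousLinearEquiv.unitsEquiv ℝ E y, fun u => rfl, ?_⟩
  rw [Ring.inverse_unit] at hy
  exact hy.le

theorem S_eq {a γ p δ : ℝ} (hγ : γ ∈ gammaRange) (ha : 0 ≤ a) (ha1 : a ≤ 1)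
    (hp : 3 ≤ p) (hδ : δ ≤ 1) {v : ℝ →ᵇ ℝ} (hv : ∀ x, |v x - Q p x / weight a γ x| ≤ δ)
    (u : ℝ →ᵇ ℝ) (x : ℝ) : S a γ p v u x = (1 - linOp a γ p (density a γ p v)) u x := by
  have hd := isDensity_density hγ ha ha1 hp hδ v.continuous hv
  rw [_root_.sub_apply, BoundedContinuousFunction.sub_apply, linOp_apply hγ ha ha1 (by linarith) hd,
    S, T, ← integral_const_mul]
  congr 1
  congr 1
  funext y
  have : ∫ z, u z * (weight a γ z * deriv (Q p) z) = ∫ z, weight a γ z * deriv (Q p) z * u z := by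
    congr 1
    funext z
    ring
  rw [linPart, this, wkernel, density]
  ring

theorem integrable_kernel_mul_linPart {a γ p δ : ℝ} (hγ : γ ∈ gammaRange) (ha : 0 ≤ a)
    (ha1 : a ≤ 1) (hp : 3 ≤ p) (hδ : δ ≤ 1) {v : ℝ →ᵇ ℝ}
    (hv : ∀ x, |v x - Q p x / weight a γ x| ≤ δ) (u : ℝ →ᵇ ℝ) (x : ℝ) :
    Integrable (fun y => kernel a γ x y * linPart a γ p v u y) := by
  have hd := isDensity_density hγ ha ha1 hp hδ v.continuous hv
  have h1 := integrable_mul_bcf (integrable_wkernel_mul hγ ha ha1 hd x) u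
  have h2 := integrable_wkernel_mul hγ ha ha1
    (isDensity_deriv_Q (a := a) (γ := γ) (by linarith : 2 ≤ p)) x
  have hw := (weight_pos' (γ := γ) ha ha1 x).ne'
  refine ((h1.sub (h2.const_mul (∫ z, u z * (weight a γ z * deriv (Q p) z)))).const_mul
    (weight a γ x)).congr (Eventually.of_forall fun y => ?_)
  simp only [Pi.sub_apply, linPart, wkernel, density]
  field_simp

theorem exists_uniform_inverse_near (q : ℝ) {p₀ : ℝ} (hp₀ : 3 ≤ p₀) : ∃ t ∈ 𝓝 p₀, ∃ δ > (0 : ℝ),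
    δ ≤ 1 / 8 ∧ ∃ C : ℝ, ∀ p ∈ t, 3 ≤ p → p ≤ q → ∀ γ : ℝ, |γ + 1 / 2| ≤ δ → ∀ a : ℝ, 0 ≤ a →
    a ≤ δ → ∀ v : ℝ →ᵇ ℝ, (∀ x, |v x - Q p x / weight a γ x| ≤ δ) →
    ∃ Φ : (ℝ →ᵇ ℝ) ≃L[ℝ] (ℝ →ᵇ ℝ), (∀ u x, Φ u x = S a γ p v u x) ∧
      ‖(Φ.symm : (ℝ →ᵇ ℝ) →L[ℝ] (ℝ →ᵇ ℝ))‖ ≤ C := by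
  have hγ₀ : (-(1 / 2) : ℝ) ∈ gammaRange := ⟨by norm_num, by norm_num⟩
  obtain ⟨ε, hε, C, hC⟩ := exists_equiv_of_norm_sub_le (isUnit_one_sub_linOp hγ₀ hp₀)
  obtain ⟨C₁, hC₁, h₁⟩ := norm_kernelOp_sub_le
  obtain ⟨C₂, hC₂, h₂⟩ := abs_density_sub_le (q := q)
  -- The principal filter gives uniformity over the whole range of `γ`, possible because the limit
  -- operator does not depend on `γ`.
  have hlim := tendsto_linOp (l := 𝓝[≥] (0 : ℝ) ×ˢ (𝓟 gammaRange ×ˢ 𝓝 p₀))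
    (A := fun i => i.1) (G := fun i => i.2.1) (P := fun i => i.2.2) hγ₀ hp₀ tendsto_fst
    ((tendsto_fst.comp tendsto_snd).eventually (mem_principal_self _))
    (tendsto_snd.comp tendsto_snd)
  have hev : ∀ᶠ i in 𝓝[≥] (0 : ℝ) ×ˢ (𝓟 gammaRange ×ˢ 𝓝 p₀),
      ‖linOp i.1 i.2.1 i.2.2 (solitonDensity i.1 i.2.1 i.2.2)
        - linOp 0 (-(1 / 2)) p₀ (solitonDensity 0 (-(1 / 2)) p₀)‖ < ε / 2 :=
    ((tendsto_iff_norm_sub_tendsto_zero (E := (ℝ →ᵇ ℝ) →L[ℝ] (ℝ →ᵇ ℝ))).mp hlim).eventually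
      (gt_mem_nhds (half_pos hε))
  obtain ⟨s₁, hs₁, s₂, hs₂, hsub⟩ := mem_prod_iff.mp hev
  obtain ⟨s₃, hs₃, s₄, hs₄, hsub'⟩ := mem_prod_iff.mp hs₂
  obtain ⟨δ₁, hδ₁, hsub₁⟩ := mem_nhdsGE_iff_exists_Icc_subset.mp hs₁
  have hδ₁' : 0 < δ₁ := hδ₁
  -- `1/8` keeps `γ` in `gammaRange`, `δ₁` makes the change in `a`, `γ`, `p` smaller than `ε/2`, and
  -- the last entry makes the change in `v` at most `ε/4`.
  refine ⟨s₄, hs₄, min (1 / 8) (min δ₁ (ε / (4 * (C₁ * C₂)))), by positivity, min_le_left _ _, C,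
    fun p hps hp3 hpq γ hγδ a ha haδ v hv => ?_⟩
  set δ := min (1 / 8) (min δ₁ (ε / (4 * (C₁ * C₂))))
  have d1 : δ ≤ 1 / 8 := min_le_left _ _
  have d2 : δ ≤ δ₁ := (min_le_right _ _).trans (min_le_left _ _)
  have d3 : δ ≤ ε / (4 * (C₁ * C₂)) := (min_le_right _ _).trans (min_le_right _ _)
  have hγ : γ ∈ gammaRange := by
    have := abs_le.mp (hγδ.trans d1)
    exact ⟨by linarith [this.1], by linarith [this.2]⟩
  have ha1 : a ≤ 1 := by linarith
  have hδ1 : δ ≤ 1 := by linarith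
  have hd := isDensity_density hγ ha ha1 hp3 hδ1 v.continuous hv
  have hd' := isDensity_solitonDensity hγ ha ha1 (by linarith : 2 ≤ p)
  have n1 : ‖kernelOp a γ (density a γ p v) - kernelOp a γ (solitonDensity a γ p)‖
      ≤ C₁ * (C₂ * δ) :=
    h₁ γ hγ a ha ha1 _ _ hd hd' _ (h₂ p hp3 hpq γ hγ a ha ha1 δ hδ1 v hv)
  have n2 : C₁ * (C₂ * δ) ≤ ε / 4 := by
    calc C₁ * (C₂ * δ) ≤ C₁ * (C₂ * (ε / (4 * (C₁ * C₂)))) := by gcongr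
      _ = ε / 4 := by field_simp
  have n3 := hsub (Set.mk_mem_prod (hsub₁ ⟨ha, haδ.trans d2⟩)
    (hsub' (Set.mk_mem_prod (mem_principal.mp hs₃ hγ) hps)))
  have n4 : ‖(1 - linOp a γ p (density a γ p v))
      - (1 - linOp 0 (-(1 / 2)) p₀ (solitonDensity 0 (-(1 / 2)) p₀))‖ < ε :=
    norm_one_sub_sub_lt hε (n1.trans n2) n3
  obtain ⟨Φ, hΦ, hΦn⟩ := hC _ n4
  refine ⟨Φ, fun u x => ?_, hΦn⟩
  rw [hΦ, S_eq hγ ha ha1 hp3 hδ1 hv]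

end GKdV

end

theorem proposition6p4 (q : ℝ) (hq : 4 < q) :
    ∃ δ > (0 : ℝ), ∃ C : ℝ,
      ∀ p : ℝ, 3 ≤ p → p ≤ q →
      ∀ γ : ℝ, |γ + 1 / 2| ≤ δ →
      ∀ a : ℝ, 0 ≤ a → a ≤ δ →
      ∀ v : BoundedContinuousFunction ℝ ℝ,
        (∀ x : ℝ, |v x - GKdV.Q p x / GKdV.weight a γ x| ≤ δ) →
        -- all integrals in the definition of the operator converge absolutely
        (∀ u : BoundedContinuousFunction ℝ ℝ,
          MeasureTheory.Integrable
              (fun z : ℝ => u z * (GKdV.weight a γ z * deriv (GKdV.Q p) z)) ∧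
          ∀ x : ℝ, MeasureTheory.Integrable
              (fun y : ℝ => GKdV.kernel a γ x y * GKdV.linPart a γ p v u y)) ∧
        -- the operator is a bounded bijection of `C_b` with inverse of norm at most `C`
        ∃ Φ : BoundedContinuousFunction ℝ ℝ ≃L[ℝ] BoundedContinuousFunction ℝ ℝ,
          (∀ (u : BoundedContinuousFunction ℝ ℝ) (x : ℝ), Φ u x = GKdV.S a γ p v u x) ∧
          ‖(Φ.symm : BoundedContinuousFunction ℝ ℝ →L[ℝ] BoundedContinuousFunction ℝ ℝ)‖ ≤ C := by
  obtain ⟨δ, hδ, hδ8, C, h⟩ : ∃ δ > (0 : ℝ), δ ≤ 1 / 8 ∧ ∃ C : ℝ, ∀ p ∈ Set.Icc (3 : ℝ) q, 3 ≤ p →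
      p ≤ q → ∀ γ : ℝ, |γ + 1 / 2| ≤ δ → ∀ a : ℝ, 0 ≤ a → a ≤ δ →
      ∀ v : BoundedContinuousFunction ℝ ℝ,
      (∀ x, |v x - GKdV.Q p x / GKdV.weight a γ x| ≤ δ) →
      ∃ Φ : BoundedContinuousFunction ℝ ℝ ≃L[ℝ] BoundedContinuousFunction ℝ ℝ,
        (∀ u x, Φ u x = GKdV.S a γ p v u x) ∧
        ‖(Φ.symm : BoundedContinuousFunction ℝ ℝ →L[ℝ] BoundedContinuousFunction ℝ ℝ)‖ ≤ C := by
    -- The local statement passes to unions by taking the smaller `δ` and the larger `C`, so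
    -- compactness of `[3, q]` yields constants independent of `p`. The bound `δ ≤ 1/8` is carried
    -- along because integrability below needs `γ` in `gammaRange`.
    refine isCompact_Icc.induction_on ⟨1 / 8, by norm_num, le_rfl, 0, by simp⟩ ?_ ?_ ?_
    · rintro s t hst ⟨δ, hδ, hδ8, C, h⟩
      exact ⟨δ, hδ, hδ8, C, fun p hp => h p (hst hp)⟩
    · rintro s t ⟨δ, hδ, hδ8, C, h⟩ ⟨δ', hδ', hδ8', C', h'⟩
      refine ⟨min δ δ', lt_min hδ hδ', (min_le_left _ _).trans hδ8, max C C',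
        fun p hp h3 hpq γ hγ a ha haδ v hv => ?_⟩
      rcases hp with hp | hp
      · obtain ⟨Φ, h1, h2⟩ := h p hp h3 hpq γ (hγ.trans (min_le_left _ _)) a ha
          (haδ.trans (min_le_left _ _)) v fun x => (hv x).trans (min_le_left _ _)
        exact ⟨Φ, h1, h2.trans (le_max_left _ _)⟩
      · obtain ⟨Φ, h1, h2⟩ := h' p hp h3 hpq γ (hγ.trans (min_le_right _ _)) a ha
          (haδ.trans (min_le_right _ _)) v fun x => (hv x).trans (min_le_right _ _)
        exact ⟨Φ, h1, h2.trans (le_max_right _ _)⟩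
    · intro p₀ hp₀
      obtain ⟨t, ht, hδ⟩ := GKdV.exists_uniform_inverse_near q hp₀.1
      exact ⟨t, mem_nhdsWithin_of_mem_nhds ht, hδ⟩
  refine ⟨δ, hδ, C, fun p hp3 hpq γ hγδ a ha haδ v hv => ⟨fun u => ?_,
    h p ⟨hp3, hpq⟩ hp3 hpq γ hγδ a ha haδ v hv⟩⟩
  have hγ : γ ∈ GKdV.gammaRange := by
    have := abs_le.mp (hγδ.trans hδ8)
    exact ⟨by linarith [this.1], by linarith [this.2]⟩
  have ha1 : a ≤ 1 := by linarith
  refine ⟨?_, fun x => GKdV.integrable_kernel_mul_linPart hγ ha ha1 hp3 (by linarith) hv u x⟩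
  simpa only [mul_comm] using GKdV.integrable_mul_bcf
    (GKdV.integrable_weight_mul_deriv_Q hγ ha ha1 (by linarith : 2 ≤ p)) u
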